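/- Let $\mathbb R_+=(0,\infty)$ and let $v:(0,\infty)\to\mathbb R\cup\{+\infty\}$ be equal to $+\infty$ on $(0,r_{\rm hc}]$ and $C^2$ on $(r_{\rm hc},\infty)$. Assume that $r_{\rm hc}>0$, that $v(r)\to\infty$ as $r\searrow r_{\rm hc}$, and that there are $r_{\rm hc}<z_{\min}<z_{\max}<2z_{\min}$, $\alpha_1,\alpha_2>0$ and $s>2$ such that (monotonicity being understood in the weak sense): (i) $z_{\max}$ is the unique minimizer of $v$, $v(z_{\max})<0$, $v$ is decreasing on $(0,z_{\max})$ and increasing and non-positive on $(z_{\max},\infty)$; (ii) $v(z)\ge-\alpha_1z^{-s}$ for all $z>0$, and $v(z)+v(z_{\max})-2\alpha_1\sum_{n\ge2}(nz)^{-s}>0$ for all $0<z<z_{\min}$; (iii) $v''$ is decreasing on $[z_{\min},z_{\max}]$ and increasing and non-positive on $[2z_{\min},\infty)$; (iv) $v''(z)\ge-\alpha_2z^{-s-2}$ for all $z>r_{\rm hc}$, and $v''(z_{\max})+\sum_{n\ge2}n^2v''(nz_{\min})>0$. Let $m\in\{1,2,\dots\}\cup\{\infty\}$ and $0<p<p^*:=|v(z_{\max})|/z_{\max}$.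 For $z\in\mathbb R_+^{N-1}$ put $$\mathcal E_N(z)=\sum_{1\le i<j\le N,\ j-i\le m}v(z_i+\dots+z_{j-1})+p\sum_{j=1}^{N-1}z_j ,$$ and, for $\beta>0$, let $\mathbb Q_N^{(\beta)}$ be the probability measure on $\mathbb R_+^{N-1}$ with density proportional to $e^{-\beta\mathcal E_N}$. Then the following holds. (Energies.) The function $r\mapsto pr+\sum_{k=1}^m v(kr)$ has a unique minimizer $a$ on $(0,\infty)$, with $a>r_{\rm hc}$, and the limit $e_0=\lim_{N\to\infty}\frac1N\inf_{\mathbb R_+^{N-1}}\mathcal E_N$ exists in $\mathbb R$. Let $h(z_1,z_2,\dots)=pz_1+\sum_{k=1}^m v(z_1+\dots+z_k)$. The functionals $$\mathcal E_{\rm surf}(z)=\sum_{j\ge1}\bigl(h(z_j,z_{j+1},\dots)-e_0\bigr),\qquad \mathcal E_{\rm bulk}(z)=\sum_{j\in\mathbb Z}\bigl(h(z_j,z_{j+1},\dots)-e_0\bigr),$$ defined for sequences $z$ in $(r_{\rm hc},\infty)^{\mathbb N}$, respectively $(r_{\rm hc},\infty)^{\mathbb Z}$, with only finitely many $z_j\ne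 a$, extend uniquely to continuous functionals with respect to the $\ell^2$-metric on the sets $\mathcal D$, respectively $\mathcal D^+$, of all sequences $z$ in $(r_{\rm hc},\infty)^{\mathbb N}$, respectively $(r_{\rm hc},\infty)^{\mathbb Z}$, with $\sum_j(z_j-a)^2<\infty$; and $\mathcal E_{\rm surf}$ attains its minimum on $\mathcal D$. Let $\overline{\mathcal E}_{\rm surf}:\mathbb R_+^{\mathbb N}\to\mathbb R\cup\{\infty\}$ and $\overline{\mathcal E}_{\rm bulk}:\mathbb R_+^{\mathbb Z}\to\mathbb R\cup\{\infty\}$ be equal to these extensions on $\mathcal D$, respectively $\mathcal D^+$, and to $+\infty$ elsewhere. (Gibbs measures.) For every $\beta>0$ there is a unique probability measure $\nu_\beta$ on $\mathbb R_+^{\mathbb N}$ such that, for all $k$ and all bounded continuous $f$ on $\mathbb R_+^k$, $\int f(z_1,\dots,z_k)\,d\mathbb Q_N^{(\beta)}\to\int f(z_1,\dots,z_k)\,d\nu_\beta$ as $N\to\infty$; and there is a unique shift-invariant probability measure $\mu_\beta$ on $\mathbb R_+^{\mathbb Z}$ such that, for all such $k,f$ and all sequences of integers $i_N\to\infty$ with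 $N-i_N\to\infty$, $\int f(z_{i_N+1},\dots,z_{i_N+k})\,d\mathbb Q_N^{(\beta)}\to\int f(z_1,\dots,z_k)\,d\mu_\beta$. (Large deviations.) As $\beta\to\infty$, the families $(\nu_\beta)$ and $(\mu_\beta)$ satisfy, in the product topologies of $\mathbb R_+^{\mathbb N}$ and $\mathbb R_+^{\mathbb Z}$, large deviations principles with speed $\beta$ and rate functions $I=\overline{\mathcal E}_{\rm surf}-\min_{\mathcal D}\mathcal E_{\rm surf}$ and $I=\overline{\mathcal E}_{\rm bulk}$, respectively: with $P_\beta=\nu_\beta$, respectively $P_\beta=\mu_\beta$, $$\limsup_{\beta\to\infty}\tfrac1\beta\log P_\beta(A)\le-\inf_AI\ \text{ for all closed }A,\qquad \liminf_{\beta\to\infty}\tfrac1\beta\log P_\beta(O)\ge-\inf_OI\ \text{ for all open }O .$$ Both rate functions are good, i.e. non-negative and lower semi-continuous with compact level sets. -/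

import Mathlib

open Filter Topology MeasureTheory Set
open scoped ENNReal BoundedContinuousFunction

noncomputable section

namespace Chain

/-- `ℝ₊ = (0, ∞)`, the space of a single interparticle spacing. -/
abbrev RPos : Type := Ioi (0 : ℝ)

/-- The standing assumption on the pair potential. The potential with values in `ℝ ∪ {+∞}` is
`v` on `(rhc, ∞)` and `+∞` on `(0, rhc]` (see `pot`); the values of `v` outside `(rhc, ∞)` are
irrelevant. "Increasing" and "decreasing" are meant in the weak sense. -/
structure PotentialAssumption (v : ℝ → ℝ) (rhc zmin zmax α₁ α₂ s : ℝ) : Prop where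
  rhc_nonneg : 0 ≤ rhc
  rhc_lt_zmin : rhc < zmin
  zmin_lt_zmax : zmin < zmax
  zmax_lt : zmax < 2 * zmin
  α₁_pos : 0 < α₁
  α₂_pos : 0 < α₂
  two_lt_s : 2 < s
  contDiffOn : ContDiffOn ℝ 2 v (Ioi rhc)
  zmax_unique_min : ∀ r, rhc < r → r ≠ zmax → v zmax < v r
  v_zmax_neg : v zmax < 0
  decreasing : AntitoneOn v (Ioo rhc zmax)
  increasing : MonotoneOn v (Ioi zmax)
  nonpos : ∀ r, zmax < r → v r ≤ 0
  lower_bound : ∀ r, rhc < r → -α₁ * r ^ (-s) ≤ v r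
  growth : ∀ r, rhc < r → r < zmin →
    0 < v r + v zmax - 2 * α₁ * ∑' n : ℕ, (((n : ℝ) + 2) * r) ^ (-s)
  deriv2_decreasing : AntitoneOn (deriv (deriv v)) (Icc zmin zmax)
  deriv2_increasing : MonotoneOn (deriv (deriv v)) (Ici (2 * zmin))
  deriv2_nonpos : ∀ r, 2 * zmin ≤ r → deriv (deriv v) r ≤ 0
  deriv2_lower_bound : ∀ r, rhc < r → -α₂ * r ^ (-s - 2) ≤ deriv (deriv v) r
  deriv2_growth :
    0 < deriv (deriv v) zmax
      + ∑' n : ℕ, ((n : ℝ) + 2) ^ 2 * deriv (deriv v) (((n : ℝ) + 2) * zmin)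

/-- The pair potential with hard core, `(0, ∞) → ℝ ∪ {+∞}`. -/
def pot (v : ℝ → ℝ) (rhc r : ℝ) : EReal := if r ≤ rhc then ⊤ else (v r : EReal)

/-! ### Finite chains

A chain of `N = n + 1` particles has `n` spacings; the spacing `z_j` of the usual labelling
`1, …, n` is `z (j - 1)`. -/

/-- The Gibbs energy `∑_{i<j, |i-j| ≤ m} v(z_i + ⋯ + z_{j-1}) + p ∑_j z_j` of `n + 1` particles. -/
def energy (v : ℝ → ℝ) (rhc : ℝ) (m : ℕ∞) (p : ℝ) (n : ℕ) (z : Fin n → RPos) : EReal :=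
  (∑ i : Fin (n + 1), ∑ j : Fin (n + 1),
    if i < j ∧ (((j : ℕ) - (i : ℕ) : ℕ) : ℕ∞) ≤ m then
      pot v rhc (∑ l : Fin n, if (i : ℕ) ≤ (l : ℕ) ∧ (l : ℕ) < (j : ℕ) then (z l : ℝ) else 0)
    else 0)
  + ((p * ∑ l : Fin n, (z l : ℝ) : ℝ) : EReal)

/-- The ground state energy of `n + 1` particles. -/
def groundEnergy (v : ℝ → ℝ) (rhc : ℝ) (m : ℕ∞) (p : ℝ) (n : ℕ) : EReal :=
  ⨅ z : Fin n → RPos, energy v rhc m p n z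

/-- The Boltzmann weight `exp(-β energy)`, which is `0` where the energy is `+∞`. -/
def weight (v : ℝ → ℝ) (rhc : ℝ) (m : ℕ∞) (p β : ℝ) (n : ℕ) (z : Fin n → RPos) : ℝ≥0∞ :=
  EReal.exp (-((β : EReal) * energy v rhc m p n z))

/-- Lebesgue measure on `ℝ₊^n`. -/
def lebesguePos (n : ℕ) : Measure (Fin n → RPos) :=
  Measure.pi fun _ => (volume : Measure ℝ).comap Subtype.val

/-- The partition function of `n + 1` particles. -/
def partitionFn (v : ℝ → ℝ) (rhc : ℝ) (m : ℕ∞) (p β : ℝ) (n : ℕ) : ℝ≥0∞ :=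
  ∫⁻ z : Fin n → RPos, weight v rhc m p β n z ∂(lebesguePos n)

/-- The finite-volume Gibbs measure of `n + 1` particles. -/
def finiteGibbs (v : ℝ → ℝ) (rhc : ℝ) (m : ℕ∞) (p β : ℝ) (n : ℕ) : Measure (Fin n → RPos) :=
  (partitionFn v rhc m p β n)⁻¹ •
    (lebesguePos n).withDensity (weight v rhc m p β n)

/-- The spacings `(z_{i+1}, …, z_{i+k})` of a chain with spacings `z_1, …, z_n`. Labels beyond `n`
give the value `1`; in the limits below this concerns finitely many `n` only. -/
def window (n i k : ℕ) (z : Fin n → RPos) : Fin k → RPos := fun j =>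
  if h : i + (j : ℕ) < n then z ⟨i + j, h⟩ else ⟨1, mem_Ioi.2 one_pos⟩

/-! ### Infinite-volume Gibbs measures -/

/-- `ν` is the thermodynamic limit at the left end of the chain (`z 0` is the first spacing). -/
structure IsSurfaceGibbs (v : ℝ → ℝ) (rhc : ℝ) (m : ℕ∞) (p β : ℝ)
    (ν : Measure (ℕ → RPos)) : Prop where
  isProb : IsProbabilityMeasure ν
  limit : ∀ (k : ℕ) (f : (Fin k → RPos) →ᵇ ℝ),
    Tendsto (fun n => ∫ z, f (window n 0 k z) ∂(finiteGibbs v rhc m p β n)) atTop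
      (𝓝 (∫ z, f (fun j : Fin k => z (j : ℕ)) ∂ν))

/-- `μ` is the shift-invariant thermodynamic limit in the bulk of the chain. -/
structure IsBulkGibbs (v : ℝ → ℝ) (rhc : ℝ) (m : ℕ∞) (p β : ℝ)
    (μ : Measure (ℤ → RPos)) : Prop where
  isProb : IsProbabilityMeasure μ
  shift_invariant : MeasurePreserving (fun (z : ℤ → RPos) (j : ℤ) => z (j + 1)) μ μ
  limit : ∀ i : ℕ → ℕ, Tendsto i atTop atTop → Tendsto (fun n => n - i n) atTop atTop →
    ∀ (k : ℕ) (f : (Fin k → RPos) →ᵇ ℝ),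
      Tendsto (fun n => ∫ z, f (window n (i n) k z) ∂(finiteGibbs v rhc m p β n)) atTop
        (𝓝 (∫ z, f (fun j : Fin k => z ((j : ℤ) + 1)) ∂μ))

/-! ### Energy functionals of infinite chains -/

/-- The energy per particle `p r + ∑_{k=1}^m v(k r)` of the chain with all spacings `r > rhc`. -/
def cauchyBorn (v : ℝ → ℝ) (m : ℕ∞) (p r : ℝ) : ℝ :=
  p * r + ∑' k : ℕ, if ((k + 1 : ℕ) : ℕ∞) ≤ m then v (((k : ℝ) + 1) * r) else 0

/-- `a` is the unique minimizer of `p r + ∑_{k=1}^m v(k r)`, which is `+∞` for `r ≤ rhc`. -/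
def IsGroundSpacing (v : ℝ → ℝ) (rhc : ℝ) (m : ℕ∞) (p a : ℝ) : Prop :=
  rhc < a ∧ ∀ r, rhc < r → r ≠ a → cauchyBorn v m p a < cauchyBorn v m p r

/-- `h(z₁, z₂, …) = p z₁ + ∑_{k=1}^m v(z₁ + ⋯ + z_k)` for spacings in `(rhc, ∞)`. -/
def hEnergy (v : ℝ → ℝ) (m : ℕ∞) (p : ℝ) (z : ℕ → ℝ) : ℝ :=
  p * z 0 + ∑' k : ℕ, if ((k + 1 : ℕ) : ℕ∞) ≤ m then v (∑ i ∈ Finset.range (k + 1), z i) else 0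

/-- Square summable strains `γ_j = z_j - a` with the `ℓ²` metric. -/
abbrev Strain (ι : Type) : Type := lp (fun _ : ι => ℝ) 2

/-- The strains of the square summable configurations in `(rhc, ∞)^ι`. -/
def strainDomain (rhc a : ℝ) (ι : Type) : Set (Strain ι) := {γ | ∀ j, rhc < a + γ j}

/-- The strains of the configurations in `(rhc, ∞)^ι` with finitely many spacings `≠ a`. -/
def finiteStrainDomain (rhc a : ℝ) (ι : Type) : Set (Strain ι) :=
  {γ | γ ∈ strainDomain rhc a ι ∧ {j | γ j ≠ 0}.Finite}

/-- The surface energy on configurations with finitely many spacings `≠ a`. -/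
def surf₀ (v : ℝ → ℝ) (m : ℕ∞) (p a e₀ : ℝ) (γ : Strain ℕ) : ℝ :=
  ∑' j : ℕ, (hEnergy v m p (fun i => a + γ (j + i)) - e₀)

/-- The bulk energy on configurations with finitely many spacings `≠ a`. -/
def bulk₀ (v : ℝ → ℝ) (m : ℕ∞) (p a e₀ : ℝ) (γ : Strain ℤ) : ℝ :=
  ∑' j : ℤ, (hEnergy v m p (fun i : ℕ => a + γ (j + (i : ℤ))) - e₀)

/-- The continuous extension of the surface energy to square summable strains. -/
def surf (v : ℝ → ℝ) (rhc : ℝ) (m : ℕ∞) (p a e₀ : ℝ) : Strain ℕ → ℝ :=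
  extendFrom (finiteStrainDomain rhc a ℕ) (surf₀ v m p a e₀)

/-- The continuous extension of the bulk energy to square summable strains. -/
def bulk (v : ℝ → ℝ) (rhc : ℝ) (m : ℕ∞) (p a e₀ : ℝ) : Strain ℤ → ℝ :=
  extendFrom (finiteStrainDomain rhc a ℤ) (bulk₀ v m p a e₀)

open Classical in
/-- Extension by `+∞` of a functional of the strain to all of `ℝ₊^ι`. -/
def extendTop {ι : Type} (rhc a : ℝ) (F : Strain ι → ℝ) (z : ι → RPos) : EReal :=
  if h : Memℓp (fun j => (z j : ℝ) - a) 2 ∧ ∀ j, rhc < (z j : ℝ) then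
    ((F ⟨fun j => (z j : ℝ) - a, h.1⟩ : ℝ) : EReal)
  else ⊤

/-- The surface energy on `ℝ₊^ℕ`. -/
def surfBar (v : ℝ → ℝ) (rhc : ℝ) (m : ℕ∞) (p a e₀ : ℝ) : (ℕ → RPos) → EReal :=
  extendTop rhc a (surf v rhc m p a e₀)

/-- The bulk energy on `ℝ₊^ℤ`. -/
def bulkBar (v : ℝ → ℝ) (rhc : ℝ) (m : ℕ∞) (p a e₀ : ℝ) : (ℤ → RPos) → EReal :=
  extendTop rhc a (bulk v rhc m p a e₀)

/-! ### Large deviations -/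

/-- The family `(P β)` satisfies, as `β → ∞`, the large deviations principle with speed `β` and
good rate function `I`. -/
structure GoodLDP {X : Type} [TopologicalSpace X] [MeasurableSpace X]
    (P : ℝ → Measure X) (I : X → EReal) : Prop where
  nonneg : ∀ x, 0 ≤ I x
  lowerSemicontinuous : LowerSemicontinuous I
  compact_level : ∀ c : ℝ, IsCompact {x | I x ≤ (c : EReal)}
  upper : ∀ A : Set X, IsClosed A →
    limsup (fun β : ℝ => ((β⁻¹ : ℝ) : EReal) * ENNReal.log (P β A)) atTop ≤ -(⨅ x ∈ A, I x)
  lower : ∀ O : Set X, IsOpen O →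
    -(⨅ x ∈ O, I x) ≤ liminf (fun β : ℝ => ((β⁻¹ : ℝ) : EReal) * ENNReal.log (P β O)) atTop

end Chain

end

noncomputable section

namespace Chain

/-! The mechanism is that stretches of a chain that are close to the ground state decouple its two
sides, together with estimates uniform in the length of the chain.

Energies. On `[zmin, zmax]` the energy per particle `cb` of a uniform chain is strongly convex,
beyond `zmax` it grows at rate at least `p`, and below `zmin` it is positive, so it has a unique
minimizer `a` with value `e₀ < 0`. For a general chain with all spacings at least `zmin`, concavity
of `v` on `[2 * zmin, ∞)` bounds the energy below by the sum of `cb (z l)`; if some spacing is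
smaller, deleting a particle next to a shortest spacing does not raise the energy. By induction,
`E_ge` bounds the energy of `n` spacings below by `n * e₀` plus `kappa` times the sum of the
truncated squares `theta`. Since `a` is stationary, first order terms cancel, and the bulk energy of
a square summable strain is a convergent sum `Phi` of second order Taylor remainders, continuous in
`ℓ²`; the surface energy is `Phi` minus the change `crossDif` of the interaction across the cut at
the origin.

Cuts. As `s > 2`, the interaction across any cut is bounded by a constant `K`, and it is close to
the constant `Waa` as soon as the spacings near the cut are close to `a` (`exists_good`). Hence the
normalized energy `X` is almost additive at such stretches, and almost nonnegative between two of
them, as periodic repetition shows (`Good.neg_le_X`). This yields convergence of finite chain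
energies to `val`, the energy of infinite chains (`tendsto_X_val`), and lower semicontinuity of
`val` in the product topology (`eventually_lt_val`). Bulk and surface are treated in parallel
through a Boolean `σ`; one-sided chains are continued to the left by `a`.

Gibbs measures. Nearest neighbour and pressure terms are absorbed into a product reference measure.
The remaining interaction `V` across a cut is bounded by `K`, and distant spacings contribute little
to it, so a Doeblin type contraction makes local expectations insensitive to the far ends of the
chain (`exists_avg_le`). With tightness this gives existence and uniqueness of the thermodynamic
limits.

Large deviations. In a fixed window the Laplace method compares an event with a neighbourhood of a
reference configuration (`exists_laplace`). By coercivity, a long window without a near ground state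
stretch is exponentially unlikely (`exists_no_stretch`), so up to a negligible event the chain has
stretches on the required sides at one of finitely many positions. Cutting there reduces the
infinite chain to a window up to a small exponential error (`Good.eventually_Gm_le`). Comparison
with almost minimal chains gives local upper bounds, and comparison of the full event with a given
configuration gives local lower bounds. With exponential tightness these imply the principle and the
goodness of the rate function (`goodLDP_of_local`); attainment of the surface minimum is then a
consequence. -/

/-- A pair potential satisfying the standing assumption, with hard core, range and pressure. -/
structure Model where
  v : ℝ → ℝ
  rhc : ℝ
  zmin : ℝ
  zmax : ℝ
  α₁ : ℝ
  α₂ : ℝ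
  s : ℝ
  hv : PotentialAssumption v rhc zmin zmax α₁ α₂ s
  hrhc : 0 < rhc
  hcore : Tendsto v (𝓝[>] rhc) atTop
  m : ℕ∞
  hm : 1 ≤ m
  p : ℝ
  hp : 0 < p
  hp' : p < |v zmax| / zmax

namespace Model

variable (D : Model)

lemma rhc_lt_zmin : D.rhc < D.zmin := D.hv.rhc_lt_zmin
lemma zmin_lt_zmax : D.zmin < D.zmax := D.hv.zmin_lt_zmax
lemma zmin_pos : 0 < D.zmin := D.hrhc.trans D.rhc_lt_zmin
lemma zmax_pos : 0 < D.zmax := D.zmin_pos.trans D.zmin_lt_zmax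
lemma rhc_lt_zmax : D.rhc < D.zmax := D.rhc_lt_zmin.trans D.zmin_lt_zmax

/-! ### Regularity and decay of the potential -/

lemma hasDerivAt_v {r : ℝ} (hr : D.rhc < r) : HasDerivAt D.v (deriv D.v r) r :=
  ((D.hv.contDiffOn.differentiableOn (by norm_num)).differentiableAt
    (isOpen_Ioi.mem_nhds hr)).hasDerivAt

lemma contDiffOn_deriv : ContDiffOn ℝ 1 (deriv D.v) (Ioi D.rhc) :=
  D.hv.contDiffOn.deriv_of_isOpen isOpen_Ioi (by norm_num)

lemma hasDerivAt_deriv {r : ℝ} (hr : D.rhc < r) :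
    HasDerivAt (deriv D.v) (deriv (deriv D.v) r) r :=
  ((D.contDiffOn_deriv.differentiableOn (by norm_num)).differentiableAt
    (isOpen_Ioi.mem_nhds hr)).hasDerivAt

lemma continuousOn_v : ContinuousOn D.v (Ioi D.rhc) := D.hv.contDiffOn.continuousOn

lemma continuousOn_deriv : ContinuousOn (deriv D.v) (Ioi D.rhc) := D.contDiffOn_deriv.continuousOn

lemma continuousOn_deriv2 : ContinuousOn (deriv (deriv D.v)) (Ioi D.rhc) :=
  (D.contDiffOn_deriv.deriv_of_isOpen (m := 0) isOpen_Ioi (by norm_num)).continuousOn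

lemma continuousAt_v {r : ℝ} (hr : D.rhc < r) : ContinuousAt D.v r := (D.hasDerivAt_v hr).continuousAt

/-- A power bound near infinity of a continuous function on `(rhc, ∞)` holds on `[ρ, ∞)`. -/
lemma exists_power_bound {f : ℝ → ℝ} (hf : ContinuousOn f (Ioi D.rhc)) {q R A : ℝ}
    (hR : ∀ r, R ≤ r → |f r| ≤ A * r ^ q) {ρ : ℝ} (hρ : D.rhc < ρ) :
    ∃ C, 0 < C ∧ ∀ r, ρ ≤ r → |f r| ≤ C * r ^ q := by
  have hρ0 : 0 < ρ := D.hrhc.trans hρ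
  have hc : ContinuousOn (fun r => f r * r ^ (-q)) (Icc ρ (max R ρ)) := by
    refine (hf.mono fun r hr => lt_of_lt_of_le hρ hr.1).mul ?_
    refine ContinuousOn.rpow_const continuousOn_id fun r hr => Or.inl ?_
    exact (hρ0.trans_le hr.1).ne'
  obtain ⟨C, hC⟩ := isCompact_Icc.exists_bound_of_continuousOn hc
  refine ⟨max (max C A) 1, lt_max_of_lt_right one_pos, fun r hr => ?_⟩
  have hr0 : 0 < r := hρ0.trans_le hr
  have hq : 0 < r ^ q := Real.rpow_pos_of_pos hr0 q
  by_cases h : R ≤ r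
  · exact (hR r h).trans (mul_le_mul_of_nonneg_right
      ((le_max_right _ _).trans (le_max_left _ _)) hq.le)
  · have h1 := hC r ⟨hr, (le_of_not_ge h).trans (le_max_left _ _)⟩
    have h2 : |f r| * r ^ (-q) ≤ C := by
      rw [Real.norm_eq_abs, abs_mul, abs_of_pos (Real.rpow_pos_of_pos hr0 _)] at h1
      exact h1
    have h3 : |f r| ≤ C * r ^ q := by
      have := mul_le_mul_of_nonneg_right h2 hq.le
      rwa [mul_assoc, ← Real.rpow_add hr0, neg_add_cancel, Real.rpow_zero, mul_one] at this
    exact h3.trans (mul_le_mul_of_nonneg_right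
      ((le_max_left _ _).trans (le_max_left _ _)) hq.le)

lemma v_nonpos {r : ℝ} (hr : D.zmax < r) : D.v r ≤ 0 := D.hv.nonpos r hr

lemma exists_bound_v {ρ : ℝ} (hρ : D.rhc < ρ) :
    ∃ C, 0 < C ∧ ∀ r, ρ ≤ r → |D.v r| ≤ C * r ^ (-D.s) := by
  refine D.exists_power_bound D.continuousOn_v (R := D.zmax + 1) (A := D.α₁) (fun r hr => ?_) hρ
  have h1 := D.v_nonpos (r := r) (by linarith)
  have h2 := D.hv.lower_bound r (by linarith [D.rhc_lt_zmax])
  rw [abs_of_nonpos h1]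
  linarith

lemma exists_bound_deriv2 {ρ : ℝ} (hρ : D.rhc < ρ) :
    ∃ C, 0 < C ∧ ∀ r, ρ ≤ r → |deriv (deriv D.v) r| ≤ C * r ^ (-D.s - 2) := by
  refine D.exists_power_bound D.continuousOn_deriv2 (R := 2 * D.zmin) (A := D.α₂)
    (fun r hr => ?_) hρ
  have h1 := D.hv.deriv2_nonpos r hr
  have h2 := D.hv.deriv2_lower_bound r (by linarith [D.rhc_lt_zmin, D.zmin_pos])
  rw [abs_of_nonpos h1]
  linarith

lemma deriv_nonneg {r : ℝ} (hr : D.zmax ≤ r) : 0 ≤ deriv D.v r := by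
  rcases hr.eq_or_lt with h | h
  · subst h
    have : IsLocalMin D.v D.zmax := by
      filter_upwards [isOpen_Ioi.mem_nhds D.rhc_lt_zmax] with r hr
      by_cases h : r = D.zmax
      · rw [h]
      · exact (D.hv.zmax_unique_min r hr h).le
    exact this.deriv_eq_zero.ge
  · have := D.hv.increasing.derivWithin_nonneg (x := r)
    rwa [derivWithin_of_isOpen isOpen_Ioi h] at this

lemma antitoneOn_deriv : AntitoneOn (deriv D.v) (Ici (2 * D.zmin)) := by
  have hsub : ∀ r ∈ Ici (2 * D.zmin), D.rhc < r := fun r hr => by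
    have := mem_Ici.1 hr
    linarith [D.rhc_lt_zmin, D.zmin_pos]
  refine antitoneOn_of_deriv_nonpos (convex_Ici _) (D.continuousOn_deriv.mono hsub) ?_ ?_
  · intro r hr
    exact (D.hasDerivAt_deriv (hsub r (interior_subset hr))).differentiableAt.differentiableWithinAt
  · intro r hr
    exact D.hv.deriv2_nonpos r (interior_subset hr)

/-- Beyond `2 * zmin` the derivative is nonnegative and decreasing, so `deriv v r` is at most the
mean slope on `[r/2, r]`. As `v r ≤ 0`, this slope is controlled by `-v (r/2)`, which gives the
decay of `v` with one more power. -/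
lemma exists_bound_deriv {ρ : ℝ} (hρ : D.rhc < ρ) :
    ∃ C, 0 < C ∧ ∀ r, ρ ≤ r → |deriv D.v r| ≤ C * r ^ (-D.s - 1) := by
  refine D.exists_power_bound D.continuousOn_deriv (R := 4 * D.zmin)
    (A := D.α₁ * 2 ^ (D.s + 1)) (fun r hr => ?_) hρ
  have hz := D.zmin_pos
  have hr0 : 0 < r := by linarith
  have hlt : r / 2 < r := by linarith
  have hsub : ∀ x, r / 2 ≤ x → D.rhc < x := fun x hx => by linarith [D.rhc_lt_zmin]
  obtain ⟨c, hc, hc'⟩ := exists_deriv_eq_slope D.v hlt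
    (fun x hx => (D.continuousAt_v (hsub x hx.1)).continuousWithinAt)
    (fun x hx => (D.hasDerivAt_v (hsub x hx.1.le)).differentiableAt.differentiableWithinAt)
  have h1 : deriv D.v r ≤ deriv D.v c :=
    D.antitoneOn_deriv (by simp only [mem_Ici]; linarith [hc.1]) (by simp only [mem_Ici]; linarith)
      hc.2.le
  have h2 := D.v_nonpos (r := r) (by linarith [D.hv.zmax_lt])
  have h3 := D.hv.lower_bound (r / 2) (hsub _ le_rfl)
  have h0 := D.deriv_nonneg (r := r) (by linarith [D.hv.zmax_lt])
  rw [abs_of_nonneg h0]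
  have h4 : (r / 2) ^ (-D.s) = 2 ^ D.s * r ^ (-D.s) := by
    rw [Real.div_rpow hr0.le (by norm_num), Real.rpow_neg (by norm_num : (0 : ℝ) ≤ 2)]
    field_simp
  have h5 : r ^ (-D.s) = r ^ (-D.s - 1) * r := by
    rw [Real.rpow_sub_one hr0.ne']
    field_simp
  have h6 : (2 : ℝ) ^ (D.s + 1) = 2 ^ D.s * 2 := by rw [Real.rpow_add_one (by norm_num)]
  rw [hc', le_div_iff₀ (by linarith)] at h1
  have h7 : deriv D.v r * r ≤ D.α₁ * 2 ^ (D.s + 1) * r ^ (-D.s - 1) * r := by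
    rw [h6]
    rw [h4, h5] at h3
    nlinarith
  exact le_of_mul_le_mul_right h7 hr0

lemma concaveOn_v : ConcaveOn ℝ (Ici (2 * D.zmin)) D.v := by
  have hsub : ∀ r ∈ Ici (2 * D.zmin), D.rhc < r := fun r hr => by
    have := mem_Ici.1 hr
    linarith [D.rhc_lt_zmin, D.zmin_pos]
  refine concaveOn_of_deriv2_nonpos' (convex_Ici _) ?_ ?_ ?_
  · exact fun r hr => (D.hasDerivAt_v (hsub r hr)).differentiableAt.differentiableWithinAt
  · exact fun r hr => (D.hasDerivAt_deriv (hsub r hr)).differentiableAt.differentiableWithinAt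
  · exact fun r hr => D.hv.deriv2_nonpos r hr

/-! ### The energy per particle of a uniform chain -/

/-- The interaction of particles whose labels differ by `k`. -/
def phi (k : ℕ) (r : ℝ) : ℝ := if (k : ℕ∞) ≤ D.m then D.v r else 0

lemma phi_one (r : ℝ) : D.phi 1 r = D.v r := by
  rw [phi, if_pos]; exact_mod_cast D.hm

lemma abs_phi_le (k : ℕ) (r : ℝ) : |D.phi k r| ≤ |D.v r| := by
  unfold phi; split_ifs <;> simp

/-- The energy per particle of the chain with all spacings `r`. -/
def cb (r : ℝ) : ℝ := cauchyBorn D.v D.m D.p r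

lemma cb_eq (r : ℝ) : D.cb r = D.p * r + ∑' k : ℕ, D.phi (k + 1) (((k : ℝ) + 1) * r) := rfl

lemma summable_rpow_add {q : ℝ} (hq : q < -1) (j : ℕ) :
    Summable fun k : ℕ => ((k : ℝ) + j) ^ q := by
  have := (summable_nat_add_iff j).2 (Real.summable_nat_rpow.2 hq)
  simpa using this

lemma exists_bound_phi_mul {ρ : ℝ} (hρ : D.rhc < ρ) :
    ∃ C, 0 < C ∧ ∀ (k : ℕ) (r : ℝ), ρ ≤ r →
      |D.phi (k + 1) (((k : ℝ) + 1) * r)| ≤ C * ((k : ℝ) + 1) ^ (-D.s) := by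
  obtain ⟨C, hC, h⟩ := D.exists_bound_v hρ
  have hρ0 : 0 < ρ := D.hrhc.trans hρ
  refine ⟨C * ρ ^ (-D.s), by positivity, fun k r hr => (D.abs_phi_le _ _).trans ?_⟩
  have hk : (1 : ℝ) ≤ k + 1 := by linarith [Nat.cast_nonneg (α := ℝ) k]
  refine (h _ (by nlinarith)).trans ?_
  rw [Real.mul_rpow (by linarith) (by linarith), mul_assoc, mul_comm (ρ ^ (-D.s))]
  gcongr ?_ * (?_ * ?_)
  exact Real.rpow_le_rpow_of_nonpos hρ0 hr (by linarith [D.hv.two_lt_s])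

lemma summable_phi_mul {r : ℝ} (hr : D.rhc < r) :
    Summable fun k : ℕ => D.phi (k + 1) (((k : ℝ) + 1) * r) := by
  obtain ⟨C, hC, h⟩ := D.exists_bound_phi_mul hr
  refine Summable.of_norm_bounded (g := fun k : ℕ => C * ((k : ℝ) + 1) ^ (-D.s)) ?_
    fun k => h k r le_rfl
  have := summable_rpow_add (q := -D.s) (by linarith [D.hv.two_lt_s]) 1
  simpa using this.mul_left C

lemma continuousOn_cb : ContinuousOn D.cb (Ioi D.rhc) := by
  intro r hr
  obtain ⟨ρ, hρ, hρr⟩ := exists_between (mem_Ioi.1 hr)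
  obtain ⟨C, hC, h⟩ := D.exists_bound_phi_mul hρ
  have hs := (summable_rpow_add (q := -D.s) (by linarith [D.hv.two_lt_s]) 1).mul_left C
  have : ContinuousOn D.cb (Ici ρ) := by
    refine (continuousOn_const.mul continuousOn_id).add
      (continuousOn_tsum (u := fun k : ℕ => C * ((k : ℝ) + 1) ^ (-D.s)) ?_ (by simpa using hs)
        fun k x hx => h k x hx)
    intro k x hx
    have hk : (1 : ℝ) ≤ k + 1 := by linarith [Nat.cast_nonneg (α := ℝ) k]
    have hx' : D.rhc < ((k : ℝ) + 1) * x := by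
      have := mem_Ici.1 hx
      nlinarith [D.hrhc]
    by_cases hm : ((k + 1 : ℕ) : ℕ∞) ≤ D.m
    · simp only [hm, if_true]
      exact ((D.continuousAt_v hx').comp (f := fun x => ((k : ℝ) + 1) * x)
        (by fun_prop)).continuousWithinAt
    · simp only [hm, if_false]
      exact continuousWithinAt_const
  exact (this.continuousAt (Ici_mem_nhds hρr)).continuousWithinAt

lemma phi_nonpos (k : ℕ) {r : ℝ} (hr : D.zmax < r) : D.phi k r ≤ 0 := by
  unfold phi; split_ifs
  · exact D.v_nonpos hr
  · exact le_rfl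

lemma zmax_lt_mul {k : ℕ} {r : ℝ} (hr : D.zmin ≤ r) : D.zmax < ((k : ℝ) + 2) * r := by
  have := D.hv.zmax_lt
  nlinarith [D.zmin_pos, Nat.cast_nonneg (α := ℝ) k]

lemma cb_eq_add {r : ℝ} (hr : D.rhc < r) :
    D.cb r = D.p * r + D.v r + ∑' k : ℕ, D.phi (k + 2) (((k : ℝ) + 2) * r) := by
  rw [cb_eq, (D.summable_phi_mul hr).tsum_eq_zero_add, ← add_assoc]
  congr 1
  · simp [phi_one]
  · refine tsum_congr fun k => ?_
    push_cast
    ring_nf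

lemma summable_phi_mul_two {r : ℝ} (hr : D.rhc < r) :
    Summable fun k : ℕ => D.phi (k + 2) (((k : ℝ) + 2) * r) := by
  refine ((summable_nat_add_iff 1).2 (D.summable_phi_mul hr)).congr fun k => ?_
  push_cast
  ring_nf

/-- This is where `p < p*` enters: `p * zmax < |v zmax|`, and all farther interactions are
nonpositive. -/
lemma cb_zmax_neg : D.cb D.zmax < 0 := by
  rw [D.cb_eq_add D.rhc_lt_zmax]
  have h1 : ∑' k : ℕ, D.phi (k + 2) (((k : ℝ) + 2) * D.zmax) ≤ 0 :=
    tsum_nonpos fun k => D.phi_nonpos _ (D.zmax_lt_mul D.zmin_lt_zmax.le)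
  have h2 := D.hp'
  rw [lt_div_iff₀ D.zmax_pos, abs_of_neg D.hv.v_zmax_neg] at h2
  linarith

/-- The growth hypothesis lets `v r` outweigh the lower bound for all farther interactions. Together
with `cb_zmax_neg` this excludes minimizers below `zmin`. -/
lemma cb_pos_of_lt_zmin {r : ℝ} (hr : D.rhc < r) (hr' : r < D.zmin) : 0 < D.cb r := by
  have hr0 := D.hrhc.trans hr
  rw [D.cb_eq_add hr]
  have h1 := D.hv.growth r hr hr'
  have hs2 := D.hv.two_lt_s
  have hsum : Summable fun n : ℕ => (((n : ℝ) + 2) * r) ^ (-D.s) := by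
    refine ((summable_rpow_add (q := -D.s) (by linarith) 2).mul_right (r ^ (-D.s))).congr
      fun n => ?_
    rw [Real.mul_rpow (by positivity) hr0.le]
    norm_num
  have h2 : -D.α₁ * ∑' n : ℕ, (((n : ℝ) + 2) * r) ^ (-D.s) ≤
      ∑' k : ℕ, D.phi (k + 2) (((k : ℝ) + 2) * r) := by
    rw [← tsum_mul_left]
    refine Summable.tsum_le_tsum (fun k => ?_) (hsum.mul_left _) (D.summable_phi_mul_two hr)
    have hk : D.rhc < ((k : ℝ) + 2) * r := by nlinarith [Nat.cast_nonneg (α := ℝ) k]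
    unfold phi
    split_ifs
    · exact D.hv.lower_bound _ hk
    · have : 0 ≤ (((k : ℝ) + 2) * r) ^ (-D.s) := by positivity
      nlinarith [D.hv.α₁_pos]
  have h3 : 0 ≤ ∑' n : ℕ, (((n : ℝ) + 2) * r) ^ (-D.s) :=
    tsum_nonneg fun n => by positivity
  have h4 := mul_nonneg D.hv.α₁_pos.le h3
  have h5 := mul_pos D.hp hr0
  nlinarith [D.hv.v_zmax_neg]

/-- Midpoint inequality for a function with second derivative at least `q`. -/
lemma midpoint_le {f : ℝ → ℝ} {q x y : ℝ} {s : Set ℝ} (hs : Convex ℝ s)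
    {f' f'' : ℝ → ℝ} (h1 : ∀ r ∈ s, HasDerivAt f (f' r) r)
    (h2 : ∀ r ∈ s, HasDerivAt f' (f'' r) r) (h3 : ∀ r ∈ s, q ≤ f'' r)
    (hx : x ∈ s) (hy : y ∈ s) :
    2 * f ((x + y) / 2) + q * (x - y) ^ 2 / 4 ≤ f x + f y := by
  have hconv : ConvexOn ℝ s (fun r => f r - q / 2 * r ^ 2) := by
    refine convexOn_of_hasDerivWithinAt2_nonneg hs (f' := fun r => f' r - q * r)
      (f'' := fun r => f'' r - q) ?_ ?_ ?_ ?_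
    · exact fun r hr => ((h1 r hr).continuousAt.sub (by fun_prop)).continuousWithinAt
    · intro r hr
      have := (h1 r (interior_subset hr)).sub (((hasDerivAt_pow 2 r).const_mul (q / 2)))
      exact (this.congr_deriv (by simp; ring)).hasDerivWithinAt
    · intro r hr
      have := (h2 r (interior_subset hr)).sub ((hasDerivAt_id r).const_mul q)
      exact (this.congr_deriv (by simp)).hasDerivWithinAt
    · intro r hr
      linarith [h3 r (interior_subset hr)]
  have := hconv.2 hx hy (by norm_num : (0 : ℝ) ≤ 1 / 2) (by norm_num : (0 : ℝ) ≤ 1 / 2)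
    (by norm_num)
  simp only [smul_eq_mul] at this
  rw [show (1 / 2 * x + 1 / 2 * y : ℝ) = (x + y) / 2 by ring] at this
  nlinarith

/-- The modulus of convexity of `cb` on `[zmin, zmax]`. -/
def modulus : ℝ := deriv (deriv D.v) D.zmax
      + ∑' n : ℕ, ((n : ℝ) + 2) ^ 2 * deriv (deriv D.v) (((n : ℝ) + 2) * D.zmin)

lemma modulus_pos : 0 < D.modulus := D.hv.deriv2_growth

lemma two_zmin_le (n : ℕ) {r : ℝ} (hr : D.zmin ≤ r) : 2 * D.zmin ≤ ((n : ℝ) + 2) * r := by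
  nlinarith [D.zmin_pos, Nat.cast_nonneg (α := ℝ) n]

lemma summable_deriv2 :
    Summable fun n : ℕ => ((n : ℝ) + 2) ^ 2 * deriv (deriv D.v) (((n : ℝ) + 2) * D.zmin) := by
  obtain ⟨C, hC, h⟩ := D.exists_bound_deriv2 D.rhc_lt_zmin
  have hz := D.zmin_pos
  have hs := (summable_rpow_add (q := -D.s) (by linarith [D.hv.two_lt_s]) 2).mul_left
    (C * D.zmin ^ (-D.s - 2))
  refine Summable.of_norm_bounded hs fun n => ?_
  have hn : (0 : ℝ) < n + 2 := by positivity
  rw [norm_mul, Real.norm_eq_abs, Real.norm_eq_abs, abs_of_pos (by positivity)]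
  refine (mul_le_mul_of_nonneg_left (h _ (by linarith [D.two_zmin_le n le_rfl]))
    (by positivity)).trans (le_of_eq ?_)
  rw [Real.mul_rpow hn.le hz.le, Real.rpow_sub hn, Nat.cast_ofNat]
  simp only [Real.rpow_ofNat]
  field_simp

/-- The nearest neighbour term has curvature at least `v''(zmax)`, as `v''` decreases on `[zmin,
zmax]`, and the `k`-th term at least `k² v''(k zmin)`, as `v''` increases beyond `2 * zmin`. A
finite range only removes terms of nonpositive curvature. -/
lemma cb_midpoint {x y : ℝ} (hx : x ∈ Icc D.zmin D.zmax) (hy : y ∈ Icc D.zmin D.zmax) :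
    2 * D.cb ((x + y) / 2) + D.modulus * (x - y) ^ 2 / 4 ≤ D.cb x + D.cb y := by
  have hsub : ∀ r ∈ Icc D.zmin D.zmax, D.rhc < r := fun r hr => D.rhc_lt_zmin.trans_le hr.1
  have hmid : (x + y) / 2 ∈ Icc D.zmin D.zmax := ⟨by linarith [hx.1, hy.1], by linarith [hx.2, hy.2]⟩
  have h1 : 2 * D.v ((x + y) / 2) + deriv (deriv D.v) D.zmax * (x - y) ^ 2 / 4 ≤ D.v x + D.v y :=
    midpoint_le (convex_Icc D.zmin D.zmax) (fun r hr => D.hasDerivAt_v (hsub r hr))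
      (fun r hr => D.hasDerivAt_deriv (hsub r hr))
      (fun r hr => D.hv.deriv2_decreasing hr (right_mem_Icc.2 D.zmin_lt_zmax.le) hr.2) hx hy
  have h2 : ∀ k : ℕ, 2 * D.phi (k + 2) (((k : ℝ) + 2) * ((x + y) / 2)) +
      ((k : ℝ) + 2) ^ 2 * deriv (deriv D.v) (((k : ℝ) + 2) * D.zmin) * ((x - y) ^ 2 / 4) ≤
      D.phi (k + 2) (((k : ℝ) + 2) * x) + D.phi (k + 2) (((k : ℝ) + 2) * y) := by
    intro k
    have hk : (0 : ℝ) ≤ k + 2 := by positivity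
    unfold phi
    split_ifs
    · have hsub' : ∀ r ∈ Ici D.zmin, D.rhc < ((k : ℝ) + 2) * r := fun r hr => by
        linarith [D.two_zmin_le k hr, D.rhc_lt_zmin, D.zmin_pos]
      have := midpoint_le (f := fun r => D.v (((k : ℝ) + 2) * r)) (convex_Ici D.zmin)
        (f' := fun r => ((k : ℝ) + 2) * deriv D.v (((k : ℝ) + 2) * r))
        (f'' := fun r => ((k : ℝ) + 2) ^ 2 * deriv (deriv D.v) (((k : ℝ) + 2) * r))
        (q := ((k : ℝ) + 2) ^ 2 * deriv (deriv D.v) (((k : ℝ) + 2) * D.zmin))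
        (x := x) (y := y) ?_ ?_ ?_ hx.1 hy.1
      · linarith
      · intro r hr
        have := (D.hasDerivAt_v (hsub' r hr)).comp r ((hasDerivAt_id r).const_mul ((k : ℝ) + 2))
        exact this.congr_deriv (by ring)
      · intro r hr
        have := ((D.hasDerivAt_deriv (hsub' r hr)).comp r
          ((hasDerivAt_id r).const_mul ((k : ℝ) + 2))).const_mul ((k : ℝ) + 2)
        exact this.congr_deriv (by ring)
      · intro r hr
        refine mul_le_mul_of_nonneg_left (D.hv.deriv2_increasing (D.two_zmin_le k le_rfl)
          (D.two_zmin_le k hr) (mul_le_mul_of_nonneg_left hr hk)) (by positivity)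
    · have := D.hv.deriv2_nonpos _ (D.two_zmin_le k le_rfl)
      have h3 : 0 ≤ ((k : ℝ) + 2) ^ 2 * ((x - y) ^ 2 / 4) := by positivity
      nlinarith
  have hS : ∀ r ∈ Icc D.zmin D.zmax, Summable fun k : ℕ => D.phi (k + 2) (((k : ℝ) + 2) * r) :=
    fun r hr => D.summable_phi_mul_two (hsub r hr)
  have h3 := Summable.tsum_le_tsum h2
    (((hS _ hmid).mul_left 2).add (D.summable_deriv2.mul_right _)) ((hS _ hx).add (hS _ hy))
  rw [Summable.tsum_add ((hS _ hmid).mul_left 2) (D.summable_deriv2.mul_right _), tsum_mul_left,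
    tsum_mul_right, Summable.tsum_add (hS _ hx) (hS _ hy)] at h3
  rw [D.cb_eq_add (hsub _ hx), D.cb_eq_add (hsub _ hy), D.cb_eq_add (hsub _ hmid), modulus]
  linarith

lemma cb_ge_of_zmax_le {r : ℝ} (hr : D.zmax ≤ r) :
    D.cb D.zmax + D.p * (r - D.zmax) ≤ D.cb r := by
  have hr' := D.rhc_lt_zmax.trans_le hr
  rw [D.cb_eq_add D.rhc_lt_zmax, D.cb_eq_add hr']
  have h1 : D.v D.zmax ≤ D.v r := by
    rcases hr.eq_or_lt with h | h
    · rw [h]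
    · exact (D.hv.zmax_unique_min r hr' h.ne').le
  have h2 : ∑' k : ℕ, D.phi (k + 2) (((k : ℝ) + 2) * D.zmax) ≤
      ∑' k : ℕ, D.phi (k + 2) (((k : ℝ) + 2) * r) := by
    refine Summable.tsum_le_tsum (fun k => ?_) (D.summable_phi_mul_two D.rhc_lt_zmax)
      (D.summable_phi_mul_two hr')
    unfold phi
    split_ifs
    · refine D.hv.increasing (D.zmax_lt_mul D.zmin_lt_zmax.le)
        (D.zmax_lt_mul (D.zmin_lt_zmax.le.trans hr)) (mul_le_mul_of_nonneg_left hr (by positivity))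
    · exact le_rfl
  nlinarith

lemma exists_minimizer : ∃ a ∈ Icc D.zmin D.zmax, ∀ r, D.rhc < r → D.cb a ≤ D.cb r := by
  have hsub : Icc D.zmin D.zmax ⊆ Ioi D.rhc := fun r hr => D.rhc_lt_zmin.trans_le hr.1
  obtain ⟨a, ha, hmin⟩ := isCompact_Icc.exists_isMinOn (nonempty_Icc.2 D.zmin_lt_zmax.le)
    (D.continuousOn_cb.mono hsub)
  have hz := hmin (right_mem_Icc.2 D.zmin_lt_zmax.le)
  simp only [mem_ofPred_eq] at hz
  refine ⟨a, ha, fun r hr => ?_⟩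
  rcases lt_or_ge r D.zmin with h | h
  · linarith [D.cb_pos_of_lt_zmin hr h, D.cb_zmax_neg]
  rcases le_or_gt r D.zmax with h' | h'
  · exact hmin ⟨h, h'⟩
  · have := D.cb_ge_of_zmax_le h'.le
    nlinarith [D.hp]

/-- The ground state spacing. -/
def a : ℝ := D.exists_minimizer.choose

/-- The ground state energy per particle. -/
def e₀ : ℝ := D.cb D.a

lemma a_mem : D.a ∈ Icc D.zmin D.zmax := D.exists_minimizer.choose_spec.1

lemma e₀_le {r : ℝ} (hr : D.rhc < r) : D.e₀ ≤ D.cb r := D.exists_minimizer.choose_spec.2 r hr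

lemma rhc_lt_a : D.rhc < D.a := D.rhc_lt_zmin.trans_le D.a_mem.1

lemma a_pos : 0 < D.a := D.hrhc.trans D.rhc_lt_a

lemma e₀_neg : D.e₀ < 0 := (D.e₀_le D.rhc_lt_zmax).trans_lt D.cb_zmax_neg

lemma cb_sub_ge {r : ℝ} (hr : r ∈ Icc D.zmin D.zmax) :
    D.modulus * (r - D.a) ^ 2 / 4 ≤ D.cb r - D.e₀ := by
  have h1 := D.cb_midpoint hr D.a_mem
  have h2 := D.e₀_le (r := (r + D.a) / 2) (by
    have := D.rhc_lt_zmin.trans_le hr.1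
    linarith [D.rhc_lt_a])
  have : D.cb D.a = D.e₀ := rfl
  linarith

lemma isGroundSpacing : IsGroundSpacing D.v D.rhc D.m D.p D.a := by
  refine ⟨D.rhc_lt_a, fun r hr hne => ?_⟩
  change D.e₀ < D.cb r
  rcases lt_or_ge r D.zmin with h | h
  · linarith [D.cb_pos_of_lt_zmin hr h, D.e₀_neg]
  rcases le_or_gt r D.zmax with h' | h'
  · have h1 := D.cb_sub_ge ⟨h, h'⟩
    have h2 : 0 < (r - D.a) ^ 2 := by
      have : r - D.a ≠ 0 := sub_ne_zero.2 hne
      positivity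
    nlinarith [D.modulus_pos]
  · have h1 := D.cb_ge_of_zmax_le h'.le
    have h2 := D.e₀_le D.rhc_lt_zmax
    nlinarith [D.hp]

/-! ### Taylor remainders -/

/-- The second order Taylor remainder of `phi k` at `k * a`. -/
def rem (k : ℕ) (x : ℝ) : ℝ :=
  if (k : ℕ∞) ≤ D.m then D.v (k * D.a + x) - D.v (k * D.a) - deriv D.v (k * D.a) * x else 0

/-- The derivative of `phi k` at `k * a`. -/
def slope (k : ℕ) : ℝ := if (k : ℕ∞) ≤ D.m then deriv D.v (k * D.a) else 0

lemma phi_add (k : ℕ) (x : ℝ) :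
    D.phi k (k * D.a + x) - D.phi k (k * D.a) = D.rem k x + D.slope k * x := by
  unfold phi rem slope; split_ifs <;> ring

lemma rem_zero (k : ℕ) : D.rem k 0 = 0 := by simp [rem]

/-- After subtraction of the tangent line the derivative at `r` is at most `B * |r - k a|`, and the
mean value theorem applies between the two points; the power of `k` is the decay of `v''` at
distances at least `k ρ`. Differences, not just values, are estimated because continuity of `Phi`
rests on them. -/
lemma exists_rem_bound {ρ : ℝ} (hρ : D.rhc < ρ) (hρa : ρ ≤ D.a) :
    ∃ C, 0 < C ∧ ∀ (k : ℕ) (x y : ℝ), 1 ≤ k → (k : ℝ) * ρ ≤ k * D.a + x →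
      (k : ℝ) * ρ ≤ k * D.a + y →
      |D.rem k x - D.rem k y| ≤ C * (k : ℝ) ^ (-D.s - 2) * (|x - y| * (|x| + |y|)) := by
  obtain ⟨C, hC, h⟩ := D.exists_bound_deriv2 hρ
  have hρ0 : 0 < ρ := D.hrhc.trans hρ
  refine ⟨C * ρ ^ (-D.s - 2), by positivity, fun k x y hk hx hy => ?_⟩
  have hk1 : (1 : ℝ) ≤ k := by exact_mod_cast hk
  have hk0 : (0 : ℝ) < k := by linarith
  unfold rem
  split_ifs
  swap
  · simp only [sub_zero, abs_zero]; positivity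
  set B := C * ρ ^ (-D.s - 2) * (k : ℝ) ^ (-D.s - 2) with hB
  have hB0 : 0 ≤ B := by positivity
  have hlarge : ∀ r ∈ Ici ((k : ℝ) * ρ), D.rhc < r := fun r hr => by
    have := mem_Ici.1 hr; nlinarith
  have hd2 : ∀ r ∈ Ici ((k : ℝ) * ρ), ‖deriv (deriv D.v) r‖ ≤ B := by
    intro r hr
    have hr' := mem_Ici.1 hr
    refine (h r (by nlinarith)).trans ?_
    rw [hB, mul_assoc]
    refine mul_le_mul_of_nonneg_left ?_ hC.le
    rw [← Real.mul_rpow hρ0.le hk0.le, mul_comm]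
    exact Real.rpow_le_rpow_of_nonpos (by positivity) hr' (by linarith [D.hv.two_lt_s])
  have hka : (k : ℝ) * D.a ∈ Ici ((k : ℝ) * ρ) := mul_le_mul_of_nonneg_left hρa hk0.le
  have hd1 : ∀ r ∈ Ici ((k : ℝ) * ρ), |deriv D.v r - deriv D.v (k * D.a)| ≤ B * |r - k * D.a| :=
    fun r hr => (convex_Ici _).norm_image_sub_le_of_norm_deriv_le
      (fun r hr => (D.hasDerivAt_deriv (hlarge r hr)).differentiableAt) hd2 hka hr
  set g : ℝ → ℝ := fun r => D.v r - deriv D.v (k * D.a) * r with hg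
  have hgd : ∀ r ∈ Ici ((k : ℝ) * ρ), HasDerivAt g (deriv D.v r - deriv D.v (k * D.a)) r := by
    intro r hr
    exact ((D.hasDerivAt_v (hlarge r hr)).sub
      ((hasDerivAt_id r).const_mul (deriv D.v (k * D.a)))).congr_deriv (by simp)
  have hsub : uIcc (k * D.a + y) (k * D.a + x) ⊆ Ici ((k : ℝ) * ρ) := by
    intro r hr
    rw [mem_uIcc] at hr
    rw [mem_Ici]
    rcases hr with hr | hr <;> linarith [hr.1]
  have hfin := (convex_uIcc (k * D.a + y) (k * D.a + x)).norm_image_sub_le_of_norm_deriv_le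
    (f := g) (C := B * (|x| + |y|)) (fun r hr => (hgd r (hsub hr)).differentiableAt) (by
      intro r hr
      rw [(hgd r (hsub hr)).deriv]
      refine (hd1 r (hsub hr)).trans (mul_le_mul_of_nonneg_left ?_ hB0)
      rw [mem_uIcc] at hr
      rw [abs_le]
      have h1 := neg_abs_le x
      have h2 := neg_abs_le y
      have h3 := le_abs_self x
      have h4 := le_abs_self y
      have h5 := abs_nonneg x
      have h6 := abs_nonneg y
      constructor <;> rcases hr with hr | hr <;> linarith [hr.1, hr.2])
    left_mem_uIcc right_mem_uIcc
  have e1 : g (k * D.a + x) - g (k * D.a + y) = D.v (k * D.a + x) - D.v (k * D.a) -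
      deriv D.v (k * D.a) * x - (D.v (k * D.a + y) - D.v (k * D.a) - deriv D.v (k * D.a) * y) := by
    simp only [hg]; ring
  rw [Real.norm_eq_abs, e1, Real.norm_eq_abs, show k * D.a + x - (k * D.a + y) = x - y by ring]
    at hfin
  calc _ ≤ _ := hfin
    _ = _ := by ring

lemma exists_slope_bound :
    ∃ C, 0 < C ∧ ∀ k : ℕ, 1 ≤ k → |D.slope k| ≤ C * (k : ℝ) ^ (-D.s - 1) := by
  obtain ⟨C, hC, h⟩ := D.exists_bound_deriv D.rhc_lt_a
  have ha := D.a_pos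
  refine ⟨C * D.a ^ (-D.s - 1), by positivity, fun k hk => ?_⟩
  have hk1 : (1 : ℝ) ≤ k := by exact_mod_cast hk
  unfold slope
  split_ifs
  · refine (h _ (by nlinarith)).trans (le_of_eq ?_)
    rw [Real.mul_rpow (by linarith) ha.le]
    ring
  · simp only [abs_zero]; positivity

lemma summable_mul_slope : Summable fun k : ℕ => ((k + 1 : ℕ) : ℝ) * D.slope (k + 1) := by
  obtain ⟨C, hC, h⟩ := D.exists_slope_bound
  have hs := (summable_rpow_add (q := -D.s) (by linarith [D.hv.two_lt_s]) 1).mul_left C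
  refine Summable.of_norm_bounded hs fun k => ?_
  rw [norm_mul, Real.norm_natCast, Real.norm_eq_abs]
  refine (mul_le_mul_of_nonneg_left (h (k + 1) (by omega)) (by positivity)).trans (le_of_eq ?_)
  have : ((k + 1 : ℕ) : ℝ) ≠ 0 := by positivity
  rw [Real.rpow_sub_one this]
  push_cast at this ⊢
  field_simp

lemma cb_taylor {x : ℝ} (hx : D.rhc < D.a + x) :
    D.cb (D.a + x) - D.e₀ = (D.p + ∑' k : ℕ, ((k + 1 : ℕ) : ℝ) * D.slope (k + 1)) * x +
      ∑' k : ℕ, D.rem (k + 1) (((k + 1 : ℕ) : ℝ) * x) := by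
  have hS := (D.summable_phi_mul hx).sub (D.summable_phi_mul D.rhc_lt_a)
  have hterm : ∀ k : ℕ, D.phi (k + 1) (((k : ℝ) + 1) * (D.a + x)) -
      D.phi (k + 1) (((k : ℝ) + 1) * D.a) =
      D.rem (k + 1) (((k + 1 : ℕ) : ℝ) * x) + ((k + 1 : ℕ) : ℝ) * D.slope (k + 1) * x := by
    intro k
    have := D.phi_add (k + 1) (((k + 1 : ℕ) : ℝ) * x)
    rw [← mul_add] at this
    push_cast at this ⊢
    rw [this]; ring
  have hL := D.summable_mul_slope.mul_right x
  have hR : Summable fun k : ℕ => D.rem (k + 1) (((k + 1 : ℕ) : ℝ) * x) := by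
    refine (hS.sub hL).congr fun k => ?_
    rw [hterm]; ring
  rw [show D.e₀ = D.cb D.a from rfl, cb_eq, cb_eq, add_sub_add_comm,
    ← Summable.tsum_sub (D.summable_phi_mul hx) (D.summable_phi_mul D.rhc_lt_a),
    tsum_congr hterm, Summable.tsum_add hR hL, tsum_mul_right]
  ring

/-- The ground state is stress free: the external pressure balances the internal forces. -/
lemma stationary : D.p + ∑' k : ℕ, ((k + 1 : ℕ) : ℝ) * D.slope (k + 1) = 0 := by
  set d := D.p + ∑' k : ℕ, ((k + 1 : ℕ) : ℝ) * D.slope (k + 1) with hd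
  obtain ⟨ρ, hρ, hρa⟩ := exists_between D.rhc_lt_a
  obtain ⟨C, hC, h⟩ := D.exists_rem_bound hρ hρa.le
  have hs := (summable_rpow_add (q := -D.s) (by linarith [D.hv.two_lt_s]) 1).mul_left C
  set B := ∑' k : ℕ, C * ((k : ℝ) + (1 : ℕ)) ^ (-D.s) with hB
  have hBn : 0 ≤ B := tsum_nonneg fun k => by positivity
  have key : ∀ x : ℝ, |x| ≤ D.a - ρ → 0 ≤ d * x + B * x ^ 2 := by
    intro x hx
    have hx' := abs_le.1 hx
    have h1 := D.e₀_le (r := D.a + x) (by linarith)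
    have h2 := D.cb_taylor (x := x) (by linarith)
    have h3 : ∀ k : ℕ, ‖D.rem (k + 1) (((k + 1 : ℕ) : ℝ) * x)‖ ≤
        C * ((k : ℝ) + (1 : ℕ)) ^ (-D.s) * x ^ 2 := by
      intro k
      have hk0 : (0 : ℝ) < ((k + 1 : ℕ) : ℝ) := by positivity
      have := h (k + 1) (((k + 1 : ℕ) : ℝ) * x) 0 (by omega) (by nlinarith) (by nlinarith)
      rw [D.rem_zero, sub_zero, sub_zero, abs_zero, add_zero, abs_mul, abs_of_pos hk0] at this
      refine this.trans (le_of_eq ?_)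
      rw [Real.rpow_sub hk0, ← sq_abs x]
      simp only [Real.rpow_ofNat]
      push_cast at hk0 ⊢
      field_simp
    have h4 := tsum_of_norm_bounded (hs.mul_right (x ^ 2)).hasSum h3
    rw [tsum_mul_right, ← hB] at h4
    have := le_of_abs_le h4
    linarith
  by_contra hne
  have hapos : 0 < D.a - ρ := by linarith
  -- At this step length the quadratic term is at most half of the linear one.
  set t := min (D.a - ρ) (|d| / (2 * (B + 1))) with ht
  have hdpos : 0 < |d| := abs_pos.2 hne
  have htpos : 0 < t := lt_min hapos (by positivity)
  have ht2 : t * (2 * (B + 1)) ≤ |d| := by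
    rw [← le_div_iff₀ (by positivity)]; exact min_le_right _ _
  have hta : t ≤ D.a - ρ := min_le_left _ _
  rcases lt_or_gt_of_ne hne with hneg | hpos
  · have := key t (by rwa [abs_of_pos htpos])
    rw [abs_of_neg hneg] at ht2
    nlinarith
  · have := key (-t) (by rwa [abs_neg, abs_of_pos htpos])
    rw [abs_of_pos hpos] at ht2
    nlinarith

/-- At `a = zmax` all slopes at the points `k a ≥ zmax` would be nonnegative and could not balance
the positive pressure. -/
lemma a_lt_zmax : D.a < D.zmax := by
  refine lt_of_le_of_ne D.a_mem.2 fun h => ?_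
  have h1 := D.stationary
  have h2 : 0 ≤ ∑' k : ℕ, ((k + 1 : ℕ) : ℝ) * D.slope (k + 1) := by
    refine tsum_nonneg fun k => mul_nonneg (by positivity) ?_
    unfold slope
    split_ifs
    · refine D.deriv_nonneg ?_
      rw [h]
      push_cast
      nlinarith [D.zmax_pos, Nat.cast_nonneg (α := ℝ) k]
    · exact le_rfl
  linarith [D.hp]

/-- A bounded measure of the distance to the ground state spacing. -/
def theta (r : ℝ) : ℝ := min ((r - D.a) ^ 2) 1

lemma theta_nonneg (r : ℝ) : 0 ≤ D.theta r := le_min (sq_nonneg _) zero_le_one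
lemma theta_le_one (r : ℝ) : D.theta r ≤ 1 := min_le_right _ _
lemma theta_le_sq (r : ℝ) : D.theta r ≤ (r - D.a) ^ 2 := min_le_left _ _

/-- Growth is quadratic on `[zmin, zmax]`, and beyond `zmax` there is a fixed gap, which suffices
because `theta` is capped at 1. The condition `2 * κ ≤ -e₀` pays for the at most two values of
`theta` lost when a particle is deleted in `Epos_ge`. -/
lemma exists_kappa : ∃ κ, 0 < κ ∧ 2 * κ ≤ -D.e₀ ∧
    ∀ r, D.zmin ≤ r → κ * D.theta r ≤ D.cb r - D.e₀ := by
  have hc := D.modulus_pos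
  have hw : 0 < D.cb D.zmax - D.e₀ := by
    have := D.cb_sub_ge (right_mem_Icc.2 D.zmin_lt_zmax.le)
    have h2 : 0 < (D.zmax - D.a) ^ 2 := by
      have : 0 < D.zmax - D.a := by linarith [D.a_lt_zmax]
      positivity
    nlinarith
  have he := D.e₀_neg
  refine ⟨min (D.modulus / 4) (min (D.cb D.zmax - D.e₀) (-D.e₀ / 2)), ?_, ?_, ?_⟩
  · refine lt_min (by linarith) (lt_min hw (by linarith))
  · have := (min_le_right (D.modulus / 4) (min (D.cb D.zmax - D.e₀) (-D.e₀ / 2))).trans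
      (min_le_right _ _)
    linarith
  · intro r hr
    rcases le_or_gt r D.zmax with h' | h'
    · have h1 := D.cb_sub_ge ⟨hr, h'⟩
      have h2 := mul_le_mul (min_le_left (D.modulus / 4) (min (D.cb D.zmax - D.e₀) (-D.e₀ / 2)))
        (D.theta_le_sq r) (D.theta_nonneg r) (by linarith)
      linarith
    · have h1 := D.cb_ge_of_zmax_le h'.le
      have h2 := mul_le_mul ((min_le_right (D.modulus / 4) (min (D.cb D.zmax - D.e₀)
        (-D.e₀ / 2))).trans (min_le_left _ _)) (D.theta_le_one r) (D.theta_nonneg r) hw.le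
      nlinarith [D.hp]

/-- The coercivity constant of the energy. -/
def kappa : ℝ := D.exists_kappa.choose
lemma kappa_pos : 0 < D.kappa := D.exists_kappa.choose_spec.1
lemma two_kappa_le : 2 * D.kappa ≤ -D.e₀ := D.exists_kappa.choose_spec.2.1
lemma kappa_theta_le {r : ℝ} (hr : D.zmin ≤ r) : D.kappa * D.theta r ≤ D.cb r - D.e₀ :=
  D.exists_kappa.choose_spec.2.2 r hr

end Model

/-! ### Sums over pairs of particles -/

/-- The sum of `f` over the pairs `b ≤ i < j ≤ e`. -/
def pairSum (f : ℤ → ℤ → ℝ) (b e : ℤ) : ℝ := ∑ i ∈ Finset.Ico b e, ∑ j ∈ Finset.Ioc i e, f i j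

/-- The sum of `f` over the pairs `b ≤ i < t < j ≤ e`. -/
def crossSum (f : ℤ → ℤ → ℝ) (b t e : ℤ) : ℝ :=
  ∑ i ∈ Finset.Ico b t, ∑ j ∈ Finset.Ioc t e, f i j

lemma pairSum_self (f : ℤ → ℤ → ℝ) (b : ℤ) : pairSum f b b = 0 := by simp [pairSum]

lemma crossSum_left_self (f : ℤ → ℤ → ℝ) (b e : ℤ) : crossSum f b b e = 0 := by simp [crossSum]

lemma sum_Ico_consecutive {f : ℤ → ℝ} {b t e : ℤ} (hb : b ≤ t) (he : t ≤ e) :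
    ∑ i ∈ Finset.Ico b e, f i = ∑ i ∈ Finset.Ico b t, f i + ∑ i ∈ Finset.Ico t e, f i := by
  rw [← Finset.sum_union (Finset.Ico_disjoint_Ico_consecutive b t e),
    Finset.Ico_union_Ico_eq_Ico hb he]

lemma sum_Ioc_consecutive {f : ℤ → ℝ} {b t e : ℤ} (hb : b ≤ t) (he : t ≤ e) :
    ∑ i ∈ Finset.Ioc b e, f i = ∑ i ∈ Finset.Ioc b t, f i + ∑ i ∈ Finset.Ioc t e, f i := by
  rw [← Finset.sum_union (Finset.Ioc_disjoint_Ioc_of_le le_rfl),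
    Finset.Ioc_union_Ioc_eq_Ioc hb he]

lemma pairSum_split (f : ℤ → ℤ → ℝ) {b t e : ℤ} (hb : b ≤ t) (he : t ≤ e) :
    pairSum f b e = pairSum f b t + pairSum f t e + crossSum f b t e := by
  unfold pairSum crossSum
  rw [sum_Ico_consecutive hb he, add_right_comm, ← Finset.sum_add_distrib]
  congr 1
  refine Finset.sum_congr rfl fun i hi => ?_
  exact sum_Ioc_consecutive (Finset.mem_Ico.1 hi).2.le he

lemma pairSum_congr {f g : ℤ → ℤ → ℝ} {b e : ℤ}
    (h : ∀ i j, b ≤ i → i < j → j ≤ e → f i j = g i j) : pairSum f b e = pairSum g b e := by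
  refine Finset.sum_congr rfl fun i hi => Finset.sum_congr rfl fun j hj => ?_
  exact h i j (Finset.mem_Ico.1 hi).1 (Finset.mem_Ioc.1 hj).1 (Finset.mem_Ioc.1 hj).2

lemma crossSum_congr {f g : ℤ → ℤ → ℝ} {b t e : ℤ}
    (h : ∀ i j, b ≤ i → i < t → t < j → j ≤ e → f i j = g i j) :
    crossSum f b t e = crossSum g b t e := by
  refine Finset.sum_congr rfl fun i hi => Finset.sum_congr rfl fun j hj => ?_
  exact h i j (Finset.mem_Ico.1 hi).1 (Finset.mem_Ico.1 hi).2 (Finset.mem_Ioc.1 hj).1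
    (Finset.mem_Ioc.1 hj).2

lemma pairSum_shift (f : ℤ → ℤ → ℝ) (b e c : ℤ) :
    pairSum (fun i j => f (i + c) (j + c)) b e = pairSum f (b + c) (e + c) := by
  unfold pairSum
  rw [← Finset.map_add_right_Ico, Finset.sum_map]
  refine Finset.sum_congr rfl fun i _ => ?_
  simp only [addRightEmbedding_apply]
  rw [← Finset.map_add_right_Ioc, Finset.sum_map]
  rfl

lemma pairSum_succ (f : ℤ → ℤ → ℝ) {b e : ℤ} (hb : b ≤ e) :
    pairSum f b (e + 1) = pairSum f b e + ∑ i ∈ Finset.Ico b (e + 1), f i (e + 1) := by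
  rw [pairSum_split f hb (by omega : e ≤ e + 1), sum_Ico_consecutive hb (by omega : e ≤ e + 1),
    add_assoc, add_comm (pairSum f e (e + 1))]
  have h1 : Finset.Ico e (e + 1) = {e} := by ext; simp; omega
  have h2 : Finset.Ioc e (e + 1) = {e + 1} := by ext; simp; omega
  simp [pairSum, crossSum, h1, h2]

/-- Coordinates for the pairs on the two sides of a cut. -/
lemma crossSum_eq (f : ℤ → ℤ → ℝ) {b t e : ℤ} :
    crossSum f b t e = ∑ q ∈ Finset.range (t - b).toNat ×ˢ Finset.range (e - t).toNat,
      f (t - 1 - q.1) (t + 1 + q.2) := by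
  unfold crossSum
  rw [Finset.sum_product]
  refine Finset.sum_bij' (fun i _ => (t - 1 - i).toNat) (fun α _ => t - 1 - α) ?_ ?_ ?_ ?_ ?_
  · intro i hi; simp only [Finset.mem_Ico, Finset.mem_range] at *; omega
  · intro i hi; simp only [Finset.mem_Ico, Finset.mem_range] at *; omega
  · intro i hi; simp only [Finset.mem_Ico] at *; omega
  · intro i hi; simp only [Finset.mem_range] at *; omega
  intro i hi
  have hi' : t - 1 - ((t - 1 - i).toNat : ℤ) = i := by
    simp only [Finset.mem_Ico] at hi; omega
  simp only [hi']
  refine Finset.sum_bij' (fun j _ => (j - t - 1).toNat) (fun α _ => t + 1 + α) ?_ ?_ ?_ ?_ ?_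
  · intro i hi; simp only [Finset.mem_Ioc, Finset.mem_range] at *; omega
  · intro i hi; simp only [Finset.mem_Ioc, Finset.mem_range] at *; omega
  · intro i hi; simp only [Finset.mem_Ioc] at *; omega
  · intro i hi; simp only [Finset.mem_range] at *; omega
  intro j hj
  have hj' : t + 1 + ((j - t - 1).toNat : ℤ) = j := by
    simp only [Finset.mem_Ioc] at hj; omega
  rw [hj']

lemma abs_crossSum_le {f : ℤ → ℤ → ℝ} {b t e : ℤ} {d : ℕ × ℕ → ℝ} (hd : Summable d)
    (hd0 : ∀ q, 0 ≤ d q)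
    (h : ∀ α β : ℕ, b ≤ t - 1 - α → t + 1 + β ≤ e → |f (t - 1 - α) (t + 1 + β)| ≤ d (α, β)) :
    |crossSum f b t e| ≤ ∑' q, d q := by
  rw [crossSum_eq]
  refine (Finset.abs_sum_le_sum_abs _ _).trans
    ((Finset.sum_le_sum fun q hq => ?_).trans (hd.sum_le_tsum _ fun q _ => hd0 q))
  simp only [Finset.mem_product, Finset.mem_range] at hq
  exact h q.1 q.2 (by omega) (by omega)

lemma crossSum_sub (f g : ℤ → ℤ → ℝ) (b t e : ℤ) :
    crossSum f b t e - crossSum g b t e = crossSum (fun i j => f i j - g i j) b t e := by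
  simp [crossSum, Finset.sum_sub_distrib]

/-- The distance of the particles `i ≤ j` of the chain with spacings `z`. -/
def len (z : ℤ → ℝ) (i j : ℤ) : ℝ := ∑ l ∈ Finset.Ico i j, z l

lemma len_add {z : ℤ → ℝ} {i j k : ℤ} (h : i ≤ j) (h' : j ≤ k) :
    len z i k = len z i j + len z j k := sum_Ico_consecutive h h'

lemma len_succ (z : ℤ → ℝ) (i : ℤ) : len z i (i + 1) = z i := by
  have h1 : Finset.Ico i (i + 1) = {i} := by ext; simp; omega
  simp [len, h1]

lemma len_congr {z y : ℤ → ℝ} {i j : ℤ} (h : ∀ l, i ≤ l → l < j → z l = y l) :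
    len z i j = len y i j :=
  Finset.sum_congr rfl fun l hl => h l (Finset.mem_Ico.1 hl).1 (Finset.mem_Ico.1 hl).2

lemma len_shift (z : ℤ → ℝ) (i j c : ℤ) : len (fun l => z (l + c)) i j = len z (i + c) (j + c) := by
  unfold len
  rw [← Finset.map_add_right_Ico, Finset.sum_map]
  rfl

lemma le_len {z : ℤ → ℝ} {i j : ℤ} {ρ : ℝ} (hij : i ≤ j) (h : ∀ l, i ≤ l → l < j → ρ ≤ z l) :
    ((j - i : ℤ) : ℝ) * ρ ≤ len z i j := by
  have := Finset.card_nsmul_le_sum (Finset.Ico i j) z ρ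
    fun l hl => h l (Finset.mem_Ico.1 hl).1 (Finset.mem_Ico.1 hl).2
  rw [nsmul_eq_mul, Int.card_Ico] at this
  have h2 : (((j - i).toNat : ℕ) : ℝ) = ((j - i : ℤ) : ℝ) := by
    rw [← Int.cast_natCast, Int.toNat_of_nonneg (by omega)]
  rwa [h2] at this

lemma len_const (r : ℝ) {i j : ℤ} (hij : i ≤ j) : len (fun _ => r) i j = ((j - i : ℤ) : ℝ) * r := by
  unfold len
  rw [Finset.sum_const, nsmul_eq_mul, Int.card_Ico, ← Int.cast_natCast,
    Int.toNat_of_nonneg (by omega)]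

/-- Positions of the particles of the chain with spacings `z`. -/
def position (z : ℤ → ℝ) (j : ℤ) : ℝ := if 0 ≤ j then len z 0 j else -len z j 0

lemma len_eq_position (z : ℤ → ℝ) {i j : ℤ} (h : i ≤ j) :
    len z i j = position z j - position z i := by
  unfold position
  by_cases hi : 0 ≤ i
  · rw [if_pos hi, if_pos (hi.trans h), len_add hi h]; ring
  by_cases hj : 0 ≤ j
  · rw [if_neg hi, if_pos hj, len_add (by omega : i ≤ 0) hj]; ring
  · rw [if_neg hi, if_neg hj, len_add h (by omega : j ≤ 0)]; ring

namespace Model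

variable (D : Model)

/-- The interaction of the particles `i < j` of the chain with spacings `z`. -/
def blk (z : ℤ → ℝ) (i j : ℤ) : ℝ := D.phi (j - i).toNat (len z i j)

/-- The energy of the particles `b, …, e` of the chain with spacings `z`. -/
def E (z : ℤ → ℝ) (b e : ℤ) : ℝ := pairSum (D.blk z) b e + D.p * len z b e

lemma blk_congr {z y : ℤ → ℝ} {i j : ℤ} (h : ∀ l, i ≤ l → l < j → z l = y l) :
    D.blk z i j = D.blk y i j := by
  unfold blk; rw [len_congr h]

lemma E_congr {z y : ℤ → ℝ} {b e : ℤ} (h : ∀ l, b ≤ l → l < e → z l = y l) :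
    D.E z b e = D.E y b e := by
  unfold E
  rw [len_congr h, pairSum_congr fun i j hi _ hj => D.blk_congr fun l hl hl' =>
    h l (hi.trans hl) (hl'.trans_le hj)]

lemma E_self (z : ℤ → ℝ) (b : ℤ) : D.E z b b = 0 := by simp [E, pairSum_self, len]

lemma E_split (z : ℤ → ℝ) {b t e : ℤ} (hb : b ≤ t) (he : t ≤ e) :
    D.E z b e = D.E z b t + D.E z t e + crossSum (D.blk z) b t e := by
  unfold E
  rw [pairSum_split _ hb he, len_add hb he]
  ring

lemma E_shift (z : ℤ → ℝ) (b e c : ℤ) :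
    D.E (fun l => z (l + c)) b e = D.E z (b + c) (e + c) := by
  unfold E
  rw [← pairSum_shift, len_shift]
  congr 2
  funext i j
  unfold blk
  rw [len_shift]
  congr 2
  omega

/-! ### Decay of the interaction -/

/-- Labels at least 2 apart force a distance of at least `2 * rhc`, well away from the singularity
at `rhc`. Hence the non-strict constraint `rhc ≤ z l` is enough, which is what clipped
configurations satisfy later. -/
lemma exists_decay : ∃ C, 0 < C ∧ ∀ (z : ℤ → ℝ) (i j : ℤ), i + 2 ≤ j →
    (∀ l, i ≤ l → l < j → D.rhc ≤ z l) → |D.blk z i j| ≤ C * ((j - i : ℤ) : ℝ) ^ (-D.s) := by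
  have h0 := D.hrhc
  obtain ⟨C, hC, h⟩ := D.exists_bound_v (ρ := 2 * D.rhc) (by linarith)
  refine ⟨C * D.rhc ^ (-D.s), by positivity, fun z i j hij hz => ?_⟩
  have h2 : (2 : ℝ) ≤ ((j - i : ℤ) : ℝ) := by exact_mod_cast (by omega : 2 ≤ j - i)
  have hlen := le_len (by omega : i ≤ j) hz
  refine (D.abs_phi_le _ _).trans ((h _ (by nlinarith)).trans ?_)
  rw [mul_assoc, mul_comm (D.rhc ^ (-D.s)), ← Real.mul_rpow (by linarith) h0.le]
  exact mul_le_mul_of_nonneg_left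
    (Real.rpow_le_rpow_of_nonpos (by nlinarith) hlen (by linarith [D.hv.two_lt_s])) hC.le

/-- A bound for the interaction of particles whose labels differ by `k ≥ 2`. -/
def c (k : ℕ) : ℝ := D.exists_decay.choose * (k : ℝ) ^ (-D.s)

lemma c_nonneg (k : ℕ) : 0 ≤ D.c k :=
  mul_nonneg D.exists_decay.choose_spec.1.le (Real.rpow_nonneg (Nat.cast_nonneg _) _)

lemma abs_blk_le {z : ℤ → ℝ} {i j : ℤ} (hij : i + 2 ≤ j)
    (hz : ∀ l, i ≤ l → l < j → D.rhc ≤ z l) : |D.blk z i j| ≤ D.c (j - i).toNat := by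
  have := D.exists_decay.choose_spec.2 z i j hij hz
  rwa [← Int.toNat_of_nonneg (by omega : 0 ≤ j - i), Int.cast_natCast] at this

/-- There are `k - 1` pairs at label distance `k` across a cut, so convergence needs `s > 2`. The
inequality `(α + 1)(β + 1) ≤ (α + β + 2)²` reduces the double series to a product of two series with
exponent `s / 2 > 1`. -/
lemma summable_c : Summable fun q : ℕ × ℕ => D.c (q.1 + q.2 + 2) := by
  have hs := D.hv.two_lt_s
  have h1 := summable_rpow_add (q := -D.s / 2) (by linarith) 1
  have h2 := Summable.mul_of_nonneg h1 h1 (fun n => by positivity) (fun n => by positivity)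
  refine Summable.mul_left _ (Summable.of_nonneg_of_le (fun q => by positivity) (fun q => ?_) h2)
  have ha : (0 : ℝ) < q.1 + 1 := by positivity
  have hb : (0 : ℝ) < q.2 + 1 := by positivity
  push_cast
  rw [← Real.mul_rpow ha.le hb.le]
  have : ((q.1 : ℝ) + q.2 + 2) ^ (-D.s) = (((q.1 : ℝ) + q.2 + 2) ^ 2) ^ (-D.s / 2) := by
    rw [← Real.rpow_natCast, ← Real.rpow_mul (by positivity)]
    congr 1
    push_cast
    ring
  rw [this]
  refine Real.rpow_le_rpow_of_nonpos (by positivity) ?_ (by linarith)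
  nlinarith [Nat.cast_nonneg (α := ℝ) q.1, Nat.cast_nonneg (α := ℝ) q.2]

/-- A bound for the interaction across a cut. -/
def K : ℝ := ∑' q : ℕ × ℕ, D.c (q.1 + q.2 + 2)

lemma K_nonneg : 0 ≤ D.K := tsum_nonneg fun _ => D.c_nonneg _

lemma abs_crossSum_blk_le {z : ℤ → ℝ} {b t e : ℤ} (hz : ∀ l, b ≤ l → l < e → D.rhc ≤ z l) :
    |crossSum (D.blk z) b t e| ≤ D.K := by
  refine abs_crossSum_le D.summable_c (fun _ => D.c_nonneg _) fun α β h1 h2 => ?_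
  have := D.abs_blk_le (z := z) (i := t - 1 - α) (j := t + 1 + β) (by omega)
    fun l hl hl' => hz l (h1.trans hl) (hl'.trans_le h2)
  rwa [show (t + 1 + (β : ℤ) - (t - 1 - α)).toNat = α + β + 2 by omega] at this

/-- The part of the bound `K` due to pairs with labels differing by more than `M`. -/
def tail (M : ℕ) : ℝ := ∑' q : ℕ × ℕ, if q.1 + q.2 + 2 ≤ M then 0 else D.c (q.1 + q.2 + 2)

lemma summable_tail (M : ℕ) :
    Summable fun q : ℕ × ℕ => if q.1 + q.2 + 2 ≤ M then 0 else D.c (q.1 + q.2 + 2) :=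
  Summable.of_nonneg_of_le (fun q => by split_ifs; exacts [le_rfl, D.c_nonneg _])
    (fun q => by split_ifs; exacts [D.c_nonneg _, le_rfl]) D.summable_c

lemma tendsto_tail : Tendsto D.tail atTop (𝓝 0) := by
  rw [← tsum_zero (α := ℝ) (β := ℕ × ℕ)]
  refine tendsto_tsum_of_dominated_convergence D.summable_c (fun q => ?_)
    (Eventually.of_forall fun M q => ?_)
  · refine tendsto_const_nhds.congr' ?_
    filter_upwards [eventually_ge_atTop (q.1 + q.2 + 2)] with M hM
    rw [if_pos hM]
  · rw [Real.norm_eq_abs]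
    split_ifs
    · rw [abs_zero]; exact D.c_nonneg _
    · exact (abs_of_nonneg (D.c_nonneg _)).le

lemma exists_lipschitz : ∃ L, 0 < L ∧ ∀ (k : ℕ) (x y : ℝ), 2 * D.rhc ≤ x → 2 * D.rhc ≤ y →
    |D.phi k x - D.phi k y| ≤ L * |x - y| := by
  have h0 := D.hrhc
  obtain ⟨C, hC, h⟩ := D.exists_bound_deriv (ρ := 2 * D.rhc) (by linarith)
  refine ⟨C * (2 * D.rhc) ^ (-D.s - 1), by positivity, fun k x y hx hy => ?_⟩
  have hlt : ∀ r ∈ Ici (2 * D.rhc), D.rhc < r := fun r hr => by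
    have := mem_Ici.1 hr; linarith
  unfold phi
  split_ifs
  · refine (convex_Ici (2 * D.rhc)).norm_image_sub_le_of_norm_deriv_le
      (fun r hr => (D.hasDerivAt_v (hlt r hr)).differentiableAt) (fun r hr => ?_) hy hx
    refine (h r hr).trans (mul_le_mul_of_nonneg_left ?_ hC.le)
    exact Real.rpow_le_rpow_of_nonpos (by positivity) hr (by linarith [D.hv.two_lt_s])
  · simp only [sub_self, abs_zero]; positivity

/-- The interaction across a cut of the uniform infinite chain. -/
def Waa : ℝ := ∑' q : ℕ × ℕ, D.phi (q.1 + q.2 + 2) (((q.1 + q.2 + 2 : ℕ) : ℝ) * D.a)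

lemma blk_const {i j : ℤ} (hij : i ≤ j) (r : ℝ) :
    D.blk (fun _ => r) i j = D.phi (j - i).toNat (((j - i).toNat : ℝ) * r) := by
  unfold blk
  rw [len_const r hij, ← Int.cast_natCast (R := ℝ), Int.toNat_of_nonneg (by omega)]

lemma abs_phi_const_le {k : ℕ} (hk : 2 ≤ k) : |D.phi k ((k : ℝ) * D.a)| ≤ D.c k := by
  have := D.abs_blk_le (z := fun _ => D.a) (i := 0) (j := k) (by omega) fun _ _ _ => D.rhc_lt_a.le
  rw [D.blk_const (by omega)] at this
  simpa using this

lemma summable_Waa :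
    Summable fun q : ℕ × ℕ => D.phi (q.1 + q.2 + 2) (((q.1 + q.2 + 2 : ℕ) : ℝ) * D.a) :=
  Summable.of_norm_bounded D.summable_c fun _ => D.abs_phi_const_le (by omega)

/-- Spacings within `ε` of `a` at distance at most `M` from a cut determine the interaction across
this cut up to `η`. -/
def Good (M : ℤ) (ε η : ℝ) : Prop :=
  1 ≤ M ∧ 0 < ε ∧ ε ≤ 1 ∧ ∀ (z : ℤ → ℝ) (b t e : ℤ), b + M ≤ t → t + M ≤ e →
    (∀ l, b ≤ l → l < e → D.rhc ≤ z l) →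
    (∀ l, t - M ≤ l → l < t + M → |z l - D.a| ≤ ε) →
    |crossSum (D.blk z) b t e - D.Waa| ≤ η

/-- Pairs at label distance more than `M` contribute at most `tail M` to each side of the
comparison. The finitely many others depend in a Lipschitz way on distances, which differ from those
of the uniform chain by a multiple of `ε`. -/
lemma exists_good {η : ℝ} (hη : 0 < η) : ∃ M ε, D.Good M ε η := by
  have hcut : ∀ᶠ M in atTop, D.tail M < η / 4 :=
    (tendsto_order.1 D.tendsto_tail).2 _ (by positivity)
  obtain ⟨M, hM, hM1⟩ := (hcut.and (eventually_ge_atTop 1)).exists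
  obtain ⟨L, hL, hLip⟩ := D.exists_lipschitz
  have hM0 : (0 : ℝ) < M := by exact_mod_cast hM1
  -- At most `M²` pairs, each with distance off by at most `M * ε` and Lipschitz constant `L`, add
  -- up to `η / 2`.
  set ε := min 1 (η / (2 * L * M ^ 3)) with hε
  have hε0 : 0 < ε := lt_min one_pos (by positivity)
  have hε2 : L * (M * ε) * M ^ 2 ≤ η / 2 := by
    have : ε ≤ η / (2 * L * M ^ 3) := min_le_right _ _
    rw [le_div_iff₀ (by positivity)] at this
    linarith
  refine ⟨M, ε, by exact_mod_cast hM1, hε0, min_le_left _ _, fun z b t e hb he hz hza => ?_⟩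
  set S := Finset.range (t - b).toNat ×ˢ Finset.range (e - t).toNat with hS
  set F : ℕ × ℕ → ℝ := fun q => if q ∈ S then D.blk z (t - 1 - q.1) (t + 1 + q.2) else 0 with hF
  have hFsum : HasSum F (crossSum (D.blk z) b t e) := by
    have h1 : crossSum (D.blk z) b t e = ∑ q ∈ S, F q := by
      rw [crossSum_eq]
      exact Finset.sum_congr rfl fun q hq => by simp only [hF]; rw [if_pos hq]
    rw [h1]
    exact hasSum_sum_of_ne_finset_zero fun q hq => by simp only [hF]; rw [if_neg hq]
  have hdiff := hFsum.sub D.summable_Waa.hasSum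
  have hd2 : HasSum (fun q : ℕ × ℕ => if q ∈ Finset.range M ×ˢ Finset.range M then L * (M * ε)
      else 0) (L * (M * ε) * M ^ 2) := by
    have := hasSum_sum_of_ne_finset_zero (s := Finset.range M ×ˢ Finset.range M)
      (f := fun q : ℕ × ℕ => if q ∈ Finset.range M ×ˢ Finset.range M then L * (M * ε) else 0)
      (L := SummationFilter.unconditional _) fun q hq => if_neg hq
    convert this using 1
    rw [Finset.sum_ite_mem, Finset.inter_self, Finset.sum_const, Finset.card_product,
      Finset.card_range, nsmul_eq_mul]
    push_cast
    ring
  have hd := hd2.add ((D.summable_tail M).hasSum.mul_left 2)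
  have hbound := tsum_of_norm_bounded (f := fun q => F q -
    D.phi (q.1 + q.2 + 2) (((q.1 + q.2 + 2 : ℕ) : ℝ) * D.a)) hd fun q => ?_
  · rw [hdiff.tsum_eq] at hbound
    refine hbound.trans ?_
    have : (∑' q : ℕ × ℕ, if q.1 + q.2 + 2 ≤ M then 0 else D.c (q.1 + q.2 + 2)) = D.tail M := rfl
    rw [this]
    linarith
  have hfar : ∀ q : ℕ × ℕ, |F q| ≤ D.c (q.1 + q.2 + 2) := by
    intro q
    simp only [hF]
    split_ifs with hq
    · simp only [hS, Finset.mem_product, Finset.mem_range] at hq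
      have := D.abs_blk_le (z := z) (i := t - 1 - q.1) (j := t + 1 + q.2) (by omega)
        fun l hl hl' => hz l (by omega) (by omega)
      rwa [show (t + 1 + (q.2 : ℤ) - (t - 1 - q.1)).toNat = q.1 + q.2 + 2 by omega] at this
    · rw [abs_zero]; exact D.c_nonneg _
  rw [Real.norm_eq_abs]
  by_cases hq : q.1 + q.2 + 2 ≤ M
  · rw [if_pos hq, if_pos (by simp only [Finset.mem_product, Finset.mem_range]; omega), mul_zero,
      add_zero]
    have hqS : q ∈ S := by
      simp only [hS, Finset.mem_product, Finset.mem_range]; omega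
    simp only [hF]
    rw [if_pos hqS]
    unfold blk
    rw [show (t + 1 + (q.2 : ℤ) - (t - 1 - q.1)).toNat = q.1 + q.2 + 2 by omega]
    have hk2 : (2 : ℝ) ≤ ((q.1 + q.2 + 2 : ℕ) : ℝ) := by exact_mod_cast (by omega)
    have hcast : ((t + 1 + (q.2 : ℤ) - (t - 1 - q.1) : ℤ) : ℝ) = ((q.1 + q.2 + 2 : ℕ) : ℝ) := by
      push_cast; ring
    have h1 := le_len (z := z) (i := t - 1 - q.1) (j := t + 1 + q.2) (ρ := D.rhc) (by omega)
      fun l hl hl' => hz l (by omega) (by omega)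
    rw [hcast] at h1
    refine (hLip _ _ _ (by nlinarith [D.hrhc]) (by nlinarith [D.hrhc, D.rhc_lt_a])).trans
      (mul_le_mul_of_nonneg_left ?_ hL.le)
    rw [← hcast, ← len_const D.a (by omega), len, len, ← Finset.sum_sub_distrib]
    refine (Finset.abs_sum_le_sum_abs _ _).trans ((Finset.sum_le_card_nsmul _ _ ε fun l hl => ?_).trans ?_)
    · rw [Finset.mem_Ico] at hl
      exact hza l (by omega) (by omega)
    · rw [nsmul_eq_mul, Int.card_Ico]
      refine mul_le_mul_of_nonneg_right ?_ hε0.le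
      exact_mod_cast (by omega)
  · rw [if_neg hq]
    have h1 := D.abs_phi_const_le (k := q.1 + q.2 + 2) (by omega)
    have h2 : (0 : ℝ) ≤ if q ∈ Finset.range M ×ˢ Finset.range M then L * (M * ε) else 0 := by
      split_ifs <;> positivity
    have h3 := hfar q
    refine (abs_sub _ _).trans ?_
    linarith

/-- The energy of the uniform finite chain, relative to the bulk. -/
lemma tendsto_E_const :
    Tendsto (fun n : ℕ => D.E (fun _ => D.a) 0 n - n * D.e₀ + D.Waa) atTop (𝓝 0) := by
  have hsum := D.summable_Waa
  have hfib : ∀ i : ℕ, Summable fun β : ℕ => D.phi (i + β + 2) (((i + β + 2 : ℕ) : ℝ) * D.a) :=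
    fun i => hsum.prod_factor i
  -- Adding one spacing adds `e₀` except for the interactions that would reach beyond the left end
  -- of the chain; these missing rows are the rows of the double series `Waa`.
  have key : ∀ n : ℕ, D.E (fun _ => D.a) 0 n - n * D.e₀ + D.Waa = D.Waa -
      ∑ i ∈ Finset.range n, ∑' β : ℕ, D.phi (i + β + 2) (((i + β + 2 : ℕ) : ℝ) * D.a) := by
    intro n
    induction n with
    | zero => simp [E_self]
    | succ n ih =>
      have h1 : D.E (fun _ => D.a) 0 ((n + 1 : ℕ) : ℤ) = D.E (fun _ => D.a) 0 n + D.p * D.a +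
          ∑ k ∈ Finset.range (n + 1), D.phi (k + 1) (((k : ℝ) + 1) * D.a) := by
        unfold E
        push_cast
        rw [pairSum_succ _ (by omega), len_add (by omega : (0 : ℤ) ≤ n) (by omega), len_succ]
        have : ∑ i ∈ Finset.Ico (0 : ℤ) (n + 1), D.blk (fun _ => D.a) i (n + 1) =
            ∑ k ∈ Finset.range (n + 1), D.phi (k + 1) (((k : ℝ) + 1) * D.a) := by
          refine Finset.sum_bij' (fun i _ => ((n : ℤ) - i).toNat) (fun k _ => (n : ℤ) - k)
            ?_ ?_ ?_ ?_ ?_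
          · intro i hi; simp only [Finset.mem_Ico, Finset.mem_range] at *; omega
          · intro i hi; simp only [Finset.mem_Ico, Finset.mem_range] at *; omega
          · intro i hi; simp only [Finset.mem_Ico] at *; omega
          · intro i hi; simp only [Finset.mem_range] at *; omega
          · intro i hi
            simp only [Finset.mem_Ico] at hi
            rw [D.blk_const (by omega),
              show ((n : ℤ) + 1 - i).toNat = ((n : ℤ) - i).toNat + 1 by omega]
            push_cast
            rfl
        rw [this]
        ring
      have h2 : D.e₀ = D.p * D.a + (∑ k ∈ Finset.range (n + 1), D.phi (k + 1) (((k : ℝ) + 1) * D.a)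
          + ∑' β : ℕ, D.phi (n + β + 2) (((n + β + 2 : ℕ) : ℝ) * D.a)) := by
        rw [show D.e₀ = D.cb D.a from rfl, cb_eq,
          ← (D.summable_phi_mul D.rhc_lt_a).sum_add_tsum_nat_add (n + 1)]
        congr 2
        refine tsum_congr fun β => ?_
        rw [show β + (n + 1) + 1 = n + β + 2 by omega]
        congr 2
        push_cast
        ring
      rw [Finset.sum_range_succ, ← sub_sub, ← ih, h1, Nat.cast_succ (R := ℝ)]
      linarith
  simp_rw [key]
  have := (hsum.hasSum.prod_fiberwise fun i => (hfib i).hasSum).tendsto_sum_nat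
  have h := (tendsto_const_nhds (x := D.Waa)).sub this
  have h0 : D.Waa - ∑' q : ℕ × ℕ, D.phi (q.1 + q.2 + 2) (((q.1 + q.2 + 2 : ℕ) : ℝ) * D.a) = 0 :=
    sub_self _
  rw [h0] at h
  exact h

end Model

/-! ### Counting blocks and pairs with a given label difference. -/

lemma sum_comp_le_tsum {ι : Type*} {s : Finset ι} {g : ℕ → ℝ} (hg : Summable g)
    (hg0 : ∀ n, 0 ≤ g n) {τ : ι → ℕ} (hτ : Set.InjOn τ s) : ∑ i ∈ s, g (τ i) ≤ ∑' n, g n := by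
  classical
  rw [← Finset.sum_image (f := g) hτ]
  exact hg.sum_le_tsum _ fun n _ => hg0 n

/-- A spacing lies in at most `k` blocks of `k` consecutive spacings. Since `h ≤ 0`, replacing the
actual number of blocks by `k` can only lower the sum. -/
lemma tsum_mul_le_sum_sub {h : ℕ → ℝ} (h0 : ∀ k, h k ≤ 0) (hs : Summable fun k : ℕ => (k : ℝ) * h k)
    (b l e : ℤ) :
    ∑' k : ℕ, (k : ℝ) * h k ≤ ∑ i ∈ Finset.Icc b l, ∑ j ∈ Finset.Ioc l e, h (j - i).toNat := by
  classical
  have hprod : ∑ i ∈ Finset.Icc b l, ∑ j ∈ Finset.Ioc l e, h (j - i).toNat =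
      ∑ q ∈ Finset.Icc b l ×ˢ Finset.Ioc l e, h (q.2 - q.1).toNat := by rw [Finset.sum_product]
  rw [hprod, Finset.sum_comp (f := h) (g := fun q : ℤ × ℤ => (q.2 - q.1).toNat)]
  have h1 : ∑' k : ℕ, (k : ℝ) * h k ≤
      ∑ k ∈ (Finset.Icc b l ×ˢ Finset.Ioc l e).image fun q : ℤ × ℤ => (q.2 - q.1).toNat,
        (k : ℝ) * h k := by
    have := hs.neg.sum_le_tsum
      ((Finset.Icc b l ×ˢ Finset.Ioc l e).image fun q : ℤ × ℤ => (q.2 - q.1).toNat)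
      fun k _ => by
        have := mul_nonneg (Nat.cast_nonneg (α := ℝ) k) (neg_nonneg.2 (h0 k))
        linarith
    rw [tsum_neg, Finset.sum_neg_distrib] at this
    linarith
  refine h1.trans (Finset.sum_le_sum fun k _ => ?_)
  rw [nsmul_eq_mul]
  refine mul_le_mul_of_nonpos_right ?_ (h0 k)
  have : ((Finset.Icc b l ×ˢ Finset.Ioc l e).filter fun q : ℤ × ℤ => (q.2 - q.1).toNat = k).card ≤
      (Finset.Ioc (l - k) l).card := by
    refine Finset.card_le_card_of_injOn (fun q => q.1) ?_ ?_
    · intro q hq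
      simp only [Finset.coe_filter, Finset.mem_product, Finset.mem_Icc, Finset.mem_Ioc,
        Set.mem_ofPred_eq, Finset.coe_Ioc, Set.mem_Ioc] at hq ⊢
      omega
    · intro q hq q' hq' hqq
      simp only [Finset.coe_filter, Finset.mem_product, Finset.mem_Icc, Finset.mem_Ioc,
        Set.mem_ofPred_eq] at hq hq'
      refine Prod.ext hqq ?_
      simp only at hqq
      omega
  rw [Int.card_Ioc] at this
  exact_mod_cast this.trans (by omega)

namespace Model

variable (D : Model)

/-- The interaction of particles which are not nearest neighbours. -/
def far (z : ℤ → ℝ) (i j : ℤ) : ℝ := if i + 2 ≤ j then D.blk z i j else 0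

lemma E_eq_sum_add (z : ℤ → ℝ) (b e : ℤ) :
    D.E z b e = ∑ l ∈ Finset.Ico b e, (D.v (z l) + D.p * z l) + pairSum (D.far z) b e := by
  unfold E len
  rw [Finset.sum_add_distrib, ← Finset.mul_sum, add_right_comm]
  congr 1
  unfold pairSum
  rw [← Finset.sum_add_distrib]
  refine Finset.sum_congr rfl fun i hi => ?_
  rw [Finset.mem_Ico] at hi
  have h1 : D.v (z i) = ∑ j ∈ Finset.Ioc i e, if j = i + 1 then D.v (z i) else 0 := by
    rw [Finset.sum_ite_eq' (Finset.Ioc i e), if_pos (by rw [Finset.mem_Ioc]; omega)]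
  rw [h1, ← Finset.sum_add_distrib]
  refine Finset.sum_congr rfl fun j hj => ?_
  rw [Finset.mem_Ioc] at hj
  unfold far
  by_cases hji : j = i + 1
  · subst hji
    rw [if_pos rfl, if_neg (by omega), add_zero, blk, len_succ,
      show (i + 1 - i).toNat = 1 by omega, phi_one]
  · rw [if_neg hji, if_pos (by omega), zero_add]

/-! ### Lower bounds for the energy -/

/-- Jensen's inequality: the distance of the two particles is the average of `k * z l` over the
block, and all these points lie in `[2 * zmin, ∞)`, where `v` is concave. -/
lemma far_ge {z : ℤ → ℝ} {i j : ℤ} (hz : ∀ l, i ≤ l → l < j → D.zmin ≤ z l) :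
    ∑ l ∈ Finset.Ico i j, (if 2 ≤ (j - i).toNat then
      D.phi (j - i).toNat ((j - i).toNat * z l) / (j - i).toNat else 0) ≤ D.far z i j := by
  unfold far
  by_cases hij : i + 2 ≤ j
  swap
  · rw [if_neg hij]
    refine (Finset.sum_eq_zero fun l hl => ?_).le
    rw [if_neg (by omega)]
  rw [if_pos hij]
  set k := (j - i).toNat with hk
  have hk2 : 2 ≤ k := by omega
  have hk2' : (2 : ℝ) ≤ k := by exact_mod_cast hk2
  simp only [if_pos hk2]
  unfold blk phi
  rw [← hk]
  split_ifs with hm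
  swap
  · simp
  have hcard : (Finset.Ico i j).card = k := by rw [Int.card_Ico]
  have := D.concaveOn_v.le_map_sum (t := Finset.Ico i j) (w := fun _ => (1 : ℝ) / k)
    (p := fun l => (k : ℝ) * z l) (fun _ _ => by positivity)
    (by rw [Finset.sum_const, hcard, nsmul_eq_mul]; field_simp) (fun l hl => by
      rw [Finset.mem_Ico] at hl
      have := hz l hl.1 hl.2
      rw [mem_Ici]
      nlinarith [D.zmin_pos])
  simp only [smul_eq_mul] at this
  have e1 : ∑ l ∈ Finset.Ico i j, 1 / (k : ℝ) * (k * z l) = len z i j := by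
    unfold len
    refine Finset.sum_congr rfl fun l _ => ?_
    field_simp
  rw [e1] at this
  refine le_trans (le_of_eq ?_) this
  refine Finset.sum_congr rfl fun l _ => ?_
  ring

/-- By `far_ge` each block of `k` spacings gives every spacing in it the share `φ_k(k z_l)/k`. A
spacing collects at most `k` such nonpositive shares, and even all `k` of them for every `k` would
only add up to the interaction terms of `cb (z l)`. -/
lemma E_ge_of_zmin_le {z : ℤ → ℝ} {b e : ℤ} (hz : ∀ l, b ≤ l → l < e → D.zmin ≤ z l) :
    ∑ l ∈ Finset.Ico b e, D.cb (z l) ≤ D.E z b e := by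
  rw [E_eq_sum_add]
  have hlow : ∑ l ∈ Finset.Ico b e, ∑' k : ℕ, D.phi (k + 2) (((k : ℝ) + 2) * z l) ≤
      pairSum (D.far z) b e := by
    calc _ ≤ ∑ l ∈ Finset.Ico b e, ∑ i ∈ Finset.Icc b l, ∑ j ∈ Finset.Ioc l e,
          (if 2 ≤ (j - i).toNat then
            D.phi (j - i).toNat ((j - i).toNat * z l) / (j - i).toNat else 0) := by
          refine Finset.sum_le_sum fun l hl => ?_
          rw [Finset.mem_Ico] at hl
          have hzl := hz l hl.1 hl.2
          set h : ℕ → ℝ := fun k => if 2 ≤ k then D.phi k (k * z l) / k else 0 with hh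
          have hk0 : ∀ k : ℕ, ((k + 2 : ℕ) : ℝ) * h (k + 2) =
              D.phi (k + 2) (((k : ℝ) + 2) * z l) := by
            intro k
            have : ((k + 2 : ℕ) : ℝ) ≠ 0 := by positivity
            simp only [hh]
            rw [if_pos (by omega), mul_comm, div_mul_cancel₀ _ this]
            push_cast
            rfl
          have hsum2 := D.summable_phi_mul_two (D.rhc_lt_zmin.trans_le hzl)
          have hsum : Summable fun k : ℕ => (k : ℝ) * h k := by
            rw [← summable_nat_add_iff 2]
            exact hsum2.congr fun k => (hk0 k).symm
          have heq : ∑' k : ℕ, (k : ℝ) * h k = ∑' k : ℕ, D.phi (k + 2) (((k : ℝ) + 2) * z l) := by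
            rw [← hsum.sum_add_tsum_nat_add 2]
            simp [Finset.sum_range_succ, hh]
            exact tsum_congr fun k => by simpa [hh] using hk0 k
          rw [← heq]
          refine tsum_mul_le_sum_sub (fun k => ?_) hsum b l e
          simp only [hh]
          split_ifs with h2
          · refine div_nonpos_of_nonpos_of_nonneg (D.phi_nonpos _ ?_) (Nat.cast_nonneg _)
            have := D.zmax_lt_mul (k := k - 2) hzl
            rwa [show (((k - 2 : ℕ) : ℝ) + 2) = k by rw [Nat.cast_sub h2]; push_cast; ring] at this
          · exact le_rfl
      _ = ∑ i ∈ Finset.Ico b e, ∑ j ∈ Finset.Ioc i e, ∑ l ∈ Finset.Ico i j,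
          (if 2 ≤ (j - i).toNat then
            D.phi (j - i).toNat ((j - i).toNat * z l) / (j - i).toNat else 0) := by
          rw [Finset.sum_comm' (t' := Finset.Ico b e) (s' := fun i => Finset.Ico i e)]
          · refine Finset.sum_congr rfl fun i _ => ?_
            refine Finset.sum_comm' fun l j => ?_
            simp only [Finset.mem_Ico, Finset.mem_Ioc]
            omega
          · intro l i
            simp only [Finset.mem_Ico, Finset.mem_Icc]
            omega
      _ ≤ _ := by
          refine Finset.sum_le_sum fun i hi => Finset.sum_le_sum fun j hj => D.far_ge ?_
          rw [Finset.mem_Ico] at hi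
          rw [Finset.mem_Ioc] at hj
          exact fun l hl hl' => hz l (by omega) (by omega)
  calc _ = ∑ l ∈ Finset.Ico b e, (D.v (z l) + D.p * z l) +
        ∑ l ∈ Finset.Ico b e, ∑' k : ℕ, D.phi (k + 2) (((k : ℝ) + 2) * z l) := by
        rw [← Finset.sum_add_distrib]
        refine Finset.sum_congr rfl fun l hl => ?_
        rw [Finset.mem_Ico] at hl
        rw [D.cb_eq_add (D.rhc_lt_zmin.trans_le (hz l hl.1 hl.2))]
        ring
    _ ≤ _ := by linarith

/-- The energy in terms of the positions of the particles. -/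
def Epos (x : ℤ → ℝ) (b e : ℤ) : ℝ :=
  pairSum (fun i j => D.phi (j - i).toNat (x j - x i)) b e + D.p * (x e - x b)

lemma E_eq_Epos (z : ℤ → ℝ) {b e : ℤ} (h : b ≤ e) : D.E z b e = D.Epos (position z) b e := by
  unfold E Epos
  rw [len_eq_position z h]
  congr 1
  refine pairSum_congr fun i j _ hij _ => ?_
  rw [blk, len_eq_position z hij.le]

lemma Epos_eq_E (x : ℤ → ℝ) {b e : ℤ} (h : b ≤ e) :
    D.Epos x b e = D.E (fun l => x (l + 1) - x l) b e := by
  have hlen : ∀ i j : ℤ, i ≤ j → len (fun l => x (l + 1) - x l) i j = x j - x i := by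
    intro i j hij
    induction j, hij using Int.leInduction with
    | base => simp [len]
    | succ j hj ih => rw [len_add hj (by omega : j ≤ j + 1), ih, len_succ]; ring
  unfold E Epos
  rw [hlen b e h]
  congr 1
  refine pairSum_congr fun i j _ hij _ => ?_
  rw [blk, hlen i j hij.le]

lemma pairSum_first (f : ℤ → ℤ → ℝ) {b e : ℤ} (hb : b ≤ e) :
    pairSum f b e = ∑ j ∈ Finset.Ioc b e, f b j + pairSum f (b + 1) e := by
  rcases hb.eq_or_lt with h | h
  · subst h; simp [pairSum]
  · unfold pairSum
    rw [sum_Ico_consecutive (by omega : b ≤ b + 1) (by omega : b + 1 ≤ e)]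
    have h1 : Finset.Ico b (b + 1) = {b} := by ext; simp; omega
    simp [h1]

lemma pairSum_gap (f : ℤ → ℤ → ℝ) {b q e : ℤ} (hb : b < q) (he : q ≤ e + 1) :
    pairSum f b e = pairSum f b (q - 1) + pairSum f q e +
      ∑ i ∈ Finset.Ico b q, ∑ j ∈ Finset.Icc q e, f i j := by
  have h0 : q - 1 + 1 = q := by ring
  have h1 := pairSum_split f (by omega : b ≤ q - 1) (by omega : q - 1 ≤ e)
  have h2 := pairSum_first f (by omega : q - 1 ≤ e)
  rw [h0] at h2
  have h3 : Finset.Ioc (q - 1) e = Finset.Icc q e := by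
    ext; simp only [Finset.mem_Ioc, Finset.mem_Icc]; omega
  have h4 : ∑ i ∈ Finset.Ico b q, ∑ j ∈ Finset.Icc q e, f i j = crossSum f b (q - 1) e +
      ∑ j ∈ Finset.Icc q e, f (q - 1) j := by
    rw [sum_Ico_consecutive (by omega : b ≤ q - 1) (by omega : q - 1 ≤ q), crossSum, h3]
    have h5 : Finset.Ico (q - 1) q = {q - 1} := by
      ext; simp only [Finset.mem_Ico, Finset.mem_singleton]; omega
    rw [h5, Finset.sum_singleton]
  rw [h1, h2, h4, h3]
  ring

/-- The labels of the particles that remain when the particle `q` is removed. -/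
def skip (q i : ℤ) : ℤ := if i < q then i else i + 1

/-- Deleting `q` removes its own interactions and brings every pair on opposite sides of `q` one
label closer. The latter changes the energy only when the range is finite. -/
lemma Epos_skip_pair (x : ℤ → ℝ) {q n : ℤ} (hq : 0 < q) (hn : q ≤ n) :
    pairSum (fun i j => D.phi (j - i).toNat (x j - x i)) 0 n =
      pairSum (fun i j => D.phi (j - i).toNat (x (skip q j) - x (skip q i))) 0 (n - 1) +
      ∑ i ∈ Finset.Ico 0 q, D.phi (q - i).toNat (x q - x i) +
      ∑ j ∈ Finset.Ioc q n, (D.phi (j - q).toNat (x j - x q) +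
        ∑ i ∈ Finset.Ico 0 q,
          (D.phi (j - i).toNat (x j - x i) - D.phi (j - 1 - i).toNat (x j - x i))) := by
  set f : ℤ → ℤ → ℝ := fun i j => D.phi (j - i).toNat (x j - x i) with hf
  set g : ℤ → ℤ → ℝ := fun i j => D.phi (j - i).toNat (x (skip q j) - x (skip q i)) with hg
  have h1 := pairSum_split f (by omega : (0 : ℤ) ≤ q) hn
  have h2 := pairSum_succ f (b := 0) (e := q - 1) (by omega)
  rw [show q - 1 + 1 = q by ring] at h2
  have h3 := pairSum_first f hn
  have h4 := pairSum_gap g (b := 0) (q := q) (e := n - 1) hq (by omega)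
  have h5 : pairSum g 0 (q - 1) = pairSum f 0 (q - 1) := by
    refine pairSum_congr fun i j _ hij hj => ?_
    simp only [hf, hg, skip]
    rw [if_pos (by omega), if_pos (by omega)]
  have h6 : pairSum g q (n - 1) = pairSum f (q + 1) n := by
    have := pairSum_shift f q (n - 1) 1
    rw [show n - 1 + 1 = n by ring] at this
    rw [← this]
    refine pairSum_congr fun i j hi hij hj => ?_
    simp only [hf, hg, skip]
    rw [if_neg (by omega), if_neg (by omega)]
    congr 2
    omega
  have h7 : ∑ i ∈ Finset.Ico 0 q, ∑ j ∈ Finset.Icc q (n - 1), g i j =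
      ∑ i ∈ Finset.Ico 0 q, ∑ j ∈ Finset.Ioc q n, D.phi (j - 1 - i).toNat (x j - x i) := by
    refine Finset.sum_congr rfl fun i hi => ?_
    rw [Finset.mem_Ico] at hi
    refine Finset.sum_bij' (fun j _ => j + 1) (fun j _ => j - 1) ?_ ?_ ?_ ?_ ?_
    · intro j hj; simp only [Finset.mem_Icc, Finset.mem_Ioc] at *; omega
    · intro j hj; simp only [Finset.mem_Icc, Finset.mem_Ioc] at *; omega
    · intro j hj; ring
    · intro j hj; ring
    · intro j hj
      rw [Finset.mem_Icc] at hj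
      simp only [hg, skip]
      rw [if_neg (by omega), if_pos (by omega)]
      congr 2
      omega
  rw [h1, h2, h3, h4, h5, h6, h7, Finset.sum_add_distrib, Finset.sum_comm (s := Finset.Ioc q n)]
  simp only [Finset.sum_sub_distrib]
  unfold crossSum
  simp only [hf]
  ring

lemma v_zmax_le {r : ℝ} (hr : D.rhc < r) : D.v D.zmax ≤ D.v r := by
  by_cases h : r = D.zmax
  · rw [h]
  · exact (D.hv.zmax_unique_min r hr h).le

/-- Removing the particle on the right of a minimal spacing below `zmin` lowers the energy. -/
lemma Epos_skip_le {x : ℤ → ℝ} {q n : ℤ} {r : ℝ} (hq : 0 < q) (hn : q ≤ n) (hr : D.rhc < r)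
    (hr' : r < D.zmin) (hxq : x q - x (q - 1) = r)
    (hx : ∀ i, 0 ≤ i → i < n → r ≤ x (i + 1) - x i) :
    D.Epos (fun i => x (skip q i)) 0 (n - 1) ≤ D.Epos x 0 n := by
  have hr0 := D.hrhc.trans hr
  have hs2 := D.hv.two_lt_s
  have hα := D.hv.α₁_pos
  have hdist : ∀ i j : ℤ, 0 ≤ i → i ≤ j → j ≤ n → ((j - i : ℤ) : ℝ) * r ≤ x j - x i := by
    intro i j hi hij
    induction j, hij using Int.leInduction with
    | base => intro _; simp
    | succ j hj ih =>
      intro hjn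
      have h1 := ih (by omega)
      have h2 := hx j (by omega) (by omega)
      push_cast at h1 ⊢
      linarith
  set L : ℕ → ℝ := fun k => D.α₁ * (((k : ℝ) + 2) * r) ^ (-D.s) with hL
  have hLnn : ∀ k, 0 ≤ L k := fun k => by positivity
  have hLs : Summable L := by
    refine (((summable_rpow_add (q := -D.s) (by linarith) 2).mul_right (r ^ (-D.s))).congr
      fun k => ?_).mul_left D.α₁
    rw [Real.mul_rpow (by positivity) hr0.le]
    norm_num
  have hphi : ∀ (k : ℕ) (y : ℝ), ((k : ℝ) + 2) * r ≤ y → ∀ l, -L k ≤ D.phi l y := by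
    intro k y hy l
    have hy' : D.rhc < y := by nlinarith [Nat.cast_nonneg (α := ℝ) k]
    unfold phi
    split_ifs
    · have h1 := D.hv.lower_bound y hy'
      have h2 : y ^ (-D.s) ≤ (((k : ℝ) + 2) * r) ^ (-D.s) :=
        Real.rpow_le_rpow_of_nonpos (by positivity) hy (by linarith)
      simp only [hL]
      nlinarith
    · linarith [hLnn k]
  have hphi1 : ∀ (y : ℝ), D.rhc < y → ∀ l, D.v D.zmax ≤ D.phi l y := by
    intro y hy l
    unfold phi
    split_ifs
    · exact D.v_zmax_le hy
    · exact D.hv.v_zmax_neg.le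
  -- interactions of the removed particle with those on its left
  have hleft : D.v r - ∑' k, L k ≤ ∑ i ∈ Finset.Ico 0 q, D.phi (q - i).toNat (x q - x i) := by
    rw [sum_Ico_consecutive (by omega : 0 ≤ q - 1) (by omega : q - 1 ≤ q)]
    have h5 : Finset.Ico (q - 1) q = {q - 1} := by
      ext; simp only [Finset.mem_Ico, Finset.mem_singleton]; omega
    rw [h5, Finset.sum_singleton, hxq, show (q - (q - 1)).toNat = 1 by omega, phi_one]
    have h6 := sum_comp_le_tsum (s := Finset.Ico 0 (q - 1)) hLs hLnn
      (τ := fun i => (q - 2 - i).toNat) (by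
        intro i hi j hj hij
        simp only [Finset.coe_Ico, Set.mem_Ico] at hi hj
        simp only at hij
        omega)
    have h7 : -∑ i ∈ Finset.Ico 0 (q - 1), L (q - 2 - i).toNat ≤
        ∑ i ∈ Finset.Ico 0 (q - 1), D.phi (q - i).toNat (x q - x i) := by
      rw [← Finset.sum_neg_distrib]
      refine Finset.sum_le_sum fun i hi => hphi _ _ ?_ _
      rw [Finset.mem_Ico] at hi
      have := hdist i q hi.1 (by omega) hn
      have hc : (((q - 2 - i).toNat : ℕ) : ℝ) + 2 = ((q - i : ℤ) : ℝ) := by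
        rw [← Int.cast_natCast, Int.toNat_of_nonneg (by omega)]; push_cast; ring
      rwa [hc]
    linarith
  -- a pair at label distance `m + 1` is matched with the removed particle and the pair's right end
  have hmatch : ∀ j, q < j → j ≤ n → ∀ w : ℝ, w ≤ 0 → w ≤ D.phi (j - q).toNat (x j - x q) →
      (D.v (x j - x q) ≥ w) →
      w ≤ D.phi (j - q).toNat (x j - x q) + ∑ i ∈ Finset.Ico 0 q,
          (D.phi (j - i).toNat (x j - x i) - D.phi (j - 1 - i).toNat (x j - x i)) := by
    intro j hj hjn w hw0 hw hw'
    -- A pair `(i, j)` starts to interact upon deletion only if its label distance is exactly `m +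
    -- 1`, so for fixed `j` there is at most one such `i`; the pair `(q, j)` is then within range.
    by_cases hex : ∃ i ∈ Finset.Ico 0 q, ((j - 1 - i).toNat : ℕ∞) ≤ D.m ∧
        ¬ ((j - i).toNat : ℕ∞) ≤ D.m
    · obtain ⟨i, hi, hi1, hi2⟩ := hex
      rw [Finset.sum_eq_single_of_mem i hi]
      · rw [Finset.mem_Ico] at hi
        have hjq : ((j - q).toNat : ℕ∞) ≤ D.m :=
          le_trans (by exact_mod_cast (by omega : (j - q).toNat ≤ (j - 1 - i).toNat)) hi1
        rw [phi, phi, phi, if_pos hjq, if_neg hi2, if_pos hi1, zero_sub, ← sub_eq_add_neg]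
        have hS : x j - x q < x j - x i := by
          have := hdist i q hi.1 hi.2.le hn
          have h1 : (1 : ℝ) ≤ ((q - i : ℤ) : ℝ) := by exact_mod_cast (by omega : 1 ≤ q - i)
          nlinarith
        have hT : D.rhc < x j - x q := by
          have := hdist q j hq.le hj.le hjn
          have h1 : (1 : ℝ) ≤ ((j - q : ℤ) : ℝ) := by exact_mod_cast (by omega : 1 ≤ j - q)
          nlinarith
        -- Below `zmax`, monotonicity makes the removed interaction of `(q, j)` at least the created
        -- one of `(i, j)`. From `zmax` on, the created interaction is nonpositive and its negative
        -- only helps.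
        rcases lt_trichotomy (x j - x i) D.zmax with h | h | h
        · have := D.hv.decreasing ⟨hT, hS.trans h⟩ ⟨hT.trans hS, h⟩ hS.le
          linarith
        · rw [h]; linarith [D.hv.v_zmax_neg]
        · linarith [D.v_nonpos h]
      · intro i' hi' hne
        rw [Finset.mem_Ico] at hi hi'
        have hk : (j - i').toNat = (j - 1 - i').toNat + 1 := by omega
        unfold phi
        by_cases h1 : ((j - i').toNat : ℕ∞) ≤ D.m
        · rw [if_pos h1, if_pos (le_trans (by exact_mod_cast (by omega)) h1), sub_self]
        · rw [if_neg h1, if_neg, sub_self]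
          intro h2
          rcases lt_or_gt_of_ne hne with h3 | h3
          · exact hi2 (le_trans (by exact_mod_cast (by omega : (j - i).toNat ≤ (j - 1 - i').toNat))
              h2)
          · exact h1 (le_trans (by exact_mod_cast (by omega : (j - i').toNat ≤ (j - 1 - i).toNat))
              hi1)
    · push Not at hex
      rw [Finset.sum_eq_zero, add_zero]
      · exact hw
      · intro i hi
        have h1 := hex i hi
        rw [Finset.mem_Ico] at hi
        unfold phi
        by_cases h2 : ((j - 1 - i).toNat : ℕ∞) ≤ D.m
        · rw [if_pos (h1 h2), if_pos h2, sub_self]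
        · rw [if_neg, if_neg h2, sub_self]
          exact fun h3 => h2 (le_trans (by exact_mod_cast (by omega)) h3)
  have hright : D.v D.zmax - ∑' k, L k ≤ ∑ j ∈ Finset.Ioc q n, (D.phi (j - q).toNat (x j - x q) +
        ∑ i ∈ Finset.Ico 0 q,
          (D.phi (j - i).toNat (x j - x i) - D.phi (j - 1 - i).toNat (x j - x i))) := by
    have hpos : 0 ≤ ∑' k, L k := tsum_nonneg hLnn
    rcases hn.eq_or_lt with h | h
    · subst h
      simp only [Finset.Ioc_self, Finset.sum_empty]
      linarith [D.hv.v_zmax_neg]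
    rw [sum_Ioc_consecutive (by omega : q ≤ q + 1) (by omega : q + 1 ≤ n)]
    have h5 : Finset.Ioc q (q + 1) = {q + 1} := by
      ext; simp only [Finset.mem_Ioc, Finset.mem_singleton]; omega
    rw [h5, Finset.sum_singleton]
    have hfar : ∀ j, q < j → j ≤ n → D.rhc < x j - x q := by
      intro j hj hjn
      have := hdist q j hq.le hj.le hjn
      have h1 : (1 : ℝ) ≤ ((j - q : ℤ) : ℝ) := by exact_mod_cast (by omega : 1 ≤ j - q)
      nlinarith
    have h1 := hmatch (q + 1) (by omega) (by omega) (D.v D.zmax) D.hv.v_zmax_neg.le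
      (hphi1 _ (hfar _ (by omega) (by omega)) _) (D.v_zmax_le (hfar _ (by omega) (by omega)))
    have h6 := sum_comp_le_tsum (s := Finset.Ioc (q + 1) n) hLs hLnn
      (τ := fun j => (j - q - 2).toNat) (by
        intro i hi j hj hij
        simp only [Finset.coe_Ioc, Set.mem_Ioc] at hi hj
        simp only at hij
        omega)
    have h7 : -∑ j ∈ Finset.Ioc (q + 1) n, L (j - q - 2).toNat ≤
        ∑ j ∈ Finset.Ioc (q + 1) n, (D.phi (j - q).toNat (x j - x q) +
        ∑ i ∈ Finset.Ico 0 q,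
          (D.phi (j - i).toNat (x j - x i) - D.phi (j - 1 - i).toNat (x j - x i))) := by
      rw [← Finset.sum_neg_distrib]
      refine Finset.sum_le_sum fun j hj => ?_
      rw [Finset.mem_Ioc] at hj
      have hc : (((j - q - 2).toNat : ℕ) : ℝ) + 2 = ((j - q : ℤ) : ℝ) := by
        rw [← Int.cast_natCast, Int.toNat_of_nonneg (by omega)]; push_cast; ring
      have h8 := hdist q j hq.le (by omega) hj.2
      rw [← hc] at h8
      refine hmatch j (by omega) hj.2 _ (by linarith [hLnn (j - q - 2).toNat]) (hphi _ _ h8 _) ?_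
      have h9 := hphi _ _ h8 1
      rwa [phi_one] at h9
    linarith
  have hgrowth := D.hv.growth r hr hr'
  rw [mul_assoc, ← tsum_mul_left] at hgrowth
  have hgr' : 0 < D.v r + D.v D.zmax - 2 * ∑' k, L k := hgrowth
  -- Deleting the last particle shortens the chain; deleting an interior one leaves its length
  -- unchanged. So the pressure term does not increase.
  have hpress : x (skip q (n - 1)) - x (skip q 0) ≤ x n - x 0 := by
    unfold skip
    rw [if_pos hq]
    split_ifs with h
    · have := hx (n - 1) (by omega) (by omega)
      rw [show n - 1 + 1 = n by ring] at this
      linarith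
    · rw [show n - 1 + 1 = n by ring]
  have := D.Epos_skip_pair x hq hn
  unfold Epos
  rw [this]
  have hp := D.hp
  nlinarith

/-- The energy bound: the ground state energy per particle plus a coercive term. -/
lemma Epos_ge (n : ℕ) : ∀ x : ℤ → ℝ, (∀ i : ℤ, 0 ≤ i → i < n → D.rhc < x (i + 1) - x i) →
    n * D.e₀ + D.kappa * ∑ i ∈ Finset.Ico (0 : ℤ) n, D.theta (x (i + 1) - x i) ≤
      D.Epos x 0 n := by
  induction n with
  | zero =>
    intro x _
    simp [Epos, pairSum_self]
  | succ n ih =>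
    intro x hx
    push_cast at hx ⊢
    by_cases hbig : ∀ i : ℤ, 0 ≤ i → i < n + 1 → D.zmin ≤ x (i + 1) - x i
    · rw [D.Epos_eq_E x (by omega)]
      refine le_trans ?_ (D.E_ge_of_zmin_le hbig)
      rw [Finset.mul_sum]
      have h1 : ((n : ℝ) + 1) * D.e₀ = ∑ i ∈ Finset.Ico (0 : ℤ) (n + 1), D.e₀ := by
        rw [Finset.sum_const, Int.card_Ico, nsmul_eq_mul,
          show ((n : ℤ) + 1 - 0).toNat = n + 1 by omega]
        push_cast; ring
      rw [h1, ← Finset.sum_add_distrib]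
      refine Finset.sum_le_sum fun i hi => ?_
      rw [Finset.mem_Ico] at hi
      have := D.kappa_theta_le (hbig i hi.1 hi.2)
      linarith
    -- Some spacing is below `zmin`: delete the right end of a shortest spacing and apply the
    -- induction hypothesis. The bound for `n + 1` spacings is weaker by `-e₀ ≥ 2 * kappa`.
    · push Not at hbig
      obtain ⟨i₀, hi0, hi1, hi2⟩ := hbig
      obtain ⟨i, hi, hmin⟩ := Finset.exists_min_image (Finset.Ico (0 : ℤ) (n + 1))
        (fun i => x (i + 1) - x i) ⟨i₀, Finset.mem_Ico.2 ⟨hi0, hi1⟩⟩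
      rw [Finset.mem_Ico] at hi
      have hsmall := (hmin i₀ (Finset.mem_Ico.2 ⟨hi0, hi1⟩)).trans_lt hi2
      have hrem := D.Epos_skip_le (x := x) (q := i + 1) (n := n + 1) (r := x (i + 1) - x i)
        (by omega) (by omega) (hx i hi.1 hi.2) hsmall
        (by rw [show i + 1 - 1 = i by ring]) fun l hl hl' => hmin l (Finset.mem_Ico.2 ⟨hl, hl'⟩)
      rw [show (n : ℤ) + 1 - 1 = n by ring] at hrem
      have hih := ih (fun l => x (skip (i + 1) l)) (by
        intro l hl hl'
        simp only [skip]
        by_cases h1 : l + 1 < i + 1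
        · rw [if_pos h1, if_pos (by omega)]
          exact hx l hl (by omega)
        by_cases h2 : l < i + 1
        · rw [if_neg h1, if_pos h2]
          have h3 := hx l hl (by omega)
          have h4 := hx (l + 1) (by omega) (by omega)
          linarith [D.hrhc]
        · rw [if_neg h1, if_neg h2]
          exact hx (l + 1) (by omega) (by omega))
      -- Two neighbouring spacings merge into one, or the last spacing disappears; at most two
      -- values of `theta`, each at most 1, are lost.
      have hth : ∑ l ∈ Finset.Ico (0 : ℤ) (n + 1), D.theta (x (l + 1) - x l) ≤
          ∑ l ∈ Finset.Ico (0 : ℤ) n, D.theta (x (skip (i + 1) (l + 1)) - x (skip (i + 1) l)) +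
            2 := by
        have e1 : ∀ l, 0 ≤ l → l < i → D.theta (x (skip (i + 1) (l + 1)) - x (skip (i + 1) l)) =
            D.theta (x (l + 1) - x l) := by
          intro l _ hl
          simp only [skip]
          rw [if_pos (by omega), if_pos (by omega)]
        have e2 : ∀ l, i + 1 ≤ l → D.theta (x (skip (i + 1) (l + 1)) - x (skip (i + 1) l)) =
            D.theta (x (l + 1 + 1) - x (l + 1)) := by
          intro l hl
          simp only [skip]
          rw [if_neg (by omega), if_neg (by omega)]
        have hone : ∀ l : ℤ, Finset.Ico l (l + 1) = {l} := by
          intro l; ext; simp only [Finset.mem_Ico, Finset.mem_singleton]; omega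
        rw [sum_Ico_consecutive hi.1 hi.2.le,
          sum_Ico_consecutive (by omega : i ≤ i + 1) (by omega : i + 1 ≤ (n : ℤ) + 1),
          hone, Finset.sum_singleton]
        have h3 := D.theta_le_one (x (i + 1) - x i)
        rcases (by omega : i = n ∨ i < n) with h | h
        · subst h
          simp only [Finset.Ico_self, Finset.sum_empty, add_zero]
          rw [Finset.sum_congr rfl fun l hl => e1 l (Finset.mem_Ico.1 hl).1 (Finset.mem_Ico.1 hl).2]
          linarith
        · rw [sum_Ico_consecutive (by omega : i + 1 ≤ i + 1 + 1) (by omega : i + 1 + 1 ≤ (n : ℤ) + 1),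
            hone, Finset.sum_singleton,
            sum_Ico_consecutive (b := 0) (t := i) (e := n) hi.1 h.le,
            sum_Ico_consecutive (b := i) (t := i + 1) (e := n) (by omega) (by omega),
            hone, Finset.sum_singleton,
            Finset.sum_congr rfl fun l hl => e1 l (Finset.mem_Ico.1 hl).1 (Finset.mem_Ico.1 hl).2,
            Finset.sum_congr (s₂ := Finset.Ico (i + 1) (n : ℤ)) rfl
              fun l hl => e2 l (Finset.mem_Ico.1 hl).1]
          have h5 : ∑ l ∈ Finset.Ico (i + 1 + 1) ((n : ℤ) + 1), D.theta (x (l + 1) - x l) =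
              ∑ l ∈ Finset.Ico (i + 1) (n : ℤ), D.theta (x (l + 1 + 1) - x (l + 1)) := by
            rw [← Finset.map_add_right_Ico, Finset.sum_map]
            rfl
          rw [h5]
          have h4 := D.theta_le_one (x (i + 1 + 1) - x (i + 1))
          have h6 := D.theta_nonneg (x (skip (i + 1) (i + 1)) - x (skip (i + 1) i))
          linarith
      have hk := D.kappa_pos
      have hk2 := D.two_kappa_le
      nlinarith

lemma E_ge {z : ℤ → ℝ} {b e : ℤ} (hbe : b ≤ e) (hz : ∀ l, b ≤ l → l < e → D.rhc < z l) :
    ((e - b : ℤ) : ℝ) * D.e₀ + D.kappa * ∑ l ∈ Finset.Ico b e, D.theta (z l) ≤ D.E z b e := by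
  obtain ⟨n, rfl⟩ : ∃ n : ℕ, e = b + n := ⟨(e - b).toNat, by omega⟩
  have h0 := D.E_shift z 0 n b
  rw [zero_add, add_comm (n : ℤ) b] at h0
  have hstep : ∀ i : ℤ, position (fun l => z (l + b)) (i + 1) - position (fun l => z (l + b)) i =
      z (i + b) := by
    intro i
    rw [← len_eq_position _ (by omega : i ≤ i + 1), len_succ]
  have := D.Epos_ge n (position fun l => z (l + b)) (by
    intro i hi hi'
    rw [hstep]
    exact hz _ (by omega) (by omega))
  rw [← D.E_eq_Epos _ (by omega), h0] at this
  simp only [hstep] at this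
  have h2 : ∑ l ∈ Finset.Ico b (b + n), D.theta (z l) = ∑ l ∈ Finset.Ico (0 : ℤ) n,
      D.theta (z (l + b)) := by
    have h3 : Finset.Ico b (b + n) = (Finset.Ico (0 : ℤ) n).map (addRightEmbedding b) := by
      rw [Finset.map_add_right_Ico, zero_add, add_comm b]
    rw [h3, Finset.sum_map]
    rfl
  rw [h2]
  have h3 : ((b + n - b : ℤ) : ℝ) = n := by push_cast; ring
  rw [h3]
  exact this

/-- The energy relative to the bulk. -/
def X (z : ℤ → ℝ) (b e : ℤ) : ℝ := D.E z b e - ((e - b : ℤ) : ℝ) * D.e₀ + D.Waa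

lemma X_ge {z : ℤ → ℝ} {b e : ℤ} (hbe : b ≤ e) (hz : ∀ l, b ≤ l → l < e → D.rhc < z l) :
    D.Waa + D.kappa * ∑ l ∈ Finset.Ico b e, D.theta (z l) ≤ D.X z b e := by
  have := D.E_ge hbe hz
  unfold X
  linarith

lemma X_split (z : ℤ → ℝ) {b t e : ℤ} (hb : b ≤ t) (he : t ≤ e) :
    D.X z b e = D.X z b t + D.X z t e + (crossSum (D.blk z) b t e - D.Waa) := by
  unfold X
  rw [D.E_split z hb he]
  push_cast
  ring

lemma X_congr {z y : ℤ → ℝ} {b e : ℤ} (h : ∀ l, b ≤ l → l < e → z l = y l) :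
    D.X z b e = D.X y b e := by
  unfold X; rw [D.E_congr h]

variable {D}

/-- A chain that is close to the ground state at both ends has almost nonnegative energy. -/
lemma Good.neg_le_X {M : ℤ} {ε η : ℝ} (hG : D.Good M ε η) {z : ℤ → ℝ} {s t : ℤ} (hst : s + M ≤ t)
    (hz : ∀ l, s ≤ l → l < t → D.rhc < z l) (hs : ∀ l, s ≤ l → l < s + M → |z l - D.a| ≤ ε)
    (ht : ∀ l, t - M ≤ l → l < t → |z l - D.a| ≤ ε) : -η ≤ D.X z s t := by
  obtain ⟨hM, hε, hε1, hG⟩ := hG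
  set T := t - s with hT
  have hT0 : 0 < T := by omega
  -- Periodic repetition of the chain. Since both ends are near the ground state, each junction
  -- costs `Waa` up to `η`. If the normalized energy were below `-η`, many copies would fall below
  -- the universal bound `e₀` per spacing given by `E_ge`.
  set y : ℤ → ℝ := fun l => z (s + l % T) with hy
  have hmod : ∀ l, 0 ≤ l % T ∧ l % T < T := fun l =>
    ⟨Int.emod_nonneg l hT0.ne', Int.emod_lt_of_pos l hT0⟩
  have hy0 : ∀ l, D.rhc < y l := fun l => hz _ (by have := hmod l; omega) (by have := hmod l; omega)
  have hmodeq : ∀ (R l : ℤ), (l + R * T) % T = l % T := fun R l => Int.add_mul_emod_self_right l R T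
  have hshift : ∀ R : ℤ, D.E y (R * T) (R * T + T) = D.E z s t := by
    intro R
    have h1 := D.E_shift y 0 T (R * T)
    have h2 := D.E_shift z 0 T s
    rw [zero_add, add_comm T] at h1
    rw [zero_add, show T + s = t by omega] at h2
    rw [← h1, ← h2]
    refine D.E_congr fun l hl hl' => ?_
    simp only [hy, hmodeq, Int.emod_eq_of_lt hl hl', add_comm s]
  have hnear : ∀ (R l : ℤ), R * T - M ≤ l → l < R * T + M → |y l - D.a| ≤ ε := by
    intro R l h1 h2
    simp only [hy]
    rcases lt_or_ge l (R * T) with h | h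
    · have : l % T = l - R * T + T := by
        have := hmodeq (R - 1) (l - R * T + T)
        rw [show l - R * T + T + (R - 1) * T = l by ring] at this
        exact this.trans (Int.emod_eq_of_lt (by omega) (by omega))
      rw [this]
      exact ht _ (by omega) (by omega)
    · have : l % T = l - R * T := by
        have := hmodeq R (l - R * T)
        rw [show l - R * T + R * T = l by ring] at this
        exact this.trans (Int.emod_eq_of_lt (by omega) (by omega))
      rw [this]
      exact hs _ (by omega) (by omega)
  have hup : ∀ R : ℕ, D.E y 0 ((R + 1 : ℕ) * T) ≤ (R + 1) * D.E z s t + R * (D.Waa + η) := by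
    intro R
    induction R with
    | zero =>
      have := hshift 0
      simp only [zero_mul, zero_add] at this
      simp [this]
    | succ R ih =>
      have e1 : ((R + 1 + 1 : ℕ) : ℤ) * T = (R + 1 : ℕ) * T + T := by push_cast; ring
      have hRT : (0 : ℤ) + M ≤ (R + 1 : ℕ) * T := by
        have : (0 : ℤ) ≤ R * T := by positivity
        push_cast
        nlinarith
      rw [e1, D.E_split y (b := 0) (t := (R + 1 : ℕ) * T) (by omega) (by omega), hshift]
      have h1 := (abs_le.1 (hG y 0 ((R + 1 : ℕ) * T) ((R + 1 : ℕ) * T + T) hRT (by omega)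
        (fun l _ _ => (hy0 l).le) (hnear _))).2
      push_cast at ih h1 ⊢
      linarith
  have hlow : ∀ R : ℕ, ((R : ℝ) + 1) * (T * D.e₀) ≤ D.E y 0 ((R + 1 : ℕ) * T) := by
    intro R
    have h1 := D.E_ge (z := y) (b := 0) (e := (R + 1 : ℕ) * T) (by positivity) fun l _ _ => hy0 l
    have h2 := mul_nonneg D.kappa_pos.le (Finset.sum_nonneg (s := Finset.Ico 0 ((R + 1 : ℕ) * T))
      fun l _ => D.theta_nonneg (y l))
    push_cast at h1 h2 ⊢
    linarith
  by_contra hcon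
  push Not at hcon
  unfold X at hcon
  rw [← hT] at hcon
  set δ := -η - (D.E z s t - T * D.e₀ + D.Waa) with hδ
  have hδ0 : 0 < δ := by linarith
  obtain ⟨R, hR⟩ := exists_nat_gt ((-D.Waa - η) / δ)
  rw [div_lt_iff₀ hδ0] at hR
  have h1 := (hlow R).trans (hup R)
  have h2 : 0 ≤ (R : ℝ) := Nat.cast_nonneg R
  nlinarith

end Model

lemma tendsto_finset_sum {ι E : Type*} [AddCommMonoid E] [TopologicalSpace E] {f : ι → E} {a : E}
    (h : HasSum f a) : Tendsto (fun s : Finset ι => ∑ i ∈ s, f i) atTop (𝓝 a) := by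
  simpa [HasSum] using h

/-! ### Sums over all blocks of consecutive spacings -/

lemma len_eq_sum_range (g : ℤ → ℝ) (j : ℤ) (k : ℕ) :
    len g j (j + k + 1) = ∑ i ∈ Finset.range (k + 1), g (j + i) := by
  unfold len
  refine Finset.sum_bij' (fun l _ => (l - j).toNat) (fun i _ => j + i) ?_ ?_ ?_ ?_ ?_
  · intro i hi; simp only [Finset.mem_Ico, Finset.mem_range] at *; omega
  · intro i hi; simp only [Finset.mem_Ico, Finset.mem_range] at *; omega
  · intro i hi; simp only [Finset.mem_Ico] at *; omega
  · intro i hi; simp only [Finset.mem_range] at *; omega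
  · intro i hi
    simp only [Finset.mem_Ico] at hi
    congr 1
    omega

lemma hasSum_len {g : ℤ → ℝ} (hg : Summable g) (k : ℕ) :
    HasSum (fun j => len g j (j + k + 1)) (((k : ℝ) + 1) * ∑' l, g l) := by
  have h1 : ∀ i : ℕ, HasSum (fun j : ℤ => g (j + i)) (∑' l, g l) := fun i =>
    (Equiv.addRight (i : ℤ)).hasSum_iff.2 hg.hasSum
  have h2 := hasSum_sum (s := Finset.range (k + 1)) fun i _ => h1 i
  rw [Finset.sum_const, Finset.card_range, nsmul_eq_mul] at h2
  push_cast at h2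
  exact h2.congr_fun fun j => len_eq_sum_range g j k

lemma len_nonneg {g : ℤ → ℝ} (hg : ∀ l, 0 ≤ g l) (i j : ℤ) : 0 ≤ len g i j :=
  Finset.sum_nonneg fun l _ => hg l

lemma summable_mul_len {w : ℕ → ℝ} (hw : ∀ k, 0 ≤ w k) (hws : Summable fun k : ℕ => w k * (k + 1))
    {g : ℤ → ℝ} (hg : Summable g) (hg0 : ∀ l, 0 ≤ g l) :
    Summable fun q : ℕ × ℤ => w q.1 * len g q.2 (q.2 + q.1 + 1) := by
  have h1 : ∀ k : ℕ, HasSum (fun j : ℤ => w k * len g j (j + k + 1))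
      (w k * (((k : ℝ) + 1) * ∑' l, g l)) := fun k => (hasSum_len hg k).mul_left (w k)
  have h2 : (0 : ℕ × ℤ → ℝ) ≤ fun q => w q.1 * len g q.2 (q.2 + q.1 + 1) :=
    fun q => mul_nonneg (hw _) (len_nonneg hg0 _ _)
  refine (summable_prod_of_nonneg h2).2 ⟨fun k => (h1 k).summable, ?_⟩
  refine (hws.mul_right (∑' l, g l)).congr fun k => ?_
  refine Eq.trans ?_ (h1 k).tsum_eq.symm
  ring

lemma tsum_mul_len {w : ℕ → ℝ} {g : ℤ → ℝ} (hg : Summable g)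
    (hs : Summable fun q : ℕ × ℤ => w q.1 * len g q.2 (q.2 + q.1 + 1)) :
    ∑' q : ℕ × ℤ, w q.1 * len g q.2 (q.2 + q.1 + 1) = (∑' k : ℕ, w k * (k + 1)) * ∑' l, g l := by
  have h1 : ∀ k : ℕ, HasSum (fun j : ℤ => w k * len g j (j + k + 1))
      (w k * (((k : ℝ) + 1) * ∑' l, g l)) := fun k => (hasSum_len hg k).mul_left (w k)
  rw [hs.tsum_prod, ← tsum_mul_right]
  refine tsum_congr fun k => (h1 k).tsum_eq.trans ?_
  ring

lemma sq_len_le (g : ℤ → ℝ) (j : ℤ) (k : ℕ) :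
    len g j (j + k + 1) ^ 2 ≤ ((k : ℝ) + 1) * len (fun l => g l ^ 2) j (j + k + 1) := by
  have := sq_sum_le_card_mul_sum_sq (s := Finset.Ico j (j + k + 1)) (f := g)
  rw [Int.card_Ico, show (j + k + 1 - j).toNat = k + 1 by omega] at this
  push_cast at this
  exact this

lemma len_sub (g h : ℤ → ℝ) (i j : ℤ) : len g i j - len h i j = len (fun l => g l - h l) i j := by
  simp [len, Finset.sum_sub_distrib]

lemma len_const_add (a : ℝ) (g : ℤ → ℝ) {i j : ℤ} (h : i ≤ j) :
    len (fun l => a + g l) i j = ((j - i : ℤ) : ℝ) * a + len g i j := by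
  rw [← len_const a h]
  simp [len, Finset.sum_add_distrib]

/-! ### Square summable strains -/

lemma memℓp_two_iff {ι : Type} {f : ι → ℝ} : Memℓp f 2 ↔ Summable fun i => f i ^ 2 := by
  rw [memℓp_gen_iff (by norm_num)]
  simp

lemma summable_sq {ι : Type} (γ : Strain ι) : Summable fun i => γ i ^ 2 := memℓp_two_iff.1 γ.2

lemma norm_sq_eq_tsum {ι : Type} (γ : Strain ι) : ‖γ‖ ^ 2 = ∑' i, γ i ^ 2 := by
  have := lp.norm_rpow_eq_tsum (p := 2) (by norm_num) γ
  simpa using this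

lemma abs_apply_le_norm {ι : Type} (γ : Strain ι) (i : ι) : |γ i| ≤ ‖γ‖ :=
  lp.norm_apply_le_norm (by norm_num) γ i

lemma tendsto_cofinite_zero {ι : Type} {f : ι → ℝ} (hf : Summable fun i => f i ^ 2) :
    Tendsto f cofinite (𝓝 0) := by
  have h := hf.tendsto_cofinite_zero
  have h2 := (Real.continuous_sqrt.tendsto 0).comp h
  simp only [Real.sqrt_zero, Function.comp_def, Real.sqrt_sq_eq_abs] at h2
  exact (tendsto_zero_iff_abs_tendsto_zero _).2 h2

open Classical in
/-- Restriction of a strain to a finite set of sites. -/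
def trunc {ι : Type} (s : Finset ι) (γ : Strain ι) : Strain ι := ∑ i ∈ s, lp.single 2 i (γ i)

open Classical in
lemma trunc_apply {ι : Type} (s : Finset ι) (γ : Strain ι) (j : ι) :
    trunc s γ j = if j ∈ s then γ j else 0 := by
  unfold trunc
  rw [lp.coeFn_sum, Finset.sum_apply]
  simp only [lp.single_apply, Pi.single_apply]
  rw [Finset.sum_ite_eq s j]

lemma tendsto_trunc {ι : Type} (γ : Strain ι) : Tendsto (fun s => trunc s γ) atTop (𝓝 γ) := by
  classical
  have := lp.hasSum_single (p := 2) (by norm_num) γ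
  exact tendsto_finset_sum this

lemma trunc_mem {ι : Type} {rhc a : ℝ} (ha : rhc < a) (s : Finset ι) {γ : Strain ι}
    (hγ : γ ∈ strainDomain rhc a ι) : trunc s γ ∈ finiteStrainDomain rhc a ι := by
  classical
  refine ⟨fun j => ?_, s.finite_toSet.subset fun j hj => ?_⟩
  · rw [trunc_apply]
    split_ifs
    · exact hγ j
    · simpa using ha
  · by_contra h
    refine hj ?_
    rw [trunc_apply, if_neg (by simpa using h)]

lemma mem_closure_finite {ι : Type} {rhc a : ℝ} (ha : rhc < a) {γ : Strain ι}
    (hγ : γ ∈ strainDomain rhc a ι) : γ ∈ closure (finiteStrainDomain rhc a ι) :=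
  mem_closure_of_tendsto (tendsto_trunc γ) (Eventually.of_forall fun s => trunc_mem ha s hγ)

/-- Square summability puts all but finitely many spacings near `a`, so strict positivity of the
gaps to the hard core becomes uniform. This is what the derivative bounds on `[ρ, ∞)` require. -/
lemma exists_uniform_gap {ι : Type} {rhc a : ℝ} (ha : rhc < a) {γ : Strain ι}
    (hγ : γ ∈ strainDomain rhc a ι) : ∃ ρ, rhc < ρ ∧ ρ ≤ a ∧ ∀ j, ρ ≤ a + γ j := by
  have h1 := tendsto_cofinite_zero (summable_sq γ)
  have h2 : ∀ᶠ j in cofinite, (rhc + a) / 2 ≤ a + γ j := by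
    filter_upwards [(tendsto_order.1 h1).1 (-(a - rhc) / 2) (by linarith)] with j hj
    linarith
  have hfin : {j | ¬ (rhc + a) / 2 ≤ a + γ j}.Finite := h2
  rcases hfin.toFinset.eq_empty_or_nonempty with he | hne
  · refine ⟨(rhc + a) / 2, by linarith, by linarith, fun j => ?_⟩
    by_contra hj
    have : j ∈ hfin.toFinset := hfin.mem_toFinset.2 hj
    rw [he] at this
    exact absurd this (Finset.notMem_empty j)
  · obtain ⟨i, hi, hmin⟩ := hfin.toFinset.exists_min_image (fun j => a + γ j) hne
    refine ⟨min ((rhc + a) / 2) (a + γ i), lt_min (by linarith) (hγ i),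
      (min_le_left _ _).trans (by linarith), fun j => ?_⟩
    by_cases hj : (rhc + a) / 2 ≤ a + γ j
    · exact (min_le_left _ _).trans hj
    · exact (min_le_right _ _).trans (hmin j (hfin.mem_toFinset.2 hj))

namespace Model

variable (D : Model)

/-- The bulk energy of square summable strains, as an absolutely convergent sum of Taylor
remainders. -/
def Phi (γ : ℤ → ℝ) : ℝ := ∑' q : ℕ × ℤ, D.rem (q.1 + 1) (len γ q.2 (q.2 + q.1 + 1))

lemma exists_rem_le {ρ : ℝ} (hρ : D.rhc < ρ) (hρa : ρ ≤ D.a) :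
    ∃ w : ℕ → ℝ, (∀ k, 0 ≤ w k) ∧ (Summable fun k : ℕ => w k * (k + 1) * (k + 1)) ∧
    ∀ (γ δ : ℤ → ℝ), (∀ j, ρ ≤ D.a + γ j) → (∀ j, ρ ≤ D.a + δ j) → ∀ q : ℕ × ℤ,
      |D.rem (q.1 + 1) (len γ q.2 (q.2 + q.1 + 1)) - D.rem (q.1 + 1) (len δ q.2 (q.2 + q.1 + 1))| ≤
      w q.1 * (|len γ q.2 (q.2 + q.1 + 1) - len δ q.2 (q.2 + q.1 + 1)| *
        (|len γ q.2 (q.2 + q.1 + 1)| + |len δ q.2 (q.2 + q.1 + 1)|)) := by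
  obtain ⟨C, hC, h⟩ := D.exists_rem_bound hρ hρa
  refine ⟨fun k => C * ((k + 1 : ℕ) : ℝ) ^ (-D.s - 2), fun k => by positivity, ?_, ?_⟩
  · refine ((summable_rpow_add (q := -D.s) (by linarith [D.hv.two_lt_s]) 1).mul_left C).congr
      fun k => ?_
    have hk : (0 : ℝ) < ((k + 1 : ℕ) : ℝ) := by positivity
    simp only [Real.rpow_sub hk, Real.rpow_ofNat]
    push_cast at hk ⊢
    field_simp
  · intro γ δ hγ hδ q
    have hlow : ∀ γ : ℤ → ℝ, (∀ j, ρ ≤ D.a + γ j) → ((q.1 + 1 : ℕ) : ℝ) * ρ ≤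
        ((q.1 + 1 : ℕ) : ℝ) * D.a + len γ q.2 (q.2 + q.1 + 1) := by
      intro γ hγ
      have := le_len (z := fun l => D.a + γ l) (i := q.2) (j := q.2 + q.1 + 1) (by omega)
        fun l _ _ => hγ l
      rw [len_const_add _ _ (by omega)] at this
      have e : ((q.2 + q.1 + 1 - q.2 : ℤ) : ℝ) = ((q.1 + 1 : ℕ) : ℝ) := by push_cast; ring
      rwa [e] at this
    exact h (q.1 + 1) _ _ (by omega) (hlow γ hγ) (hlow δ hδ)

/-- Cauchy-Schwarz in a block of `k + 1` spacings costs a factor `k + 1`, and each spacing lies in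
`k + 1` blocks of this size; hence the square of `k + 1` in the weight. -/
lemma summable_mul_sq_len {w : ℕ → ℝ} (hw : ∀ k, 0 ≤ w k)
    (hws : Summable fun k : ℕ => w k * (k + 1) * (k + 1)) {γ : ℤ → ℝ}
    (hγ : Summable fun l => γ l ^ 2) :
    (Summable fun q : ℕ × ℤ => w q.1 * len γ q.2 (q.2 + q.1 + 1) ^ 2) ∧
    ∑' q : ℕ × ℤ, w q.1 * len γ q.2 (q.2 + q.1 + 1) ^ 2 ≤
      (∑' k : ℕ, w k * (k + 1) * (k + 1)) * ∑' l, γ l ^ 2 := by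
  have h1 : Summable fun q : ℕ × ℤ =>
      w q.1 * (q.1 + 1) * len (fun l => γ l ^ 2) q.2 (q.2 + q.1 + 1) :=
    summable_mul_len (w := fun k => w k * (k + 1))
      (fun k => mul_nonneg (hw k) (by positivity)) hws hγ fun l => sq_nonneg _
  have h0 : ∑' q : ℕ × ℤ, w q.1 * (q.1 + 1) * len (fun l => γ l ^ 2) q.2 (q.2 + q.1 + 1) =
      (∑' k : ℕ, w k * (k + 1) * (k + 1)) * ∑' l, γ l ^ 2 :=
    tsum_mul_len (w := fun k => w k * (k + 1)) hγ h1
  have h2 : ∀ q : ℕ × ℤ, w q.1 * len γ q.2 (q.2 + q.1 + 1) ^ 2 ≤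
      w q.1 * (q.1 + 1) * len (fun l => γ l ^ 2) q.2 (q.2 + q.1 + 1) := fun q => by
    rw [mul_assoc]
    exact mul_le_mul_of_nonneg_left (sq_len_le γ q.2 q.1) (hw _)
  have h3 : Summable fun q : ℕ × ℤ => w q.1 * len γ q.2 (q.2 + q.1 + 1) ^ 2 :=
    Summable.of_nonneg_of_le (fun q => mul_nonneg (hw _) (sq_nonneg _)) h2 h1
  exact ⟨h3, (h3.tsum_le_tsum h2 h1).trans_eq h0⟩

lemma summable_rem {ρ : ℝ} (hρ : D.rhc < ρ) (hρa : ρ ≤ D.a) {γ : ℤ → ℝ}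
    (hγ : Summable fun l => γ l ^ 2) (hγρ : ∀ j, ρ ≤ D.a + γ j) :
    Summable fun q : ℕ × ℤ => D.rem (q.1 + 1) (len γ q.2 (q.2 + q.1 + 1)) := by
  obtain ⟨w, hw, hws, h⟩ := D.exists_rem_le hρ hρa
  refine Summable.of_norm_bounded (summable_mul_sq_len hw hws hγ).1 fun q => ?_
  have := h γ (fun _ => 0) hγρ (fun _ => by simpa using hρa) q
  have h0 : len (fun _ => (0 : ℝ)) q.2 (q.2 + q.1 + 1) = 0 := by simp [len]
  rw [h0, rem_zero, sub_zero, sub_zero, abs_zero, add_zero, ← sq, sq_abs] at this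
  exact this

lemma Phi_lipschitz {ρ : ℝ} (hρ : D.rhc < ρ) (hρa : ρ ≤ D.a) :
    ∃ B, 0 ≤ B ∧ ∀ γ δ : Strain ℤ, (∀ j, ρ ≤ D.a + γ j) → (∀ j, ρ ≤ D.a + δ j) →
      |D.Phi γ - D.Phi δ| ≤ B * ‖γ - δ‖ * (1 + ‖γ‖ ^ 2 + ‖δ‖ ^ 2) := by
  obtain ⟨w, hw, hws, h⟩ := D.exists_rem_le hρ hρa
  set B := ∑' k : ℕ, w k * (k + 1) * (k + 1) with hB
  have hB0 : 0 ≤ B := tsum_nonneg fun k =>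
    mul_nonneg (mul_nonneg (hw k) (by positivity)) (by positivity)
  refine ⟨B, hB0, fun γ δ hγ hδ => ?_⟩
  rcases eq_or_ne γ δ with rfl | hne
  · simp
  set τ := ‖γ - δ‖ with hτ
  have hτ0 : 0 < τ := norm_pos_iff.2 (sub_ne_zero.2 hne)
  have hs1 := summable_mul_sq_len hw hws (summable_sq γ)
  have hs2 := summable_mul_sq_len hw hws (summable_sq δ)
  have hs3 := summable_mul_sq_len hw hws (summable_sq (γ - δ))
  rw [← norm_sq_eq_tsum] at hs1 hs2 hs3
  have hlen : ∀ q : ℕ × ℤ, len γ q.2 (q.2 + q.1 + 1) - len δ q.2 (q.2 + q.1 + 1) =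
      len (γ - δ : Strain ℤ) q.2 (q.2 + q.1 + 1) := fun q => by
    rw [len_sub]
    rfl
  have hterm : ∀ q : ℕ × ℤ, ‖D.rem (q.1 + 1) (len γ q.2 (q.2 + q.1 + 1)) -
      D.rem (q.1 + 1) (len δ q.2 (q.2 + q.1 + 1))‖ ≤
      (2 * τ)⁻¹ * (w q.1 * len (γ - δ : Strain ℤ) q.2 (q.2 + q.1 + 1) ^ 2) +
      τ * (w q.1 * len γ q.2 (q.2 + q.1 + 1) ^ 2 + w q.1 * len δ q.2 (q.2 + q.1 + 1) ^ 2) := by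
    intro q
    refine (h γ δ hγ hδ q).trans ?_
    rw [hlen q]
    set x := len (γ - δ : Strain ℤ) q.2 (q.2 + q.1 + 1)
    set y := len γ q.2 (q.2 + q.1 + 1)
    set y' := len δ q.2 (q.2 + q.1 + 1)
    -- Young's inequality with weight `τ = ‖γ - δ‖` separates the factors into squares; after
    -- summation both parts are of order `τ`.
    have h1 : |x| * (|y| + |y'|) ≤ (2 * τ)⁻¹ * x ^ 2 + τ * (y ^ 2 + y' ^ 2) := by
      have h2 : 0 ≤ (2 * τ)⁻¹ * (|x| - τ * (|y| + |y'|)) ^ 2 := by positivity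
      have h3 : (2 * τ)⁻¹ * (|x| - τ * (|y| + |y'|)) ^ 2 =
          (2 * τ)⁻¹ * x ^ 2 - |x| * (|y| + |y'|) + τ / 2 * (|y| + |y'|) ^ 2 := by
        rw [← sq_abs x]
        field_simp
        ring
      have h4 : (|y| + |y'|) ^ 2 ≤ 2 * (y ^ 2 + y' ^ 2) := by
        rw [← sq_abs y, ← sq_abs y']
        nlinarith [sq_nonneg (|y| - |y'|)]
      nlinarith
    have := mul_le_mul_of_nonneg_left h1 (hw q.1)
    calc _ ≤ _ := this
      _ = _ := by ring
  have hsum := (hs3.1.mul_left (2 * τ)⁻¹).add ((hs1.1.add hs2.1).mul_left τ)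
  have hmain := tsum_of_norm_bounded hsum.hasSum hterm
  rw [Summable.tsum_sub (D.summable_rem hρ hρa (summable_sq γ) hγ)
      (D.summable_rem hρ hρa (summable_sq δ) hδ),
    Summable.tsum_add (hs3.1.mul_left (2 * τ)⁻¹) ((hs1.1.add hs2.1).mul_left τ), tsum_mul_left,
    tsum_mul_left, Summable.tsum_add hs1.1 hs2.1, Real.norm_eq_abs] at hmain
  refine hmain.trans ?_
  have h5 : (2 * τ)⁻¹ * ∑' q : ℕ × ℤ, w q.1 * len (γ - δ : Strain ℤ) q.2 (q.2 + q.1 + 1) ^ 2 ≤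
      B * τ := by
    have : (2 * τ)⁻¹ * ∑' q : ℕ × ℤ, w q.1 * len (γ - δ : Strain ℤ) q.2 (q.2 + q.1 + 1) ^ 2 ≤
        (2 * τ)⁻¹ * (B * τ ^ 2) := mul_le_mul_of_nonneg_left hs3.2 (by positivity)
    have h6 : (2 * τ)⁻¹ * (B * τ ^ 2) = B * τ / 2 := by field_simp
    have := mul_nonneg hB0 hτ0.le
    linarith
  have h7 := mul_le_mul_of_nonneg_left (add_le_add hs1.2 hs2.2) hτ0.le
  nlinarith

lemma continuousOn_Phi :
    ContinuousOn (fun γ : Strain ℤ => D.Phi γ) (strainDomain D.rhc D.a ℤ) := by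
  intro γ₀ hγ₀
  obtain ⟨ρ', hρ', hρa', hγρ⟩ := exists_uniform_gap D.rhc_lt_a hγ₀
  obtain ⟨ρ, hρ, hρρ⟩ := exists_between hρ'
  obtain ⟨B, hB, h⟩ := D.Phi_lipschitz hρ (hρρ.le.trans hρa')
  refine ContinuousAt.continuousWithinAt ?_
  rw [ContinuousAt, tendsto_iff_dist_tendsto_zero]
  have hlim : Tendsto (fun γ : Strain ℤ => B * ‖γ - γ₀‖ * (1 + ‖γ‖ ^ 2 + ‖γ₀‖ ^ 2)) (𝓝 γ₀)
      (𝓝 (B * ‖γ₀ - γ₀‖ * (1 + ‖γ₀‖ ^ 2 + ‖γ₀‖ ^ 2))) :=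
    Continuous.tendsto (by fun_prop) γ₀
  rw [sub_self, norm_zero, mul_zero, zero_mul] at hlim
  refine squeeze_zero' (Eventually.of_forall fun _ => dist_nonneg) ?_ hlim
  filter_upwards [Metric.ball_mem_nhds γ₀ (sub_pos.2 hρρ)] with γ hγ
  rw [Real.dist_eq]
  refine h γ γ₀ (fun j => ?_) fun j => hρρ.le.trans (hγρ j)
  have h1 := abs_apply_le_norm (γ - γ₀) j
  rw [Metric.mem_ball, dist_eq_norm] at hγ
  have h2 : (γ - γ₀ : Strain ℤ) j = γ j - γ₀ j := rfl
  rw [h2] at h1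
  have := (abs_le.1 h1).1
  linarith [hγρ j]

/-! ### Summable strains -/

/-- The change of the interaction of a block of `k + 1` spacings due to a strain. -/
def dif (γ : ℤ → ℝ) (q : ℕ × ℤ) : ℝ :=
  D.phi (q.1 + 1) (((q.1 + 1 : ℕ) : ℝ) * D.a + len γ q.2 (q.2 + q.1 + 1)) -
    D.phi (q.1 + 1) (((q.1 + 1 : ℕ) : ℝ) * D.a)

lemma dif_eq (γ : ℤ → ℝ) (q : ℕ × ℤ) : D.dif γ q = D.rem (q.1 + 1) (len γ q.2 (q.2 + q.1 + 1)) +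
    D.slope (q.1 + 1) * len γ q.2 (q.2 + q.1 + 1) := D.phi_add _ _

lemma summable_slope_len {γ : ℤ → ℝ} (hγ : Summable γ) :
    Summable fun q : ℕ × ℤ => D.slope (q.1 + 1) * len γ q.2 (q.2 + q.1 + 1) := by
  have h1 : Summable fun k : ℕ => |D.slope (k + 1)| * ((k : ℝ) + 1) :=
    D.summable_mul_slope.norm.congr fun k => by
      rw [norm_mul, Real.norm_natCast, Real.norm_eq_abs, mul_comm]
      push_cast
      rfl
  refine Summable.of_norm_bounded
    (summable_mul_len (fun k => abs_nonneg _) h1 hγ.norm fun l => norm_nonneg _) fun q => ?_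
  rw [norm_mul, Real.norm_eq_abs]
  exact mul_le_mul_of_nonneg_left (norm_sum_le _ _) (abs_nonneg _)

/-- For summable strains the linear parts may be summed separately: they give `∑ k φ_k'(k a)` times
the total strain, and this factor is `-p` because the ground state is stress free. -/
lemma hasSum_dif {ρ : ℝ} (hρ : D.rhc < ρ) (hρa : ρ ≤ D.a) {γ : ℤ → ℝ} (hγ1 : Summable γ)
    (hγ : Summable fun l => γ l ^ 2) (hγρ : ∀ j, ρ ≤ D.a + γ j) :
    HasSum (D.dif γ) (D.Phi γ - D.p * ∑' l, γ l) := by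
  have h1 := (D.summable_rem hρ hρa hγ hγρ).hasSum
  have h2 := (D.summable_slope_len hγ1).hasSum
  rw [tsum_mul_len (w := fun k => D.slope (k + 1)) hγ1 (D.summable_slope_len hγ1)] at h2
  have h3 := h1.add h2
  have h4 : ∑' k : ℕ, D.slope (k + 1) * ((k : ℝ) + 1) = -D.p := by
    have := D.stationary
    rw [← eq_neg_iff_add_eq_zero] at this
    rw [this, neg_neg]
    refine tsum_congr fun k => ?_
    push_cast
    ring
  rw [h4, neg_mul, ← sub_eq_add_neg] at h3
  exact h3.congr_fun fun q => D.dif_eq γ q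

lemma E_sub_const (γ : ℤ → ℝ) {b e : ℤ} (hbe : b ≤ e) :
    D.E (fun l => D.a + γ l) b e - D.E (fun _ => D.a) b e =
      ∑ q ∈ (Finset.range (e - b).toNat ×ˢ Finset.Ico b e).filter fun q => q.2 + q.1 + 1 ≤ e,
        D.dif γ q + D.p * len γ b e := by
  unfold E
  rw [len_const_add _ _ hbe, len_const _ hbe]
  have h1 : pairSum (D.blk fun l => D.a + γ l) b e - pairSum (D.blk fun _ => D.a) b e =
      ∑ q ∈ (Finset.range (e - b).toNat ×ˢ Finset.Ico b e).filter fun q => q.2 + q.1 + 1 ≤ e,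
        D.dif γ q := by
    unfold pairSum
    rw [← Finset.sum_sub_distrib]
    simp only [← Finset.sum_sub_distrib]
    rw [Finset.sum_sigma']
    refine Finset.sum_bij' (fun x _ => ((x.2 - x.1 - 1).toNat, x.1))
      (fun q _ => ⟨q.2, q.2 + q.1 + 1⟩) ?_ ?_ ?_ ?_ ?_
    · intro x hx
      simp only [Finset.mem_sigma, Finset.mem_Ico, Finset.mem_Ioc, Finset.mem_filter,
        Finset.mem_product, Finset.mem_range] at *
      omega
    · intro x hx
      simp only [Finset.mem_sigma, Finset.mem_Ico, Finset.mem_Ioc, Finset.mem_filter,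
        Finset.mem_product, Finset.mem_range] at *
      omega
    · intro x hx
      simp only [Finset.mem_sigma, Finset.mem_Ico, Finset.mem_Ioc] at hx
      obtain ⟨i, j⟩ := x
      simp only [Sigma.mk.injEq, heq_eq_eq, true_and] at *
      omega
    · intro x hx
      obtain ⟨k, j⟩ := x
      simp only [Prod.mk.injEq, and_true]
      omega
    · intro x hx
      simp only [Finset.mem_sigma, Finset.mem_Ico, Finset.mem_Ioc] at hx
      obtain ⟨i, j⟩ := x
      simp only at hx ⊢
      have e1 : (j - i).toNat = (j - i - 1).toNat + 1 := by omega
      have e2 : i + ((j - i - 1).toNat : ℤ) + 1 = j := by omega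
      rw [D.blk_const (by omega), blk, len_const_add _ _ (by omega), dif]
      simp only [e2, e1]
      congr 3
      rw [← e1, ← Int.cast_natCast (R := ℝ) (j - i).toNat, Int.toNat_of_nonneg (by omega)]
  linarith

lemma X_const (b e : ℤ) : D.X (fun _ => D.a) b e =
    D.E (fun _ => D.a) 0 (e - b) - ((e - b : ℤ) : ℝ) * D.e₀ + D.Waa := by
  have := D.E_shift (fun _ => D.a) 0 (e - b) b
  rw [zero_add, show e - b + b = e by ring] at this
  unfold X
  rw [← this]

lemma tendsto_X_const {b e : ℕ → ℤ} (h : Tendsto (fun n => e n - b n) atTop atTop) :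
    Tendsto (fun n => D.X (fun _ => D.a) (b n) (e n)) atTop (𝓝 0) := by
  have h1 : Tendsto (fun n => (e n - b n).toNat) atTop atTop := by
    rw [tendsto_atTop_atTop]
    intro N
    obtain ⟨n₀, hn₀⟩ := tendsto_atTop_atTop.1 h N
    exact ⟨n₀, fun n hn => by have := hn₀ n hn; omega⟩
  refine (D.tendsto_E_const.comp h1).congr' ?_
  filter_upwards [h.eventually_ge_atTop 0] with n hn
  simp only [Function.comp_apply]
  rw [X_const, ← Int.cast_natCast (R := ℝ), Int.toNat_of_nonneg hn]

lemma tendsto_X_of_summable {ρ : ℝ} (hρ : D.rhc < ρ) (hρa : ρ ≤ D.a) {γ : ℤ → ℝ} (hγ1 : Summable γ)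
    (hγ : Summable fun l => γ l ^ 2) (hγρ : ∀ j, ρ ≤ D.a + γ j) :
    Tendsto (fun n : ℕ => D.X (fun l => D.a + γ l) (-n) n) atTop (𝓝 (D.Phi γ)) := by
  have h1 : Tendsto (fun n : ℕ => (Finset.range ((n : ℤ) - -n).toNat ×ˢ
      Finset.Ico (-n : ℤ) n).filter fun q : ℕ × ℤ => q.2 + q.1 + 1 ≤ n) atTop atTop := by
    refine tendsto_atTop_finset_of_monotone ?_ ?_
    · intro n n' hn q hq
      simp only [Finset.mem_filter, Finset.mem_product, Finset.mem_range, Finset.mem_Ico] at *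
      omega
    · intro q
      refine ⟨q.1 + q.2.natAbs + 1, ?_⟩
      simp only [Finset.mem_filter, Finset.mem_product, Finset.mem_range, Finset.mem_Ico]
      omega
  have h2 := (tendsto_finset_sum (D.hasSum_dif hρ hρa hγ1 hγ hγρ)).comp h1
  have h3 : Tendsto (fun n : ℕ => Finset.Ico (-n : ℤ) n) atTop atTop := by
    refine tendsto_atTop_finset_of_monotone ?_ ?_
    · intro n n' hn q hq
      simp only [Finset.mem_Ico] at *
      omega
    · intro q
      refine ⟨q.natAbs + 1, ?_⟩
      simp only [Finset.mem_Ico]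
      omega
  have h4 := ((tendsto_finset_sum hγ1.hasSum).comp h3).const_mul D.p
  have h5 : Tendsto (fun n : ℕ => ((n : ℤ) - -n : ℤ)) atTop atTop := by
    rw [tendsto_atTop_atTop]
    exact fun N => ⟨N.natAbs, fun n hn => by omega⟩
  have h6 := (h2.add h4).add (D.tendsto_X_const h5)
  rw [sub_add_cancel, add_zero] at h6
  refine h6.congr fun n => ?_
  have h7 := D.E_sub_const γ (b := -n) (e := n) (by omega)
  simp only [Function.comp_apply, X]
  unfold len at h7
  linarith

/-- The finite chain energies converge to the bulk energy for square summable strains. -/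
lemma tendsto_X {γ : Strain ℤ} (hγ : γ ∈ strainDomain D.rhc D.a ℤ) :
    Tendsto (fun n : ℕ => D.X (fun l => D.a + γ l) (-n) n) atTop (𝓝 (D.Phi γ)) := by
  obtain ⟨ρ, hρ, hρa, hγρ⟩ := exists_uniform_gap D.rhc_lt_a hγ
  have h3 : Tendsto (fun n : ℕ => Finset.Ico (-n : ℤ) n) atTop atTop := by
    refine tendsto_atTop_finset_of_monotone ?_ ?_
    · intro n n' hn q hq
      simp only [Finset.mem_Ico] at *
      omega
    · intro q
      refine ⟨q.natAbs + 1, ?_⟩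
      simp only [Finset.mem_Ico]
      omega
  set τ : ℕ → Strain ℤ := fun n => trunc (Finset.Ico (-n : ℤ) n) γ with hτ
  have hτlim : Tendsto τ atTop (𝓝 γ) := (tendsto_trunc γ).comp h3
  have hτdom : ∀ n, τ n ∈ strainDomain D.rhc D.a ℤ := fun n => (trunc_mem D.rhc_lt_a _ hγ).1
  have hPhi : Tendsto (fun n => D.Phi (τ n)) atTop (𝓝 (D.Phi γ)) :=
    (D.continuousOn_Phi γ hγ).tendsto.comp
      (tendsto_nhdsWithin_iff.2 ⟨hτlim, Eventually.of_forall hτdom⟩)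
  have hτin : ∀ (n : ℕ) (l : ℤ), -(n : ℤ) ≤ l → l < n → τ n l = γ l := by
    intro n l h1 h2
    simp only [hτ]
    rw [trunc_apply, if_pos (Finset.mem_Ico.2 ⟨h1, h2⟩)]
  have hτout : ∀ (n : ℕ) (l : ℤ), (l < -(n : ℤ) ∨ n ≤ l) → τ n l = 0 := by
    intro n l h1
    simp only [hτ]
    rw [trunc_apply, if_neg (by rw [Finset.mem_Ico]; omega)]
  have hτρ : ∀ n j, ρ ≤ D.a + τ n j := by
    intro n j
    simp only [hτ, trunc_apply]
    split_ifs
    · exact hγρ j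
    · simpa using hρa
  have hτ1 : ∀ n, Summable (τ n) := fun n => by
    refine summable_of_ne_finset_zero (s := Finset.Ico (-n : ℤ) n) fun l hl => ?_
    refine hτout n l ?_
    rw [Finset.mem_Ico] at hl
    omega
  -- By continuity of `Phi` it suffices to compare `Phi (τ n)` with the energy of the finite chain
  -- on `[-n, n)`. As `τ n` is summable, `Phi (τ n)` is a limit over longer chains, and these can be
  -- cut at `-n` and `n`, where all spacings are near `a`; the outer parts are uniform.
  refine (tendsto_iff_of_dist ?_).1 hPhi
  rw [Metric.tendsto_atTop]
  intro η hη
  obtain ⟨M, ε, hM, hε, hε1, hG⟩ := D.exists_good (η := η / 4) (by positivity)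
  have hcof := tendsto_cofinite_zero (summable_sq γ)
  have hev : ∀ᶠ j in cofinite, |γ j| ≤ ε := by
    filter_upwards [hcof.eventually (Metric.closedBall_mem_nhds 0 hε)] with j hj
    simpa [Real.dist_eq] using hj
  have hfin : {j | ¬ |γ j| ≤ ε}.Finite := hev
  obtain ⟨R, hR⟩ : ∃ R : ℕ, ∀ j : ℤ, R ≤ j.natAbs → |γ j| ≤ ε := by
    obtain ⟨R, hR⟩ := (hfin.toFinset.image Int.natAbs).exists_nat_subset_range
    refine ⟨R, fun j hj => ?_⟩
    by_contra hc
    have := hR (Finset.mem_image_of_mem _ (hfin.mem_toFinset.2 hc))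
    rw [Finset.mem_range] at this
    omega
  refine ⟨R + M.toNat, fun n hn => ?_⟩
  have hsmall : ∀ l : ℤ, R ≤ l.natAbs → |τ n l| ≤ ε := by
    intro l hl
    simp only [hτ, trunc_apply]
    split_ifs
    · exact hR l hl
    · simpa using hε.le
  -- compare with a longer chain
  have hlim := D.tendsto_X_of_summable hρ hρa (hτ1 n) (summable_sq (τ n)) (hτρ n)
  have hr0 : Tendsto (fun N : ℕ => D.X (fun _ => D.a) n N) atTop (𝓝 0) := by
    refine D.tendsto_X_const ?_
    rw [tendsto_atTop_atTop]
    exact fun N => ⟨N.natAbs + n, fun n hn => by omega⟩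
  have hl0 : Tendsto (fun N : ℕ => D.X (fun _ => D.a) (-N) (-n)) atTop (𝓝 0) := by
    refine D.tendsto_X_const ?_
    rw [tendsto_atTop_atTop]
    exact fun N => ⟨N.natAbs + n, fun n hn => by omega⟩
  have hlim2 := (hlim.sub hr0).sub hl0
  rw [sub_zero, sub_zero] at hlim2
  have hz : ∀ l, D.rhc ≤ D.a + τ n l := fun l => hρ.le.trans (hτρ n l)
  have hbd : ∀ᶠ N : ℕ in atTop, |D.X (fun l => D.a + τ n l) (-N) N - D.X (fun _ => D.a) n N -
      D.X (fun _ => D.a) (-N) (-n) - D.X (fun l => D.a + γ l) (-n) n| ≤ η / 2 := by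
    filter_upwards [eventually_ge_atTop (n + M.toNat)] with N hN
    have e1 := D.X_split (fun l => D.a + τ n l) (b := -N) (t := -n) (e := N) (by omega) (by omega)
    have e2 := D.X_split (fun l => D.a + τ n l) (b := -n) (t := n) (e := N) (by omega) (by omega)
    have e3 : D.X (fun l => D.a + τ n l) (-N) (-n) = D.X (fun _ => D.a) (-N) (-n) :=
      D.X_congr fun l h1 h2 => by rw [hτout n l (by omega), add_zero]
    have e4 : D.X (fun l => D.a + τ n l) n N = D.X (fun _ => D.a) n N :=
      D.X_congr fun l h1 h2 => by rw [hτout n l (by omega), add_zero]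
    have e5 : D.X (fun l => D.a + τ n l) (-n) n = D.X (fun l => D.a + γ l) (-n) n :=
      D.X_congr fun l h1 h2 => by rw [hτin n l h1 h2]
    have g1 := hG (fun l => D.a + τ n l) (-N) (-n) N (by omega) (by omega) (fun l _ _ => hz l)
      fun l h1 h2 => by
        rw [add_sub_cancel_left]
        exact hsmall l (by omega)
    have g2 := hG (fun l => D.a + τ n l) (-n) n N (by omega) (by omega) (fun l _ _ => hz l)
      fun l h1 h2 => by
        rw [add_sub_cancel_left]
        exact hsmall l (by omega)
    rw [e3] at e1
    rw [e4, e5] at e2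
    rw [e1, e2]
    rw [abs_le] at g1 g2 ⊢
    constructor <;> linarith [g1.1, g1.2, g2.1, g2.2]
  have hfinal := le_of_tendsto ((hlim2.sub_const _).abs) hbd
  rw [dist_zero_right, Real.norm_eq_abs, abs_of_nonneg dist_nonneg, Real.dist_eq]
  exact hfinal.trans_lt (by linarith)

end Model

/-- Extension of a one-sided strain by zero. -/
def extZ (γ : ℕ → ℝ) (j : ℤ) : ℝ := if 0 ≤ j then γ j.toNat else 0

lemma extZ_natCast (γ : ℕ → ℝ) (j : ℕ) : extZ γ j = γ j := by simp [extZ]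

lemma extZ_neg (γ : ℕ → ℝ) {j : ℤ} (hj : j < 0) : extZ γ j = 0 := by
  unfold extZ; rw [if_neg (by omega)]

lemma extZ_of_nonneg (γ : ℕ → ℝ) {j : ℤ} (hj : 0 ≤ j) : extZ γ j = γ j.toNat := by
  unfold extZ; rw [if_pos hj]

lemma hasSum_extZ_sq {γ : ℕ → ℝ} {A : ℝ} (h : HasSum (fun i => γ i ^ 2) A) :
    HasSum (fun j => extZ γ j ^ 2) A := by
  refine (Function.Injective.hasSum_iff (g := fun n : ℕ => (n : ℤ)) Nat.cast_injective ?_).1 ?_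
  · intro j hj
    have : j < 0 := by
      by_contra hc
      exact hj ⟨j.toNat, by simp only; omega⟩
    rw [extZ_neg _ this]
    norm_num
  · simpa [Function.comp_def, extZ_natCast] using h

/-- Extension of one-sided square summable strains by zero. -/
def extStrain (γ : Strain ℕ) : Strain ℤ :=
  ⟨extZ γ, memℓp_two_iff.2 (hasSum_extZ_sq (summable_sq γ).hasSum).summable⟩

lemma extStrain_apply (γ : Strain ℕ) (j : ℤ) : extStrain γ j = extZ γ j := rfl

lemma coe_extStrain (γ : Strain ℕ) : (extStrain γ : ℤ → ℝ) = extZ γ := rfl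

lemma norm_extStrain_sub (γ δ : Strain ℕ) : ‖extStrain γ - extStrain δ‖ = ‖γ - δ‖ := by
  have h1 : (fun j => (extStrain γ - extStrain δ : Strain ℤ) j ^ 2) =
      fun j => extZ (γ - δ : Strain ℕ) j ^ 2 := by
    funext j
    change (extZ γ j - extZ δ j) ^ 2 = _
    unfold extZ
    split_ifs
    · rfl
    · norm_num
  have h2 : ‖extStrain γ - extStrain δ‖ ^ 2 = ‖γ - δ‖ ^ 2 := by
    rw [norm_sq_eq_tsum, norm_sq_eq_tsum, h1]
    exact (hasSum_extZ_sq (summable_sq (γ - δ)).hasSum).tsum_eq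
  exact (sq_eq_sq₀ (norm_nonneg _) (norm_nonneg _)).1 h2

lemma continuous_extStrain : Continuous extStrain := by
  refine Isometry.continuous (Isometry.of_dist_eq fun γ δ => ?_)
  rw [dist_eq_norm, dist_eq_norm, norm_extStrain_sub]

lemma extStrain_mem {rhc a : ℝ} (ha : rhc < a) {γ : Strain ℕ} (hγ : γ ∈ strainDomain rhc a ℕ) :
    extStrain γ ∈ strainDomain rhc a ℤ := by
  intro j
  rw [extStrain_apply]
  unfold extZ
  split_ifs
  · exact hγ _
  · simpa using ha

lemma continuous_strain_apply {ι : Type} (i : ι) : Continuous fun γ : Strain ι => γ i := by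
  refine (LipschitzWith.of_dist_le_mul (K := 1) fun γ δ => ?_).continuous
  rw [Real.dist_eq, dist_eq_norm, NNReal.coe_one, one_mul]
  exact abs_apply_le_norm (γ - δ) i

lemma hasSum_add_fiber {f : ℕ × ℤ → ℝ} {g : ℤ → ℝ} {A B : ℝ} (hg : HasSum g B) (hf : HasSum f A) :
    HasSum (fun j => g j + ∑' k, f (k, j)) (B + A) := by
  refine hg.add ?_
  have h2 : HasSum (fun q : ℤ × ℕ => f (q.2, q.1)) A := (Equiv.prodComm ℤ ℕ).hasSum_iff.2 hf
  exact h2.prod_fiberwise fun j => (hf.summable.comp_injective (i := fun k : ℕ => (k, j))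
      fun k k' h => (Prod.mk.inj h).1).hasSum

namespace Model

variable (D : Model)

/-! ### Identification of the energy functionals -/

lemma hEnergy_eq (γ : ℤ → ℝ) (j : ℤ) :
    hEnergy D.v D.m D.p (fun i : ℕ => D.a + γ (j + i)) = D.p * (D.a + γ j) +
      ∑' k : ℕ, D.phi (k + 1) (((k + 1 : ℕ) : ℝ) * D.a + len γ j (j + k + 1)) := by
  unfold hEnergy
  beta_reduce
  rw [Nat.cast_zero, add_zero]
  congr 1
  refine tsum_congr fun k => ?_
  rw [Finset.sum_add_distrib, ← len_eq_sum_range, Finset.sum_const, Finset.card_range,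
    nsmul_eq_mul]
  rfl

lemma hEnergy_sub {γ : ℤ → ℝ} (hs : Summable (D.dif γ)) (j : ℤ) :
    hEnergy D.v D.m D.p (fun i : ℕ => D.a + γ (j + i)) - D.e₀ =
      D.p * γ j + ∑' k : ℕ, D.dif γ (k, j) := by
  have h1 : Summable fun k : ℕ => D.dif γ (k, j) :=
    hs.comp_injective (i := fun k : ℕ => (k, j)) fun k k' h => (Prod.mk.inj h).1
  have h2 := D.summable_phi_mul D.rhc_lt_a
  have h3 : ∀ k : ℕ, D.phi (k + 1) (((k + 1 : ℕ) : ℝ) * D.a + len γ j (j + k + 1)) =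
      D.dif γ (k, j) + D.phi (k + 1) (((k : ℝ) + 1) * D.a) := by
    intro k
    unfold dif
    push_cast
    ring
  rw [hEnergy_eq, tsum_congr h3, Summable.tsum_add h1 h2, show D.e₀ = D.cb D.a from rfl, cb_eq]
  ring

lemma hasSum_hEnergy {ρ : ℝ} (hρ : D.rhc < ρ) (hρa : ρ ≤ D.a) {γ : ℤ → ℝ} (hγ1 : Summable γ)
    (hγ : Summable fun l => γ l ^ 2) (hγρ : ∀ j, ρ ≤ D.a + γ j) :
    HasSum (fun j : ℤ => hEnergy D.v D.m D.p (fun i : ℕ => D.a + γ (j + i)) - D.e₀)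
      (D.Phi γ) := by
  have h1 := D.hasSum_dif hρ hρa hγ1 hγ hγρ
  have h4 := hasSum_add_fiber (hγ1.hasSum.mul_left D.p) h1
  rw [add_sub_cancel] at h4
  have h5 : (fun j : ℤ => hEnergy D.v D.m D.p (fun i : ℕ => D.a + γ (j + i)) - D.e₀) =
      fun j : ℤ => D.p * γ j + ∑' k : ℕ, D.dif γ (k, j) :=
    funext fun j => D.hEnergy_sub h1.summable j
  rw [h5]
  exact h4

lemma summable_of_finite_ne {ι : Type} {γ : ι → ℝ} (h : {j | γ j ≠ 0}.Finite) : Summable γ :=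
  summable_of_hasFiniteSupport h

lemma bulk₀_eq {γ : Strain ℤ} (hγ : γ ∈ finiteStrainDomain D.rhc D.a ℤ) :
    bulk₀ D.v D.m D.p D.a D.e₀ γ = D.Phi γ := by
  obtain ⟨ρ, hρ, hρa, hγρ⟩ := exists_uniform_gap D.rhc_lt_a hγ.1
  exact (D.hasSum_hEnergy hρ hρa (summable_of_finite_ne hγ.2) (summable_sq γ) hγρ).tsum_eq

/-- The change of the interaction across the cut at the origin due to a strain. -/
def crossDif (γ : ℤ → ℝ) : ℝ :=
  ∑' q : ℕ × ℕ, (D.blk (fun l => D.a + γ l) (-1 - q.1) (1 + q.2) -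
    D.phi (q.1 + q.2 + 2) (((q.1 + q.2 + 2 : ℕ) : ℝ) * D.a))

lemma abs_blk_cut_le {z : ℤ → ℝ} (hz : ∀ l, D.rhc ≤ z l) (q : ℕ × ℕ) :
    |D.blk z (-1 - q.1) (1 + q.2)| ≤ D.c (q.1 + q.2 + 2) := by
  have := D.abs_blk_le (z := z) (i := -1 - q.1) (j := 1 + q.2) (by omega) fun l _ _ => hz l
  rwa [show (1 + (q.2 : ℤ) - (-1 - q.1)).toNat = q.1 + q.2 + 2 by omega] at this

lemma abs_crossDif_term_le {γ : ℤ → ℝ} (hγ : ∀ l, D.rhc ≤ D.a + γ l) (q : ℕ × ℕ) :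
    ‖D.blk (fun l => D.a + γ l) (-1 - q.1) (1 + q.2) -
      D.phi (q.1 + q.2 + 2) (((q.1 + q.2 + 2 : ℕ) : ℝ) * D.a)‖ ≤ 2 * D.c (q.1 + q.2 + 2) := by
  have h1 := D.abs_blk_cut_le hγ q
  have h2 := D.abs_phi_const_le (k := q.1 + q.2 + 2) (by omega)
  rw [Real.norm_eq_abs]
  refine (abs_sub _ _).trans ?_
  linarith

lemma dif_eq_blk (γ : ℤ → ℝ) (q : ℕ × ℕ) : D.dif γ (q.2 + (q.1 + 1), -((q.1 : ℤ) + 1)) =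
    D.blk (fun l => D.a + γ l) (-1 - q.1) (1 + q.2) -
      D.phi (q.1 + q.2 + 2) (((q.1 + q.2 + 2 : ℕ) : ℝ) * D.a) := by
  unfold dif blk
  rw [len_const_add _ _ (by omega)]
  simp only
  have e1 : q.2 + (q.1 + 1) + 1 = q.1 + q.2 + 2 := by omega
  have e2 : (1 + (q.2 : ℤ) - (-1 - (q.1 : ℤ))).toNat = q.1 + q.2 + 2 := by omega
  have e3 : -((q.1 : ℤ) + 1) + ((q.2 + (q.1 + 1) : ℕ) : ℤ) + 1 = 1 + q.2 := by push_cast; ring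
  have e4 : -((q.1 : ℤ) + 1) = -1 - q.1 := by ring
  have e5 : ((1 + (q.2 : ℤ) - (-1 - (q.1 : ℤ)) : ℤ) : ℝ) = ((q.1 + q.2 + 2 : ℕ) : ℝ) := by
    push_cast; ring
  rw [e1, e2, e3, e4, e5]

/-- Continue the chain to the left by the spacing `a`. In the two-sided sum, the sites to the left
of the origin then contribute exactly the change of the interaction across the origin, so the
surface energy is the bulk energy minus this change. -/
lemma surf₀_eq {γ : Strain ℕ} (hγ : γ ∈ finiteStrainDomain D.rhc D.a ℕ) :
    surf₀ D.v D.m D.p D.a D.e₀ γ = D.Phi (extZ γ) - D.crossDif (extZ γ) := by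
  have hext := extStrain_mem D.rhc_lt_a hγ.1
  obtain ⟨ρ, hρ, hρa, hγρ⟩ := exists_uniform_gap D.rhc_lt_a hext
  have hfin : {j | extStrain γ j ≠ 0}.Finite := by
    refine (hγ.2.image fun n : ℕ => (n : ℤ)).subset fun j hj => ?_
    have hj' : extZ γ j ≠ 0 := hj
    unfold extZ at hj'
    split_ifs at hj' with h
    · exact ⟨j.toNat, hj', by simp only; omega⟩
    · exact absurd rfl hj'
  have hs1 := summable_of_finite_ne hfin
  have h := D.hasSum_hEnergy hρ hρa hs1 (summable_sq (extStrain γ)) hγρ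
  have hdif := (D.hasSum_dif hρ hρa hs1 (summable_sq (extStrain γ)) hγρ).summable
  rw [coe_extStrain] at h hdif
  set f : ℤ → ℝ := fun j => hEnergy D.v D.m D.p (fun i : ℕ => D.a + extZ γ (j + i)) - D.e₀ with hf
  have hz : ∀ l, D.rhc ≤ D.a + extZ γ l := fun l => hρ.le.trans (hγρ l)
  have hcs : Summable fun q : ℕ × ℕ => D.blk (fun l => D.a + extZ γ l) (-1 - q.1) (1 + q.2) -
      D.phi (q.1 + q.2 + 2) (((q.1 + q.2 + 2 : ℕ) : ℝ) * D.a) :=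
    Summable.of_norm_bounded (D.summable_c.mul_left 2) fun q => D.abs_crossDif_term_le hz q
  have hneg : ∀ α : ℕ, f (-((α : ℤ) + 1)) = ∑' β : ℕ,
      (D.blk (fun l => D.a + extZ γ l) (-1 - α) (1 + β) -
        D.phi (α + β + 2) (((α + β + 2 : ℕ) : ℝ) * D.a)) := by
    intro α
    simp only [hf]
    rw [D.hEnergy_sub hdif, extZ_neg _ (by omega), mul_zero, zero_add]
    have hk : Summable fun k : ℕ => D.dif (extZ γ) (k, -((α : ℤ) + 1)) :=
      hdif.comp_injective (i := fun k : ℕ => (k, -((α : ℤ) + 1))) fun k k' h => (Prod.mk.inj h).1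
    -- Blocks of at most `α + 1` spacings starting at `-(α + 1)` do not reach the origin and contain
    -- only unstrained spacings.
    rw [← hk.sum_add_tsum_nat_add (α + 1), Finset.sum_eq_zero, zero_add]
    · exact tsum_congr fun β => D.dif_eq_blk (extZ γ) (α, β)
    · intro k hk
      rw [Finset.mem_range] at hk
      unfold dif
      have : len (extZ γ) (-((α : ℤ) + 1)) (-((α : ℤ) + 1) + k + 1) = 0 :=
        Finset.sum_eq_zero fun l hl => extZ_neg _ (by rw [Finset.mem_Ico] at hl; omega)
      simp only [this, add_zero, sub_self]
  have h1 : Summable fun n : ℕ => f n := h.summable.comp_injective Nat.cast_injective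
  have h2 : Summable fun n : ℕ => f (-((n : ℤ) + 1)) :=
    h.summable.comp_injective fun n n' hn => by
      have : -((n : ℤ) + 1) = -((n' : ℤ) + 1) := hn
      omega
  have h3 := tsum_of_nat_of_neg_add_one h1 h2
  rw [h.tsum_eq, tsum_congr hneg, ← hcs.tsum_prod] at h3
  have h4 : surf₀ D.v D.m D.p D.a D.e₀ γ = ∑' n : ℕ, f n := by
    unfold surf₀
    refine tsum_congr fun j => ?_
    simp only [hf, ← Nat.cast_add, extZ_natCast]
  rw [h4, h3]
  unfold crossDif
  ring

/-- Pairs across the cut have label distance at least 2, so each term is continuous and dominated by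
a summable sequence on the whole domain, without any uniform gap to the hard core. -/
lemma continuousOn_crossDif :
    ContinuousOn (fun γ : Strain ℕ => D.crossDif (extZ γ)) (strainDomain D.rhc D.a ℕ) := by
  refine continuousOn_tsum (u := fun q : ℕ × ℕ => 2 * D.c (q.1 + q.2 + 2)) (fun q => ?_)
    (D.summable_c.mul_left 2) fun q γ hγ => D.abs_crossDif_term_le
      (fun l => (extStrain_mem D.rhc_lt_a hγ l).le) q
  refine ContinuousOn.sub ?_ continuousOn_const
  unfold blk phi
  split_ifs
  · refine D.continuousOn_v.comp ?_ ?_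
    · refine Continuous.continuousOn (continuous_finsetSum _ fun l _ => ?_)
      refine continuous_const.add ?_
      exact (continuous_strain_apply l).comp continuous_extStrain
    · intro γ hγ
      have := le_len (z := fun l => D.a + extZ γ l) (i := -1 - q.1) (j := 1 + q.2) (by omega)
        fun l _ _ => (extStrain_mem D.rhc_lt_a hγ l).le
      have h2 : (2 : ℝ) ≤ ((1 + q.2 - (-1 - q.1) : ℤ) : ℝ) := by
        exact_mod_cast (by omega : (2 : ℤ) ≤ 1 + q.2 - (-1 - q.1))
      rw [mem_Ioi]
      nlinarith [D.hrhc]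
  · exact continuousOn_const

lemma continuousOn_surface : ContinuousOn
    (fun γ : Strain ℕ => D.Phi (extZ γ) - D.crossDif (extZ γ)) (strainDomain D.rhc D.a ℕ) :=
  (D.continuousOn_Phi.comp continuous_extStrain.continuousOn
    fun _ hγ => extStrain_mem D.rhc_lt_a hγ).sub D.continuousOn_crossDif

/-- Continuous extension from the finitely supported strains. -/
lemma extendFrom_eqOn {ι : Type} {rhc a : ℝ} (ha : rhc < a) {f g : Strain ι → ℝ}
    (hg : ContinuousOn g (strainDomain rhc a ι)) (hfg : EqOn f g (finiteStrainDomain rhc a ι)) :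
    EqOn (extendFrom (finiteStrainDomain rhc a ι) f) g (strainDomain rhc a ι) := by
  intro γ hγ
  refine extendFrom_eq (mem_closure_finite ha hγ) ?_
  have h1 : Tendsto g (𝓝[finiteStrainDomain rhc a ι] γ) (𝓝 (g γ)) :=
    (hg γ hγ).tendsto.mono_left (nhdsWithin_mono _ fun δ hδ => hδ.1)
  exact h1.congr' (eventually_nhdsWithin_of_forall fun δ hδ => (hfg hδ).symm)

lemma bulk_eqOn : EqOn (bulk D.v D.rhc D.m D.p D.a D.e₀) (fun γ => D.Phi γ)
    (strainDomain D.rhc D.a ℤ) :=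
  extendFrom_eqOn D.rhc_lt_a D.continuousOn_Phi fun _ hγ => D.bulk₀_eq hγ

lemma surf_eqOn : EqOn (surf D.v D.rhc D.m D.p D.a D.e₀)
    (fun γ : Strain ℕ => D.Phi (extZ γ) - D.crossDif (extZ γ)) (strainDomain D.rhc D.a ℕ) :=
  extendFrom_eqOn D.rhc_lt_a D.continuousOn_surface fun _ hγ => D.surf₀_eq hγ

lemma continuousOn_bulk :
    ContinuousOn (bulk D.v D.rhc D.m D.p D.a D.e₀) (strainDomain D.rhc D.a ℤ) :=
  D.continuousOn_Phi.congr D.bulk_eqOn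

lemma continuousOn_surf :
    ContinuousOn (surf D.v D.rhc D.m D.p D.a D.e₀) (strainDomain D.rhc D.a ℕ) :=
  D.continuousOn_surface.congr D.surf_eqOn

lemma bulk_eqOn_bulk₀ : EqOn (bulk D.v D.rhc D.m D.p D.a D.e₀) (bulk₀ D.v D.m D.p D.a D.e₀)
    (finiteStrainDomain D.rhc D.a ℤ) :=
  fun _ hγ => (D.bulk_eqOn hγ.1).trans (D.bulk₀_eq hγ).symm

lemma surf_eqOn_surf₀ : EqOn (surf D.v D.rhc D.m D.p D.a D.e₀) (surf₀ D.v D.m D.p D.a D.e₀)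
    (finiteStrainDomain D.rhc D.a ℕ) :=
  fun _ hγ => (D.surf_eqOn hγ.1).trans (D.surf₀_eq hγ).symm

/-! ### Infinite chains as limits of finite chains

The two kinds of infinite chains are treated in parallel: `σ = true` for two-sided chains and
`σ = false` for one-sided chains, which are extended to the left by the spacing `a`. -/

/-- Configurations of finite energy. -/
def Dom (z : ℤ → ℝ) : Prop := (∀ j, D.rhc < z j) ∧ Summable fun j => (z j - D.a) ^ 2

/-- The configurations of two-sided chains, respectively one-sided chains. -/
def Conf (σ : Bool) (z : ℤ → ℝ) : Prop := σ = false → ∀ j < 0, z j = D.a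

/-- The energy of an infinite chain. -/
def val (σ : Bool) (z : ℤ → ℝ) : ℝ :=
  D.Phi (fun j => z j - D.a) - if σ then 0 else D.crossDif fun j => z j - D.a

end Model

/-- The left end of the chain with labels in `[-n, n]`, respectively in `[0, n]`. -/
def lo (σ : Bool) (n : ℕ) : ℤ := if σ then -n else 0

namespace Model

variable (D : Model)

/-- The finite chain energies converge to the energy of the infinite chain. -/
lemma tendsto_X_val {σ : Bool} {z : ℤ → ℝ} (hz : D.Dom z) (hc : D.Conf σ z) :
    Tendsto (fun n : ℕ => D.X z (lo σ n) n) atTop (𝓝 (D.val σ z)) := by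
  set γ : Strain ℤ := ⟨fun j => z j - D.a, memℓp_two_iff.2 hz.2⟩ with hγ
  have hγa : ∀ j, γ j = z j - D.a := fun j => rfl
  have hγd : γ ∈ strainDomain D.rhc D.a ℤ := fun j => by
    rw [hγa]; have := hz.1 j; linarith
  have h1 := D.tendsto_X hγd
  have hzγ : (fun l => D.a + γ l) = z := by funext l; rw [hγa]; ring
  rw [hzγ] at h1
  cases σ with
  | true => simpa [lo, val] using h1
  | false =>
    -- The left half is uniform, so its normalized energy tends to 0; splitting at the origin leaves
    -- the interaction across it, which converges to `crossDif + Waa`.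
    have hneg := hc rfl
    have h2 : Tendsto (fun n : ℕ => D.X (fun _ => D.a) (-n) 0) atTop (𝓝 0) := by
      refine D.tendsto_X_const ?_
      rw [tendsto_atTop_atTop]
      exact fun N => ⟨N.natAbs, fun n hn => by omega⟩
    have h3 : HasSum (fun q : ℕ × ℕ => D.blk z (-1 - q.1) (1 + q.2))
        (D.crossDif (fun j => z j - D.a) + D.Waa) := by
      have hs := Summable.of_norm_bounded (D.summable_c.mul_left 2) fun q =>
        D.abs_crossDif_term_le (γ := γ) (fun l => by
          rw [hγa]; have := hz.1 l; linarith) q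
      have := hs.hasSum.add D.summable_Waa.hasSum
      rw [hzγ] at this
      simp only [sub_add_cancel] at this
      unfold crossDif
      have e : (fun l => D.a + (z l - D.a)) = z := by funext l; ring
      rw [e]
      exact this
    have h4 : Tendsto (fun n : ℕ => crossSum (D.blk z) (-n) 0 n) atTop
        (𝓝 (D.crossDif (fun j => z j - D.a) + D.Waa)) := by
      have hT : Tendsto (fun n : ℕ => Finset.range n ×ˢ Finset.range n) atTop atTop := by
        refine tendsto_atTop_finset_of_monotone ?_ fun q => ⟨q.1 + q.2 + 1, ?_⟩
        · intro n n' hn q hq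
          simp only [Finset.mem_product, Finset.mem_range] at *
          omega
        · simp only [Finset.mem_product, Finset.mem_range]
          omega
      refine ((tendsto_finset_sum h3).comp hT).congr fun n => ?_
      rw [crossSum_eq]
      simp
    have h5 := (h1.sub h2).sub (h4.sub_const D.Waa)
    have h6 : D.Phi γ - 0 - (D.crossDif (fun j => z j - D.a) + D.Waa - D.Waa) = D.val false z := by
      simp only [val, Bool.false_eq_true, if_false]
      have : (γ : ℤ → ℝ) = fun j => z j - D.a := rfl
      rw [this]
      ring
    rw [h6] at h5
    refine h5.congr fun n => ?_
    have e1 := D.X_split z (b := -n) (t := 0) (e := n) (by omega) (by omega)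
    have e2 : D.X z (-n) 0 = D.X (fun _ => D.a) (-n) 0 := D.X_congr fun l _ hl => hneg l hl
    simp only [lo, Bool.false_eq_true, if_false]
    linarith

end Model

namespace Model

variable (D : Model)

/-! ### Lower semicontinuity of the energy of infinite chains -/

/-- All spacings with labels in `[i, j)` are within `ε` of the ground state spacing. -/
def Near (ε : ℝ) (z : ℤ → ℝ) (i j : ℤ) : Prop := ∀ l, i ≤ l → l < j → |z l - D.a| ≤ ε

/-- The spacings near the ends of `[s, t)` are within `ε` of the ground state spacing; only the
right end is considered for one-sided chains. -/
def Stretch (σ : Bool) (M : ℤ) (ε : ℝ) (z : ℤ → ℝ) (s t : ℤ) : Prop :=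
  D.Near ε z (t - M) (t + M) ∧ (σ = true → D.Near ε z (s - M) (s + M))

/-- The position of the cuts `s < t` in a chain with labels in `[b, e]`. -/
def Cuts (σ : Bool) (M b s t e : ℤ) : Prop :=
  (if σ then b + M ≤ s else b = s) ∧ s + M ≤ t ∧ t + M ≤ e

variable {D}

lemma Near.mono {ε : ℝ} {z : ℤ → ℝ} {i j i' j' : ℤ} (h : D.Near ε z i j) (hi : i ≤ i')
    (hj : j' ≤ j) : D.Near ε z i' j' := fun l h1 h2 => h l (hi.trans h1) (h2.trans_le hj)

lemma Good.one_le {M : ℤ} {ε η : ℝ} (hG : D.Good M ε η) : 1 ≤ M := hG.1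

lemma Good.eta_nonneg {M : ℤ} {ε η : ℝ} (hG : D.Good M ε η) : 0 ≤ η :=
  (abs_nonneg _).trans (hG.2.2.2 (fun _ => D.a) (-M) 0 M (by omega) (by omega)
    (fun _ _ _ => D.rhc_lt_a.le) fun _ _ _ => by simpa using hG.2.1.le)

lemma Cuts.le {σ : Bool} {M b s t e : ℤ} (hM : 1 ≤ M) (h : Cuts σ M b s t e) :
    b ≤ s ∧ s ≤ t ∧ t ≤ e := by
  obtain ⟨h1, h2, h3⟩ := h
  cases σ <;> simp at h1 <;> omega

/-- The energy decouples at stretches. -/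
lemma Good.abs_split_le {σ : Bool} {M : ℤ} {ε η : ℝ} (hG : D.Good M ε η) {z : ℤ → ℝ}
    {b s t e : ℤ} (hc : Cuts σ M b s t e) (hz : ∀ l, b ≤ l → l < e → D.rhc ≤ z l)
    (h : D.Stretch σ M ε z s t) :
    |D.X z b e - (D.X z s t + D.X z t e + if σ then D.X z b s else 0)| ≤ 2 * η := by
  have hM := hG.one_le
  have hle := hc.le hM
  obtain ⟨hbs, hst, hte⟩ := hc
  have h1 := D.X_split z (b := b) (t := t) (e := e) (by omega) (by omega)
  have h2 := D.X_split z (b := b) (t := s) (e := t) (by omega) (by omega)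
  have h3 := hG.2.2.2 z b t e (by omega) hte hz h.1
  have hη := hG.eta_nonneg
  cases σ with
  | false =>
    simp only [Bool.false_eq_true, if_false] at hbs ⊢
    subst hbs
    rw [show D.X z b e - (D.X z b t + D.X z t e + 0) = crossSum (D.blk z) b t e - D.Waa by
      linarith]
    linarith
  | true =>
    simp only [if_true] at hbs ⊢
    have h4 := hG.2.2.2 z b s t hbs hst (fun l hl hl' => hz l hl (by omega)) (h.2 rfl)
    rw [show D.X z b e - (D.X z s t + D.X z t e + D.X z b s) =
      (crossSum (D.blk z) b s t - D.Waa) + (crossSum (D.blk z) b t e - D.Waa) by linarith]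
    exact (abs_add_le _ _).trans (by linarith)

variable (D)

lemma eventually_near {z : ℤ → ℝ} (hz : Summable fun j => (z j - D.a) ^ 2) {ε : ℝ} (hε : 0 < ε) :
    ∃ T : ℕ, ∀ l : ℤ, T ≤ |l| → |z l - D.a| ≤ ε := by
  have h1 := tendsto_cofinite_zero (f := fun j => z j - D.a) hz
  have h2 := (h1.abs).eventually_le_const (u := ε) (by simpa using hε)
  have h3 : {l : ℤ | ¬ |z l - D.a| ≤ ε}.Finite := h2
  obtain ⟨T, hT⟩ := (h3.image fun l => l.natAbs).bddAbove
  refine ⟨T + 1, fun l hl => ?_⟩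
  by_contra hc
  have : l.natAbs ≤ T := hT ⟨l, hc, rfl⟩
  rw [Int.abs_eq_natAbs] at hl
  omega

lemma lo_le (σ : Bool) (n : ℕ) : lo σ n ≤ 0 := by
  cases σ <;> simp [lo]

/-- The position of the cuts of an infinite chain. -/
lemma eventually_cuts {σ : Bool} {M s t : ℤ} (hs : σ = false → s = 0) (hst : s + M ≤ t) :
    ∀ᶠ n : ℕ in atTop, Cuts σ M (lo σ n) s t n := by
  filter_upwards [eventually_ge_atTop (s.natAbs + t.natAbs + M.natAbs)] with n hn
  refine ⟨?_, hst, by omega⟩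
  cases σ
  · simp [lo, hs rfl]
  · simp only [lo, if_true]; omega

variable {D}

/-- Cutting an infinite chain at stretches does not raise the energy. -/
lemma Good.X_le_val {σ : Bool} {M : ℤ} {ε η : ℝ} (hG : D.Good M ε η) {z : ℤ → ℝ} (hz : D.Dom z)
    (hc : D.Conf σ z) {s t : ℤ} (hs : σ = false → s = 0) (hst : s + M ≤ t)
    (h : D.Stretch σ M ε z s t) : D.X z s t ≤ D.val σ z + 4 * η := by
  have hM := hG.one_le
  have hη := hG.eta_nonneg
  obtain ⟨T, hT⟩ := D.eventually_near hz.2 hG.2.1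
  -- The junctions cost at most `2 * η`, and each discarded outer part has near ground state ends,
  -- so its energy is at least `-η`.
  have h1 : ∀ᶠ n : ℕ in atTop, D.X z s t ≤ D.X z (lo σ n) n + 4 * η := by
    filter_upwards [eventually_cuts (M := M) hs hst,
      eventually_ge_atTop (T + M.natAbs + s.natAbs + t.natAbs)] with n hn hnT
    have h2 := hG.abs_split_le hn (fun l _ _ => (hz.1 l).le) h
    have h3 : -η ≤ D.X z t n := hG.neg_le_X hn.2.2 (fun l _ _ => hz.1 l)
      (h.1.mono (by omega) le_rfl) fun l hl _ => hT l (by rw [le_abs]; omega)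
    have h4 := (abs_le.1 h2).1
    cases σ with
    | false =>
      simp only [Bool.false_eq_true, if_false] at h4
      linarith
    | true =>
      have h5 : -η ≤ D.X z (-n) s := hG.neg_le_X (by simpa [Cuts, lo] using hn.1)
        (fun l _ _ => hz.1 l) (fun l _ hl => hT l (by rw [le_abs]; omega))
        ((h.2 rfl).mono le_rfl (by omega))
      simp only [if_true, lo] at h4 ⊢
      linarith
  exact ge_of_tendsto ((D.tendsto_X_val hz hc).add_const _) h1

variable (D)

lemma continuous_len (i j : ℤ) : Continuous fun z : ℤ → ℝ => len z i j :=
  continuous_finsetSum _ fun l _ => continuous_apply l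

lemma continuousAt_blk {z : ℤ → ℝ} {i j : ℤ} (hij : i < j)
    (hz : ∀ l, i ≤ l → l < j → D.rhc < z l) : ContinuousAt (fun y => D.blk y i j) z := by
  unfold blk phi
  split_ifs
  · refine ContinuousAt.comp (f := fun y => len y i j) (D.continuousAt_v ?_)
      (continuous_len i j).continuousAt
    rw [len_add (by omega : i ≤ i + 1) (by omega), len_succ]
    have h1 := hz i le_rfl hij
    have h2 : 0 ≤ len z (i + 1) j := Finset.sum_nonneg fun l hl => by
      rw [Finset.mem_Ico] at hl
      exact (D.hrhc.trans (hz l (by omega) hl.2)).le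
    linarith
  · exact continuousAt_const

lemma continuousAt_E {z : ℤ → ℝ} {b e : ℤ} (hz : ∀ l, b ≤ l → l < e → D.rhc < z l) :
    ContinuousAt (fun y => D.E y b e) z := by
  refine ContinuousAt.add ?_ ((continuous_len b e).const_mul _ |>.continuousAt)
  refine tendsto_finsetSum _ fun i hi => tendsto_finsetSum _ fun j hj => ?_
  rw [Finset.mem_Ico] at hi
  rw [Finset.mem_Ioc] at hj
  exact D.continuousAt_blk hj.1 fun l hl hl' => hz l (hi.1.trans hl) (hl'.trans_le hj.2)

lemma continuousAt_X {z : ℤ → ℝ} {b e : ℤ} (hz : ∀ l, b ≤ l → l < e → D.rhc < z l) :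
    ContinuousAt (fun y => D.X y b e) z :=
  ((D.continuousAt_E hz).sub continuousAt_const).add continuousAt_const

lemma continuous_theta : Continuous D.theta := by
  unfold theta
  fun_prop

lemma summable_of_theta {ι : Type*} {f : ι → ℝ} (h : Summable fun i => D.theta (f i)) :
    Summable fun i => (f i - D.a) ^ 2 := by
  have h1 := h.tendsto_cofinite_zero.eventually_lt_const (u := 1) one_pos
  refine (summable_congr_cofinite ?_).1 h
  filter_upwards [h1] with i hi
  unfold theta at *
  rcases le_total ((f i - D.a) ^ 2) 1 with h2 | h2
  · exact min_eq_left h2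
  · rw [min_eq_right h2] at hi
    exact absurd hi (lt_irrefl _)

lemma le_val {σ : Bool} {y : ℤ → ℝ} (hy : D.Dom y) (hc : D.Conf σ y) (T : ℕ) :
    D.Waa + D.kappa * ∑ l ∈ Finset.Ico (lo σ T) T, D.theta (y l) ≤ D.val σ y := by
  refine ge_of_tendsto (D.tendsto_X_val hy hc) ?_
  filter_upwards [eventually_ge_atTop T] with n hn
  refine le_trans ?_ (D.X_ge (by have := lo_le σ n; omega) fun l _ _ => hy.1 l)
  have := D.kappa_pos
  have hsub : Finset.Ico (lo σ T) (T : ℤ) ⊆ Finset.Ico (lo σ n) n := by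
    intro l hl
    rw [Finset.mem_Ico] at hl ⊢
    cases σ <;> simp [lo] at hl ⊢ <;> omega
  have := Finset.sum_le_sum_of_subset_of_nonneg hsub fun l _ _ => D.theta_nonneg (y l)
  nlinarith

lemma Waa_le_val {σ : Bool} {y : ℤ → ℝ} (hy : D.Dom y) (hc : D.Conf σ y) : D.Waa ≤ D.val σ y := by
  refine le_trans ?_ (D.le_val hy hc 0)
  have := mul_nonneg D.kappa_pos.le (Finset.sum_nonneg (s := Finset.Ico (lo σ 0) (0 : ℕ))
    fun l _ => D.theta_nonneg (y l))
  linarith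

/-- Cut on both sides of the site: each cut changes the energy by at most `K`, up to `Waa`, and the
outer pieces have normalized energy at least `Waa`. The bound makes the energy blow up as a spacing
approaches the hard core. -/
lemma site_le_val {σ : Bool} {y : ℤ → ℝ} (hy : D.Dom y) (hc : D.Conf σ y) {j : ℤ}
    (hj : σ = false → 0 ≤ j) :
    D.v (y j) + D.p * y j - D.e₀ + D.Waa - 2 * D.K ≤ D.val σ y := by
  refine ge_of_tendsto (D.tendsto_X_val hy hc) ?_
  filter_upwards [eventually_ge_atTop (j.natAbs + 1)] with n hn
  have hjn : lo σ n ≤ j := by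
    cases σ
    · exact hj rfl
    · simp only [lo, if_true]; omega
  have h1 := D.X_split y (b := lo σ n) (t := j) (e := n) hjn (by omega)
  have h2 := D.X_split y (b := j) (t := j + 1) (e := n) (by omega) (by omega)
  have h3 := (abs_le.1 (D.abs_crossSum_blk_le (z := y) (b := lo σ n) (t := j) (e := n)
    fun l _ _ => (hy.1 l).le)).1
  have h4 := (abs_le.1 (D.abs_crossSum_blk_le (z := y) (b := j) (t := j + 1) (e := n)
    fun l _ _ => (hy.1 l).le)).1
  have h5 := D.X_ge (z := y) (b := lo σ n) (e := j) hjn fun l _ _ => hy.1 l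
  have h6 := D.X_ge (z := y) (b := j + 1) (e := n) (by omega) fun l _ _ => hy.1 l
  have h7 : ∀ b e, 0 ≤ D.kappa * ∑ l ∈ Finset.Ico b e, D.theta (y l) := fun b e =>
    mul_nonneg D.kappa_pos.le (Finset.sum_nonneg fun l _ => D.theta_nonneg (y l))
  have h8 := h7 (lo σ n) j
  have h9 := h7 (j + 1) n
  have h10 : D.X y j (j + 1) = D.v (y j) + D.p * y j - D.e₀ + D.Waa := by
    unfold X
    rw [E_eq_sum_add, show Finset.Ico j (j + 1) = {j} by ext; simp; omega]
    have : pairSum (D.far y) j (j + 1) = 0 := by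
      refine Finset.sum_eq_zero fun i hi => Finset.sum_eq_zero fun k hk => ?_
      rw [Finset.mem_Ico] at hi
      rw [Finset.mem_Ioc] at hk
      unfold far
      rw [if_neg (by omega)]
    rw [this]
    simp
  linarith

/-- The energy of infinite chains, set to `+∞` outside `Dom`, is lower semicontinuous. -/
lemma eventually_lt_val {σ : Bool} {z : ℤ → ℝ} (hc : D.Conf σ z) {c : ℝ}
    (h : D.Dom z → c < D.val σ z) :
    ∀ᶠ y in 𝓝 z, D.Dom y → D.Conf σ y → c < D.val σ y := by
  by_cases h1 : ∀ j, D.rhc < z j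
  · by_cases h2 : Summable fun j => (z j - D.a) ^ 2
    -- Finite energy: a long finite piece carries the energy of `z` up to `η` and depends
    -- continuously on the spacings. It ends near the ground state for all `y` close to `z`, so
    -- cutting `y` there gains at most `4 * η`.
    · have hd : D.Dom z := ⟨h1, h2⟩
      have hlt := h hd
      set η := (D.val σ z - c) / 8 with hη
      have hη0 : 0 < η := by rw [hη]; linarith
      obtain ⟨M, ε, hG⟩ := D.exists_good hη0
      have hM := hG.one_le
      obtain ⟨T, hT⟩ := D.eventually_near h2 (half_pos hG.2.1)
      obtain ⟨t, ht, htT⟩ := (((D.tendsto_X_val hd hc).eventually_const_lt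
        (show D.val σ z - η < D.val σ z by linarith)).and
          (eventually_ge_atTop (T + M.natAbs))).exists
      have h3 := (D.continuousAt_X (b := lo σ t) (e := t) fun l _ _ => h1 l).eventually_const_lt ht
      have h4 : ∀ᶠ y in 𝓝 z, ∀ l ∈ Finset.Icc (-(t : ℤ) - M) (t + M), |y l - z l| < ε / 2 := by
        rw [Filter.eventually_all_finset]
        intro l _
        have : ContinuousAt (fun y : ℤ → ℝ => |y l - z l|) z :=
          ((continuous_apply l).sub continuous_const).abs.continuousAt
        exact this.eventually_lt_const (by simpa using half_pos hG.2.1)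
      filter_upwards [h3, h4] with y hy3 hy4 hyd hyc
      have h5 : ∀ l : ℤ, T ≤ |l| → -(t : ℤ) - M ≤ l → l ≤ t + M → |y l - D.a| ≤ ε := by
        intro l hl hl1 hl2
        have e1 := hT l hl
        have e2 := hy4 l (Finset.mem_Icc.2 ⟨hl1, hl2⟩)
        have e3 := abs_sub_le (y l) (z l) D.a
        linarith
      have h6 := hG.X_le_val hyd hyc (s := lo σ t) (t := t) (fun hσ => by simp [hσ, lo])
        (by have := lo_le σ t; omega)
        ⟨fun l hl hl' => h5 l (by rw [le_abs]; omega) (by omega) (by omega), fun hσ l hl hl' => by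
          simp only [hσ, lo, if_true] at hl hl'
          exact h5 l (by rw [le_abs]; omega) (by omega) (by omega)⟩
      linarith
    -- Strain not square summable: the coercive sum over a suitable finite window exceeds any bound,
    -- and continues to do so near `z`.
    · have h3 : ¬ Summable fun j => D.theta (z j) := fun hs => h2 (D.summable_of_theta hs)
      have h4 : ∃ T : ℕ, (c + 1 - D.Waa) / D.kappa <
          ∑ l ∈ Finset.Ico (lo σ T) (T : ℤ), D.theta (z l) := by
        by_contra hcon
        push Not at hcon
        refine h3 (summable_of_sum_le (fun j => D.theta_nonneg _)
          (c := (c + 1 - D.Waa) / D.kappa) fun u => ?_)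
        obtain ⟨T, hT⟩ := (u.image fun l => l.natAbs).bddAbove
        refine le_trans ?_ (hcon (T + 1))
        have hsplit : ∑ l ∈ u, D.theta (z l) =
            ∑ l ∈ u.filter (fun l => σ = false → 0 ≤ l), D.theta (z l) := by
          refine (Finset.sum_filter_of_ne fun l _ hl hσ => ?_).symm
          by_contra hneg
          rw [hc hσ l (by omega)] at hl
          simp [theta] at hl
        rw [hsplit]
        refine Finset.sum_le_sum_of_subset_of_nonneg (fun l hl => ?_)
          fun l _ _ => D.theta_nonneg _
        rw [Finset.mem_filter] at hl
        have h5 : l.natAbs ≤ T := hT (Finset.mem_coe.2 (Finset.mem_image_of_mem _ hl.1))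
        rw [Finset.mem_Ico]
        cases σ
        · have := hl.2 rfl
          simp only [lo, Bool.false_eq_true, if_false]
          push_cast
          omega
        · simp only [lo, if_true]
          push_cast
          omega
      obtain ⟨T, hT⟩ := h4
      have h5 : Continuous fun y : ℤ → ℝ => ∑ l ∈ Finset.Ico (lo σ T) (T : ℤ), D.theta (y l) :=
        continuous_finsetSum _ fun l _ => D.continuous_theta.comp (continuous_apply l)
      filter_upwards [h5.continuousAt.eventually_const_lt hT] with y hy hyd hyc
      have h6 := D.le_val hyd hyc T
      rw [div_lt_iff₀ D.kappa_pos] at hy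
      linarith
  -- A spacing of `z` is at most `rhc`: every admissible `y` near `z` has this spacing just above
  -- `rhc`, where `v` is arbitrarily large.
  · push Not at h1
    obtain ⟨j, hj⟩ := h1
    have hjσ : σ = false → 0 ≤ j := by
      intro hσ
      by_contra hneg
      rw [hc hσ j (by omega)] at hj
      exact absurd hj (not_le.2 D.rhc_lt_a)
    have h2 := D.hcore.eventually_gt_atTop (c + 1 + D.e₀ - D.Waa + 2 * D.K)
    rw [eventually_nhdsWithin_iff, Metric.eventually_nhds_iff] at h2
    obtain ⟨δ, hδ, h2⟩ := h2
    have h3 : ∀ᶠ y in 𝓝 z, y j < z j + δ :=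
      (continuous_apply j).continuousAt.eventually_lt_const (by linarith)
    filter_upwards [h3] with y hy hyd hyc
    have h4 := hyd.1 j
    have h5 := h2 (y := y j) (by rw [Real.dist_eq, abs_of_pos (by linarith)]; linarith) h4
    have h6 := D.site_le_val hyd hyc hjσ
    have h7 : 0 < D.p * y j := mul_pos D.hp (D.hrhc.trans h4)
    linarith

/-- Cutting a chain at a stretch and continuing it by the ground state. -/
def cut (z : ℤ → ℝ) (s t : ℤ) (l : ℤ) : ℝ := if s ≤ l ∧ l < t then z l else D.a

lemma dom_cut {z : ℤ → ℝ} {s t : ℤ} (hz : ∀ l, s ≤ l → l < t → D.rhc < z l) :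
    D.Dom (D.cut z s t) := by
  constructor
  · intro j
    unfold cut
    split_ifs with h
    · exact hz j h.1 h.2
    · exact D.rhc_lt_a
  · refine summable_of_hasFiniteSupport ((Finset.finite_toSet (Finset.Ico s t)).subset fun l hl => ?_)
    by_contra hc
    refine hl ?_
    rw [Finset.mem_coe, Finset.mem_Ico] at hc
    simp [cut, hc]

lemma conf_cut {σ : Bool} (z : ℤ → ℝ) {s t : ℤ} (hs : σ = false → s = 0) :
    D.Conf σ (D.cut z s t) := by
  intro hσ j hj
  unfold cut
  rw [if_neg (by have := hs hσ; omega)]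

variable {D}

/-- The continuation of the cut chain is uniform and contributes nothing in the limit, so only the
errors at the junctions remain. -/
lemma Good.val_cut_le {σ : Bool} {M : ℤ} {ε η : ℝ} (hG : D.Good M ε η) {z : ℤ → ℝ} {s t : ℤ}
    (hz : ∀ l, s ≤ l → l < t → D.rhc < z l) (hs : σ = false → s = 0) (hst : s + M ≤ t)
    (h1 : D.Near ε z (t - M) t) (h2 : σ = true → D.Near ε z s (s + M)) :
    D.val σ (D.cut z s t) ≤ D.X z s t + 2 * η := by
  have hM := hG.one_le
  set y := D.cut z s t with hy
  have hin : ∀ l, s ≤ l → l < t → y l = z l := fun l hl hl' => if_pos ⟨hl, hl'⟩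
  have hout : ∀ l, ¬ (s ≤ l ∧ l < t) → y l = D.a := fun l hl => if_neg hl
  have hd := D.dom_cut hz
  rw [← hy] at hd
  have hstr : D.Stretch σ M ε y s t := by
    have ha : |D.a - D.a| ≤ ε := by simpa using hG.2.1.le
    refine ⟨fun l hl hl' => ?_, fun hσ l hl hl' => ?_⟩
    · by_cases h : l < t
      · rw [hin l (by omega) h]; exact h1 l hl h
      · rw [hout l (by omega)]; exact ha
    · by_cases h : s ≤ l
      · rw [hin l h (by omega)]; exact h2 hσ l h hl'
      · rw [hout l (by omega)]; exact ha
  have hlim1 : Tendsto (fun n : ℕ => D.X (fun _ => D.a) t n) atTop (𝓝 0) := by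
    refine D.tendsto_X_const ?_
    rw [tendsto_atTop_atTop]
    exact fun N => ⟨N.natAbs + t.natAbs, fun n hn => by omega⟩
  have hlim2 : Tendsto (fun n : ℕ => if σ then D.X (fun _ => D.a) (lo σ n) s else 0) atTop
      (𝓝 0) := by
    cases σ
    · simp
    · simp only [if_true, lo]
      refine D.tendsto_X_const ?_
      rw [tendsto_atTop_atTop]
      exact fun N => ⟨N.natAbs + s.natAbs, fun n hn => by omega⟩
  have hlim := ((hlim1.const_add (D.X z s t)).add hlim2).add_const (2 * η)
  rw [add_zero, add_zero] at hlim
  refine le_of_tendsto_of_tendsto (D.tendsto_X_val hd (D.conf_cut z hs)) hlim ?_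
  filter_upwards [eventually_cuts (M := M) hs hst] with n hn
  have h3 := (abs_le.1 (hG.abs_split_le hn (fun l _ _ => (hd.1 l).le) hstr)).2
  rw [D.X_congr hin, D.X_congr (y := fun _ => D.a) fun l (hl : t ≤ l) (_ : l < n) =>
    hout l (by omega), D.X_congr (b := lo σ n) (e := s) (y := fun _ => D.a) fun l _ hl =>
    hout l (by omega)] at h3
  linarith

variable (D)

/-- The minimal energy of an infinite chain. -/
def base (σ : Bool) : ℝ := sInf (D.val σ '' {z | D.Dom z ∧ D.Conf σ z})

lemma dom_a : D.Dom fun _ => D.a := ⟨fun _ => D.rhc_lt_a, by simp⟩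

lemma base_le {σ : Bool} {z : ℤ → ℝ} (hz : D.Dom z) (hc : D.Conf σ z) : D.base σ ≤ D.val σ z := by
  refine csInf_le ⟨D.Waa, ?_⟩ ⟨z, ⟨hz, hc⟩, rfl⟩
  rintro _ ⟨y, ⟨hy, hyc⟩, rfl⟩
  exact D.Waa_le_val hy hyc

lemma exists_val_lt (σ : Bool) {δ : ℝ} (hδ : 0 < δ) :
    ∃ z, D.Dom z ∧ D.Conf σ z ∧ D.val σ z < D.base σ + δ := by
  have hne : (D.val σ '' {z | D.Dom z ∧ D.Conf σ z}).Nonempty :=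
    ⟨_, _, ⟨D.dom_a, fun _ _ _ => rfl⟩, rfl⟩
  obtain ⟨_, ⟨z, ⟨hz, hc⟩, rfl⟩, h⟩ := exists_lt_of_csInf_lt hne
    (show sInf (D.val σ '' {z | D.Dom z ∧ D.Conf σ z}) < D.base σ + δ by
      change D.base σ < _; linarith)
  exact ⟨z, hz, hc, h⟩

/-- Far out, a two-sided chain of finite energy is near the ground state at both ends, so
`Good.neg_le_X` applies with every `η`. -/
lemma val_bulk_nonneg {z : ℤ → ℝ} (hz : D.Dom z) : 0 ≤ D.val true z := by
  refine le_of_forall_pos_le_add fun η hη => ?_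
  obtain ⟨M, ε, hG⟩ := D.exists_good hη
  have hM := hG.one_le
  obtain ⟨T, hT⟩ := D.eventually_near hz.2 hG.2.1
  have h : -η ≤ D.val true z := by
    refine ge_of_tendsto (D.tendsto_X_val hz (fun h => by simp at h)) ?_
    filter_upwards [eventually_ge_atTop (T + M.natAbs)] with n hn
    exact hG.neg_le_X (by simp only [lo, if_true]; omega) (fun l _ _ => hz.1 l)
      (fun l _ hl => hT l (by simp only [lo, if_true] at hl; rw [le_abs]; omega))
      fun l hl _ => hT l (by rw [le_abs]; omega)
  linarith

lemma base_bulk : D.base true = 0 := by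
  refine le_antisymm ?_ ?_
  · refine (D.base_le D.dom_a fun h => by simp at h).trans ?_
    simp [val, Phi, len, rem_zero]
  · refine le_csInf ⟨_, _, ⟨D.dom_a, fun h => by simp at h⟩, rfl⟩ ?_
    rintro _ ⟨y, ⟨hy, -⟩, rfl⟩
    exact D.val_bulk_nonneg hy

end Model

/-! ### Splicing of configurations and tilted product measures -/

section Splice

variable {ι Y : Type}

open Classical in
/-- The configuration which is `ω` on `Λ` and `ζ` outside `Λ`. -/
def spl (Λ : Set ι) (ω ζ : ι → Y) (l : ι) : Y := if l ∈ Λ then ω l else ζ l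

lemma spl_of_mem {Λ : Set ι} {ω ζ : ι → Y} {l : ι} (h : l ∈ Λ) : spl Λ ω ζ l = ω l := if_pos h

lemma spl_of_notMem {Λ : Set ι} {ω ζ : ι → Y} {l : ι} (h : l ∉ Λ) : spl Λ ω ζ l = ζ l := if_neg h

lemma spl_univ (ω ζ : ι → Y) : spl univ ω ζ = ω := funext fun _ => spl_of_mem (mem_univ _)

lemma spl_spl {Λ Λ' : Set ι} (h : Λ ⊆ Λ') (ω₁ ω₂ ζ : ι → Y) :
    spl Λ' (spl Λ ω₁ ω₂) ζ = spl Λ ω₁ (spl Λ' ω₂ ζ) := by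
  funext l
  by_cases h1 : l ∈ Λ
  · rw [spl_of_mem (h h1), spl_of_mem h1, spl_of_mem h1]
  · by_cases h2 : l ∈ Λ'
    · rw [spl_of_mem h2, spl_of_notMem h1, spl_of_notMem h1, spl_of_mem h2]
    · rw [spl_of_notMem h2, spl_of_notMem h1, spl_of_notMem h2]

lemma spl_spl_self (Λ : Set ι) (ω₁ ω₂ ζ : ι → Y) : spl Λ ω₁ (spl Λ ω₂ ζ) = spl Λ ω₁ ζ := by
  funext l
  by_cases h1 : l ∈ Λ
  · rw [spl_of_mem h1, spl_of_mem h1]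
  · rw [spl_of_notMem h1, spl_of_notMem h1, spl_of_notMem h1]

variable [MeasurableSpace Y]

lemma measurable_spl (Λ : Set ι) : Measurable fun q : (ι → Y) × (ι → Y) => spl Λ q.1 q.2 := by
  rw [measurable_pi_iff]
  intro l
  unfold spl
  split_ifs
  · exact (measurable_pi_apply l).comp measurable_fst
  · exact (measurable_pi_apply l).comp measurable_snd

lemma measurable_spl_left (Λ : Set ι) (ζ : ι → Y) : Measurable fun ω => spl Λ ω ζ :=
  (measurable_spl Λ).comp (measurable_id.prodMk measurable_const)

variable (π : Measure Y) [IsProbabilityMeasure π]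

/-- The product measure with all marginals `π`. -/
abbrev prodMeas (ι : Type) {Y : Type} [MeasurableSpace Y] (π : Measure Y) [IsProbabilityMeasure π] :
    Measure (ι → Y) := Measure.infinitePi fun _ : ι => π

lemma measurePreserving_spl (Λ : Set ι) :
    MeasurePreserving (fun q : (ι → Y) × (ι → Y) => spl Λ q.1 q.2)
      ((prodMeas ι π).prod (prodMeas ι π)) (prodMeas ι π) := by
  classical
  refine ⟨measurable_spl Λ, Measure.eq_infinitePi (μ := fun _ : ι => π) fun s t ht => ?_⟩
  have hpre : (fun q : (ι → Y) × (ι → Y) => spl Λ q.1 q.2) ⁻¹' (Set.pi s t) =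
      (Set.pi (s.filter (· ∈ Λ) : Finset ι) t) ×ˢ (Set.pi (s.filter (· ∉ Λ) : Finset ι) t) := by
    ext q
    simp only [mem_preimage, Set.mem_pi, mem_prod, Finset.coe_filter, Set.mem_ofPred_eq,
      Finset.mem_coe]
    constructor
    · intro h
      exact ⟨fun i hi => by have := h i hi.1; rwa [spl_of_mem hi.2] at this,
        fun i hi => by have := h i hi.1; rwa [spl_of_notMem hi.2] at this⟩
    · rintro ⟨h1, h2⟩ i hi
      by_cases hΛ : i ∈ Λ
      · rw [spl_of_mem hΛ]; exact h1 i ⟨hi, hΛ⟩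
      · rw [spl_of_notMem hΛ]; exact h2 i ⟨hi, hΛ⟩
  rw [Measure.map_apply (measurable_spl Λ) (.pi s.countable_toSet fun i _ => ht i), hpre,
    Measure.prod_prod, Measure.infinitePi_pi _ fun i _ => ht i,
    Measure.infinitePi_pi _ fun i _ => ht i, Finset.prod_filter_mul_prod_filter_not]

lemma lintegral_spl (Λ : Set ι) {F : (ι → Y) → ℝ≥0∞} (hF : Measurable F) :
    ∫⁻ ω, F ω ∂(prodMeas ι π) = ∫⁻ ζ, ∫⁻ ω, F (spl Λ ω ζ) ∂(prodMeas ι π) ∂(prodMeas ι π) := by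
  rw [← (measurePreserving_spl π Λ).lintegral_comp hF]
  exact lintegral_prod_symm _ (hF.comp (measurable_spl Λ)).aemeasurable

/-- Functions of disjoint sets of coordinates are independent. -/
lemma lintegral_mul_of_dependsOn {Λ : Set ι} {F G : (ι → Y) → ℝ≥0∞} (hF : Measurable F)
    (hG : Measurable G) (hFd : DependsOn F Λ) (hGd : DependsOn G Λᶜ) :
    ∫⁻ ω, F ω * G ω ∂(prodMeas ι π) =
      (∫⁻ ω, F ω ∂(prodMeas ι π)) * ∫⁻ ω, G ω ∂(prodMeas ι π) := by
  rw [lintegral_spl π Λ (F := fun ω => F ω * G ω) (hF.mul hG)]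
  have h1 : ∀ ω ζ, F (spl Λ ω ζ) = F ω := fun ω ζ => hFd fun i hi => spl_of_mem hi
  have h2 : ∀ ω ζ, G (spl Λ ω ζ) = G ζ := fun ω ζ => hGd fun i hi => spl_of_notMem hi
  simp only [h1, h2]
  have h3 : ∀ ζ, ∫⁻ ω, F ω * G ζ ∂(prodMeas ι π) = (∫⁻ ω, F ω ∂(prodMeas ι π)) * G ζ :=
    fun ζ => lintegral_mul_const _ hF
  simp only [h3]
  exact lintegral_const_mul _ hG

end Splice

/-- Bounded measurable functions. -/
def Bdd {Ω : Type} [MeasurableSpace Ω] (F : Ω → ℝ) : Prop := Measurable F ∧ ∃ C, ∀ ω, |F ω| ≤ C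

/-! ### Expectations under exponentially tilted measures. -/

section Bdd

variable {Ω Ω' : Type} [MeasurableSpace Ω] [MeasurableSpace Ω'] {F G : Ω → ℝ}

lemma Bdd.integrable (hF : Bdd F) (P : Measure Ω) [IsFiniteMeasure P] : Integrable F P := by
  obtain ⟨h, C, hC⟩ := hF
  exact Integrable.of_bound h.aestronglyMeasurable C (ae_of_all _ hC)

lemma Bdd.mul (hF : Bdd F) (hG : Bdd G) : Bdd fun ω => F ω * G ω := by
  obtain ⟨h, C, hC⟩ := hF
  obtain ⟨h', C', hC'⟩ := hG
  refine ⟨h.mul h', C * C', fun ω => ?_⟩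
  rw [abs_mul]
  exact mul_le_mul (hC ω) (hC' ω) (abs_nonneg _) ((abs_nonneg _).trans (hC ω))

lemma Bdd.comp (hF : Bdd F) {u : Ω' → Ω} (hu : Measurable u) : Bdd fun ω => F (u ω) :=
  ⟨hF.1.comp hu, hF.2.imp fun _ h ω => h (u ω)⟩

lemma Bdd.exp_neg (hF : Bdd F) : Bdd fun ω => Real.exp (-F ω) := by
  obtain ⟨h, C, hC⟩ := hF
  refine ⟨Real.measurable_exp.comp h.neg, Real.exp C, fun ω => ?_⟩
  rw [abs_of_pos (Real.exp_pos _), Real.exp_le_exp]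
  linarith [(abs_le.1 (hC ω)).1]

lemma Bdd.integral_exp_pos (hF : Bdd F) (P : Measure Ω) [IsProbabilityMeasure P] :
    0 < ∫ ω, Real.exp (-F ω) ∂P :=
  MeasureTheory.integral_exp_pos (hF.exp_neg.integrable P)

/-- Comparison of tilted expectations. -/
lemma tilted_sub_le (P : Measure Ω) [IsProbabilityMeasure P] {h h' g g' : Ω → ℝ} (hh : Bdd h)
    (hh' : Bdd h') (hg : Bdd g) (hg' : Bdd g') {d A ε r : ℝ}
    (hA : ∀ ω, |h ω - h' ω - d| ≤ A) (hε : ∀ ω, g ω ≤ g' ω + ε)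
    (hr : ∀ ω ω', g' ω ≤ g' ω' + r) :
    (∫ ω, g ω * Real.exp (-h ω) ∂P) / (∫ ω, Real.exp (-h ω) ∂P) -
      (∫ ω, g' ω * Real.exp (-h' ω) ∂P) / (∫ ω, Real.exp (-h' ω) ∂P) ≤
      ε + (1 - Real.exp (-(2 * A))) * r := by
  set Z := ∫ ω, Real.exp (-h ω) ∂P with hZ
  set Z' := ∫ ω, Real.exp (-h' ω) ∂P with hZ'
  have hZ0 : 0 < Z := hh.integral_exp_pos P
  have hZ0' : 0 < Z' := hh'.integral_exp_pos P
  have : Nonempty Ω := nonempty_of_isProbabilityMeasure P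
  obtain ⟨C, hC⟩ := hg'.2
  have hbdd : BddBelow (range g') := ⟨-C, by rintro _ ⟨ω, rfl⟩; exact (abs_le.1 (hC ω)).1⟩
  set m := sInf (range g') with hm
  have hm1 : ∀ ω, m ≤ g' ω := fun ω => csInf_le hbdd ⟨ω, rfl⟩
  have hm2 : ∀ ω, g' ω ≤ m + r := by
    intro ω
    have : g' ω - r ≤ m := le_csInf (range_nonempty _) (by
      rintro _ ⟨ω', rfl⟩
      linarith [hr ω ω'])
    linarith
  have hr0 : 0 ≤ r := by
    have := hm1 (Classical.arbitrary Ω)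
    linarith [hm2 (Classical.arbitrary Ω)]
  have hZZ : Z' ≤ Real.exp (A + d) * Z := by
    rw [hZ, hZ', ← integral_const_mul]
    refine integral_mono (hh'.exp_neg.integrable P) ((hh.exp_neg.integrable P).const_mul _)
      fun ω => ?_
    beta_reduce
    rw [← Real.exp_add, Real.exp_le_exp]
    linarith [(abs_le.1 (hA ω)).2]
  -- Minorization of one normalized density by the other, with one factor `exp (-A)` from the
  -- numerators and one from the normalizations. The two measures share mass `exp (-2A)`, and only
  -- the rest sees the oscillation `r`.
  have hq : ∀ ω, Real.exp (-(2 * A)) * (Real.exp (-h ω) / Z) ≤ Real.exp (-h' ω) / Z' := by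
    intro ω
    rw [mul_div_assoc', div_le_div_iff₀ hZ0 hZ0', ← Real.exp_add]
    calc Real.exp (-(2 * A) + -h ω) * Z' ≤ Real.exp (-(2 * A) + -h ω) * (Real.exp (A + d) * Z) :=
          mul_le_mul_of_nonneg_left hZZ (Real.exp_pos _).le
      _ = Real.exp (-(2 * A) + -h ω + (A + d)) * Z := by rw [← mul_assoc, ← Real.exp_add]
      _ ≤ Real.exp (-h' ω) * Z := by
          refine mul_le_mul_of_nonneg_right (Real.exp_le_exp.2 ?_) hZ0.le
          linarith [(abs_le.1 (hA ω)).1]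
  have i1 := (hh.exp_neg.integrable P).div_const Z
  have i2 := (hh'.exp_neg.integrable P).div_const Z'
  have i3 := (hg.mul hh.exp_neg).integrable P |>.div_const Z
  have i4 := (hg'.mul hh'.exp_neg).integrable P |>.div_const Z'
  have s1 : ∫ ω, Real.exp (-h ω) / Z ∂P = 1 := by rw [integral_div, ← hZ, div_self hZ0.ne']
  have s2 : ∫ ω, Real.exp (-h' ω) / Z' ∂P = 1 := by rw [integral_div, ← hZ', div_self hZ0'.ne']
  have hpt : ∀ ω, g ω * Real.exp (-h ω) / Z - g' ω * Real.exp (-h' ω) / Z' ≤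
      (ε + m + (1 - Real.exp (-(2 * A))) * r) * (Real.exp (-h ω) / Z) -
        m * (Real.exp (-h' ω) / Z') := by
    intro ω
    have e1 := hq ω
    have e2 : 0 < Real.exp (-h ω) / Z := div_pos (Real.exp_pos _) hZ0
    have e3 := hm1 ω
    have e4 := hm2 ω
    have e5 := hε ω
    have e6 : 0 ≤ 1 - Real.exp (-(2 * A)) := by
      rw [sub_nonneg, Real.exp_le_one_iff]
      linarith [(abs_nonneg _).trans (hA ω)]
    rw [mul_div_assoc, mul_div_assoc]
    set q := Real.exp (-h ω) / Z
    set q' := Real.exp (-h' ω) / Z'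
    have f1 : (g ω - g' ω) * q ≤ ε * q := mul_le_mul_of_nonneg_right (by linarith) e2.le
    have f2 : (g' ω - m) * (q - q') ≤ (g' ω - m) * ((1 - Real.exp (-(2 * A))) * q) :=
      mul_le_mul_of_nonneg_left (by linarith) (by linarith)
    have f3 : (g' ω - m) * ((1 - Real.exp (-(2 * A))) * q) ≤ r * ((1 - Real.exp (-(2 * A))) * q) :=
      mul_le_mul_of_nonneg_right (by linarith) (mul_nonneg e6 e2.le)
    linarith
  rw [← integral_div, ← integral_div, ← integral_sub i3 i4]
  refine (integral_mono (i3.sub i4) ((i1.const_mul _).sub (i2.const_mul _)) hpt).trans ?_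
  simp only [Pi.sub_apply]
  rw [integral_sub (i1.const_mul _) (i2.const_mul _), integral_const_mul, integral_const_mul,
    s1, s2]
  linarith

end Bdd

/-! ### Contraction of boundary effects in conditional Gibbs expectations. -/

section Gibbs

variable {ι Y : Type} [MeasurableSpace Y] (π : Measure Y) [IsProbabilityMeasure π]

/-- The conditional Gibbs expectation in `Λ` given the configuration `ζ` outside `Λ`. -/
def cav (Λ : Set ι) (H F : (ι → Y) → ℝ) (ζ : ι → Y) : ℝ :=
  (∫ ω, F (spl Λ ω ζ) * Real.exp (-H (spl Λ ω ζ)) ∂(prodMeas ι π)) /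
    ∫ ω, Real.exp (-H (spl Λ ω ζ)) ∂(prodMeas ι π)

/-- The Gibbs expectation. -/
def avg (H F : (ι → Y) → ℝ) : ℝ :=
  (∫ ω, F ω * Real.exp (-H ω) ∂(prodMeas ι π)) / ∫ ω, Real.exp (-H ω) ∂(prodMeas ι π)

variable {H H' F : (ι → Y) → ℝ}

lemma cav_univ (ζ : ι → Y) : cav π univ H F ζ = avg π H F := by simp [cav, avg, spl_univ]

lemma cav_spl (Λ : Set ι) (ω ζ : ι → Y) : cav π Λ H F (spl Λ ω ζ) = cav π Λ H F ζ := by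
  simp only [cav, spl_spl_self]

lemma measurable_integral_spl {G : (ι → Y) → ℝ} (hG : Measurable G) (Λ : Set ι) :
    Measurable fun ζ => ∫ ω, G (spl Λ ω ζ) ∂(prodMeas ι π) :=
  ((hG.comp (measurable_spl Λ)).stronglyMeasurable.integral_prod_left').measurable

lemma cav_mem (hH : Bdd H) (hF : Measurable F) (hF01 : ∀ ω, F ω ∈ Icc (0 : ℝ) 1) (Λ : Set ι)
    (ζ : ι → Y) : cav π Λ H F ζ ∈ Icc (0 : ℝ) 1 := by
  have hm := measurable_spl_left Λ ζ
  have hHs := hH.comp hm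
  have hFb : Bdd F := ⟨hF, 1, fun ω => abs_le.2 ⟨by linarith [(hF01 ω).1], (hF01 ω).2⟩⟩
  have hpos := hHs.integral_exp_pos (prodMeas ι π)
  refine ⟨div_nonneg (integral_nonneg fun ω => mul_nonneg (hF01 _).1 (Real.exp_pos _).le) hpos.le,
    (div_le_one hpos).2 (integral_mono (((hFb.comp hm).mul hHs.exp_neg).integrable _)
      (hHs.exp_neg.integrable _) fun ω => ?_)⟩
  exact mul_le_of_le_one_left (Real.exp_pos _).le (hF01 _).2

lemma bdd_cav (hH : Bdd H) (hF : Measurable F) (hF01 : ∀ ω, F ω ∈ Icc (0 : ℝ) 1) (Λ : Set ι) :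
    Bdd (cav π Λ H F) := by
  refine ⟨?_, 1, fun ζ => abs_le.2 ⟨?_, (cav_mem π hH hF hF01 Λ ζ).2⟩⟩
  · exact (measurable_integral_spl π (G := fun ω => F ω * Real.exp (-H ω))
      (hF.mul hH.exp_neg.1) Λ).div (measurable_integral_spl π hH.exp_neg.1 Λ)
  · linarith [(cav_mem π hH hF hF01 Λ ζ).1]

lemma integral_spl {G : (ι → Y) → ℝ} (hG : Bdd G) (Λ : Set ι) :
    ∫ ω, G ω ∂(prodMeas ι π) = ∫ ζ, ∫ ω, G (spl Λ ω ζ) ∂(prodMeas ι π) ∂(prodMeas ι π) := by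
  have h1 : Integrable (fun q : (ι → Y) × (ι → Y) => G (spl Λ q.1 q.2))
      ((prodMeas ι π).prod (prodMeas ι π)) := (hG.comp (measurable_spl Λ)).integrable _
  rw [← integral_prod_symm _ h1]
  have h2 := integral_map (μ := (prodMeas ι π).prod (prodMeas ι π)) (measurable_spl Λ).aemeasurable
    hG.1.aestronglyMeasurable
  rwa [(measurePreserving_spl π Λ).map_eq] at h2

/-- The tower property of conditional Gibbs expectations. -/
lemma cav_tower (hH : Bdd H) (hF : Measurable F) (hF01 : ∀ ω, F ω ∈ Icc (0 : ℝ) 1) {Λ Λ' : Set ι}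
    (h : Λ ⊆ Λ') (ζ : ι → Y) :
    cav π Λ' H F ζ = (∫ ω, cav π Λ H F (spl Λ' ω ζ) * Real.exp (-H (spl Λ' ω ζ)) ∂(prodMeas ι π)) /
      ∫ ω, Real.exp (-H (spl Λ' ω ζ)) ∂(prodMeas ι π) := by
  have hm := measurable_spl_left Λ' ζ
  have hFb : Bdd F := ⟨hF, 1, fun ω => abs_le.2 ⟨by linarith [(hF01 ω).1], (hF01 ω).2⟩⟩
  have hHs := (hH.comp hm).exp_neg
  rw [cav, integral_spl π ((hFb.comp hm).mul hHs) Λ,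
    integral_spl π (((bdd_cav π hH hF hF01 Λ).comp hm).mul hHs) Λ]
  congr 1
  refine integral_congr_ae (ae_of_all _ fun ω₂ => ?_)
  beta_reduce
  simp only [spl_spl h, cav_spl]
  have hpos := (hH.comp (measurable_spl_left Λ (spl Λ' ω₂ ζ))).integral_exp_pos (prodMeas ι π)
  rw [integral_const_mul, cav, div_mul_cancel₀ _ hpos.ne']

/-- The oscillation of conditional Gibbs expectations. -/
def OscLe (Λ : Set ι) (F : (ι → Y) → ℝ) (S : Set ((ι → Y) → ℝ)) (r : ℝ) : Prop :=
  ∀ H ∈ S, ∀ H' ∈ S, ∀ ζ ζ', cav π Λ H F ζ ≤ cav π Λ H' F ζ' + r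

variable {π}

/-- By the tower property, the expectation in `Λ'` averages the one in `Λ`. The part of the mass
shared by the two averages sees equal values on `Λ' \ Λ`, where boundary effects are at most `ε`;
only the remaining fraction `1 - exp (-2A)` is exposed to the old oscillation `r`. -/
lemma OscLe.step {Λ Λ' : Set ι} (hΛ : Λ ⊆ Λ') {S : Set ((ι → Y) → ℝ)} {A ε r : ℝ}
    (hS : ∀ H ∈ S, Bdd H) (hF : Measurable F) (hF01 : ∀ ω, F ω ∈ Icc (0 : ℝ) 1)
    (hA : ∀ H ∈ S, ∀ H' ∈ S, ∀ ζ ζ', ∃ d, ∀ ω,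
      |H (spl Λ' ω ζ) - H' (spl Λ' ω ζ') - d| ≤ A)
    (hε : ∀ H ∈ S, ∀ H' ∈ S, ∀ ζ ζ', (∀ l ∈ Λ' \ Λ, ζ l = ζ' l) → ∃ d, ∀ ω,
      |H (spl Λ ω ζ) - H' (spl Λ ω ζ') - d| ≤ ε)
    (hFd : DependsOn F Λ)
    (h : OscLe π Λ F S r) :
    OscLe π Λ' F S (1 - Real.exp (-(2 * ε)) + (1 - Real.exp (-(2 * A))) * r) := by
  intro H hH H' hH' ζ ζ'
  have hb := hS H hH
  have hb' := hS H' hH'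
  obtain ⟨d, hd⟩ := hA H hH H' hH' ζ ζ'
  rw [← sub_le_iff_le_add', cav_tower π hb hF hF01 hΛ, cav_tower π hb' hF hF01 hΛ]
  refine tilted_sub_le (prodMeas ι π) (hb.comp (measurable_spl_left Λ' ζ))
    (hb'.comp (measurable_spl_left Λ' ζ')) ((bdd_cav π hb hF hF01 Λ).comp (measurable_spl_left Λ' ζ))
    ((bdd_cav π hb' hF hF01 Λ).comp (measurable_spl_left Λ' ζ')) hd (fun ω => ?_)
    fun ω ω' => h H' hH' H' hH' _ _
  obtain ⟨d', hd'⟩ := hε H hH H' hH' (spl Λ' ω ζ) (spl Λ' ω ζ')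
    fun l hl => by rw [spl_of_mem hl.1, spl_of_mem hl.1]
  have hFb : Bdd F := ⟨hF, 1, fun ω => abs_le.2 ⟨by linarith [(hF01 ω).1], (hF01 ω).2⟩⟩
  have key := tilted_sub_le (prodMeas ι π) (ε := 0) (r := 1)
    (hb.comp (measurable_spl_left Λ (spl Λ' ω ζ)))
    (hb'.comp (measurable_spl_left Λ (spl Λ' ω ζ')))
    (hFb.comp (measurable_spl_left Λ (spl Λ' ω ζ)))
    (hFb.comp (measurable_spl_left Λ (spl Λ' ω ζ'))) hd'
    (fun ω₁ => by
      rw [add_zero]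
      exact (hFd fun i hi => by rw [spl_of_mem hi, spl_of_mem hi]).le)
    fun ω₁ ω₂ => by linarith [(hF01 (spl Λ ω₁ (spl Λ' ω ζ'))).2, (hF01 (spl Λ ω₂ (spl Λ' ω ζ'))).1]
  rw [zero_add, mul_one] at key
  unfold cav
  linarith

lemma OscLe.avg_le {Λ : Set ι} {S : Set ((ι → Y) → ℝ)} {r : ℝ} (h : OscLe π Λ F S r)
    (hS : ∀ H ∈ S, Bdd H) (hF : Measurable F) (hF01 : ∀ ω, F ω ∈ Icc (0 : ℝ) 1)
    (hH : H ∈ S) (hH' : H' ∈ S) : avg π H F ≤ avg π H' F + r := by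
  have hP : Nonempty (ι → Y) := nonempty_of_isProbabilityMeasure (prodMeas ι π)
  obtain ⟨ζ⟩ := hP
  have tow : ∀ G ∈ S, avg π G F = (∫ ω, cav π Λ G F ω * Real.exp (-G ω) ∂(prodMeas ι π)) /
      ∫ ω, Real.exp (-G ω) ∂(prodMeas ι π) := by
    intro G hG
    have := cav_tower π (hS G hG) hF hF01 (subset_univ Λ) ζ
    simpa only [cav_univ, spl_univ] using this
  have hle : ∀ ω, avg π H F ≤ cav π Λ H' F ω + r := by
    intro ω
    rw [tow H hH, div_le_iff₀ ((hS H hH).integral_exp_pos _), ← integral_const_mul]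
    refine integral_mono (((bdd_cav π (hS H hH) hF hF01 Λ).mul (hS H hH).exp_neg).integrable _)
      (((hS H hH).exp_neg.integrable _).const_mul _) fun ω' => ?_
    exact mul_le_mul_of_nonneg_right (h H hH H' hH' ω' ω) (Real.exp_pos _).le
  rw [← sub_le_iff_le_add, tow H' hH', le_div_iff₀ ((hS H' hH').integral_exp_pos _),
    ← integral_const_mul]
  refine integral_mono (((hS H' hH').exp_neg.integrable _).const_mul _)
    (((bdd_cav π (hS H' hH') hF hF01 Λ).mul (hS H' hH').exp_neg).integrable _) fun ω' => ?_
  exact mul_le_mul_of_nonneg_right (by linarith [hle ω']) (Real.exp_pos _).le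

/-- Gibbs expectations of local observables do not depend on the distant parts of the
Hamiltonian if the boundary effects are bounded and decay. -/
theorem exists_avg_le {Λ : ℕ → Set ι} (hΛ : Monotone Λ) {S : ℕ → Set ((ι → Y) → ℝ)}
    (hSanti : Antitone S) (hS : ∀ N, ∀ H ∈ S N, Bdd H) {A : ℝ}
    (hA : ∀ N, ∀ H ∈ S N, ∀ H' ∈ S N, ∀ ζ ζ', ∃ d, ∀ ω,
      |H (spl (Λ N) ω ζ) - H' (spl (Λ N) ω ζ') - d| ≤ A)
    (hε : ∀ N, ∀ ε > 0, ∃ N' ≥ N, ∀ H ∈ S N', ∀ H' ∈ S N', ∀ ζ ζ',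
      (∀ l ∈ Λ N' \ Λ N, ζ l = ζ' l) → ∃ d, ∀ ω,
      |H (spl (Λ N) ω ζ) - H' (spl (Λ N) ω ζ') - d| ≤ ε)
    {N₀ : ℕ} (hF : Measurable F) (hF01 : ∀ ω, F ω ∈ Icc (0 : ℝ) 1) (hFd : DependsOn F (Λ N₀))
    {δ : ℝ} (hδ : 0 < δ) : ∃ N, ∀ H ∈ S N, ∀ H' ∈ S N, avg π H F ≤ avg π H' F + δ := by
  set ρ := 1 - Real.exp (-(2 * |A|)) with hρ
  have hρ0 : 0 ≤ ρ := by
    rw [hρ, sub_nonneg, Real.exp_le_one_iff]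
    linarith [abs_nonneg A]
  have hρ1 : ρ < 1 := by rw [hρ]; linarith [Real.exp_pos (-(2 * |A|))]
  -- Each step multiplies the oscillation by the same `ρ < 1`, because the boundary effect is
  -- bounded by `A` at every scale. The error `τ = (1 - ρ) * (δ / 2)` makes `δ / 2` a fixed point of
  -- the recursion.
  have key : ∀ k : ℕ, ∃ N ≥ N₀, OscLe π (Λ N) F (S N) (ρ ^ k + δ / 2) := by
    intro k
    induction k with
    | zero =>
      refine ⟨N₀, le_rfl, fun H hH H' hH' ζ ζ' => ?_⟩
      have h1 := cav_mem π (hS N₀ H hH) hF hF01 (Λ N₀) ζ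
      have h2 := cav_mem π (hS N₀ H' hH') hF hF01 (Λ N₀) ζ'
      rw [pow_zero]
      linarith [h1.2, h2.1]
    | succ k ih =>
      obtain ⟨N, hN, hosc⟩ := ih
      set τ := (1 - ρ) * (δ / 2) with hτ
      have hτ0 : 0 < τ := mul_pos (by linarith) (by linarith)
      obtain ⟨N', hN', h'⟩ := hε N (τ / 2) (by linarith)
      refine ⟨N', hN.trans hN', ?_⟩
      have h1 : OscLe π (Λ N) F (S N') (ρ ^ k + δ / 2) := fun H hH H' hH' =>
        hosc H (hSanti hN' hH) H' (hSanti hN' hH')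
      have h2 := h1.step (hΛ hN') (hS N') hF hF01 (A := |A|) (fun H hH H' hH' ζ ζ' => by
        obtain ⟨d, hd⟩ := hA N' H hH H' hH' ζ ζ'
        exact ⟨d, fun ω => (hd ω).trans (le_abs_self A)⟩) h'
        (fun x y hxy => hFd fun i hi => hxy i (hΛ hN hi))
      intro H hH H' hH' ζ ζ'
      refine (h2 H hH H' hH' ζ ζ').trans ?_
      have h3 := Real.add_one_le_exp (-(2 * (τ / 2)))
      rw [← hρ]
      have h4 : ρ * (ρ ^ k + δ / 2) = ρ ^ (k + 1) + ρ * (δ / 2) := by ring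
      rw [h4]
      have h5 : τ = δ / 2 - ρ * (δ / 2) := by rw [hτ]; ring
      linarith
  obtain ⟨k, hk⟩ := exists_pow_lt_of_lt_one (show 0 < δ / 2 by linarith) hρ1
  obtain ⟨N, -, hosc⟩ := key k
  refine ⟨N, fun H hH H' hH' => ?_⟩
  have := hosc.avg_le (hS N) hF hF01 hH hH'
  linarith

end Gibbs

namespace Model

variable (D : Model)

/-! ### The interaction beyond nearest neighbours -/

/-- The spacings of a configuration, raised to the hard core radius. -/
def clip (ω : ℤ → RPos) (l : ℤ) : ℝ := max (ω l) D.rhc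

lemma rhc_le_clip (ω : ℤ → RPos) (l : ℤ) : D.rhc ≤ D.clip ω l := le_max_right _ _

/-- The interaction energy beyond nearest neighbours of the particles `b, …, e`. -/
def V (b e : ℤ) (ω : ℤ → RPos) : ℝ := pairSum (D.far (D.clip ω)) b e

lemma far_congr {z y : ℤ → ℝ} {i j : ℤ} (h : ∀ l, i ≤ l → l < j → z l = y l) :
    D.far z i j = D.far y i j := by
  unfold far; rw [D.blk_congr h]

lemma dependsOn_V (b e : ℤ) : DependsOn (D.V b e) (Set.Ico b e) := by
  intro ω ω' h
  refine pairSum_congr fun i j hi _ hj => D.far_congr fun l hl hl' => ?_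
  unfold clip
  rw [h l ⟨hi.trans hl, hl'.trans_le hj⟩]

lemma crossSum_far (z : ℤ → ℝ) (b t e : ℤ) :
    crossSum (D.far z) b t e = crossSum (D.blk z) b t e :=
  crossSum_congr fun i j _ hi hj _ => if_pos (by omega)

lemma V_split {b t e : ℤ} (hb : b ≤ t) (he : t ≤ e) (ω : ℤ → RPos) :
    D.V b e ω = D.V b t ω + D.V t e ω + crossSum (D.blk (D.clip ω)) b t e := by
  unfold V
  rw [pairSum_split _ hb he, crossSum_far]

lemma abs_cross_clip_le (b t e : ℤ) (ω : ℤ → RPos) :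
    |crossSum (D.blk (D.clip ω)) b t e| ≤ D.K :=
  D.abs_crossSum_blk_le fun l _ _ => D.rhc_le_clip ω l

lemma exists_abs_V_le (b e : ℤ) : ∃ C, ∀ ω, |D.V b e ω| ≤ C := by
  refine ⟨∑ i ∈ Finset.Ico b e, ∑ j ∈ Finset.Ioc i e, D.c (j - i).toNat, fun ω => ?_⟩
  unfold V pairSum
  refine (Finset.abs_sum_le_sum_abs _ _).trans (Finset.sum_le_sum fun i _ =>
    (Finset.abs_sum_le_sum_abs _ _).trans (Finset.sum_le_sum fun j _ => ?_))
  unfold far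
  split_ifs with h
  · exact D.abs_blk_le h fun l _ _ => D.rhc_le_clip ω l
  · simpa using D.c_nonneg _

/-- After clipping, particles with labels at least 2 apart are at distance at least `2 * rhc`, so no
singularity is met, even for configurations that violate the hard core. -/
lemma continuous_V (b e : ℤ) : Continuous (D.V b e) := by
  unfold V pairSum
  refine continuous_finsetSum _ fun i _ => continuous_finsetSum _ fun j _ => ?_
  unfold far
  split_ifs with h
  · unfold blk phi
    split_ifs
    · refine D.continuousOn_v.comp_continuous ?_ fun ω => ?_
      · refine (continuous_len i j).comp (continuous_pi fun l => ?_)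
        exact (continuous_subtype_val.comp (continuous_apply l)).max continuous_const
      · have h1 := le_len (i := i) (j := j) (by omega) fun l _ _ => D.rhc_le_clip ω l
        have h2 : (2 : ℝ) ≤ ((j - i : ℤ) : ℝ) := by exact_mod_cast (by omega : (2 : ℤ) ≤ j - i)
        rw [mem_Ioi]
        nlinarith [D.hrhc]
    · exact continuous_const
  · exact continuous_const

lemma measurable_V (b e : ℤ) : Measurable (D.V b e) := (D.continuous_V b e).measurable

lemma bdd_V (β : ℝ) (b e : ℤ) : Bdd fun ω => β * D.V b e ω := by
  obtain ⟨C, hC⟩ := D.exists_abs_V_le b e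
  refine ⟨(D.measurable_V b e).const_mul β, |β| * C, fun ω => ?_⟩
  rw [abs_mul]
  exact mul_le_mul_of_nonneg_left (hC ω) (abs_nonneg β)

/-- Pairs at label distance at most `M` see only spacings on which the configurations agree; each
other pair contributes at most twice its bound. -/
lemma abs_cross_sub_le {z y : ℤ → ℝ} (hz : ∀ l, D.rhc ≤ z l) (hy : ∀ l, D.rhc ≤ y l) {M : ℕ}
    {b t e : ℤ} (h : ∀ l, b ≤ l → l < e → t - M ≤ l → l < t + M → z l = y l) :
    |crossSum (D.blk z) b t e - crossSum (D.blk y) b t e| ≤ 2 * D.tail M := by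
  rw [crossSum_sub, tail, ← tsum_mul_left]
  refine abs_crossSum_le ((D.summable_tail M).mul_left 2)
    (fun q => mul_nonneg zero_le_two (by split_ifs; exacts [le_rfl, D.c_nonneg _]))
    fun α β hα hβ => ?_
  have hk : (t + 1 + β - (t - 1 - α) : ℤ).toNat = α + β + 2 := by omega
  split_ifs with hM
  · rw [D.blk_congr (y := y) fun l hl hl' => h l (by omega) (by omega)
      (by simp only at hM; omega) (by simp only at hM; omega)]
    simp
  · have h1 := D.abs_blk_le (z := z) (i := t - 1 - α) (j := t + 1 + β) (by omega) fun l _ _ => hz l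
    have h2 := D.abs_blk_le (z := y) (i := t - 1 - α) (j := t + 1 + β) (by omega) fun l _ _ => hy l
    rw [hk] at h1 h2
    exact (abs_sub _ _).trans (by simp only; linarith)

/-! ### Uniqueness of the thermodynamic limit -/

/-- The chains with labels in `[b, e]` contain the chain with labels in `[lo σ N, N]`. -/
def Adm (σ : Bool) (N : ℕ) (b e : ℤ) : Prop := (if σ then b ≤ lo σ N else b = 0) ∧ (N : ℤ) ≤ e

lemma Adm.le {σ : Bool} {N : ℕ} {b e : ℤ} (h : Adm σ N b e) : b ≤ lo σ N := by
  cases σ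
  · simpa [Adm, lo] using h.1.le
  · simpa [Adm, lo] using h.1

lemma lo_anti (σ : Bool) {N N' : ℕ} (h : N ≤ N') : lo σ N' ≤ lo σ N := by
  cases σ <;> simp [lo]; exact h

lemma Adm.mono {σ : Bool} {N N' : ℕ} (hN : N ≤ N') {b e : ℤ} (h : Adm σ N' b e) : Adm σ N b e := by
  refine ⟨?_, by have := h.2; omega⟩
  have := lo_anti σ hN
  cases σ
  · simpa using h.1
  · have h1 := h.1
    simp only [if_true] at h1 ⊢
    omega

/-- In one dimension a window communicates with the outside through at most two cuts, each with
interaction at most `K`; for two Hamiltonians this gives the bound `4 * β * K` on boundary effects.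
A buffer of `M` frozen spacings reduces the effect to `8 * β * tail M`. -/
lemma exists_avg_V_le (σ : Bool) {β : ℝ} (hβ : 0 < β) (π : Measure RPos) [IsProbabilityMeasure π]
    {F : (ℤ → RPos) → ℝ} {N₀ : ℕ} (hF : Measurable F) (hF01 : ∀ ω, F ω ∈ Icc (0 : ℝ) 1)
    (hFd : DependsOn F (Set.Ico (lo σ N₀) (N₀ : ℤ))) {δ : ℝ} (hδ : 0 < δ) :
    ∃ N, ∀ b e b' e', Adm σ N b e → Adm σ N b' e' →
      avg π (fun ω => β * D.V b e ω) F ≤ avg π (fun ω => β * D.V b' e' ω) F + δ := by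
  set Λ : ℕ → Set ℤ := fun N => Set.Ico (lo σ N) (N : ℤ) with hΛ
  set S : ℕ → Set ((ℤ → RPos) → ℝ) :=
    fun N => {H | ∃ b e, Adm σ N b e ∧ H = fun ω => β * D.V b e ω} with hS
  have hK := D.K_nonneg
  have split3 : ∀ {b s t e : ℤ}, b ≤ s → s ≤ t → t ≤ e → ∀ ω : ℤ → RPos,
      D.V b e ω = D.V b s ω + D.V s t ω + D.V t e ω + crossSum (D.blk (D.clip ω)) b s t +
        crossSum (D.blk (D.clip ω)) b t e := by
    intro b s t e h1 h2 h3 ω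
    rw [D.V_split (h1.trans h2) h3, D.V_split h1 h2]
    ring
  have key := exists_avg_le (π := π) (F := F) (Λ := Λ) (S := S) (A := β * (4 * D.K)) (N₀ := N₀)
    (δ := δ) ?_ ?_ ?_ ?_ ?_ hF hF01 hFd hδ
  · obtain ⟨N, hN⟩ := key
    exact ⟨N, fun b e b' e' h h' => hN _ ⟨b, e, h, rfl⟩ _ ⟨b', e', h', rfl⟩⟩
  · intro N N' h l hl
    have := lo_anti σ h
    simp only [hΛ, Set.mem_Ico] at hl ⊢
    omega
  · rintro N N' h _ ⟨b, e, hA, rfl⟩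
    exact ⟨b, e, hA.mono h, rfl⟩
  · rintro N _ ⟨b, e, -, rfl⟩
    exact D.bdd_V β b e
  · rintro N _ ⟨b, e, hA, rfl⟩ _ ⟨b', e', hA', rfl⟩ ζ ζ'
    set s := lo σ N with hs
    have hs0 := lo_le σ N
    refine ⟨β * (D.V b s ζ + D.V N e ζ - (D.V b' s ζ' + D.V N e' ζ')), fun ω => ?_⟩
    have hin : ∀ x : ℤ → RPos, D.V s N (spl (Λ N) ω x) = D.V s N ω := fun x =>
      D.dependsOn_V s N fun l hl => spl_of_mem hl
    have hleft : ∀ (x : ℤ → RPos) b, D.V b s (spl (Λ N) ω x) = D.V b s x := fun x b =>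
      D.dependsOn_V b s fun l hl => spl_of_notMem fun h => by
        simp only [hΛ, Set.mem_Ico] at h hl; omega
    have hright : ∀ (x : ℤ → RPos) e, D.V N e (spl (Λ N) ω x) = D.V N e x := fun x e =>
      D.dependsOn_V N e fun l hl => spl_of_notMem fun h => by
        simp only [hΛ, Set.mem_Ico] at h hl; omega
    beta_reduce
    rw [split3 hA.le (by omega : s ≤ N) hA.2, split3 hA'.le (by omega : s ≤ N) hA'.2, hin, hin,
      hleft, hleft, hright, hright, ← mul_sub, ← mul_sub, abs_mul, abs_of_pos hβ]
    refine mul_le_mul_of_nonneg_left ?_ hβ.le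
    have e1 := abs_le.1 (D.abs_cross_clip_le b s N (spl (Λ N) ω ζ))
    have e2 := abs_le.1 (D.abs_cross_clip_le b N e (spl (Λ N) ω ζ))
    have e3 := abs_le.1 (D.abs_cross_clip_le b' s N (spl (Λ N) ω ζ'))
    have e4 := abs_le.1 (D.abs_cross_clip_le b' N e' (spl (Λ N) ω ζ'))
    rw [abs_le]
    constructor <;> linarith [e1.1, e1.2, e2.1, e2.2, e3.1, e3.2, e4.1, e4.2]
  · intro N ε hε
    obtain ⟨M, hM⟩ := (D.tendsto_tail.eventually_lt_const
      (show (0 : ℝ) < ε / (8 * β) by positivity)).exists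
    refine ⟨N + M, Nat.le_add_right _ _, ?_⟩
    rintro _ ⟨b, e, hA, rfl⟩ _ ⟨b', e', hA', rfl⟩ ζ ζ' hζ
    set N' := N + M with hN'
    set s := lo σ N' with hs
    have hs0 := lo_le σ N'
    set C : ℤ → ℤ → (ℤ → RPos) → ℝ := fun b e x => D.V b s x + D.V N' e x +
      crossSum (D.blk (D.clip x)) b s N' + crossSum (D.blk (D.clip x)) b N' e with hC
    refine ⟨β * (C b e ζ - C b' e' ζ'), fun ω => ?_⟩
    have hmem : ∀ l : ℤ, l ∉ Set.Ico s (N' : ℤ) → l ∉ Λ N := by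
      intro l hl h
      have := lo_anti σ (show N ≤ N' by omega)
      simp only [hΛ, Set.mem_Ico] at h hl
      omega
    have hin : D.V s N' (spl (Λ N) ω ζ) = D.V s N' (spl (Λ N) ω ζ') := by
      refine D.dependsOn_V s N' fun l hl => ?_
      by_cases h : l ∈ Λ N
      · rw [spl_of_mem h, spl_of_mem h]
      · rw [spl_of_notMem h, spl_of_notMem h]
        exact hζ l ⟨hl, h⟩
    have hleft : ∀ (x : ℤ → RPos) b, D.V b s (spl (Λ N) ω x) = D.V b s x := fun x b =>
      D.dependsOn_V b s fun l hl => spl_of_notMem (hmem l fun h => by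
        simp only [Set.mem_Ico] at h hl; omega)
    have hright : ∀ (x : ℤ → RPos) e, D.V N' e (spl (Λ N) ω x) = D.V N' e x := fun x e =>
      D.dependsOn_V N' e fun l hl => spl_of_notMem (hmem l fun h => by
        simp only [Set.mem_Ico] at h hl; omega)
    have hclip : ∀ (x : ℤ → RPos) l, l ∉ Λ N → D.clip (spl (Λ N) ω x) l = D.clip x l := by
      intro x l hl
      unfold clip
      rw [spl_of_notMem hl]
    have hcr : ∀ (x : ℤ → RPos) b e, |crossSum (D.blk (D.clip (spl (Λ N) ω x))) b N' e -
        crossSum (D.blk (D.clip x)) b N' e| ≤ 2 * D.tail M := fun x b e =>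
      D.abs_cross_sub_le (D.rhc_le_clip _) (D.rhc_le_clip _) fun l _ _ h1 _ => hclip x l fun h => by
        simp only [hΛ, Set.mem_Ico] at h; omega
    have hcl : ∀ (x : ℤ → RPos) b e, Adm σ N' b e →
        |crossSum (D.blk (D.clip (spl (Λ N) ω x))) b s N' -
          crossSum (D.blk (D.clip x)) b s N'| ≤ 2 * D.tail M := by
      intro x b e hAb
      have ht : 0 ≤ D.tail M :=
        tsum_nonneg fun q => by split_ifs; exacts [le_rfl, D.c_nonneg _]
      cases σ with
      | false =>
        have hb : b = s := by simpa [Adm, lo, hs] using hAb.1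
        rw [hb, crossSum_left_self, crossSum_left_self]
        simpa using ht
      | true =>
        refine D.abs_cross_sub_le (D.rhc_le_clip _) (D.rhc_le_clip _) fun l _ _ _ h1 =>
          hclip x l fun h => ?_
        simp only [hΛ, Set.mem_Ico, lo, if_true, hs] at h h1
        omega
    beta_reduce
    rw [split3 hA.le (by omega : s ≤ N') hA.2, split3 hA'.le (by omega : s ≤ N') hA'.2, hin,
      hleft, hleft, hright, hright, ← mul_sub, ← mul_sub, abs_mul, abs_of_pos hβ, mul_comm]
    rw [lt_div_iff₀ (by positivity)] at hM
    refine (mul_le_mul_of_nonneg_right (show _ ≤ 8 * D.tail M from ?_) hβ.le).trans (by linarith)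
    have e1 := abs_le.1 (hcr ζ b e)
    have e2 := abs_le.1 (hcr ζ' b' e')
    have e3 := abs_le.1 (hcl ζ b e hA)
    have e4 := abs_le.1 (hcl ζ' b' e' hA')
    rw [abs_le]
    simp only [hC]
    constructor <;> linarith [e1.1, e1.2, e2.1, e2.2, e3.1, e3.2, e4.1, e4.2]

end Model

/-! ### Product measures with densities -/

section ProductDensity

variable {Y : Type} [MeasurableSpace Y]

lemma map_comp_prodMeas {ι κ : Type} (π : Measure Y) [IsProbabilityMeasure π] {e : κ → ι}
    (he : Function.Injective e) :
    (prodMeas ι π).map (fun ω k => ω (e k)) = prodMeas κ π := by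
  have hm : Measurable fun (ω : ι → Y) k => ω (e k) :=
    measurable_pi_iff.2 fun k => measurable_pi_apply (e k)
  refine Measure.eq_infinitePi (μ := fun _ : κ => π) fun s t ht => ?_
  have hpre : (fun (ω : ι → Y) k => ω (e k)) ⁻¹' (Set.pi s t) =
      Set.pi (s.map ⟨e, he⟩ : Finset ι) (Function.extend e t fun _ => univ) := by
    ext ω
    simp [Set.mem_pi, he.extend_apply]
  rw [Measure.map_apply hm (.pi s.countable_toSet fun i _ => ht i), hpre, Measure.infinitePi_pi]
  · simp [Finset.prod_map, he.extend_apply]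
  · intro i hi
    obtain ⟨k, -, rfl⟩ := Finset.mem_map.1 hi
    simpa [he.extend_apply] using ht k

lemma pi_withDensity {ι : Type} [Fintype ι] {μ : Measure Y} [SigmaFinite μ] {g : Y → ℝ}
    (hg0 : ∀ y, 0 ≤ g y) (hi : Integrable g μ) :
    Measure.pi (fun _ : ι => μ.withDensity fun y => ENNReal.ofReal (g y)) =
      (Measure.pi fun _ : ι => μ).withDensity fun x => ENNReal.ofReal (∏ i, g (x i)) := by
  have : IsFiniteMeasure (μ.withDensity fun y => ENNReal.ofReal (g y)) :=
    isFiniteMeasure_withDensity_ofReal hi.2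
  refine Measure.pi_eq fun t ht => ?_
  have hind : ∀ i, Integrable ((t i).indicator g) μ := fun i => hi.indicator (ht i)
  have hnn : ∀ i y, 0 ≤ (t i).indicator g y := fun i y => indicator_nonneg (fun y _ => hg0 y) y
  rw [withDensity_apply _ (.univ_pi ht), ← lintegral_indicator (.univ_pi ht)]
  have h1 : ∀ x : ι → Y, (Set.univ.pi t).indicator (fun x => ENNReal.ofReal (∏ i, g (x i))) x =
      ENNReal.ofReal (∏ i, (t i).indicator g (x i)) := by
    intro x
    by_cases hx : x ∈ Set.univ.pi t
    · rw [indicator_of_mem hx]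
      congr 1
      exact Finset.prod_congr rfl fun i _ => (indicator_of_mem (hx i (mem_univ i)) g).symm
    · rw [indicator_of_notMem hx]
      simp only [Set.mem_pi, mem_univ, forall_true_left, not_forall] at hx
      obtain ⟨i, hxi⟩ := hx
      rw [Finset.prod_eq_zero (Finset.mem_univ i) (indicator_of_notMem hxi g), ENNReal.ofReal_zero]
  simp only [h1]
  rw [← ofReal_integral_eq_lintegral_ofReal (Integrable.fintype_prod hind)
    (ae_of_all _ fun x => Finset.prod_nonneg fun i _ => hnn i _),
    integral_fintype_prod_eq_prod, ENNReal.ofReal_prod_of_nonneg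
      fun i _ => integral_nonneg fun y => hnn i y]
  refine Finset.prod_congr rfl fun i _ => ?_
  rw [ofReal_integral_eq_lintegral_ofReal (hind i) (ae_of_all _ fun y => hnn i y),
    withDensity_apply _ (ht i), ← lintegral_indicator (ht i)]
  refine lintegral_congr fun y => ?_
  by_cases hy : y ∈ t i
  · rw [indicator_of_mem hy, indicator_of_mem hy]
  · rw [indicator_of_notMem hy, indicator_of_notMem hy, ENNReal.ofReal_zero]

/-- Infinite products of different measures are in general mutually singular, so the density is used
only for functions of finitely many coordinates. -/
lemma lintegral_prodMeas_withDensity {ι : Type} {π π' : Measure Y} [IsProbabilityMeasure π]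
    [IsProbabilityMeasure π'] {g : Y → ℝ} (hg : Measurable g) (hg0 : ∀ y, 0 ≤ g y)
    (hi : Integrable g π) (hπ : π' = π.withDensity fun y => ENNReal.ofReal (g y)) {Λ : Finset ι}
    {F : (ι → Y) → ℝ≥0∞} (hF : Measurable F) (hFd : DependsOn F (Λ : Set ι)) :
    ∫⁻ ω, F ω ∂(prodMeas ι π') =
      ∫⁻ ω, F ω * ENNReal.ofReal (∏ l ∈ Λ, g (ω l)) ∂(prodMeas ι π) := by
  classical
  obtain ⟨y₀⟩ : Nonempty Y := nonempty_of_isProbabilityMeasure π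
  set F' : ((i : Λ) → Y) → ℝ≥0∞ := fun y => F fun l => if h : l ∈ Λ then y ⟨l, h⟩ else y₀ with hF'
  have hF'm : Measurable F' := by
    refine hF.comp (measurable_pi_iff.2 fun l => ?_)
    by_cases h : l ∈ Λ
    · simp only [h, dif_pos]; exact measurable_pi_apply _
    · simp only [h, dif_neg, not_false_eq_true]; exact measurable_const
  have hFF : ∀ ω, F ω = F' (Λ.restrict ω) := fun ω => hFd fun i hi => by
    simp [Finset.mem_coe.1 hi]
  have hGm : Measurable fun y : (i : Λ) → Y => ENNReal.ofReal (∏ i, g (y i)) :=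
    (Finset.measurable_prod _ fun i _ => hg.comp (measurable_pi_apply i)).ennreal_ofReal
  have hGG : ∀ ω : ι → Y, ENNReal.ofReal (∏ l ∈ Λ, g (ω l)) =
      ENNReal.ofReal (∏ i : Λ, g (Λ.restrict ω i)) := fun ω => by
    rw [← Finset.prod_coe_sort]
    rfl
  simp only [hFF, hGG]
  rw [lintegral_restrict_infinitePi (fun _ : ι => π') hF'm,
    lintegral_restrict_infinitePi (fun _ : ι => π)
      (f := fun y => F' y * ENNReal.ofReal (∏ i : Λ, g (y i))) (hF'm.mul hGm)]
  simp only [hπ]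
  rw [pi_withDensity hg0 hi, lintegral_withDensity_eq_lintegral_mul _ hGm hF'm]
  exact lintegral_congr fun y => mul_comm _ _

end ProductDensity

/-! ### The reference measure of a single spacing -/

/-- Lebesgue measure on `ℝ₊`. -/
def leb : Measure RPos := (volume : Measure ℝ).comap Subtype.val

instance : SigmaFinite leb := by
  refine SigmaFinite.of_map leb measurable_subtype_coe.aemeasurable ?_
  unfold leb
  rw [map_comap_subtype_coe measurableSet_Ioi]
  infer_instance

lemma leb_apply_preimage (s : Set ℝ) :
    leb (Subtype.val ⁻¹' s) = volume (s ∩ Ioi 0) := by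
  unfold leb
  rw [(MeasurableEmbedding.subtype_coe measurableSet_Ioi).comap_apply,
    Subtype.image_preimage_coe, inter_comm]

namespace Model

variable (D : Model)

/-- The energy of a single spacing. -/
def u (r : ℝ) : ℝ := D.v r + D.p * r

/-- The Boltzmann factor of a single spacing. -/
def psi (β r : ℝ) : ℝ := (Ioi D.rhc).indicator (fun r => Real.exp (-β * D.u r)) r

lemma psi_nonneg (β r : ℝ) : 0 ≤ D.psi β r := indicator_nonneg (fun _ _ => (Real.exp_pos _).le) _

lemma psi_of_lt (β : ℝ) {r : ℝ} (hr : D.rhc < r) : D.psi β r = Real.exp (-β * D.u r) :=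
  indicator_of_mem (mem_Ioi.2 hr) _

lemma psi_of_le (β : ℝ) {r : ℝ} (hr : r ≤ D.rhc) : D.psi β r = 0 :=
  indicator_of_notMem (by simpa using hr) _

lemma continuousOn_u : ContinuousOn D.u (Ioi D.rhc) :=
  D.continuousOn_v.add (continuous_const.mul continuous_id).continuousOn

lemma measurable_psi (β : ℝ) : Measurable (D.psi β) := by
  classical
  have : D.psi β = (Ioi D.rhc).piecewise (fun r => Real.exp (-β * D.u r)) fun _ => 0 := by
    unfold psi
    rw [← Set.piecewise_eq_indicator]
    rfl
  rw [this]
  refine ContinuousOn.measurable_piecewise ?_ continuousOn_const measurableSet_Ioi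
  exact Real.continuous_exp.comp_continuousOn (continuousOn_const.mul D.continuousOn_u)

lemma le_u {r : ℝ} (hr : D.rhc < r) : D.v D.zmax + D.p * r ≤ D.u r := by
  unfold u
  linarith [D.v_zmax_le hr]

lemma integrable_psi {β : ℝ} (hβ : 0 < β) : Integrable (fun x : RPos => D.psi β x) leb := by
  have h1 : IntegrableOn (D.psi β) (Ioi 0) := by
    have h2 := (integrableOn_exp_mul_Ioi (neg_lt_zero.2 (mul_pos hβ D.hp)) 0).const_mul
      (Real.exp (-β * D.v D.zmax))
    refine Integrable.mono' h2 (D.measurable_psi β).aestronglyMeasurable (ae_of_all _ fun r => ?_)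
    rw [Real.norm_of_nonneg (D.psi_nonneg β r)]
    by_cases hr : D.rhc < r
    · rw [D.psi_of_lt β hr, ← Real.exp_add, Real.exp_le_exp]
      nlinarith [D.le_u hr]
    · rw [D.psi_of_le β (not_lt.1 hr)]
      positivity
  have h3 := (MeasurableEmbedding.subtype_coe (measurableSet_Ioi (a := (0 : ℝ)))).integrableOn_iff_comap
    (μ := volume) (f := D.psi β) (s := Ioi 0)
    (by rw [Subtype.range_coe])
  have h4 := h3.1 h1
  rw [Subtype.coe_preimage_self, integrableOn_univ] at h4
  exact h4

/-- The normalization of the reference measure. -/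
def zc (β : ℝ) : ℝ := ∫ x : RPos, D.psi β x ∂leb

lemma zc_pos {β : ℝ} (hβ : 0 < β) : 0 < D.zc β := by
  unfold zc
  rw [integral_pos_iff_support_of_nonneg (f := fun x : RPos => D.psi β x)
    (fun x => D.psi_nonneg β x) (D.integrable_psi hβ)]
  have h1 : Subtype.val ⁻¹' (Ioi D.rhc) ⊆ Function.support fun x : RPos => D.psi β x := by
    intro x hx
    rw [Function.mem_support, D.psi_of_lt β hx]
    exact (Real.exp_pos _).ne'
  refine lt_of_lt_of_le ?_ (measure_mono h1)
  rw [leb_apply_preimage, inter_eq_left.2 (Ioi_subset_Ioi D.hrhc.le),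
    Real.volume_Ioi]
  exact ENNReal.zero_lt_top

/-- The reference measure of a single spacing, with density proportional to `psi`. -/
def ref (β : ℝ) : Measure RPos :=
  if 0 < β then leb.withDensity fun x => ENNReal.ofReal (D.psi β x / D.zc β)
  -- A default for `β ≤ 0`, chosen so that `ref β` is a probability measure for every `β`.
  else Measure.dirac ⟨1, mem_Ioi.2 one_pos⟩

lemma ref_eq {β : ℝ} (hβ : 0 < β) :
    D.ref β = leb.withDensity fun x => ENNReal.ofReal (D.psi β x / D.zc β) := if_pos hβ

instance (β : ℝ) : IsProbabilityMeasure (D.ref β) := by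
  unfold ref
  split_ifs with h
  · refine ⟨?_⟩
    have h0 := D.zc_pos h
    rw [withDensity_apply _ .univ, Measure.restrict_univ, ← ofReal_integral_eq_lintegral_ofReal
      ((D.integrable_psi h).div_const _) (ae_of_all _ fun x => div_nonneg (D.psi_nonneg β x) h0.le),
      integral_div]
    unfold zc at h0 ⊢
    rw [div_self h0.ne', ENNReal.ofReal_one]
  · infer_instance

lemma measurable_psi_coe (β : ℝ) : Measurable fun x : RPos => D.psi β x :=
  (D.measurable_psi β).comp measurable_subtype_coe

lemma ref_apply {β : ℝ} (hβ : 0 < β) {s : Set RPos} (hs : MeasurableSet s) :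
    D.ref β s = ∫⁻ x in s, ENNReal.ofReal (D.psi β x / D.zc β) ∂leb := by
  rw [D.ref_eq hβ, withDensity_apply _ hs]

lemma ref_core {β : ℝ} (hβ : 0 < β) : D.ref β {x | (x : ℝ) ≤ D.rhc} = 0 := by
  rw [D.ref_apply hβ (measurableSet_le measurable_subtype_coe measurable_const)]
  refine (setLIntegral_congr_fun (measurableSet_le measurable_subtype_coe measurable_const)
    (g := fun _ => 0) fun x hx => ?_).trans (by simp)
  beta_reduce
  rw [D.psi_of_le β hx, zero_div, ENNReal.ofReal_zero]

lemma ref_pos {β : ℝ} (hβ : 0 < β) {s : Set ℝ} (hs : IsOpen s) {r : ℝ} (hr : D.rhc < r)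
    (hrs : r ∈ s) : 0 < D.ref β (Subtype.val ⁻¹' s) := by
  have hz := D.zc_pos hβ
  set q : Set ℝ := s ∩ Ioi D.rhc with hq
  have hqo : IsOpen q := hs.inter isOpen_Ioi
  have hqm : MeasurableSet (Subtype.val ⁻¹' q : Set RPos) := measurable_subtype_coe hqo.measurableSet
  refine lt_of_lt_of_le ?_ (measure_mono (preimage_mono (inter_subset_left : q ⊆ s)))
  rw [D.ref_apply hβ hqm, setLIntegral_pos_iff
    ((D.measurable_psi_coe β).div_const _).ennreal_ofReal]
  have h1 : (Subtype.val ⁻¹' q : Set RPos) ⊆ (Function.support fun x : RPos =>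
      ENNReal.ofReal (D.psi β x / D.zc β)) ∩ (Subtype.val ⁻¹' q) := by
    intro x hx
    refine ⟨?_, hx⟩
    rw [Function.mem_support, D.psi_of_lt β hx.2]
    exact (ENNReal.ofReal_pos.2 (div_pos (Real.exp_pos _) hz)).ne'
  refine lt_of_lt_of_le ?_ (measure_mono h1)
  rw [leb_apply_preimage,
    inter_eq_left.2 (inter_subset_right.trans (Ioi_subset_Ioi D.hrhc.le))]
  exact hqo.measure_pos volume ⟨r, hrs, hr⟩

/-- The density of the reference measures at different temperatures. -/
lemma ref_withDensity {β : ℝ} (hβ : 0 < β) : D.ref β = (D.ref 1).withDensity fun x =>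
    ENNReal.ofReal (D.zc 1 / D.zc β * D.psi (β - 1) x) := by
  have h1 := D.zc_pos one_pos
  have h2 := D.zc_pos hβ
  rw [D.ref_eq hβ, D.ref_eq one_pos, ← withDensity_mul _
    ((D.measurable_psi_coe 1).div_const _).ennreal_ofReal
    ((D.measurable_psi_coe _).const_mul _).ennreal_ofReal]
  congr 1
  funext x
  rw [Pi.mul_apply, ← ENNReal.ofReal_mul (div_nonneg (D.psi_nonneg 1 x) h1.le)]
  congr 1
  by_cases hx : D.rhc < x
  · rw [D.psi_of_lt _ hx, D.psi_of_lt _ hx, D.psi_of_lt _ hx]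
    have : -β * D.u x = -1 * D.u x + -(β - 1) * D.u x := by ring
    rw [this, Real.exp_add]
    field_simp
  · rw [D.psi_of_le _ (not_lt.1 hx), D.psi_of_le _ (not_lt.1 hx)]
    simp

lemma integrable_density {β : ℝ} (hβ : 0 < β) :
    Integrable (fun x : RPos => D.zc 1 / D.zc β * D.psi (β - 1) x) (D.ref 1) := by
  have h0 : ∀ x : RPos, 0 ≤ D.zc 1 / D.zc β * D.psi (β - 1) x := fun x =>
    mul_nonneg (div_nonneg (D.zc_pos one_pos).le (D.zc_pos hβ).le) (D.psi_nonneg _ _)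
  refine ⟨((D.measurable_psi_coe _).const_mul _).aestronglyMeasurable, ?_⟩
  rw [hasFiniteIntegral_iff_ofReal (ae_of_all _ h0)]
  have h1 := measure_univ (μ := D.ref β)
  rw [D.ref_withDensity hβ, withDensity_apply _ .univ, Measure.restrict_univ] at h1
  rw [h1]
  exact ENNReal.one_lt_top

end Model

/-! ### Finite sums with values in the extended reals. -/

lemma EReal_sum_ne_bot {ι : Type*} {s : Finset ι} {f : ι → EReal} (h : ∀ i ∈ s, f i ≠ ⊥) :
    ∑ i ∈ s, f i ≠ ⊥ := by
  classical
  induction s using Finset.induction_on with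
  | empty => simp
  | insert i s hi ih =>
    rw [Finset.sum_insert hi]
    rw [Ne, EReal.add_eq_bot_iff, not_or]
    exact ⟨h i (Finset.mem_insert_self _ _), ih fun j hj => h j (Finset.mem_insert_of_mem hj)⟩

lemma EReal_sum_eq_top {ι : Type*} {s : Finset ι} {f : ι → EReal} (h : ∀ i ∈ s, f i ≠ ⊥) {i : ι}
    (hi : i ∈ s) (hf : f i = ⊤) : ∑ i ∈ s, f i = ⊤ := by
  classical
  rw [← Finset.add_sum_erase s f hi, hf]
  exact EReal.top_add_of_ne_bot (EReal_sum_ne_bot fun j hj => h j (Finset.mem_of_mem_erase hj))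

lemma coe_sum {ι : Type*} (s : Finset ι) (f : ι → ℝ) :
    ((∑ i ∈ s, f i : ℝ) : EReal) = ∑ i ∈ s, (f i : EReal) := by
  classical
  induction s using Finset.induction_on with
  | empty => simp
  | insert i s hi ih => rw [Finset.sum_insert hi, Finset.sum_insert hi, EReal.coe_add, ih]

lemma sum_Ico_eq_sum_fin (g : ℤ → ℝ) (n : ℕ) :
    ∑ i ∈ Finset.Ico (0 : ℤ) n, g i = ∑ l : Fin n, g l := by
  rw [Fin.sum_univ_eq_sum_range (fun l : ℕ => g l) n]
  refine Finset.sum_bij' (fun l _ => l.toNat) (fun i _ => (i : ℤ)) ?_ ?_ ?_ ?_ ?_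
  · intro l hl; rw [Finset.mem_Ico] at hl; rw [Finset.mem_range]; omega
  · intro l hl; rw [Finset.mem_range] at hl; rw [Finset.mem_Ico]; omega
  · intro l hl; rw [Finset.mem_Ico] at hl; exact Int.toNat_of_nonneg hl.1
  · intro l _; simp
  · intro l hl; rw [Finset.mem_Ico] at hl
    rw [Int.toNat_of_nonneg hl.1]

namespace Model

variable (D : Model)

/-! ### Energy and weight of finite chains -/

lemma sum_fin_eq_len (y : ℤ → ℝ) {n : ℕ} {z : Fin n → RPos} (hy : ∀ l : Fin n, y l = z l)
    {i j : ℕ} (hj : j ≤ n) :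
    (∑ l : Fin n, if i ≤ (l : ℕ) ∧ (l : ℕ) < j then (z l : ℝ) else 0) = len y i j := by
  have h1 : ∀ l : Fin n, (if i ≤ (l : ℕ) ∧ (l : ℕ) < j then (z l : ℝ) else 0) =
      (fun q : ℤ => if (i : ℤ) ≤ q ∧ q < j then y q else 0) l := by
    intro l
    simp only [hy, Nat.cast_le, Nat.cast_lt]
  rw [Finset.sum_congr rfl fun l _ => h1 l, 
    ← sum_Ico_eq_sum_fin (fun q : ℤ => if (i : ℤ) ≤ q ∧ q < j then y q else 0), ← Finset.sum_filter]
  refine Finset.sum_congr ?_ fun _ _ => rfl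
  ext q
  simp only [Finset.mem_filter, Finset.mem_Ico]
  omega

lemma energy_eq_E (y : ℤ → ℝ) {n : ℕ} {z : Fin n → RPos} (hy : ∀ l : Fin n, y l = z l)
    (hz : ∀ l, D.rhc < z l) : energy D.v D.rhc D.m D.p n z = ((D.E y 0 n : ℝ) : EReal) := by
  have h1 : ∀ i j : Fin (n + 1),
      (if i < j ∧ (((j : ℕ) - (i : ℕ) : ℕ) : ℕ∞) ≤ D.m then
        pot D.v D.rhc (∑ l : Fin n, if (i : ℕ) ≤ (l : ℕ) ∧ (l : ℕ) < (j : ℕ) then (z l : ℝ) else 0)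
      else 0) = ((if i < j then D.blk y i j else 0 : ℝ) : EReal) := by
    intro i j
    by_cases hij : i < j
    · have hij' : (i : ℕ) < j := hij
      have hj : (j : ℕ) ≤ n := by omega
      have hlen : D.rhc < len y i j := by
        rw [len_add (by omega : (i : ℤ) ≤ i + 1) (by omega), len_succ]
        have e1 : y i = z ⟨i, by omega⟩ := hy ⟨i, by omega⟩
        have e2 : 0 ≤ len y ((i : ℤ) + 1) j := Finset.sum_nonneg fun l hl => by
          rw [Finset.mem_Ico] at hl
          have := hy ⟨l.toNat, by omega⟩
          rw [Int.toNat_of_nonneg (by omega)] at this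
          rw [this]
          exact (D.hrhc.trans (hz _)).le
        rw [e1]
        linarith [hz ⟨i, by omega⟩]
      rw [sum_fin_eq_len y hy hj, if_pos hij]
      unfold pot blk phi
      have e3 : ((j : ℤ) - (i : ℤ)).toNat = (j : ℕ) - i := by omega
      rw [if_neg (not_le.2 hlen), e3]
      simp only [hij, true_and]
      split_ifs <;> simp
    · rw [if_neg (fun h => hij h.1), if_neg hij, EReal.coe_zero]
  unfold energy
  simp only [h1]
  simp only [← coe_sum]
  rw [← EReal.coe_add]
  congr 1
  unfold E
  congr 1
  · unfold pairSum
    rw [sum_Ico_eq_sum_fin, Fin.sum_univ_castSucc]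
    have h2 : ∑ j : Fin (n + 1), (if Fin.last n < j then D.blk y (Fin.last n : ℕ) j else 0) = 0 :=
      Finset.sum_eq_zero fun j _ => if_neg (not_lt.2 (Fin.le_last j))
    rw [h2, add_zero]
    refine Finset.sum_congr rfl fun i _ => ?_
    have h3 := sum_Ico_eq_sum_fin (fun q => if (i : ℤ) < q then D.blk y i q else 0) (n + 1)
    have h4 : ∑ j : Fin (n + 1), (if i.castSucc < j then D.blk y (i.castSucc : ℕ) j else 0) =
        ∑ j : Fin (n + 1), (fun q : ℤ => if (i : ℤ) < q then D.blk y i q else 0) j := by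
      refine Finset.sum_congr rfl fun j _ => ?_
      simp only [Fin.lt_def, Fin.val_castSucc, Nat.cast_lt]
    rw [h4, ← h3, ← Finset.sum_filter]
    refine Finset.sum_congr ?_ fun _ _ => rfl
    ext q
    simp only [Finset.mem_filter, Finset.mem_Ico, Finset.mem_Ioc]
    push_cast
    omega
  · unfold len
    rw [sum_Ico_eq_sum_fin]
    simp only [hy]

lemma pot_ne_bot (r : ℝ) : pot D.v D.rhc r ≠ ⊥ := by
  unfold pot
  split_ifs
  · exact bot_lt_top.ne'
  · exact EReal.coe_ne_bot _

lemma energy_eq_top {n : ℕ} {z : Fin n → RPos} {l : Fin n} (hl : (z l : ℝ) ≤ D.rhc) :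
    energy D.v D.rhc D.m D.p n z = ⊤ := by
  have hterm : ∀ i j : Fin (n + 1),
      (if i < j ∧ (((j : ℕ) - (i : ℕ) : ℕ) : ℕ∞) ≤ D.m then
        pot D.v D.rhc (∑ l : Fin n, if (i : ℕ) ≤ (l : ℕ) ∧ (l : ℕ) < (j : ℕ) then (z l : ℝ) else 0)
      else 0) ≠ ⊥ := by
    intro i j
    split_ifs
    · exact D.pot_ne_bot _
    · exact EReal.zero_ne_bot
  unfold energy
  rw [EReal_sum_eq_top (fun i _ => EReal_sum_ne_bot fun j _ => hterm i j)
    (Finset.mem_univ l.castSucc), EReal.top_add_coe]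
  refine EReal_sum_eq_top (fun j _ => hterm _ j) (Finset.mem_univ l.succ) ?_
  have h1 : (∑ q : Fin n, if ((l.castSucc : Fin (n + 1)) : ℕ) ≤ (q : ℕ) ∧ (q : ℕ) < (l.succ : ℕ)
      then (z q : ℝ) else 0) = z l := by
    rw [Finset.sum_eq_single l]
    · simp
    · intro q _ hq
      rw [if_neg]
      simp only [Fin.val_castSucc, Fin.val_succ]
      intro h
      exact hq (Fin.ext (by omega))
    · simp
  rw [h1, if_pos ⟨Fin.castSucc_lt_succ, by simpa using D.hm⟩]
  unfold pot
  rw [if_pos hl]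

lemma E_eq_V {ω : ℤ → RPos} {b e : ℤ} (hω : ∀ l, b ≤ l → l < e → D.rhc < ω l) :
    D.E (fun l => ω l) b e = ∑ l ∈ Finset.Ico b e, D.u (ω l) + D.V b e ω := by
  rw [E_eq_sum_add]
  congr 1
  refine pairSum_congr fun i j hi _ hj => D.far_congr fun l hl hl' => ?_
  exact (max_eq_left (hω l (hi.trans hl) (hl'.trans_le hj)).le).symm

lemma sum_Ico_shift (g : ℤ → ℝ) (b : ℤ) (n : ℕ) :
    ∑ l ∈ Finset.Ico b (b + n), g l = ∑ l : Fin n, g (b + l) := by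
  have h1 := sum_Ico_eq_sum_fin (fun l => g (b + l)) n
  rw [← h1]
  have h2 : Finset.Ico b (b + (n : ℤ)) = (Finset.Ico 0 (n : ℤ)).map (addLeftEmbedding b) := by
    rw [Finset.map_add_left_Ico, add_zero]
  rw [h2, Finset.sum_map]
  rfl

/-- The spacings of a finite chain inside a configuration. -/
def fin (b : ℤ) (n : ℕ) (ω : ℤ → RPos) (l : Fin n) : RPos := ω (b + l)

lemma measurable_fin (b : ℤ) (n : ℕ) : Measurable (fin b n) :=
  measurable_pi_iff.2 fun l => measurable_pi_apply (b + l)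

/-- Nearest neighbour and pressure terms factorize over the spacings, and the hard core makes both
sides vanish. What remains is the bounded interaction `V`. -/
lemma weight_fin {β : ℝ} (hβ : 0 < β) (b : ℤ) (n : ℕ) (ω : ℤ → RPos) :
    weight D.v D.rhc D.m D.p β n (fin b n ω) =
      ENNReal.ofReal (∏ l : Fin n, D.psi β (ω (b + l))) *
        ENNReal.ofReal (Real.exp (-(β * D.V b (b + n) ω))) := by
  unfold weight
  by_cases h : ∀ l : Fin n, D.rhc < ω (b + l)
  · have h1 := D.energy_eq_E (fun l => ω (l + b)) (z := fin b n ω)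
      (fun l => by unfold fin; rw [add_comm]) h
    have hω : ∀ l, b ≤ l → l < b + n → D.rhc < ω l := by
      intro l hl hl'
      have := h ⟨(l - b).toNat, by omega⟩
      rwa [show b + (((⟨(l - b).toNat, by omega⟩ : Fin n) : ℕ) : ℤ) = l by
        simp only; omega] at this
    have h2 := D.E_shift (fun l => (ω l : ℝ)) 0 n b
    rw [zero_add, add_comm (n : ℤ) b] at h2
    rw [h1, h2, D.E_eq_V hω, sum_Ico_shift, ← EReal.coe_mul, ← EReal.coe_neg, EReal.exp_coe,
      ← ENNReal.ofReal_mul (Finset.prod_nonneg fun l _ => D.psi_nonneg _ _)]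
    congr 1
    rw [Finset.prod_congr rfl fun l _ => D.psi_of_lt β (h l), ← Real.exp_sum, ← Real.exp_add,
      ← Finset.mul_sum]
    congr 1
    ring
  · push Not at h
    obtain ⟨l, hl⟩ := h
    rw [D.energy_eq_top (z := fin b n ω) (l := l) hl, EReal.coe_mul_top_of_pos hβ, EReal.neg_top,
      EReal.exp_bot, Finset.prod_eq_zero (Finset.mem_univ l) (D.psi_of_le β hl), ENNReal.ofReal_zero,
      zero_mul]

/-! ### Gibbs measures on two-sided configurations -/

/-- The Boltzmann factor of the interaction beyond nearest neighbours. -/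
def bf (β : ℝ) (b e : ℤ) (ω : ℤ → RPos) : ℝ≥0∞ := ENNReal.ofReal (Real.exp (-(β * D.V b e ω)))

lemma measurable_bf (β : ℝ) (b e : ℤ) : Measurable (D.bf β b e) :=
  (D.bdd_V β b e).exp_neg.1.ennreal_ofReal

lemma dependsOn_bf (β : ℝ) (b e : ℤ) : DependsOn (D.bf β b e) (Set.Ico b e) := fun ω ω' h => by
  unfold bf
  rw [D.dependsOn_V b e h]

/-- The reference measure of configurations. -/
abbrev Pref (β : ℝ) : Measure (ℤ → RPos) := prodMeas ℤ (D.ref β)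

/-- The unnormalized Gibbs measure of the chain with labels in `[b, e]`. -/
def wm (β : ℝ) (b e : ℤ) : Measure (ℤ → RPos) := (D.Pref β).withDensity (D.bf β b e)

lemma wm_apply (β : ℝ) (b e : ℤ) {A : Set (ℤ → RPos)} (hA : MeasurableSet A) :
    D.wm β b e A = ∫⁻ ω in A, D.bf β b e ω ∂(D.Pref β) := withDensity_apply _ hA

lemma wm_univ (β : ℝ) (b e : ℤ) : D.wm β b e univ =
    ENNReal.ofReal (∫ ω, Real.exp (-(β * D.V b e ω)) ∂(D.Pref β)) := by
  rw [D.wm_apply _ _ _ .univ, Measure.restrict_univ, ofReal_integral_eq_lintegral_ofReal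
    ((D.bdd_V β b e).exp_neg.integrable _) (ae_of_all _ fun ω => (Real.exp_pos _).le)]
  rfl

lemma wm_univ_ne_zero (β : ℝ) (b e : ℤ) : D.wm β b e univ ≠ 0 := by
  rw [wm_univ]
  exact (ENNReal.ofReal_pos.2 ((D.bdd_V β b e).integral_exp_pos _)).ne'

lemma wm_univ_ne_top (β : ℝ) (b e : ℤ) : D.wm β b e univ ≠ ⊤ := by
  rw [wm_univ]
  exact ENNReal.ofReal_ne_top

instance (β : ℝ) (b e : ℤ) : IsFiniteMeasure (D.wm β b e) :=
  ⟨(D.wm_univ_ne_top β b e).lt_top⟩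

/-- The Gibbs measure of the chain with labels in `[b, e]`; the other spacings are independent. -/
def Gm (β : ℝ) (b e : ℤ) : Measure (ℤ → RPos) := (D.wm β b e univ)⁻¹ • D.wm β b e

instance (β : ℝ) (b e : ℤ) : IsProbabilityMeasure (D.Gm β b e) := by
  refine ⟨?_⟩
  unfold Gm
  rw [Measure.smul_apply, smul_eq_mul, ENNReal.inv_mul_cancel (D.wm_univ_ne_zero β b e)
    (D.wm_univ_ne_top β b e)]

lemma Gm_apply (β : ℝ) (b e : ℤ) (A : Set (ℤ → RPos)) :
    D.Gm β b e A = (D.wm β b e univ)⁻¹ * D.wm β b e A := by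
  unfold Gm
  rw [Measure.smul_apply, smul_eq_mul]

lemma integral_Gm (β : ℝ) (b e : ℤ) (F : (ℤ → RPos) → ℝ) :
    ∫ ω, F ω ∂(D.Gm β b e) = avg (D.ref β) (fun ω => β * D.V b e ω) F := by
  unfold Gm wm avg
  rw [integral_smul_measure]
  have h1 : (D.Pref β).withDensity (D.bf β b e) =
      (D.Pref β).withDensity fun ω => ((Real.toNNReal (Real.exp (-(β * D.V b e ω))) : NNReal) :
        ℝ≥0∞) := rfl
  change ((D.wm β b e univ)⁻¹).toReal • _ = _
  rw [wm_univ, h1, integral_withDensity_eq_integral_smul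
    ((D.bdd_V β b e).exp_neg.1.real_toNNReal), ENNReal.toReal_inv,
    ENNReal.toReal_ofReal ((D.bdd_V β b e).integral_exp_pos _).le, smul_eq_mul, div_eq_inv_mul]
  congr 1
  refine integral_congr_ae (ae_of_all _ fun ω => ?_)
  beta_reduce
  rw [NNReal.smul_def, Real.coe_toNNReal _ (Real.exp_pos _).le, smul_eq_mul, mul_comm]

/-- The finite chain Gibbs measure as a marginal of a Gibbs measure on two-sided
configurations. -/
lemma finiteGibbs_eq_map {β : ℝ} (hβ : 0 < β) (b : ℤ) (n : ℕ) :
    finiteGibbs D.v D.rhc D.m D.p β n = (D.Gm β b (b + n)).map (fin b n) := by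
  have hz := D.zc_pos hβ
  set e := b + (n : ℤ) with he
  set y₀ : RPos := ⟨1, mem_Ioi.2 one_pos⟩
  set ext : (Fin n → RPos) → ℤ → RPos := fun z l =>
    if h : b ≤ l ∧ l < e then z ⟨(l - b).toNat, by omega⟩ else y₀ with hext
  have hextm : Measurable ext := by
    refine measurable_pi_iff.2 fun l => ?_
    by_cases h : b ≤ l ∧ l < e
    · simp only [hext, h, and_self, dif_pos]; exact measurable_pi_apply _
    · simp only [hext, h, dif_neg, not_false_eq_true]; exact measurable_const
  have hext_fin : ∀ ω l, l ∈ Set.Ico b e → ext (fin b n ω) l = ω l := by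
    intro ω l hl
    have hl' : b ≤ l ∧ l < e := hl
    simp only [hext, hl', and_self, dif_pos, fin]
    congr 1
    omega
  have hfin_ext : ∀ z, fin b n (ext z) = z := by
    intro z
    funext l
    have hl : b ≤ b + (l : ℤ) ∧ b + (l : ℤ) < e := by omega
    simp only [fin, hext, hl, and_self, dif_pos]
    congr 1
    ext
    simp
  have hmap : (D.Pref β).map (fin b n) = Measure.pi fun _ : Fin n => D.ref β := by
    have := map_comp_prodMeas (D.ref β) (e := fun l : Fin n => b + (l : ℤ)) fun l l' h => by
      have : b + (l : ℤ) = b + (l' : ℤ) := h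
      exact Fin.ext (by omega)
    exact this.trans (Measure.infinitePi_eq_pi fun _ : Fin n => D.ref β)
  have hpi : (Measure.pi fun _ : Fin n => D.ref β) = (lebesguePos n).withDensity fun z =>
      ENNReal.ofReal (∏ l, D.psi β (z l) / D.zc β) := by
    rw [D.ref_eq hβ]
    exact pi_withDensity (fun x => div_nonneg (D.psi_nonneg β x) hz.le)
      ((D.integrable_psi hβ).div_const _)
  have hprodm : Measurable fun z : Fin n → RPos => ENNReal.ofReal (∏ l, D.psi β (z l) / D.zc β) :=
    (Finset.measurable_prod _ fun l _ => ((D.measurable_psi_coe β).comp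
      (measurable_pi_apply l)).div_const _).ennreal_ofReal
  have hw : ∀ z, weight D.v D.rhc D.m D.p β n z = ENNReal.ofReal (D.zc β ^ n) *
      (ENNReal.ofReal (∏ l, D.psi β (z l) / D.zc β) * D.bf β b e (ext z)) := by
    intro z
    conv_lhs => rw [← hfin_ext z, D.weight_fin hβ]
    rw [← mul_assoc, ← ENNReal.ofReal_mul (p := D.zc β ^ n) (by positivity),
      Finset.prod_div_distrib, Finset.prod_const, Finset.card_univ, Fintype.card_fin,
      mul_div_cancel₀ _ (pow_pos hz n).ne']
    have : ∀ l : Fin n, ext z (b + l) = z l := fun l => congrFun (hfin_ext z) l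
    simp only [this]
    rfl
  -- The power of `zc` converts the normalized reference measure back to Lebesgue measure and drops
  -- out upon normalization.
  have key : ∀ s, MeasurableSet s → ∫⁻ z in s, weight D.v D.rhc D.m D.p β n z ∂(lebesguePos n) =
      ENNReal.ofReal (D.zc β ^ n) * D.wm β b e (fin b n ⁻¹' s) := by
    intro s hs
    have hbm : Measurable fun z => D.bf β b e (ext z) := (D.measurable_bf β b e).comp hextm
    simp only [hw]
    rw [lintegral_const_mul' _ _ ENNReal.ofReal_ne_top]
    congr 1
    have h1 : ∫⁻ z in s, ENNReal.ofReal (∏ l, D.psi β (z l) / D.zc β) * D.bf β b e (ext z)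
        ∂(lebesguePos n) = ∫⁻ z in s, D.bf β b e (ext z) ∂((D.Pref β).map (fin b n)) := by
      rw [hmap, hpi, setLIntegral_withDensity_eq_setLIntegral_mul _ hprodm hbm hs]
      rfl
    rw [h1, setLIntegral_map hs hbm (measurable_fin b n),
      D.wm_apply _ _ _ (measurable_fin b n hs)]
    refine lintegral_congr fun ω => ?_
    exact D.dependsOn_bf β b e fun l hl => hext_fin ω l hl
  have hc0 : ENNReal.ofReal (D.zc β ^ n) ≠ 0 := (ENNReal.ofReal_pos.2 (by positivity)).ne'
  refine Measure.ext fun s hs => ?_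
  rw [Measure.map_apply (measurable_fin b n) hs, Gm_apply]
  unfold finiteGibbs partitionFn
  rw [Measure.smul_apply, withDensity_apply _ hs, key s hs, smul_eq_mul]
  have hu := key univ .univ
  rw [Measure.restrict_univ, preimage_univ] at hu
  rw [hu, ENNReal.mul_inv (Or.inl hc0) (Or.inl ENNReal.ofReal_ne_top), mul_mul_mul_comm,
    ENNReal.inv_mul_cancel hc0 ENNReal.ofReal_ne_top, one_mul]

end Model

/-! ### Decoupling of tilted product measures -/

section Decouple

variable {ι Y : Type}

lemma dependsOn_indicator {Λ : Set ι} {B : Set (ι → Y)} (hB : DependsOn (fun ω => ω ∈ B) Λ)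
    {f : (ι → Y) → ℝ≥0∞} (hf : DependsOn f Λ) : DependsOn (B.indicator f) Λ := by
  classical
  intro ω ω' h
  have h1 : (ω ∈ B) = (ω' ∈ B) := hB h
  simp only [indicator, h1, hf h]

variable [MeasurableSpace Y] (π : Measure Y) [IsProbabilityMeasure π]

lemma setLIntegral_mul_of_dependsOn {Λ : Set ι} {B S : Set (ι → Y)} (hB : MeasurableSet B)
    (hS : MeasurableSet S) (hBd : DependsOn (fun ω => ω ∈ B) Λ)
    (hSd : DependsOn (fun ω => ω ∈ S) Λᶜ) {f g : (ι → Y) → ℝ≥0∞} (hf : Measurable f)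
    (hg : Measurable g) (hfd : DependsOn f Λ) (hgd : DependsOn g Λᶜ) :
    ∫⁻ ω in B ∩ S, f ω * g ω ∂(prodMeas ι π) =
      (∫⁻ ω in B, f ω ∂(prodMeas ι π)) * ∫⁻ ω in S, g ω ∂(prodMeas ι π) := by
  rw [← lintegral_indicator (hB.inter hS), ← lintegral_indicator hB, ← lintegral_indicator hS,
    ← lintegral_mul_of_dependsOn π (hf.indicator hB) (hg.indicator hS)
      (dependsOn_indicator hBd hfd) (dependsOn_indicator hSd hgd)]
  exact lintegral_congr fun ω => inter_indicator_mul f g ω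

/-- If the Hamiltonian nearly splits on `S`, then tilted probabilities of events in `Λ` are
comparable to those for the Hamiltonian inside `Λ`. -/
lemma setLIntegral_decouple {Λ : Set ι} {H Hin Hout : (ι → Y) → ℝ} (hin : Measurable Hin)
    (hout : Measurable Hout) (hind : DependsOn Hin Λ) (houtd : DependsOn Hout Λᶜ)
    {B B' S : Set (ι → Y)} (hB : MeasurableSet B) (hB' : MeasurableSet B') (hS : MeasurableSet S)
    (hBd : DependsOn (fun ω => ω ∈ B) Λ) (hBd' : DependsOn (fun ω => ω ∈ B') Λ)
    (hSd : DependsOn (fun ω => ω ∈ S) Λᶜ) {C η : ℝ}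
    (h : ∀ ω ∈ S, ω ∈ B ∪ B' → |H ω - Hin ω - Hout ω - C| ≤ η) :
    (∫⁻ ω in B ∩ S, ENNReal.ofReal (Real.exp (-H ω)) ∂(prodMeas ι π)) *
        (∫⁻ ω in B', ENNReal.ofReal (Real.exp (-Hin ω)) ∂(prodMeas ι π)) ≤
      ENNReal.ofReal (Real.exp (2 * η)) *
        ((∫⁻ ω in B, ENNReal.ofReal (Real.exp (-Hin ω)) ∂(prodMeas ι π)) *
          ∫⁻ ω in B' ∩ S, ENNReal.ofReal (Real.exp (-H ω)) ∂(prodMeas ι π)) := by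
  set f : (ι → Y) → ℝ≥0∞ := fun ω => ENNReal.ofReal (Real.exp (-Hin ω)) with hf
  set g : (ι → Y) → ℝ≥0∞ := fun ω => ENNReal.ofReal (Real.exp (-Hout ω)) with hg
  set k : (ι → Y) → ℝ≥0∞ := fun ω => ENNReal.ofReal (Real.exp (-H ω)) with hk
  have hfm : Measurable f := (Real.measurable_exp.comp hin.neg).ennreal_ofReal
  have hgm : Measurable g := (Real.measurable_exp.comp hout.neg).ennreal_ofReal
  have hfd : DependsOn f Λ := fun ω ω' hω => by simp only [hf, hind hω]
  have hgd : DependsOn g Λᶜ := fun ω ω' hω => by simp only [hg, houtd hω]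
  -- On the decoupling event the tilted integral factorizes up to `exp η`. The constant `C` and the
  -- outer integral are common to this upper bound for `B` and the lower bound for `B'`, so they
  -- cancel in the comparison.
  have h1 : ∫⁻ ω in B ∩ S, k ω ∂(prodMeas ι π) ≤ ENNReal.ofReal (Real.exp (η - C)) *
      ((∫⁻ ω in B, f ω ∂(prodMeas ι π)) * ∫⁻ ω in S, g ω ∂(prodMeas ι π)) := by
    rw [← setLIntegral_mul_of_dependsOn π hB hS hBd hSd hfm hgm hfd hgd,
      ← lintegral_const_mul' _ _ ENNReal.ofReal_ne_top]
    refine setLIntegral_mono' (hB.inter hS) fun ω hω => ?_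
    simp only [hf, hg, hk]
    rw [← ENNReal.ofReal_mul (Real.exp_pos _).le, ← ENNReal.ofReal_mul (Real.exp_pos _).le,
      ← Real.exp_add, ← Real.exp_add]
    refine ENNReal.ofReal_le_ofReal (Real.exp_le_exp.2 ?_)
    linarith [(abs_le.1 (h ω hω.2 (Or.inl hω.1))).1]
  have h2 : ENNReal.ofReal (Real.exp (-η - C)) *
      ((∫⁻ ω in B', f ω ∂(prodMeas ι π)) * ∫⁻ ω in S, g ω ∂(prodMeas ι π)) ≤
        ∫⁻ ω in B' ∩ S, k ω ∂(prodMeas ι π) := by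
    rw [← setLIntegral_mul_of_dependsOn π hB' hS hBd' hSd hfm hgm hfd hgd,
      ← lintegral_const_mul' _ _ ENNReal.ofReal_ne_top]
    refine setLIntegral_mono' (hB'.inter hS) fun ω hω => ?_
    simp only [hf, hg, hk]
    rw [← ENNReal.ofReal_mul (Real.exp_pos _).le, ← ENNReal.ofReal_mul (Real.exp_pos _).le,
      ← Real.exp_add, ← Real.exp_add]
    refine ENNReal.ofReal_le_ofReal (Real.exp_le_exp.2 ?_)
    linarith [(abs_le.1 (h ω hω.2 (Or.inr hω.1))).2]
  have h3 : ENNReal.ofReal (Real.exp (2 * η)) * ENNReal.ofReal (Real.exp (-η - C)) =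
      ENNReal.ofReal (Real.exp (η - C)) := by
    rw [← ENNReal.ofReal_mul (Real.exp_pos _).le, ← Real.exp_add]
    congr 2
    ring
  refine (mul_le_mul_left h1 _).trans ?_
  refine le_trans (le_of_eq ?_) (mul_le_mul_right (mul_le_mul_right h2 _) _)
  rw [← h3]
  ring

end Decouple

namespace Model

variable (D : Model)

lemma V_succ (j : ℤ) (ω : ℤ → RPos) : D.V j (j + 1) ω = 0 := by
  unfold V pairSum
  refine Finset.sum_eq_zero fun i hi => Finset.sum_eq_zero fun k hk => ?_
  rw [Finset.mem_Ico] at hi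
  rw [Finset.mem_Ioc] at hk
  exact if_neg (by omega)

/-- The law of a single spacing is comparable to the reference measure. -/
lemma Gm_site_le {β : ℝ} (hβ : 0 < β) (b e j : ℤ) {A : Set RPos} (hA : MeasurableSet A) :
    D.Gm β b e {ω | ω j ∈ A} ≤ ENNReal.ofReal (Real.exp (4 * (β * D.K))) * D.ref β A := by
  set B : Set (ℤ → RPos) := {ω | ω j ∈ A} with hB
  have hBm : MeasurableSet B := measurable_pi_apply j hA
  have hBd : DependsOn (fun ω : ℤ → RPos => ω ∈ B) (Set.Ico j (j + 1)) := by
    intro ω ω' h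
    have := h j ⟨le_rfl, by omega⟩
    simp only [hB, Set.mem_ofPred_eq, this]
  -- The two cuts at `j` and `j + 1` remove an interaction of at most `2 * K`; if `j` is not a label
  -- of the chain, nothing has to be removed.
  obtain ⟨Vo, hVo, hVod, hVo2⟩ : ∃ Vo : (ℤ → RPos) → ℝ, Measurable Vo ∧
      DependsOn Vo (Set.Ico j (j + 1))ᶜ ∧ ∀ ω, |D.V b e ω - Vo ω| ≤ 2 * D.K := by
    have hK := D.K_nonneg
    by_cases hj : b ≤ j ∧ j < e
    · refine ⟨fun ω => D.V b j ω + D.V (j + 1) e ω, (D.measurable_V _ _).add (D.measurable_V _ _),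
        fun ω ω' h => ?_, fun ω => ?_⟩
      · beta_reduce
        rw [D.dependsOn_V b j fun l hl => h l fun hl' => by simp only [Set.mem_Ico] at hl hl'; omega,
          D.dependsOn_V (j + 1) e fun l hl => h l fun hl' => by
            simp only [Set.mem_Ico] at hl hl'; omega]
      · have h1 := D.V_split hj.1 hj.2.le ω
        have h2 := D.V_split (by omega : j ≤ j + 1) (by omega : j + 1 ≤ e) ω
        have h3 := D.V_succ j ω
        have h4 := abs_le.1 (D.abs_cross_clip_le b j e ω)
        have h5 := abs_le.1 (D.abs_cross_clip_le j (j + 1) e ω)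
        rw [abs_le]
        constructor <;> linarith [h4.1, h4.2, h5.1, h5.2]
    · refine ⟨D.V b e, D.measurable_V _ _, fun ω ω' h => D.dependsOn_V b e fun l hl =>
        h l fun hl' => hj ?_, fun ω => by simpa using hK⟩
      simp only [Set.mem_Ico] at hl hl'
      omega
  have key := setLIntegral_decouple (D.ref β) (H := fun ω => β * D.V b e ω) (Hin := fun _ => 0)
    (Hout := fun ω => β * Vo ω) (Λ := Set.Ico j (j + 1)) (B := B) (B' := univ) (S := univ) (C := 0)
    (η := β * (2 * D.K)) measurable_const (hVo.const_mul β) (fun _ _ _ => rfl)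
    (fun ω ω' h => by simp only [hVod h]) hBm .univ .univ hBd (fun _ _ _ => rfl) (fun _ _ _ => rfl)
    (fun ω _ _ => by
      rw [sub_zero, sub_zero, ← mul_sub, abs_mul, abs_of_pos hβ]
      exact mul_le_mul_of_nonneg_left (hVo2 ω) hβ.le)
  have hP : D.Pref β B = D.ref β A := by
    have := (measurePreserving_eval_infinitePi (fun _ : ℤ => D.ref β) j).measure_preimage
      hA.nullMeasurableSet
    exact this
  simp only [inter_univ, neg_zero, Real.exp_zero, ENNReal.ofReal_one, Measure.restrict_univ,
    lintegral_const, measure_univ, mul_one, one_mul, Measure.restrict_apply_univ] at key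
  rw [Gm_apply, D.wm_apply _ _ _ hBm]
  have hu : D.wm β b e univ = ∫⁻ ω, ENNReal.ofReal (Real.exp (-(β * D.V b e ω))) ∂(D.Pref β) := by
    rw [D.wm_apply _ _ _ .univ, Measure.restrict_univ]
    rfl
  rw [← hu, show 2 * (β * (2 * D.K)) = 4 * (β * D.K) by ring] at key
  refine (mul_le_mul_right key _).trans (le_of_eq ?_)
  change _ * (_ * (D.Pref β B * _)) = _
  rw [hP]
  calc (D.wm β b e univ)⁻¹ * (ENNReal.ofReal (Real.exp (4 * (β * D.K))) *
        (D.ref β A * D.wm β b e univ)) = ((D.wm β b e univ)⁻¹ * D.wm β b e univ) *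
        (ENNReal.ofReal (Real.exp (4 * (β * D.K))) * D.ref β A) := by ring
    _ = _ := by rw [ENNReal.inv_mul_cancel (D.wm_univ_ne_zero β b e) (D.wm_univ_ne_top β b e),
        one_mul]

/-! ### Existence of the thermodynamic limit -/

lemma exists_integral_Gm_le (σ : Bool) {β : ℝ} (hβ : 0 < β) (F : (ℤ → RPos) →ᵇ ℝ) {N₀ : ℕ}
    (hFd : DependsOn F (Set.Ico (lo σ N₀) (N₀ : ℤ))) {δ : ℝ} (hδ : 0 < δ) :
    ∃ N, ∀ b e b' e', Adm σ N b e → Adm σ N b' e' →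
      ∫ ω, F ω ∂(D.Gm β b e) ≤ ∫ ω, F ω ∂(D.Gm β b' e') + δ := by
  set c : ℝ := 2 * ‖F‖ + 1 with hc
  have hc0 : 0 < c := by positivity
  set G : (ℤ → RPos) → ℝ := fun ω => (F ω + ‖F‖) / c with hG
  have hGm : Measurable G := (F.continuous.measurable.add_const _).div_const _
  have hG01 : ∀ ω, G ω ∈ Icc (0 : ℝ) 1 := by
    intro ω
    have h1 := abs_le.1 (F.norm_coe_le_norm ω)
    refine ⟨div_nonneg (by linarith [h1.1]) hc0.le, (div_le_one hc0).2 ?_⟩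
    rw [hc]
    linarith [h1.2]
  obtain ⟨N, hN⟩ := D.exists_avg_V_le σ hβ (D.ref β) (N₀ := N₀) hGm hG01
    (fun ω ω' h => by simp only [hG, hFd h]) (div_pos hδ hc0)
  refine ⟨N, fun b e b' e' h h' => ?_⟩
  have h1 := hN b e b' e' h h'
  rw [← integral_Gm, ← integral_Gm] at h1
  have h2 : ∀ b e, ∫ ω, G ω ∂(D.Gm β b e) = (∫ ω, F ω ∂(D.Gm β b e) + ‖F‖) / c := by
    intro b e
    simp only [hG]
    rw [integral_div, integral_add (F.integrable _) (integrable_const _)]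
    simp
  rw [h2, h2, ← add_div, div_le_div_iff_of_pos_right hc0] at h1
  linarith

lemma exists_compact_ref (β : ℝ) {ε : ℝ≥0∞} (hε : 0 < ε) :
    ∃ A : Set RPos, IsCompact A ∧ D.ref β Aᶜ ≤ ε := by
  have : PolishSpace RPos := (isOpen_Ioi (a := (0 : ℝ))).polishSpace
  have h := isTightMeasureSet_singleton (μ := D.ref β)
  rw [isTightMeasureSet_iff_exists_isCompact_measure_compl_le] at h
  obtain ⟨A, hA, h⟩ := h ε hε
  exact ⟨A, hA, h _ rfl⟩

/-- `Gm_site_le` bounds every one-site marginal by a multiple of the reference measure, uniformly in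
the chain; a product of compact sets with summable exceptional masses then works for all chains. -/
lemma isTight_Gm {β : ℝ} (hβ : 0 < β) :
    IsTightMeasureSet {μ : Measure (ℤ → RPos) | ∃ b e, μ = D.Gm β b e} := by
  rw [isTightMeasureSet_iff_exists_isCompact_measure_compl_le]
  intro ε hε
  obtain ⟨δ, hδ, hsum⟩ := ENNReal.exists_pos_sum_of_countable' hε.ne' ℤ
  set q := ENNReal.ofReal (Real.exp (4 * (β * D.K))) with hq
  have hq0 : q ≠ 0 := (ENNReal.ofReal_pos.2 (Real.exp_pos _)).ne'
  choose A hA hAδ using fun j => D.exists_compact_ref β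
    (ENNReal.div_pos (hδ j).ne' (ENNReal.ofReal_ne_top : q ≠ ⊤))
  refine ⟨Set.univ.pi A, isCompact_univ_pi hA, ?_⟩
  rintro _ ⟨b, e, rfl⟩
  have hsub : (Set.univ.pi A)ᶜ ⊆ ⋃ j : ℤ, {ω : ℤ → RPos | ω j ∈ (A j)ᶜ} := by
    intro ω hω
    simp only [mem_compl_iff, Set.mem_pi, mem_univ, forall_true_left, not_forall] at hω
    obtain ⟨j, hj⟩ := hω
    exact mem_iUnion.2 ⟨j, hj⟩
  refine (measure_mono hsub).trans ((measure_iUnion_le _).trans (le_trans ?_ hsum.le))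
  refine ENNReal.tsum_le_tsum fun j => ?_
  refine (D.Gm_site_le hβ b e j (hA j).measurableSet.compl).trans ?_
  refine (mul_le_mul_right (hAδ j) _).trans ?_
  rw [← hq, ENNReal.mul_div_cancel hq0 ENNReal.ofReal_ne_top]

/-- Tightness provides a cluster point. Since local expectations hardly depend on the ends of the
chain, convergence to this cluster point holds along all admissible chains, not just a subsequence.
-/
lemma exists_limit (σ : Bool) {β : ℝ} (hβ : 0 < β) : ∃ P : Measure (ℤ → RPos),
    IsProbabilityMeasure P ∧ ∀ (F : (ℤ → RPos) →ᵇ ℝ) (N₀ : ℕ),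
      DependsOn F (Set.Ico (lo σ N₀) (N₀ : ℤ)) → ∀ δ > 0, ∃ N, ∀ b e, Adm σ N b e →
        |∫ ω, F ω ∂(D.Gm β b e) - ∫ ω, F ω ∂P| ≤ δ := by
  set Q : ℕ → ProbabilityMeasure (ℤ → RPos) := fun n => ⟨D.Gm β (lo σ n) n, inferInstance⟩ with hQ
  have hadm : ∀ n, Adm σ n (lo σ n) n := fun n => by
    refine ⟨?_, le_rfl⟩
    cases σ <;> simp [lo]
  have hT : IsTightMeasureSet {((μ : ProbabilityMeasure (ℤ → RPos)) : Measure (ℤ → RPos)) |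
      μ ∈ range Q} := by
    refine (D.isTight_Gm hβ).subset ?_
    rintro _ ⟨_, ⟨n, rfl⟩, rfl⟩
    exact ⟨_, _, rfl⟩
  obtain ⟨P, -, hP⟩ := (isCompact_closure_of_isTightMeasureSet hT).exists_mapClusterPt
    (f := atTop) (u := Q) (by
      rw [le_principal_iff, mem_map]
      exact Eventually.of_forall fun n => subset_closure ⟨n, rfl⟩)
  refine ⟨P, inferInstance, fun F N₀ hF δ hδ => ?_⟩
  obtain ⟨N, hN⟩ := D.exists_integral_Gm_le σ hβ F hF (half_pos hδ)
  refine ⟨N, fun b e h => ?_⟩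
  have hc := hP.continuousAt_comp
    (ProbabilityMeasure.continuous_integral_boundedContinuousFunction F).continuousAt
  have hfr := (mapClusterPt_iff_frequently.1 hc _ (Metric.ball_mem_nhds _ (half_pos hδ)))
  obtain ⟨n, hn, hnN⟩ := (hfr.and_eventually (eventually_ge_atTop N)).exists
  have h1 := abs_lt.1 (mem_ball_iff_norm.1 hn)
  have h2 := hN b e _ _ h ((hadm n).mono hnN)
  have h3 := hN _ _ b e ((hadm n).mono hnN) h
  have h4 : (∫ ω, F ω ∂(Q n : Measure (ℤ → RPos))) = ∫ ω, F ω ∂(D.Gm β (lo σ n) n) := rfl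
  simp only [Function.comp, h4] at h1
  rw [abs_le]
  constructor <;> linarith [h1.1, h1.2]

end Model

lemma aestronglyMeasurable_comp {ι κ : Type} [Countable ι] (f : (κ → RPos) →ᵇ ℝ) (j : κ → ι)
    (P : Measure (ι → RPos)) : AEStronglyMeasurable (fun ω => f fun i => ω (j i)) P :=
  (f.continuous.comp (continuous_pi fun i => continuous_apply (j i))).aestronglyMeasurable

/-- Probability measures on sequences are determined by their finite dimensional marginals. -/
lemma ext_of_forall_integral_restrict {ι : Type} {P P' : Measure (ι → RPos)}
    [IsProbabilityMeasure P] [IsProbabilityMeasure P']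
    (h : ∀ (I : Finset ι) (f : (I → RPos) →ᵇ ℝ),
      ∫ ω, f (fun i => ω i) ∂P = ∫ ω, f (fun i => ω i) ∂P') : P = P' := by
  have hm : ∀ I : Finset ι, Measurable (I.restrict : (ι → RPos) → (I → RPos)) :=
    fun I => I.measurable_restrict
  have : ∀ I : Finset ι, IsProbabilityMeasure (P'.map (I.restrict : (ι → RPos) → (I → RPos))) :=
    fun I => Measure.isProbabilityMeasure_map (hm I).aemeasurable
  have : ∀ I : Finset ι, IsProbabilityMeasure (P.map (I.restrict : (ι → RPos) → (I → RPos))) :=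
    fun I => Measure.isProbabilityMeasure_map (hm I).aemeasurable
  refine IsProjectiveLimit.unique (P := fun I => P'.map I.restrict) (fun I => ?_) fun I => rfl
  refine ext_of_forall_integral_eq_of_IsFiniteMeasure fun f => ?_
  rw [integral_map (hm I).aemeasurable f.continuous.aestronglyMeasurable,
    integral_map (hm I).aemeasurable f.continuous.aestronglyMeasurable]
  exact h I f

namespace Model

variable (D : Model)

/-! ### The infinite volume Gibbs measures -/

/-- The thermodynamic limit of the chains with labels in `[lo σ n, n]`. -/
def lim (σ : Bool) (β : ℝ) : Measure (ℤ → RPos) :=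
  if h : 0 < β then (D.exists_limit σ h).choose else D.Pref β

lemma lim_spec (σ : Bool) {β : ℝ} (hβ : 0 < β) : IsProbabilityMeasure (D.lim σ β) ∧
    ∀ (F : (ℤ → RPos) →ᵇ ℝ) (N₀ : ℕ), DependsOn F (Set.Ico (lo σ N₀) (N₀ : ℤ)) →
      ∀ δ > 0, ∃ N, ∀ b e, Adm σ N b e →
        |∫ ω, F ω ∂(D.Gm β b e) - ∫ ω, F ω ∂(D.lim σ β)| ≤ δ := by
  unfold lim
  rw [dif_pos hβ]
  exact (D.exists_limit σ hβ).choose_spec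

instance (σ : Bool) (β : ℝ) : IsProbabilityMeasure (D.lim σ β) := by
  by_cases h : 0 < β
  · exact (D.lim_spec σ h).1
  · unfold lim
    rw [dif_neg h]
    infer_instance

lemma tendsto_lim {σ : Bool} {β : ℝ} (hβ : 0 < β) (F : (ℤ → RPos) →ᵇ ℝ) {N₀ : ℕ}
    (hF : DependsOn F (Set.Ico (lo σ N₀) (N₀ : ℤ))) {b e : ℕ → ℤ}
    (hA : ∀ N, ∀ᶠ n in atTop, Adm σ N (b n) (e n)) :
    Tendsto (fun n => ∫ ω, F ω ∂(D.Gm β (b n) (e n))) atTop (𝓝 (∫ ω, F ω ∂(D.lim σ β))) := by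
  rw [Metric.tendsto_atTop']
  intro δ hδ
  obtain ⟨N, hN⟩ := (D.lim_spec σ hβ).2 F N₀ hF (δ / 2) (half_pos hδ)
  obtain ⟨n₀, h⟩ := eventually_atTop.1 (hA N)
  refine ⟨n₀, fun n hn => ?_⟩
  rw [Real.dist_eq]
  exact (hN _ _ (h n hn.le)).trans_lt (half_lt_self hδ)

lemma adm_lo (σ : Bool) (n : ℕ) : Adm σ n (lo σ n) n := by
  refine ⟨?_, le_rfl⟩
  cases σ <;> simp [lo]

lemma eventually_adm_lo (σ : Bool) (N : ℕ) : ∀ᶠ n : ℕ in atTop, Adm σ N (lo σ n) n := by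
  filter_upwards [eventually_ge_atTop N] with n hn using (adm_lo σ n).mono hn

/-- Bounded continuous functions of finitely many spacings. -/
def windowFun {κ : Type} (j : κ → ℤ) (f : (κ → RPos) →ᵇ ℝ) : (ℤ → RPos) →ᵇ ℝ :=
  f.compContinuous ⟨fun ω i => ω (j i), continuous_pi fun i => continuous_apply (j i)⟩

lemma windowFun_apply {κ : Type} (j : κ → ℤ) (f : (κ → RPos) →ᵇ ℝ) (ω : ℤ → RPos) :
    windowFun j f ω = f fun i => ω (j i) := rfl

lemma dependsOn_windowFun {κ : Type} {j : κ → ℤ} (f : (κ → RPos) →ᵇ ℝ) {Λ : Set ℤ}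
    (h : ∀ i, j i ∈ Λ) : DependsOn (windowFun j f) Λ := fun ω ω' hω => by
  rw [windowFun_apply, windowFun_apply]
  congr 1
  funext i
  exact hω _ (h i)

lemma measurable_window (n i k : ℕ) : Measurable (window n i k) := by
  refine measurable_pi_iff.2 fun j => ?_
  unfold window
  split_ifs
  exacts [measurable_pi_apply _, measurable_const]

lemma integral_finiteGibbs {β : ℝ} (hβ : 0 < β) {n i k : ℕ} (hk : i + k ≤ n) (b : ℤ)
    (f : (Fin k → RPos) →ᵇ ℝ) :
    ∫ z, f (window n i k z) ∂(finiteGibbs D.v D.rhc D.m D.p β n) =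
      ∫ ω, windowFun (fun l : Fin k => b + i + l) f ω ∂(D.Gm β b (b + n)) := by
  rw [D.finiteGibbs_eq_map hβ b n, integral_map (measurable_fin b n).aemeasurable
    (f := fun z => f (window n i k z))
    (f.continuous.measurable.comp (measurable_window n i k)).aestronglyMeasurable]
  refine integral_congr_ae (ae_of_all _ fun ω => ?_)
  simp only [windowFun_apply]
  congr 1
  funext j
  unfold window fin
  rw [dif_pos (by omega)]
  simp only
  congr 1
  push_cast
  ring

/-- The surface Gibbs measure. -/
def surfaceGibbs (β : ℝ) : Measure (ℕ → RPos) := (D.lim false β).map fun ω k => ω k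

lemma measurable_nat : Measurable fun (ω : ℤ → RPos) (k : ℕ) => ω k :=
  measurable_pi_iff.2 fun k => measurable_pi_apply (k : ℤ)

instance (β : ℝ) : IsProbabilityMeasure (D.surfaceGibbs β) :=
  Measure.isProbabilityMeasure_map measurable_nat.aemeasurable

lemma isSurfaceGibbs {β : ℝ} (hβ : 0 < β) :
    IsSurfaceGibbs D.v D.rhc D.m D.p β (D.surfaceGibbs β) := by
  refine ⟨inferInstance, fun k f => ?_⟩
  have h1 := D.tendsto_lim (σ := false) hβ (windowFun (fun l : Fin k => (l : ℤ)) f) (N₀ := k)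
    (dependsOn_windowFun f fun i => by simp [lo])
    (eventually_adm_lo false)
  have h2 : ∫ z, f (fun j : Fin k => z (j : ℕ)) ∂(D.surfaceGibbs β) =
      ∫ ω, windowFun (fun l : Fin k => (l : ℤ)) f ω ∂(D.lim false β) := by
    unfold surfaceGibbs
    rw [integral_map measurable_nat.aemeasurable (aestronglyMeasurable_comp f _ _)]
    rfl
  rw [h2]
  refine h1.congr' ?_
  filter_upwards [eventually_ge_atTop k] with n hn
  rw [D.integral_finiteGibbs hβ (by omega) 0]
  simp [lo]

lemma surfaceGibbs_unique {v : ℝ → ℝ} {rhc : ℝ} {m : ℕ∞} {p β : ℝ} {ν ν' : Measure (ℕ → RPos)}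
    (h : IsSurfaceGibbs v rhc m p β ν) (h' : IsSurfaceGibbs v rhc m p β ν') : ν = ν' := by
  have := h.isProb
  have := h'.isProb
  refine ext_of_forall_integral_restrict fun I f => ?_
  obtain ⟨k, hk⟩ := I.bddAbove
  set g : (Fin (k + 1) → RPos) →ᵇ ℝ := f.compContinuous
    ⟨fun y (i : I) => y ⟨i, Nat.lt_succ_of_le (hk i.2)⟩, continuous_pi fun i => continuous_apply _⟩
  exact tendsto_nhds_unique (h.limit (k + 1) g) (h'.limit (k + 1) g)

lemma measurePreserving_shift {μ : Measure (ℤ → RPos)}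
    (h : MeasurePreserving (fun (z : ℤ → RPos) (j : ℤ) => z (j + 1)) μ μ) (q : ℕ) :
    MeasurePreserving (fun (z : ℤ → RPos) (j : ℤ) => z (j + q)) μ μ := by
  induction q with
  | zero =>
    simp only [Nat.cast_zero, add_zero]
    exact MeasurePreserving.id μ
  | succ q ih =>
    have := h.comp ih
    convert this using 1
    funext z j
    simp only [Function.comp]
    congr 1
    push_cast
    ring

/-- The limit property determines only windows starting at label 1; shift invariance moves every
finite window there. -/
lemma bulkGibbs_unique {v : ℝ → ℝ} {rhc : ℝ} {m : ℕ∞} {p β : ℝ} {μ μ' : Measure (ℤ → RPos)}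
    (h : IsBulkGibbs v rhc m p β μ) (h' : IsBulkGibbs v rhc m p β μ') : μ = μ' := by
  have := h.isProb
  have := h'.isProb
  refine ext_of_forall_integral_restrict fun I f => ?_
  obtain ⟨T, hT⟩ := (I.image Int.natAbs).bddAbove
  have hT' : ∀ l ∈ I, l.natAbs ≤ T := fun l hl => hT (Finset.mem_coe.2 (Finset.mem_image_of_mem _ hl))
  set g : (Fin (2 * T + 1) → RPos) →ᵇ ℝ := f.compContinuous
    ⟨fun y (i : I) => y ⟨((i : ℤ) + T).toNat, by have := hT' i i.2; omega⟩,
      continuous_pi fun i => continuous_apply _⟩ with hg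
  have hlim := fun {μ : Measure (ℤ → RPos)} (h : IsBulkGibbs v rhc m p β μ) =>
    h.limit (fun n => n / 2) (Nat.tendsto_div_const_atTop two_ne_zero)
      (tendsto_atTop_atTop.2 fun N => ⟨2 * N, fun n hn => by omega⟩) (2 * T + 1) g
  have hsh : ∀ {μ : Measure (ℤ → RPos)}, IsBulkGibbs v rhc m p β μ →
      ∫ ω, f (fun i => ω i) ∂μ = ∫ z, g (fun j => z ((j : ℤ) + 1)) ∂μ := by
    intro μ h
    have h1 := measurePreserving_shift h.shift_invariant (T + 1)
    conv_lhs => rw [← h1.map_eq]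
    rw [integral_map h1.measurable.aemeasurable (aestronglyMeasurable_comp f _ _)]
    refine integral_congr_ae (ae_of_all _ fun z => ?_)
    simp only [hg, BoundedContinuousFunction.compContinuous_apply, ContinuousMap.coe_mk]
    congr 1
    funext i
    congr 1
    have := hT' i i.2
    push_cast
    rw [Int.toNat_of_nonneg (by omega)]
    ring
  rw [hsh h, hsh h']
  exact tendsto_nhds_unique (hlim h) (hlim h')

lemma isBulkGibbs {β : ℝ} (hβ : 0 < β) : IsBulkGibbs D.v D.rhc D.m D.p β (D.lim true β) := by
  have hsm : Measurable fun (z : ℤ → RPos) (j : ℤ) => z (j + 1) :=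
    measurable_pi_iff.2 fun j => measurable_pi_apply _
  refine ⟨inferInstance, ⟨hsm, ?_⟩, fun i hi hi' k f => ?_⟩
  · have := Measure.isProbabilityMeasure_map (μ := D.lim true β) hsm.aemeasurable
    refine ext_of_forall_integral_restrict fun I f => ?_
    rw [integral_map hsm.aemeasurable (aestronglyMeasurable_comp f _ _)]
    obtain ⟨T, hT⟩ := (I.image Int.natAbs).bddAbove
    have hT' : ∀ l ∈ I, l.natAbs ≤ T :=
      fun l hl => hT (Finset.mem_coe.2 (Finset.mem_image_of_mem _ hl))
    -- Shift invariance: the chains on `[-n, n)` and on `[1 - n, n + 1)` are relabellings of the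
    -- same finite chain, and both converge to `lim`.
    have h1 := D.tendsto_lim (σ := true) hβ (windowFun (fun l : I => (l : ℤ)) f) (N₀ := T + 2)
      (dependsOn_windowFun f fun i => by
        have := hT' i i.2
        simp only [lo, if_true, Set.mem_Ico]
        push_cast
        omega) (b := fun n => -(n : ℤ)) (e := fun n => -(n : ℤ) + (2 * n : ℕ)) fun N => by
          filter_upwards [eventually_ge_atTop N] with n hn
          simp only [Adm, lo, if_true]
          omega
    have h2 := D.tendsto_lim (σ := true) hβ (windowFun (fun l : I => (l : ℤ) + 1) f) (N₀ := T + 2)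
      (dependsOn_windowFun f fun i => by
        have := hT' i i.2
        simp only [lo, if_true, Set.mem_Ico]
        push_cast
        omega) (b := fun n => -(n : ℤ) + 1) (e := fun n => -(n : ℤ) + 1 + (2 * n : ℕ)) fun N => by
          filter_upwards [eventually_ge_atTop (N + 1)] with n hn
          simp only [Adm, lo, if_true]
          omega
    refine tendsto_nhds_unique h2 (h1.congr' ?_)
    filter_upwards [eventually_ge_atTop (T + 1)] with n hn
    have hfin : ∀ i : I, ((i : ℤ) + n).toNat < 2 * n := fun i => by have := hT' i i.2; omega
    set g : (Fin (2 * n) → RPos) →ᵇ ℝ := f.compContinuous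
      ⟨fun y (i : I) => y ⟨((i : ℤ) + n).toNat, hfin i⟩, continuous_pi fun i => continuous_apply _⟩
      with hg
    have h3 := D.integral_finiteGibbs hβ (n := 2 * n) (i := 0) (k := 2 * n) (by omega) (-(n : ℤ)) g
    rw [D.integral_finiteGibbs hβ (n := 2 * n) (i := 0) (k := 2 * n) (by omega) (-(n : ℤ) + 1) g]
      at h3
    convert h3.symm using 3 with ω ω
    · simp only [windowFun_apply, hg, BoundedContinuousFunction.compContinuous_apply,
        ContinuousMap.coe_mk]
      congr 1
      funext i
      congr 1
      have := hT' i i.2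
      rw [Int.toNat_of_nonneg (by omega)]
      simp
    · simp only [windowFun_apply, hg, BoundedContinuousFunction.compContinuous_apply,
        ContinuousMap.coe_mk]
      congr 1
      funext i
      congr 1
      have := hT' i i.2
      rw [Int.toNat_of_nonneg (by omega)]
      simp
      ring
  -- The left end `1 - i n` is chosen so that the window after the first `i n` spacings occupies the
  -- labels `1, …, k`; both ends then move to infinity.
  · have h1 := D.tendsto_lim (σ := true) hβ (windowFun (fun l : Fin k => (l : ℤ) + 1) f)
      (N₀ := k + 1) (dependsOn_windowFun f fun i => by
        simp only [lo, if_true, Set.mem_Ico]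
        push_cast
        omega) (b := fun n => 1 - (i n : ℤ)) (e := fun n => 1 - (i n : ℤ) + n) fun N => by
          filter_upwards [hi.eventually_ge_atTop (N + 1), hi'.eventually_ge_atTop (N + 1)]
            with n hn hn'
          simp only [Adm, lo, if_true]
          omega
    refine h1.congr' ?_
    filter_upwards [hi'.eventually_ge_atTop (k + 1)] with n hn
    rw [D.integral_finiteGibbs hβ (by omega) (1 - (i n : ℤ))]
    congr 3
    funext j
    ring_nf

/-! ### Passing to the limit in probabilities of local events -/

/-- The law of the spacings in `Λ`, all other spacings being set to `1`. -/
def localLaw (P : Measure (ℤ → RPos)) [IsProbabilityMeasure P] (Λ : Set ℤ) :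
    ProbabilityMeasure (ℤ → RPos) :=
  ⟨P.map fun ω => spl Λ ω fun _ => ⟨1, mem_Ioi.2 one_pos⟩,
    Measure.isProbabilityMeasure_map (measurable_spl_left Λ _).aemeasurable⟩

lemma coe_localLaw (P : Measure (ℤ → RPos)) [IsProbabilityMeasure P] (Λ : Set ℤ) :
    (localLaw P Λ : Measure (ℤ → RPos)) =
      P.map fun ω => spl Λ ω fun _ => ⟨1, mem_Ioi.2 one_pos⟩ := rfl

lemma localLaw_apply (P : Measure (ℤ → RPos)) [IsProbabilityMeasure P] {Λ : Set ℤ}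
    {A : Set (ℤ → RPos)} (hA : MeasurableSet A) (hd : DependsOn (fun ω => ω ∈ A) Λ) :
    (localLaw P Λ : Measure (ℤ → RPos)) A = P A := by
  rw [coe_localLaw, Measure.map_apply (measurable_spl_left Λ _) hA]
  congr 1
  ext ω
  exact (hd fun l hl => spl_of_mem hl : (spl Λ ω _ ∈ A) = (ω ∈ A)).to_iff

/-- Freezing the spacings outside a window makes every bounded continuous function local, so
convergence of local expectations becomes weak convergence, to which the portmanteau theorem
applies. -/
lemma tendsto_localLaw {σ : Bool} {β : ℝ} (hβ : 0 < β) (N₀ : ℕ) :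
    Tendsto (fun n : ℕ => localLaw (D.Gm β (lo σ n) n) (Set.Ico (lo σ N₀) (N₀ : ℤ))) atTop
      (𝓝 (localLaw (D.lim σ β) (Set.Ico (lo σ N₀) (N₀ : ℤ)))) := by
  rw [ProbabilityMeasure.tendsto_iff_forall_integral_tendsto]
  intro F
  set Λ : Set ℤ := Set.Ico (lo σ N₀) (N₀ : ℤ) with hΛ
  have hm := measurable_spl_left Λ fun _ => (⟨1, mem_Ioi.2 one_pos⟩ : RPos)
  have hc : Continuous fun ω : ℤ → RPos => spl Λ ω fun _ => ⟨1, mem_Ioi.2 one_pos⟩ := by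
    refine continuous_pi fun l => ?_
    unfold spl
    split_ifs
    exacts [continuous_apply l, continuous_const]
  have h := D.tendsto_lim (σ := σ) hβ (F.compContinuous ⟨_, hc⟩) (N₀ := N₀) (fun ω ω' hω => by
    simp only [BoundedContinuousFunction.compContinuous_apply, ContinuousMap.coe_mk]
    congr 1
    funext l
    by_cases hl : l ∈ Λ
    · rw [spl_of_mem hl, spl_of_mem hl, hω l hl]
    · rw [spl_of_notMem hl, spl_of_notMem hl]) (eventually_adm_lo σ)
  simp only [coe_localLaw]
  rw [integral_map hm.aemeasurable F.continuous.aestronglyMeasurable]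
  refine h.congr fun n => ?_
  rw [integral_map hm.aemeasurable F.continuous.aestronglyMeasurable]
  rfl

lemma lim_le_of_isOpen {σ : Bool} {β : ℝ} (hβ : 0 < β) {N₀ : ℕ} {O : Set (ℤ → RPos)}
    (hO : IsOpen O) (hd : DependsOn (fun ω => ω ∈ O) (Set.Ico (lo σ N₀) (N₀ : ℤ))) {c : ℝ≥0∞}
    (h : ∀ᶠ n : ℕ in atTop, D.Gm β (lo σ n) n O ≤ c) : D.lim σ β O ≤ c := by
  have h1 := ProbabilityMeasure.le_liminf_measure_open_of_tendsto
    (D.tendsto_localLaw (σ := σ) hβ N₀) hO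
  simp only [localLaw_apply _ hO.measurableSet hd] at h1
  exact h1.trans ((liminf_le_liminf h).trans (liminf_const c).le)

lemma le_lim_of_isClosed {σ : Bool} {β : ℝ} (hβ : 0 < β) {N₀ : ℕ} {O : Set (ℤ → RPos)}
    (hO : IsClosed O) (hd : DependsOn (fun ω => ω ∈ O) (Set.Ico (lo σ N₀) (N₀ : ℤ))) {c : ℝ≥0∞}
    (h : ∀ᶠ n : ℕ in atTop, c ≤ D.Gm β (lo σ n) n O) : c ≤ D.lim σ β O := by
  have h1 := ProbabilityMeasure.limsup_measure_closed_le_of_tendsto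
    (D.tendsto_localLaw (σ := σ) hβ N₀) hO
  simp only [localLaw_apply _ hO.measurableSet hd] at h1
  exact ((limsup_const c).ge.trans (limsup_le_limsup h)).trans h1

end Model

/-! ### A criterion for large deviations principles -/

lemma ofReal_exp_le_iff {x y : ℝ} :
    ENNReal.ofReal (Real.exp x) ≤ ENNReal.ofReal (Real.exp y) ↔ x ≤ y := by
  rw [ENNReal.ofReal_le_ofReal_iff (Real.exp_pos y).le, Real.exp_le_exp]

lemma log_ofReal_exp (x : ℝ) : ENNReal.log (ENNReal.ofReal (Real.exp x)) = x := by
  rw [← EReal.exp_coe, EReal.log_exp]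

lemma inv_mul_log_exp {β : ℝ} (hβ : 0 < β) (c : ℝ) :
    ((β⁻¹ : ℝ) : EReal) * ENNReal.log (ENNReal.ofReal (Real.exp (-(β * c)))) = -(c : EReal) := by
  rw [log_ofReal_exp, ← EReal.coe_mul, ← EReal.coe_neg]
  congr 1
  field_simp

lemma inv_mul_log_le {β c : ℝ} (hβ : 0 < β) {q : ℝ≥0∞}
    (h : q ≤ ENNReal.ofReal (Real.exp (-(β * c)))) :
    ((β⁻¹ : ℝ) : EReal) * ENNReal.log q ≤ -(c : EReal) := by
  rw [← inv_mul_log_exp hβ]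
  exact mul_le_mul_of_nonneg_left (ENNReal.log_monotone h) (EReal.coe_nonneg.2 (inv_pos.2 hβ).le)

lemma le_inv_mul_log {β c : ℝ} (hβ : 0 < β) {q : ℝ≥0∞}
    (h : ENNReal.ofReal (Real.exp (-(β * c))) ≤ q) :
    -(c : EReal) ≤ ((β⁻¹ : ℝ) : EReal) * ENNReal.log q := by
  rw [← inv_mul_log_exp hβ]
  exact mul_le_mul_of_nonneg_left (ENNReal.log_monotone h) (EReal.coe_nonneg.2 (inv_pos.2 hβ).le)

/-- Constant prefactors do not matter on the exponential scale. -/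
lemma eventually_const_mul_exp_le {k : ℝ≥0∞} (hk : k ≠ ⊤) {c c' : ℝ} (h : c < c') :
    ∀ᶠ β : ℝ in atTop, k * ENNReal.ofReal (Real.exp (-(β * c'))) ≤
      ENNReal.ofReal (Real.exp (-(β * c))) := by
  have h1 : Tendsto (fun β : ℝ => Real.exp (β * (c' - c))) atTop atTop :=
    Real.tendsto_exp_atTop.comp (tendsto_id.atTop_mul_const (sub_pos.2 h))
  filter_upwards [h1.eventually_ge_atTop k.toReal] with β hβ
  rw [← ENNReal.ofReal_toReal hk, ← ENNReal.ofReal_mul ENNReal.toReal_nonneg]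
  refine ENNReal.ofReal_le_ofReal ?_
  refine (mul_le_mul_of_nonneg_right hβ (Real.exp_pos _).le).trans (le_of_eq ?_)
  rw [← Real.exp_add]
  congr 1
  ring

/-- The global upper bound follows from the local ones by a finite subcover of the compact set given
by exponential tightness. The properties of the rate function need no separate proof: they follow
from consistency of the upper and lower local bounds. -/
lemma goodLDP_of_local {X : Type} [TopologicalSpace X] [T2Space X] [MeasurableSpace X]
    {P : ℝ → Measure X} {I : X → EReal} (hP : ∀ β > 0, P β univ ≤ 1)
    (hU : ∀ x (c : ℝ), (c : EReal) < I x →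
      ∃ U ∈ 𝓝 x, ∀ᶠ β in atTop, P β U ≤ ENNReal.ofReal (Real.exp (-(β * c))))
    (hT : ∀ L : ℝ, ∃ K, IsCompact K ∧
      ∀ᶠ β in atTop, P β Kᶜ ≤ ENNReal.ofReal (Real.exp (-(β * L))))
    (hL : ∀ x (c : ℝ) (O : Set X), I x < c → IsOpen O → x ∈ O →
      ∀ᶠ β in atTop, ENNReal.ofReal (Real.exp (-(β * c))) ≤ P β O) : GoodLDP P I := by
  -- A lower bound with rate `c` and an upper bound with rate `c'` on the same open set are
  -- compatible only if `c' ≤ c`.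
  have hlt : ∀ x (c c' : ℝ) (O : Set X), I x < c → IsOpen O → x ∈ O →
      (∀ᶠ β in atTop, P β O ≤ ENNReal.ofReal (Real.exp (-(β * c')))) → c' ≤ c := by
    intro x c c' O hx hO hxO h
    obtain ⟨β, h1, h2, h3⟩ := ((hL x c O hx hO hxO).and (h.and (eventually_gt_atTop 0))).exists
    have := ofReal_exp_le_iff.1 (h1.trans h2)
    nlinarith
  have hlsc : LowerSemicontinuous I := by
    intro x y hy
    obtain ⟨c, hc, hcx⟩ := EReal.lt_iff_exists_real_btwn.1 hy
    obtain ⟨U, hU, hβ⟩ := hU x c hcx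
    filter_upwards [interior_mem_nhds.2 hU] with x' hx'
    by_contra hcon
    obtain ⟨d, hd, hdc⟩ := EReal.lt_iff_exists_real_btwn.1 ((not_lt.1 hcon).trans_lt hc)
    have h1 := hlt x' d c _ hd isOpen_interior hx'
      (hβ.mono fun β h => (measure_mono interior_subset).trans h)
    exact absurd (EReal.coe_le_coe_iff.2 h1) (not_le.2 hdc)
  refine ⟨fun x => ?_, hlsc, fun c => ?_, fun A hA => ?_, fun O hO => ?_⟩
  · by_contra hcon
    obtain ⟨c, hc, hc0⟩ := EReal.lt_iff_exists_real_btwn.1 (not_le.1 hcon)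
    have h1 := hlt x c 0 univ hc isOpen_univ (mem_univ x) (by
      filter_upwards [eventually_gt_atTop 0] with β hβ
      simpa using hP β hβ)
    exact absurd (EReal.coe_le_coe_iff.2 h1) (not_le.2 hc0)
  -- A point of the level set outside `K` would give the open set `Kᶜ` mass at least `exp (-β (c +
  -- 1))`, while tightness allows only `exp (-β (c + 2))`.
  · obtain ⟨K, hK, h⟩ := hT (c + 2)
    refine hK.of_isClosed_subset (hlsc.isClosed_preimage c) fun x hx => ?_
    by_contra hxK
    have h1 := hlt x (c + 1) (c + 2) Kᶜ
      (lt_of_le_of_lt hx (EReal.coe_lt_coe_iff.2 (by linarith))) hK.isClosed.isOpen_compl hxK h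
    linarith
  · refine EReal.le_of_forall_lt_iff_le.1 fun z hz => ?_
    set c : ℝ := -z with hc
    have hz' : ((c : ℝ) : EReal) < ⨅ x ∈ A, I x := by
      rw [hc, EReal.coe_neg]
      exact EReal.neg_lt_comm.1 hz
    obtain ⟨c', hc1, hc2⟩ := EReal.lt_iff_exists_real_btwn.1 hz'
    have hc1' : c < c' := EReal.coe_lt_coe_iff.1 hc1
    obtain ⟨K, hK, hKβ⟩ := hT c'
    choose! U hUx hUβ using fun x (hx : x ∈ A) => hU x c' (hc2.trans_le (iInf₂_le x hx))
    obtain ⟨t, htA, ht⟩ := (hK.inter_right hA).elim_nhds_subcover U fun x hx => hUx x hx.2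
    have hsub : A ⊆ Kᶜ ∪ ⋃ x ∈ t, U x := by
      intro x hx
      by_cases hxK : x ∈ K
      · exact Or.inr (ht ⟨hxK, hx⟩)
      · exact Or.inl hxK
    have hall : ∀ᶠ β in atTop, ∀ x ∈ t, P β (U x) ≤ ENNReal.ofReal (Real.exp (-(β * c'))) :=
      (Finset.eventually_all t).2 fun x hx => hUβ x (htA x hx).2
    refine limsup_le_of_le ?_ ?_
    · isBoundedDefault
    filter_upwards [hKβ, hall, eventually_gt_atTop 0,
      eventually_const_mul_exp_le (k := 1 + t.card) (by simp) hc1'] with β h1 h2 h3 h4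
    have h5 : P β A ≤ ENNReal.ofReal (Real.exp (-(β * c))) := by
      refine le_trans ?_ h4
      refine (measure_mono hsub).trans ((measure_union_le _ _).trans ?_)
      rw [add_mul, one_mul]
      refine add_le_add h1 ((measure_biUnion_finset_le t U).trans ?_)
      refine (Finset.sum_le_sum h2).trans ?_
      rw [Finset.sum_const, nsmul_eq_mul]
    refine (inv_mul_log_le h3 h5).trans (le_of_eq ?_)
    rw [hc, EReal.coe_neg, neg_neg]
  · rw [EReal.neg_le]
    refine le_iInf₂ fun x hx => ?_
    refine EReal.le_of_forall_lt_iff_le.1 fun c hc => ?_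
    rw [EReal.neg_le]
    refine le_liminf_of_le ?_ ?_
    · isBoundedDefault
    filter_upwards [hL x c O hc hO hx, eventually_gt_atTop 0] with β h1 h2
    exact le_inv_mul_log h2 h1

/-! ### Boxes as local neighbourhoods in the product topology. -/

lemma exists_box_subset {z : ℤ → ℝ} {W : Set (ℤ → ℝ)} (hW : W ∈ 𝓝 z) :
    ∃ T : ℕ, ∃ r > 0, ∀ y, (∀ l, -(T : ℤ) ≤ l → l < T → |y l - z l| < r) → y ∈ W := by
  rw [nhds_pi, Filter.mem_pi] at hW
  obtain ⟨I, hI, t, ht, hsub⟩ := hW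
  have h1 : ∀ᶠ r : ℝ in 𝓝[>] 0, ∀ i ∈ I, Metric.ball (z i) r ⊆ t i := by
    rw [hI.eventually_all]
    intro i _
    obtain ⟨δ, hδ, h⟩ := Metric.mem_nhds_iff.1 (ht i)
    filter_upwards [Ioo_mem_nhdsGT hδ] with r hr
    exact (Metric.ball_subset_ball hr.2.le).trans h
  obtain ⟨r, hr, hr0⟩ := (h1.and self_mem_nhdsWithin).exists
  obtain ⟨T, hT⟩ := (hI.toFinset.image Int.natAbs).bddAbove
  refine ⟨T + 1, r, hr0, fun y hy => hsub fun i hi => hr i hi ?_⟩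
  have : i.natAbs ≤ T :=
    hT (Finset.mem_coe.2 (Finset.mem_image_of_mem _ (hI.mem_toFinset.2 hi)))
  exact hy i (by push_cast; omega) (by push_cast; omega)

/-- The configurations whose spacings with labels in `[s, t)` are within `r` of those of `y`. -/
def box (y : ℤ → ℝ) (r : ℝ) (s t : ℤ) : Set (ℤ → RPos) :=
  {ω | ∀ l, s ≤ l → l < t → |(ω l : ℝ) - y l| < r}

lemma dependsOn_box (y : ℤ → ℝ) (r : ℝ) (s t : ℤ) :
    DependsOn (fun ω => ω ∈ box y r s t) (Set.Ico s t) := fun ω ω' h =>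
  propext ⟨fun hω l hl hl' => by rw [← h l ⟨hl, hl'⟩]; exact hω l hl hl',
    fun hω l hl hl' => by rw [h l ⟨hl, hl'⟩]; exact hω l hl hl'⟩

lemma box_eq_pi (y : ℤ → ℝ) (r : ℝ) (s t : ℤ) :
    box y r s t = Set.pi (Finset.Ico s t : Set ℤ) fun l => Subtype.val ⁻¹' Metric.ball (y l) r := by
  ext ω
  simp [box, Set.mem_pi, Real.dist_eq]

lemma isOpen_box (y : ℤ → ℝ) (r : ℝ) (s t : ℤ) : IsOpen (box y r s t) := by
  rw [box_eq_pi]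
  exact isOpen_set_pi (Finset.finite_toSet _) fun l _ =>
    Metric.isOpen_ball.preimage continuous_subtype_val

lemma box_mono (y : ℤ → ℝ) {r r' : ℝ} {s t s' t' : ℤ} (hr : r ≤ r') (hs : s ≤ s') (ht : t' ≤ t) :
    box y r s t ⊆ box y r' s' t' := fun _ hω l hl hl' =>
  (hω l (hs.trans hl) (hl'.trans_le ht)).trans_le hr

namespace Model

variable (D : Model)

lemma Pref_box_pos {β : ℝ} (hβ : 0 < β) {y : ℤ → ℝ} (hy : ∀ l, D.rhc < y l) {r : ℝ} (hr : 0 < r)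
    (s t : ℤ) : 0 < D.Pref β (box y r s t) := by
  rw [box_eq_pi, Measure.infinitePi_pi _ fun l _ =>
    measurable_subtype_coe Metric.isOpen_ball.measurableSet]
  exact CanonicallyOrderedAdd.prod_pos.2 fun l _ =>
    D.ref_pos hβ Metric.isOpen_ball (hy l) (Metric.mem_ball_self hr)

lemma exists_box_X_le {y : ℤ → ℝ} (hy : ∀ l, D.rhc < y l) (s t : ℤ) {r₀ η : ℝ} (hr₀ : 0 < r₀)
    (hη : 0 < η) : ∃ r, 0 < r ∧ r ≤ r₀ ∧
      ∀ ω ∈ box y r s t, D.X (fun l => ω l) s t ≤ D.X y s t + η := by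
  have h1 := (D.continuousAt_X (b := s) (e := t) fun l _ _ => hy l).eventually_lt_const
    (show D.X y s t < D.X y s t + η by linarith)
  obtain ⟨T, r, hr, h⟩ := exists_box_subset h1
  refine ⟨min r r₀, lt_min hr hr₀, min_le_right _ _, fun ω hω => ?_⟩
  set x : ℤ → ℝ := fun l => if s ≤ l ∧ l < t then ω l else y l with hx
  rw [D.X_congr (y := x) fun l hl hl' => (if_pos ⟨hl, hl'⟩).symm]
  refine (h x fun l _ _ => ?_).le
  simp only [hx]
  split_ifs with hl
  · exact (hω l hl.1 hl.2).trans_le (min_le_left _ _)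
  · simpa using hr

lemma ae_rhc_lt {β : ℝ} (hβ : 0 < β) : ∀ᵐ ω ∂(D.Pref β), ∀ l, D.rhc < ω l := by
  rw [ae_all_iff]
  intro l
  have h := (measurePreserving_eval_infinitePi (fun _ : ℤ => D.ref β) l).measure_preimage
    (measurableSet_le measurable_subtype_coe measurable_const :
      MeasurableSet {x : RPos | (x : ℝ) ≤ D.rhc}).nullMeasurableSet
  rw [D.ref_core hβ] at h
  rw [ae_iff]
  simpa [Function.eval] using h

/-! ### The Laplace method in a fixed window -/

/-- The Boltzmann factor of a window relative to the reference measure at `β = 1`. -/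
def dens (β : ℝ) (s t : ℤ) (ω : ℤ → RPos) : ℝ≥0∞ :=
  D.bf β s t ω * ENNReal.ofReal (∏ l ∈ Finset.Ico s t, (D.zc 1 / D.zc β * D.psi (β - 1) (ω l)))

lemma wm_eq_dens {β : ℝ} (hβ : 0 < β) {s t : ℤ} {A : Set (ℤ → RPos)} (hA : MeasurableSet A)
    (hAd : DependsOn (fun ω => ω ∈ A) (Set.Ico s t)) :
    D.wm β s t A = ∫⁻ ω in A, D.dens β s t ω ∂(D.Pref 1) := by
  have h0 : ∀ x : RPos, 0 ≤ D.zc 1 / D.zc β * D.psi (β - 1) x := fun x =>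
    mul_nonneg (div_nonneg (D.zc_pos one_pos).le (D.zc_pos hβ).le) (D.psi_nonneg _ _)
  rw [D.wm_apply _ _ _ hA, ← lintegral_indicator hA, ← lintegral_indicator hA,
    lintegral_prodMeas_withDensity (π := D.ref 1) ((D.measurable_psi_coe _).const_mul _) h0
      (D.integrable_density hβ) (D.ref_withDensity hβ) (Λ := Finset.Ico s t)
      ((D.measurable_bf β s t).indicator hA) (by
        rw [Finset.coe_Ico]
        exact dependsOn_indicator hAd (D.dependsOn_bf β s t))]
  refine lintegral_congr fun ω => ?_
  by_cases hω : ω ∈ A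
  · rw [indicator_of_mem hω, indicator_of_mem hω]
    rfl
  · rw [indicator_of_notMem hω, indicator_of_notMem hω, zero_mul]

lemma dens_eq {β : ℝ} {s t : ℤ} {ω : ℤ → RPos}
    (hω : ∀ l, s ≤ l → l < t → D.rhc < ω l) :
    D.dens β s t ω = ENNReal.ofReal ((D.zc 1 / D.zc β) ^ (Finset.Ico s t).card *
      Real.exp (-(β - 1) * D.E (fun l => ω l) s t - D.V s t ω)) := by
  have h1 : ∀ l ∈ Finset.Ico s t, D.psi (β - 1) (ω l) = Real.exp (-(β - 1) * D.u (ω l)) :=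
    fun l hl => D.psi_of_lt _ (hω l (Finset.mem_Ico.1 hl).1 (Finset.mem_Ico.1 hl).2)
  unfold dens bf
  rw [← ENNReal.ofReal_mul (Real.exp_pos _).le, Finset.prod_mul_distrib, Finset.prod_const,
    Finset.prod_congr rfl h1, ← Real.exp_sum, ← Finset.mul_sum, mul_left_comm, ← Real.exp_add,
    D.E_eq_V hω]
  congr 3
  ring

lemma dens_eq_zero {β : ℝ} {s t : ℤ} {ω : ℤ → RPos} {l : ℤ} (hs : s ≤ l) (ht : l < t)
    (hω : (ω l : ℝ) ≤ D.rhc) : D.dens β s t ω = 0 := by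
  unfold dens
  rw [Finset.prod_eq_zero (Finset.mem_Ico.2 ⟨hs, ht⟩) (by rw [D.psi_of_le _ hω, mul_zero]),
    ENNReal.ofReal_zero, mul_zero]

/-- Writing `exp (-β E)` as `exp (-(β - 1) E) * exp (-E)` and using the reference measure at `β =
1`, the temperature enters only through `(β - 1) * E` and a normalization common to `A` and `B`. So
`C` depends on the bound for `V` and the reference mass of `B`, but not on `β`, `A` or `x`. -/
lemma exists_laplace (s t : ℤ) {B : Set (ℤ → RPos)} (hB : MeasurableSet B)
    (hBd : DependsOn (fun ω => ω ∈ B) (Set.Ico s t)) (hB0 : 0 < D.Pref 1 B) {x' : ℝ}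
    (hBx : ∀ ω ∈ B, D.X (fun l => ω l) s t ≤ x') :
    ∃ C : ℝ, ∀ (A : Set (ℤ → RPos)) (x : ℝ), MeasurableSet A →
      DependsOn (fun ω => ω ∈ A) (Set.Ico s t) →
      (∀ ω ∈ A, (∀ l, s ≤ l → l < t → D.rhc < ω l) → x ≤ D.X (fun l => ω l) s t) →
      ∀ β : ℝ, 1 ≤ β → D.wm β s t A ≤
        ENNReal.ofReal (Real.exp (C - (β - 1) * (x - x'))) * D.wm β s t B := by
  obtain ⟨Cv, hCv⟩ := D.exists_abs_V_le s t
  set q : ℝ := (D.Pref 1 B).toReal with hq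
  have hq0 : 0 < q := ENNReal.toReal_pos hB0.ne' (measure_ne_top _ _)
  have hPq : D.Pref 1 B = ENNReal.ofReal q := (ENNReal.ofReal_toReal (measure_ne_top _ _)).symm
  refine ⟨2 * Cv - Real.log q, fun A x hA hAd hAx β hβ => ?_⟩
  have hβ0 : 0 < β := by linarith
  set k : ℝ := (D.zc 1 / D.zc β) ^ (Finset.Ico s t).card with hk
  have hk0 : 0 < k := pow_pos (div_pos (D.zc_pos one_pos) (D.zc_pos hβ0)) _
  set c : ℝ := ((t - s : ℤ) : ℝ) * D.e₀ - D.Waa with hc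
  have hEX : ∀ z, D.E z s t = D.X z s t + c := fun z => by rw [hc, X]; ring
  have hup : D.wm β s t A ≤ ENNReal.ofReal (k * Real.exp (-(β - 1) * (x + c) + Cv)) := by
    rw [D.wm_eq_dens hβ0 hA hAd]
    calc ∫⁻ ω in A, D.dens β s t ω ∂(D.Pref 1)
        ≤ ∫⁻ ω in A, ENNReal.ofReal (k * Real.exp (-(β - 1) * (x + c) + Cv)) ∂(D.Pref 1) := by
          refine setLIntegral_mono' hA fun ω hω => ?_
          by_cases h : ∀ l, s ≤ l → l < t → D.rhc < ω l
          · rw [D.dens_eq h, hEX]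
            refine ENNReal.ofReal_le_ofReal (mul_le_mul_of_nonneg_left (Real.exp_le_exp.2 ?_) hk0.le)
            have h1 := (abs_le.1 (hCv ω)).1
            have h2 := hAx ω hω h
            nlinarith
          · push Not at h
            obtain ⟨l, h1, h2, h3⟩ := h
            rw [D.dens_eq_zero h1 h2 h3]
            exact zero_le
      _ ≤ _ := by
          rw [setLIntegral_const]
          exact mul_le_of_le_one_right' prob_le_one
  have hlow : ENNReal.ofReal (k * Real.exp (-(β - 1) * (x' + c) - Cv)) * ENNReal.ofReal q ≤
      D.wm β s t B := by
    rw [D.wm_eq_dens hβ0 hB hBd, ← hPq, ← setLIntegral_const]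
    refine lintegral_mono_ae ((ae_restrict_iff' hB).2 ?_)
    filter_upwards [D.ae_rhc_lt one_pos] with ω hω hωB
    rw [D.dens_eq fun l _ _ => hω l, hEX]
    refine ENNReal.ofReal_le_ofReal (mul_le_mul_of_nonneg_left (Real.exp_le_exp.2 ?_) hk0.le)
    have h1 := (abs_le.1 (hCv ω)).2
    have h2 := hBx ω hωB
    nlinarith
  refine hup.trans (le_trans (le_of_eq ?_) (mul_le_mul_right hlow _))
  rw [← ENNReal.ofReal_mul (by positivity), ← ENNReal.ofReal_mul (by positivity)]
  congr 1
  have h3 : q = Real.exp (Real.log q) := (Real.exp_log hq0).symm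
  have h4 : Real.exp (-(β - 1) * (x + c) + Cv) =
      Real.exp (2 * Cv - Real.log q - (β - 1) * (x - x')) *
        (Real.exp (-(β - 1) * (x' + c) - Cv) * Real.exp (Real.log q)) := by
    rw [← Real.exp_add, ← Real.exp_add]
    congr 1
    ring
  rw [h4, ← h3]
  ring

lemma wm_pos {β : ℝ} {s t : ℤ} {B : Set (ℤ → RPos)} (hB : MeasurableSet B)
    (h : 0 < D.Pref β B) : 0 < D.wm β s t B := by
  rw [D.wm_apply _ _ _ hB, setLIntegral_pos_iff (D.measurable_bf β s t)]
  have : Function.support (D.bf β s t) = univ := by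
    refine eq_univ_of_forall fun ω => ?_
    exact (ENNReal.ofReal_pos.2 (Real.exp_pos _)).ne'
  rwa [this, univ_inter]

/-- Comparison of the probabilities of two events inside `[s, t)` in a larger chain, on an event
outside `[s, t)` on which the energy nearly decouples. -/
lemma Gm_decouple {s t b e : ℤ} {A B S : Set (ℤ → RPos)}
    (hA : MeasurableSet A) (hB : MeasurableSet B) (hS : MeasurableSet S)
    (hAd : DependsOn (fun ω => ω ∈ A) (Set.Ico s t))
    (hBd : DependsOn (fun ω => ω ∈ B) (Set.Ico s t))
    (hSd : DependsOn (fun ω => ω ∈ S) (Set.Ico s t)ᶜ) {C η β : ℝ} (hβ : 0 < β)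
    (h : ∀ ω ∈ S, ω ∈ A ∪ B → |D.V b e ω - D.V s t ω - (D.V b s ω + D.V t e ω) - C| ≤ η)
    (hB0 : 0 < D.Pref β B) {q : ℝ} (hAB : D.wm β s t A ≤ ENNReal.ofReal q * D.wm β s t B) :
    D.Gm β b e (A ∩ S) ≤
      ENNReal.ofReal (Real.exp (2 * (β * η)) * q) * D.Gm β b e (B ∩ S) := by
  have hout : ∀ l, l ∈ Set.Ico b s ∨ l ∈ Set.Ico t e → l ∈ (Set.Ico s t)ᶜ := by
    intro l hl hl'
    simp only [Set.mem_Ico] at hl hl'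
    omega
  have key := setLIntegral_decouple (D.ref β) (H := fun ω => β * D.V b e ω)
    (Hin := fun ω => β * D.V s t ω) (Hout := fun ω => β * (D.V b s ω + D.V t e ω))
    (Λ := Set.Ico s t) (B := A) (B' := B) (S := S) (C := β * C) (η := β * η)
    ((D.measurable_V s t).const_mul β) (((D.measurable_V b s).add (D.measurable_V t e)).const_mul β)
    (fun ω ω' hω => by simp only [D.dependsOn_V s t hω])
    (fun ω ω' hω => by
      beta_reduce
      rw [D.dependsOn_V b s fun l hl => hω l (hout l (Or.inl hl)),
        D.dependsOn_V t e fun l hl => hω l (hout l (Or.inr hl))]) hA hB hS hAd hBd hSd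
    (fun ω hω hω' => by
      rw [← mul_sub, ← mul_sub, ← mul_sub, abs_mul, abs_of_pos hβ]
      exact mul_le_mul_of_nonneg_left (h ω hω hω') hβ.le)
  change (∫⁻ ω in A ∩ S, D.bf β b e ω ∂(D.Pref β)) * (∫⁻ ω in B, D.bf β s t ω ∂(D.Pref β)) ≤
    _ * ((∫⁻ ω in A, D.bf β s t ω ∂(D.Pref β)) * ∫⁻ ω in B ∩ S, D.bf β b e ω ∂(D.Pref β)) at key
  rw [← D.wm_apply _ _ _ (hA.inter hS), ← D.wm_apply _ _ _ hA, ← D.wm_apply _ _ _ hB,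
    ← D.wm_apply _ _ _ (hB.inter hS)] at key
  have hw0 := (D.wm_pos (s := s) (t := t) hB hB0).ne'
  have hwt : D.wm β s t B ≠ ⊤ := measure_ne_top _ _
  have h2 : D.wm β b e (A ∩ S) ≤
      ENNReal.ofReal (Real.exp (2 * (β * η)) * q) * D.wm β b e (B ∩ S) := by
    rw [← ENNReal.mul_le_mul_iff_left hw0 hwt]
    refine key.trans ((mul_le_mul_right (mul_le_mul_left hAB _) _).trans (le_of_eq ?_))
    rw [ENNReal.ofReal_mul (Real.exp_pos _).le]
    ring
  rw [Gm_apply, Gm_apply]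
  refine (mul_le_mul_right h2 _).trans (le_of_eq ?_)
  ring

end Model

namespace Model

variable (D : Model)

/-! ### Exponential tightness -/

/-- Small spacings are excluded by the divergence of `v` at the hard core, large ones by the linear
growth of the pressure term. -/
lemma exists_compact_u_gt (ℓ : ℝ) :
    ∃ A : Set RPos, IsCompact A ∧ ∀ x ∉ A, D.rhc < (x : ℝ) → ℓ ≤ D.u x := by
  have h1 := D.hcore.eventually_ge_atTop ℓ
  obtain ⟨r, hr, h⟩ := (mem_nhdsGT_iff_exists_Ioo_subset).1 h1
  rw [mem_Ioi] at hr
  set R := (ℓ - D.v D.zmax) / D.p with hR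
  refine ⟨Subtype.val ⁻¹' Icc r R, ?_, fun x hx hxr => ?_⟩
  · refine Topology.IsEmbedding.subtypeVal.isCompact_preimage_iff ?_ |>.2 isCompact_Icc
    rw [Subtype.range_coe]
    exact fun x hx => (D.hrhc.trans hr).trans_le hx.1
  · rw [mem_preimage, mem_Icc, not_and_or] at hx
    rcases hx with hx | hx
    · have h2 : ℓ ≤ D.v x := h ⟨hxr, not_le.1 hx⟩
      have h3 : 0 < D.p * x := mul_pos D.hp (D.hrhc.trans hxr)
      unfold u
      linarith
    · rw [not_le, hR, div_lt_iff₀ D.hp] at hx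
      linarith [D.le_u hxr]

/-- Exponential tightness of a single spacing, uniformly in the chain. -/
lemma exists_compact_site (L : ℝ) : ∃ A : Set RPos, IsCompact A ∧ ∀ β : ℝ, 2 ≤ β → ∀ b e j,
    D.Gm β b e {ω | ω j ∈ Aᶜ} ≤ ENNReal.ofReal (Real.exp (-(β * L))) := by
  obtain ⟨r, hr, -, hbox⟩ := D.exists_box_X_le (y := fun _ => D.a) (fun _ => D.rhc_lt_a) 0 1
    one_pos one_pos
  obtain ⟨C, hC⟩ := D.exists_laplace 0 1 (isOpen_box _ r 0 1).measurableSet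
    (dependsOn_box _ r 0 1) (D.Pref_box_pos one_pos (fun _ => D.rhc_lt_a) hr 0 1) hbox
  set x' := D.X (fun _ => D.a) 0 1 + 1 with hx'
  have hK := D.K_nonneg
  -- The factor 2 compensates `β - 1 ≥ β / 2`, valid for `β ≥ 2`; the summands cover the rate, the
  -- decoupling cost in `Gm_site_le` and the Laplace constant.
  set y := 2 * (|L| + 4 * D.K + |C|) with hy
  have hy0 : 0 ≤ y := by positivity
  obtain ⟨A, hA, hAu⟩ := D.exists_compact_u_gt (y + x' + D.e₀ - D.Waa)
  refine ⟨A, hA, fun β hβ b e j => (D.Gm_site_le (by linarith) b e j hA.measurableSet.compl).trans ?_⟩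
  have hV : ∀ ω, D.bf β 0 1 ω = 1 := fun ω => by
    have := D.V_succ 0 ω
    rw [zero_add] at this
    simp [bf, this]
  have hAm : MeasurableSet {ω : ℤ → RPos | ω 0 ∈ Aᶜ} :=
    measurable_pi_apply (0 : ℤ) hA.measurableSet.compl
  have hwm : ∀ S : Set (ℤ → RPos), MeasurableSet S → D.wm β 0 1 S = D.Pref β S := fun S hS => by
    rw [D.wm_apply _ _ _ hS]
    simp [hV]
  have h1 := hC {ω | ω 0 ∈ Aᶜ} (y + x') hAm
    (fun ω ω' h => by
      have := h 0 ⟨le_rfl, one_pos⟩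
      simp only [Set.mem_ofPred_eq, this]) (fun ω hω hr => by
      have h2 := hAu (ω 0) hω (hr 0 le_rfl one_pos)
      have h3 := D.E_eq_V (b := 0) (e := 1) hr
      have h4 := D.V_succ 0 ω
      rw [zero_add] at h4
      have h5 : Finset.Ico (0 : ℤ) 1 = {0} := by decide
      rw [h4, h5, Finset.sum_singleton, add_zero] at h3
      rw [X, h3]
      push_cast
      linarith) β (by linarith)
  rw [hwm _ hAm, hwm _ (isOpen_box _ r 0 1).measurableSet] at h1
  have h2 : D.Pref β {ω | ω 0 ∈ Aᶜ} = D.ref β Aᶜ :=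
    (measurePreserving_eval_infinitePi (fun _ : ℤ => D.ref β) 0).measure_preimage
      hA.measurableSet.compl.nullMeasurableSet
  rw [h2] at h1
  refine (mul_le_mul_right (h1.trans (mul_le_of_le_one_right' prob_le_one)) _).trans ?_
  rw [← ENNReal.ofReal_mul (Real.exp_pos _).le, ← Real.exp_add, ofReal_exp_le_iff]
  have h3 := le_abs_self L
  have h4 := le_abs_self C
  have h5 : β * (y / 2) ≤ (β - 1) * y := by nlinarith
  have h6 : β * (y / 2) = β * |L| + 4 * (β * D.K) + β * |C| := by rw [hy]; ring
  have h7 : |C| ≤ β * |C| := by nlinarith [abs_nonneg C]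
  have h8 : β * L ≤ β * |L| := by nlinarith
  have h9 : y + x' - (D.X (fun _ => D.a) 0 1 + 1) = y := by rw [hx']; ring
  rw [h9]
  linarith

/-! ### Stretches close to the ground state -/

variable {D}

lemma dependsOn_near (ε : ℝ) (i j : ℤ) :
    DependsOn (fun ω : ℤ → RPos => D.Near ε (fun l => ω l) i j) (Set.Ico i j) := fun ω ω' h =>
  propext ⟨fun hω l hl hl' => by beta_reduce; rw [← h l ⟨hl, hl'⟩]; exact hω l hl hl',
    fun hω l hl hl' => by beta_reduce; rw [h l ⟨hl, hl'⟩]; exact hω l hl hl'⟩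

lemma measurableSet_near (ε : ℝ) (i j : ℤ) :
    MeasurableSet {ω : ℤ → RPos | D.Near ε (fun l => ω l) i j} := by
  have : {ω : ℤ → RPos | D.Near ε (fun l => ω l) i j} =
      ⋂ l : ℤ, ⋂ (_ : i ≤ l), ⋂ (_ : l < j), {ω : ℤ → RPos | |(ω l : ℝ) - D.a| ≤ ε} := by
    ext ω
    simp [Near]
  rw [this]
  refine MeasurableSet.iInter fun l => .iInter fun _ => .iInter fun _ => ?_
  exact measurableSet_le (((measurable_subtype_coe.comp (measurable_pi_apply l)).sub_const _).abs)
    measurable_const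

lemma Near.clip {ε : ℝ} {ω : ℤ → RPos} {i j : ℤ} (h : D.Near ε (fun l => ω l) i j) :
    D.Near ε (D.clip ω) i j := by
  intro l hl hl'
  have h1 := abs_le.1 (h l hl hl')
  have h2 := D.rhc_lt_a
  unfold Model.clip
  rcases max_cases (ω l : ℝ) D.rhc with ⟨h3, -⟩ | ⟨h3, h4⟩
  · rw [h3]; exact h l hl hl'
  · rw [h3, abs_le]
    constructor <;> linarith [h1.1, h1.2]

variable (D)

lemma abs_V_sub_le {b s t e : ℤ} (hbs : b ≤ s) (hst : s ≤ t) (hte : t ≤ e) (ω : ℤ → RPos) :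
    |D.V b e ω - D.V s t ω - (D.V b s ω + D.V t e ω) - 0| ≤ 2 * D.K := by
  have h1 := D.V_split (hbs.trans hst) hte ω
  have h2 := D.V_split hbs hst ω
  have h3 := abs_le.1 (D.abs_cross_clip_le b t e ω)
  have h4 := abs_le.1 (D.abs_cross_clip_le b s t ω)
  rw [abs_le]
  constructor <;> linarith [h3.1, h3.2, h4.1, h4.2]

lemma le_sum_theta {M : ℤ} (hM : 1 ≤ M) {ε : ℝ} (hε : 0 < ε) {z : ℤ → ℝ} (τ : ℤ) (R : ℕ)
    (h : ∀ i : ℕ, i < R → ¬ D.Near ε z (τ + 2 * M * i) (τ + 2 * M * (i + 1))) :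
    R * min (ε ^ 2) 1 ≤ ∑ l ∈ Finset.Ico τ (τ + 2 * M * R), D.theta (z l) := by
  induction R with
  | zero => simp
  | succ R ih =>
    have h1 : 0 ≤ 2 * M * R := by positivity
    have h2 : τ + 2 * M * R ≤ τ + 2 * M * ((R + 1 : ℕ) : ℤ) := by push_cast; linarith
    rw [sum_Ico_consecutive (by omega : τ ≤ τ + 2 * M * R) h2]
    have h3 := ih fun i hi => h i (by omega)
    have h4 := h R (by omega)
    unfold Near at h4
    push Not at h4
    obtain ⟨l, hl, hl', h5⟩ := h4
    have h6 : min (ε ^ 2) 1 ≤ D.theta (z l) := by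
      unfold theta
      refine min_le_min ?_ le_rfl
      rw [← sq_abs (z l - D.a)]
      exact pow_le_pow_left₀ hε.le h5.le 2
    have h7 := Finset.single_le_sum (f := fun l => D.theta (z l)) (fun l _ => D.theta_nonneg _)
      (Finset.mem_Ico.2 ⟨hl, by push_cast; exact hl'⟩ :
        l ∈ Finset.Ico (τ + 2 * M * R) (τ + 2 * M * ((R + 1 : ℕ) : ℤ)))
    push_cast at h7 ⊢
    linarith

/-- It is exponentially unlikely that a long window contains no stretch close to the ground state. -/
lemma exists_no_stretch {M : ℤ} (hM : 1 ≤ M) {ε : ℝ} (hε : 0 < ε) (L : ℝ) : ∃ R : ℕ, ∀ τ : ℤ,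
    ∀ᶠ β in atTop, ∀ b e, b ≤ τ → τ + 2 * M * R ≤ e →
      D.Gm β b e {ω | ∀ i : ℕ, i < R →
        ¬ D.Near ε (fun l => ω l) (τ + 2 * M * i) (τ + 2 * M * (i + 1))} ≤
          ENNReal.ofReal (Real.exp (-(β * L))) := by
  set ε' := min (ε ^ 2) 1 with hε'
  have hε'0 : 0 < ε' := lt_min (by positivity) one_pos
  have hκ := D.kappa_pos
  have h1 : Tendsto (fun R : ℕ => D.X (fun _ => D.a) 0 (2 * M * R)) atTop (𝓝 0) := by
    refine D.tendsto_X_const ?_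
    rw [tendsto_atTop_atTop]
    exact fun N => ⟨N.natAbs, fun n hn => by
      have : (n : ℤ) ≤ 2 * M * n := by nlinarith
      omega⟩
  have h2 : Tendsto (fun R : ℕ => D.kappa * ε' * R) atTop atTop :=
    tendsto_natCast_atTop_atTop.const_mul_atTop (mul_pos hκ hε'0)
  -- Each of the `R` blocks costs at least `kappa * ε'`. For large `R` the total beats the rate `L`,
  -- the decoupling cost `4 * K`, the energy 2 allowed for the comparison box, and one unit that
  -- absorbs the constants for large `β`.
  obtain ⟨R, hR1, hR2⟩ := ((h1.eventually_lt_const one_pos).and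
    (h2.eventually_ge_atTop (L + 4 * D.K + 3 - D.Waa))).exists
  refine ⟨R, fun τ => ?_⟩
  set t := τ + 2 * M * R with ht
  have hτt : τ ≤ t := by have : 0 ≤ 2 * M * R := by positivity
                         omega
  have hXa : D.X (fun _ => D.a) τ t < 1 := by
    have h3 := D.E_shift (fun _ => D.a) 0 (2 * M * R) τ
    rw [zero_add, add_comm (2 * M * (R : ℤ)) τ] at h3
    unfold X at hR1 ⊢
    rw [← h3, show t - τ = 2 * M * R - 0 by rw [ht]; ring]
    exact hR1
  obtain ⟨r, hr, -, hbox⟩ := D.exists_box_X_le (y := fun _ => D.a) (fun _ => D.rhc_lt_a) τ t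
    one_pos one_pos
  obtain ⟨C, hC⟩ := D.exists_laplace τ t (isOpen_box _ r τ t).measurableSet
    (dependsOn_box _ r τ t) (D.Pref_box_pos one_pos (fun _ => D.rhc_lt_a) hr τ t)
    (x' := 2) (fun ω hω => (hbox ω hω).trans (by linarith))
  set A : Set (ℤ → RPos) := {ω | ∀ i : ℕ, i < R →
    ¬ D.Near ε (fun l => ω l) (τ + 2 * M * i) (τ + 2 * M * (i + 1))} with hA
  have hAm : MeasurableSet A := by
    have : A = ⋂ i : ℕ, ⋂ (_ : i < R),
        {ω : ℤ → RPos | D.Near ε (fun l => ω l) (τ + 2 * M * i) (τ + 2 * M * (i + 1))}ᶜ := by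
      ext ω
      simp [hA]
    rw [this]
    exact MeasurableSet.iInter fun i => .iInter fun _ => (measurableSet_near _ _ _).compl
  have hAd : DependsOn (fun ω => ω ∈ A) (Set.Ico τ t) := by
    intro ω ω' h
    refine forall_congr fun i => forall_congr fun hi => congrArg Not ?_
    refine dependsOn_near (D := D) ε _ _ fun l hl => h l ?_
    have h3 : 0 ≤ 2 * M * i := by positivity
    have h4 : 2 * M * ((i : ℤ) + 1) ≤ 2 * M * R :=
      mul_le_mul_of_nonneg_left (by exact_mod_cast hi) (by omega)
    simp only [Set.mem_Ico] at hl ⊢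
    omega
  have hx : ∀ ω ∈ A, (∀ l, τ ≤ l → l < t → D.rhc < ω l) →
      D.Waa + D.kappa * (R * ε') ≤ D.X (fun l => ω l) τ t := fun ω hω hrω => by
    have h3 := D.le_sum_theta hM hε τ R hω
    have h4 := D.X_ge hτt hrω
    nlinarith
  set y := D.Waa + D.kappa * (R * ε') - 2 with hy
  have hyL : L + 4 * D.K + 1 ≤ y := by
    have : D.kappa * ε' * R = D.kappa * (R * ε') := by ring
    rw [hy]
    linarith
  filter_upwards [eventually_ge_atTop 1, eventually_ge_atTop (C + y)] with β hβ hβ' b e hb he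
  have h5 := D.Gm_decouple (b := b) (e := e) (S := univ) (C := 0) (η := 2 * D.K) (β := β) hAm
    (isOpen_box _ r τ t).measurableSet .univ hAd (dependsOn_box _ r τ t) (fun _ _ _ => rfl)
    (by linarith) (fun ω _ _ => D.abs_V_sub_le hb hτt he ω)
    (D.Pref_box_pos (by linarith) (fun _ => D.rhc_lt_a) hr τ t) (hC A _ hAm hAd hx β hβ)
  rw [inter_univ] at h5
  refine h5.trans ((mul_le_of_le_one_right' prob_le_one).trans ?_)
  rw [← Real.exp_add, ofReal_exp_le_iff, ← hy]
  nlinarith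

/-- Outside an exponentially unlikely event, there are stretches close to the ground state on both
sides of a given window, at one of finitely many positions. -/
lemma exists_grid (σ : Bool) {M : ℤ} (hM : 1 ≤ M) {ε : ℝ} (hε : 0 < ε) (L : ℝ) (T : ℕ) :
    ∃ G : Finset (ℤ × ℤ), (∀ q ∈ G, (σ = false → q.1 = 0) ∧ (σ = true → q.1 + M ≤ -(T : ℤ)) ∧
      (T : ℤ) + M ≤ q.2) ∧ ∀ᶠ β in atTop, ∀ᶠ n : ℕ in atTop,
        D.Gm β (lo σ n) n {ω | ∀ q ∈ G, ¬ D.Stretch σ M ε (fun l => ω l) q.1 q.2} ≤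
          ENNReal.ofReal (Real.exp (-(β * L))) := by
  -- Rate `L + 1` leaves room for the factor 2 from the union over the two sides of the window.
  obtain ⟨R, hR⟩ := D.exists_no_stretch hM hε (L + 1)
  set τ : ℤ := -(T : ℤ) - 2 * M * R with hτ
  set f : ℕ × ℕ → ℤ × ℤ := fun i =>
    (if σ then τ + 2 * M * i.1 + M else 0, (T : ℤ) + 2 * M * i.2 + M) with hf
  have hmul : ∀ i : ℕ, i < R → 2 * M * ((i : ℤ) + 1) ≤ 2 * M * R := fun i hi =>
    mul_le_mul_of_nonneg_left (by exact_mod_cast hi) (by omega)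
  refine ⟨(Finset.range R ×ˢ Finset.range R).image f, fun q hq => ?_, ?_⟩
  · obtain ⟨⟨i, j⟩, hij, rfl⟩ := Finset.mem_image.1 hq
    rw [Finset.mem_product, Finset.mem_range, Finset.mem_range] at hij
    simp only [hf]
    refine ⟨fun h => by simp [h], fun h => ?_, ?_⟩
    · rw [if_pos h]
      have := hmul i hij.1
      rw [hτ]
      linarith
    · have : 0 ≤ 2 * M * (j : ℤ) := by positivity
      linarith
  · filter_upwards [hR T, hR τ, eventually_const_mul_exp_le (k := 2) (by simp)
      (show L < L + 1 by linarith)] with β h1 h2 h3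
    filter_upwards [eventually_ge_atTop (T + (2 * M * R).toNat)] with n hn
    have hn' : (T : ℤ) + 2 * M * R ≤ n := by omega
    have hpos : 0 ≤ 2 * M * (R : ℤ) := by positivity
    have hright := h1 (lo σ n) n (by have := lo_le σ n; omega) hn'
    refine le_trans ?_ h3
    rw [two_mul]
    cases σ with
    | false =>
      refine (measure_mono ?_).trans (hright.trans le_self_add)
      intro ω hω i hi hnear
      refine hω (f (i, i)) (Finset.mem_image_of_mem f (by simpa using hi)) ⟨?_, by simp⟩
      simp only [hf]
      convert hnear using 1 <;> ring
    | true =>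
      have hleft := h2 (lo true n) n (by simp only [lo, if_true]; omega) (by omega)
      refine le_trans ((measure_mono ?_).trans (measure_union_le _ _)) (add_le_add hleft hright)
      intro ω hω
      by_contra hcon
      simp only [mem_union, not_or, Set.mem_ofPred_eq, not_forall, not_not] at hcon
      obtain ⟨⟨i, hi, hi'⟩, ⟨j, hj, hj'⟩⟩ := hcon
      refine hω (f (i, j)) (Finset.mem_image_of_mem f (by simpa using ⟨hi, hj⟩)) ⟨?_, fun _ => ?_⟩
      · simp only [hf]
        convert hj' using 1 <;> ring
      · simp only [hf, if_true]
        convert hi' using 1 <;> ring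

end Model

namespace Model

variable {D : Model}

/-! ### Local large deviations bounds -/

lemma Stretch.mono {σ : Bool} {M : ℤ} {ε ε' : ℝ} {z : ℤ → ℝ} {s t : ℤ}
    (h : D.Stretch σ M ε z s t) (hε : ε ≤ ε') : D.Stretch σ M ε' z s t :=
  ⟨fun l hl hl' => (h.1 l hl hl').trans hε, fun hσ l hl hl' => (h.2 hσ l hl hl').trans hε⟩

lemma Good.abs_V_sub_le {σ : Bool} {M : ℤ} {ε η : ℝ} (hG : D.Good M ε η) {b s t e : ℤ}
    (hc : Cuts σ M b s t e) {ω : ℤ → RPos} (h : D.Stretch σ M ε (fun l => ω l) s t) :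
    |D.V b e ω - D.V s t ω - (D.V b s ω + D.V t e ω) - (D.Waa + if σ then D.Waa else 0)| ≤
      2 * η := by
  have hM := hG.one_le
  have hη := hG.eta_nonneg
  obtain ⟨h1, h2, h3⟩ := hc.le hM
  have h4 := D.V_split (h1.trans h2) h3 ω
  have h5 := D.V_split h1 h2 ω
  obtain ⟨hbs, hst, hte⟩ := hc
  have h6 := abs_le.1 (hG.2.2.2 (D.clip ω) b t e (by omega) hte (fun l _ _ => D.rhc_le_clip ω l)
    h.1.clip)
  cases σ with
  | false =>
    have hbs' : b = s := by simpa using hbs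
    subst hbs'
    rw [crossSum_left_self] at h5
    simp only [Bool.false_eq_true, if_false, add_zero]
    rw [abs_le]
    constructor <;> linarith [h6.1, h6.2]
  | true =>
    simp only [if_true] at hbs ⊢
    have h7 := abs_le.1 (hG.2.2.2 (D.clip ω) b s t hbs hst (fun l _ _ => D.rhc_le_clip ω l)
      (h.2 rfl).clip)
    rw [abs_le]
    constructor <;> linarith [h6.1, h6.2, h7.1, h7.2]

/-- At stretches close to the ground state, the probability of an event inside `[s, t)` is
compared to the probability of a neighbourhood of a configuration of finite energy. -/
lemma Good.eventually_Gm_le {σ : Bool} {M : ℤ} {ε η : ℝ} (hG : D.Good M ε η) (hη : 0 < η) {s t : ℤ}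
    (hs : σ = false → s = 0) (hst : s + M ≤ t) {A : Set (ℤ → RPos)} (hA : MeasurableSet A)
    (hAd : DependsOn (fun ω => ω ∈ A) (Set.Ico s t)) {x : ℝ}
    (hAx : ∀ ω ∈ A, (∀ l, s ≤ l → l < t → D.rhc < ω l) → x ≤ D.val σ (D.cut (fun l => ω l) s t))
    {y : ℤ → ℝ} (hy : D.Dom y) (hyc : D.Conf σ y) (hys : D.Stretch σ M (ε / 2) y s t) {r₀ : ℝ}
    (hr₀ : 0 < r₀) :
    ∀ᶠ β in atTop, ∀ b e, Cuts σ M b s t e →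
      D.Gm β b e (A ∩ {ω | D.Stretch σ M ε (fun l => ω l) s t}) ≤
        ENNReal.ofReal (Real.exp (-(β * (x - D.val σ y - 12 * η)))) *
          D.Gm β b e (box y r₀ s t) := by
  have hM := hG.one_le
  have hε := hG.2.1
  set Sin : Set (ℤ → RPos) := {ω | D.Near ε (fun l => ω l) (t - M) t ∧
    (σ = true → D.Near ε (fun l => ω l) s (s + M))} with hSin
  set Sout : Set (ℤ → RPos) := {ω | D.Near ε (fun l => ω l) t (t + M) ∧
    (σ = true → D.Near ε (fun l => ω l) (s - M) s)} with hSout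
  have hglue : ∀ ω, D.Stretch σ M ε (fun l => ω l) s t ↔ ω ∈ Sin ∧ ω ∈ Sout := by
    intro ω
    constructor
    · intro h
      exact ⟨⟨h.1.mono le_rfl (by omega), fun hσ => (h.2 hσ).mono (by omega) le_rfl⟩,
        ⟨h.1.mono (by omega) le_rfl, fun hσ => (h.2 hσ).mono le_rfl (by omega)⟩⟩
    · rintro ⟨h1, h2⟩
      refine ⟨fun l hl hl' => ?_, fun hσ l hl hl' => ?_⟩
      · rcases lt_or_ge l t with h | h
        exacts [h1.1 l hl h, h2.1 l h hl']
      · rcases lt_or_ge l s with h | h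
        exacts [h2.2 hσ l hl h, h1.2 hσ l h hl']
  have hmeas : ∀ i j i' j' : ℤ, MeasurableSet {ω : ℤ → RPos | D.Near ε (fun l => ω l) i j ∧
      (σ = true → D.Near ε (fun l => ω l) i' j')} := by
    intro i j i' j'
    cases σ
    · simpa using measurableSet_near (D := D) ε i j
    · simp only [forall_true_left]
      exact (measurableSet_near ε i j).inter (measurableSet_near ε i' j')
  have hdep : ∀ (i j i' j' : ℤ) (Λ : Set ℤ), Set.Ico i j ⊆ Λ → Set.Ico i' j' ⊆ Λ →
      DependsOn (fun ω : ℤ → RPos => D.Near ε (fun l => ω l) i j ∧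
        (σ = true → D.Near ε (fun l => ω l) i' j')) Λ := by
    intro i j i' j' Λ h1 h2 ω ω' h
    have e1 := dependsOn_near (D := D) ε i j fun l hl => h l (h1 hl)
    have e2 := dependsOn_near (D := D) ε i' j' fun l hl => h l (h2 hl)
    beta_reduce at e1 e2 ⊢
    rw [e1, e2]
  have hSind : DependsOn (fun ω => ω ∈ Sin) (Set.Ico s t) := hdep _ _ _ _ _
    (Set.Ico_subset_Ico (by omega) le_rfl) (Set.Ico_subset_Ico le_rfl (by omega))
  have hSoutd : DependsOn (fun ω => ω ∈ Sout) (Set.Ico s t)ᶜ := by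
    refine hdep _ _ _ _ _ ?_ ?_ <;>
    · intro l hl hl'
      simp only [Set.mem_Ico] at hl hl'
      omega
  obtain ⟨r, hr, hrr, hbox⟩ := D.exists_box_X_le hy.1 s t (lt_min hr₀ (half_pos hε)) hη
  have hXy := hG.X_le_val hy hyc hs hst (hys.mono (by linarith))
  obtain ⟨C, hC⟩ := D.exists_laplace s t (isOpen_box y r s t).measurableSet
    (dependsOn_box y r s t) (D.Pref_box_pos one_pos hy.1 hr s t) (x' := D.val σ y + 5 * η)
    (fun ω hω => (hbox ω hω).trans (by linarith))
  have hA'm : MeasurableSet (A ∩ Sin) := hA.inter (hmeas _ _ _ _)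
  have hA'd : DependsOn (fun ω => ω ∈ A ∩ Sin) (Set.Ico s t) := fun ω ω' h => by
    have e1 := hAd h
    have e2 := hSind h
    beta_reduce at e1 e2 ⊢
    rw [mem_inter_iff, mem_inter_iff, e1, e2]
  have hA'x : ∀ ω ∈ A ∩ Sin, (∀ l, s ≤ l → l < t → D.rhc < ω l) →
      x - 2 * η ≤ D.X (fun l => ω l) s t := fun ω hω hrω => by
    have h1 := hG.val_cut_le (σ := σ) hrω hs hst hω.2.1 hω.2.2
    have h2 := hAx ω hω.1 hrω
    linarith
  have hBin : box y r s t ⊆ Sin := by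
    have h1 : ∀ ω ∈ box y r s t, ∀ l, s ≤ l → l < t → |y l - D.a| ≤ ε / 2 → |(ω l : ℝ) - D.a| ≤ ε := by
      intro ω hω l hl hl' h
      have h2 := hω l hl hl'
      have h3 := abs_sub_le (ω l : ℝ) (y l) D.a
      have h4 := hrr.trans (min_le_right _ _)
      linarith
    intro ω hω
    exact ⟨fun l hl hl' => h1 ω hω l (by omega) hl' (hys.1 l hl (by omega)),
      fun hσ l hl hl' => h1 ω hω l hl (by omega) (hys.2 hσ l (by omega) hl')⟩
  have hset : A ∩ {ω | D.Stretch σ M ε (fun l => ω l) s t} = (A ∩ Sin) ∩ Sout := by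
    ext ω
    simp only [mem_inter_iff, Set.mem_ofPred_eq, hglue, and_assoc]
  -- Seven units of `η` are spent so far: 2 on cutting the configurations of `A`, 4 on cutting `y`
  -- and 1 on the box. Decoupling takes 4 more, and the last one absorbs the constant `C + w` for
  -- large `β`.
  set w := x - D.val σ y - 7 * η with hw
  filter_upwards [eventually_ge_atTop 1, eventually_ge_atTop ((C + w) / η)] with β hβ hβ' b e hc
  rw [div_le_iff₀ hη] at hβ'
  have h5 := D.Gm_decouple (b := b) (e := e) (S := Sout) (β := β) hA'm
    (isOpen_box y r s t).measurableSet (hmeas _ _ _ _) hA'd (dependsOn_box y r s t) hSoutd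
    (by linarith) (fun ω hω hω' => hG.abs_V_sub_le hc ((hglue ω).2
      ⟨by rcases hω' with h | h; exacts [h.2, hBin h], hω⟩))
    (D.Pref_box_pos (by linarith) hy.1 hr s t) (hC _ _ hA'm hA'd hA'x β hβ)
  rw [hset]
  refine h5.trans (mul_le_mul' ?_ (measure_mono (inter_subset_left.trans
    (box_mono y (hrr.trans (min_le_left _ _)) le_rfl le_rfl))))
  rw [← Real.exp_add, ofReal_exp_le_iff]
  have h6 : x - 2 * η - (D.val σ y + 5 * η) = w := by rw [hw]; ring
  have h7 : x - D.val σ y - 12 * η = w - 5 * η := by rw [hw]; ring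
  rw [h6, h7]
  nlinarith

variable (D)

lemma grid_cuts {σ : Bool} {M : ℤ} (hM : 1 ≤ M) {T : ℕ} {q : ℤ × ℤ}
    (h : (σ = false → q.1 = 0) ∧ (σ = true → q.1 + M ≤ -(T : ℤ)) ∧ (T : ℤ) + M ≤ q.2) :
    q.1 + M ≤ q.2 := by
  obtain ⟨h1, h2, h3⟩ := h
  cases σ
  · have := h1 rfl; omega
  · have := h2 rfl; omega

lemma grid_stretch {σ : Bool} {M : ℤ} {ε : ℝ} {T : ℕ} {q : ℤ × ℤ}
    (h : (σ = false → q.1 = 0) ∧ (σ = true → q.1 + M ≤ -(T : ℤ)) ∧ (T : ℤ) + M ≤ q.2)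
    {y : ℤ → ℝ} (hy : ∀ l : ℤ, T ≤ |l| → |y l - D.a| ≤ ε) : D.Stretch σ M ε y q.1 q.2 := by
  obtain ⟨h1, h2, h3⟩ := h
  exact ⟨fun l hl _ => hy l (le_abs.2 (Or.inl (by omega))),
    fun hσ l _ hl' => hy l (le_abs.2 (Or.inr (by have := h2 hσ; omega)))⟩

lemma grid_lo {σ : Bool} {M : ℤ} (hM : 1 ≤ M) {T : ℕ} {q : ℤ × ℤ}
    (h : (σ = false → q.1 = 0) ∧ (σ = true → q.1 + M ≤ -(T : ℤ)) ∧ (T : ℤ) + M ≤ q.2) :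
    q.1 ≤ lo σ T ∧ (T : ℤ) ≤ q.2 := by
  obtain ⟨h1, h2, h3⟩ := h
  refine ⟨?_, by omega⟩
  cases σ
  · simpa [lo] using (h1 rfl).le
  · have := h2 rfl
    simp only [lo, if_true]
    omega

lemma Gm_le_grid {σ : Bool} {M : ℤ} {ε : ℝ} (G : Finset (ℤ × ℤ)) (β : ℝ) (b e : ℤ)
    (A : Set (ℤ → RPos)) :
    D.Gm β b e A ≤ D.Gm β b e {ω | ∀ q ∈ G, ¬ D.Stretch σ M ε (fun l => ω l) q.1 q.2} +
      ∑ q ∈ G, D.Gm β b e (A ∩ {ω | D.Stretch σ M ε (fun l => ω l) q.1 q.2}) := by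
  refine le_trans (measure_mono ?_) ((measure_union_le _ _).trans
    (add_le_add le_rfl (measure_biUnion_finset_le G _)))
  intro ω hω
  by_cases h : ∀ q ∈ G, ¬ D.Stretch σ M ε (fun l => ω l) q.1 q.2
  · exact Or.inl h
  · push Not at h
    obtain ⟨q, hq, hq'⟩ := h
    exact Or.inr (mem_biUnion hq ⟨hω, hq'⟩)

/-- Split according to the position of a stretch. Cutting there and continuing by `a` yields an
infinite chain still close to `z` in the window, so by lower semicontinuity its energy exceeds `c₁ +
base`. The comparison configuration is an almost minimal chain, whose box has probability at most 1.
-/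
lemma exists_box_Gm_le {σ : Bool} {z : ℤ → ℝ} (hc : D.Conf σ z) {c : ℝ}
    (h : D.Dom z → c + D.base σ < D.val σ z) : ∃ T : ℕ, ∃ r > 0, ∀ᶠ β in atTop,
      ∀ᶠ n : ℕ in atTop, D.Gm β (lo σ n) n (box z r (lo σ T) T) ≤
        ENNReal.ofReal (Real.exp (-(β * c))) := by
  obtain ⟨c₁, hcc, hc₁⟩ : ∃ c₁, c < c₁ ∧ (D.Dom z → c₁ + D.base σ < D.val σ z) := by
    by_cases hz : D.Dom z
    · have := h hz
      exact ⟨(c + (D.val σ z - D.base σ)) / 2, by linarith, fun _ => by linarith⟩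
    · exact ⟨c + 1, by linarith, fun h => absurd h hz⟩
  obtain ⟨T, r, hr, hbox⟩ := exists_box_subset (D.eventually_lt_val hc hc₁)
  refine ⟨T, r, hr, ?_⟩
  set η := (c₁ - c) / 20 with hη
  have hη0 : 0 < η := by rw [hη]; linarith
  obtain ⟨M, ε, hG⟩ := D.exists_good hη0
  obtain ⟨y, hy, hyc, hyb⟩ := D.exists_val_lt σ hη0
  obtain ⟨T', hT'⟩ := D.eventually_near hy.2 (half_pos hG.2.1)
  obtain ⟨G, hGr, hno⟩ := D.exists_grid σ hG.one_le hG.2.1 (c + 1) (max T T')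
  have hlo : ∀ q ∈ G, q.1 ≤ lo σ T ∧ (T : ℤ) ≤ q.2 := fun q hq => by
    obtain ⟨h1, h2⟩ := grid_lo hG.one_le (hGr q hq)
    have := lo_anti σ (le_max_left T T')
    exact ⟨h1.trans this, by push_cast at h2; omega⟩
  have hall : ∀ᶠ β in atTop, ∀ q ∈ G, ∀ b e, Cuts σ M b q.1 q.2 e →
      D.Gm β b e (box z r (lo σ T) T ∩ {ω | D.Stretch σ M ε (fun l => ω l) q.1 q.2}) ≤
        ENNReal.ofReal (Real.exp (-(β * (c + η)))) := by
    rw [Filter.eventually_all_finset]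
    intro q hq
    have hst := grid_cuts hG.one_le (hGr q hq)
    have h1 := hG.eventually_Gm_le hη0 (hGr q hq).1 hst (isOpen_box z r (lo σ T) T).measurableSet
      (fun ω ω' hω => dependsOn_box z r (lo σ T) T fun l hl => hω l
        ⟨(hlo q hq).1.trans hl.1, hl.2.trans_le (hlo q hq).2⟩) (x := c₁ + D.base σ)
      (fun ω hω hrω => by
        have hconf := D.conf_cut (σ := σ) (fun l => (ω l : ℝ)) (s := q.1) (t := q.2) (hGr q hq).1
        refine (hbox _ (fun l hl hl' => ?_) (D.dom_cut hrω) hconf).le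
        by_cases hl0 : lo σ T ≤ l
        · unfold cut
          rw [if_pos ⟨(hlo q hq).1.trans hl0, hl'.trans_le (hlo q hq).2⟩]
          exact hω l hl0 hl'
        · cases σ with
          | true => simp only [lo, if_true] at hl0; omega
          | false =>
            simp only [lo, Bool.false_eq_true, if_false, not_le] at hl0
            rw [hconf rfl l hl0, hc rfl l hl0]
            simpa using hr)
      hy hyc (D.grid_stretch (hGr q hq) fun l hl => hT' l (le_trans (by simp) hl)) one_pos
    filter_upwards [h1, eventually_ge_atTop 0] with β h2 hβ b e hcut
    refine (h2 b e hcut).trans ((mul_le_of_le_one_right' prob_le_one).trans ?_)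
    rw [ofReal_exp_le_iff]
    have : c + η ≤ c₁ + D.base σ - D.val σ y - 12 * η := by linarith
    nlinarith
  have hc' : c < min (c + 1) (c + η) := lt_min (by linarith) (by linarith)
  filter_upwards [hno, hall, eventually_ge_atTop 0,
    eventually_const_mul_exp_le (k := 1 + G.card) (by simp) hc'] with β h1 h2 hβ h3
  have hcuts : ∀ᶠ n : ℕ in atTop, ∀ q ∈ G, Cuts σ M (lo σ n) q.1 q.2 n := by
    rw [Filter.eventually_all_finset]
    exact fun q hq => eventually_cuts (hGr q hq).1 (grid_cuts hG.one_le (hGr q hq))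
  filter_upwards [h1, hcuts] with n h4 h5
  refine (D.Gm_le_grid (σ := σ) (M := M) (ε := ε) G β _ _ _).trans (le_trans ?_ h3)
  rw [add_mul, one_mul]
  refine add_le_add (h4.trans (ofReal_exp_le_iff.2 (neg_le_neg
    (mul_le_mul_of_nonneg_left (min_le_left _ _) hβ)))) ?_
  refine (Finset.sum_le_sum fun q hq => (h2 q hq _ _ (h5 q hq)).trans (ofReal_exp_le_iff.2
    (neg_le_neg (mul_le_mul_of_nonneg_left (min_le_right (c + 1) _) hβ)))).trans ?_
  rw [Finset.sum_const, nsmul_eq_mul]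

/-- With probability at least one half there is a stretch at one of finitely many positions. At each
of them the whole event is compared with the box around `z`; every cut chain has energy at least
`base`, so the loss is governed by the excess energy of `z`. Thus the box cannot be less likely than
claimed. -/
lemma eventually_le_Gm_box {σ : Bool} {z : ℤ → ℝ} (hz : D.Dom z) (hc : D.Conf σ z) {c : ℝ}
    (h : D.val σ z - D.base σ < c) (T : ℕ) {r : ℝ} (hr : 0 < r) : ∀ᶠ β in atTop,
      ∀ᶠ n : ℕ in atTop, ENNReal.ofReal (Real.exp (-(β * c))) ≤
        D.Gm β (lo σ n) n (box z r (lo σ T) T) := by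
  set η := (c - (D.val σ z - D.base σ)) / 20 with hη
  have hη0 : 0 < η := by rw [hη]; linarith
  obtain ⟨M, ε, hG⟩ := D.exists_good hη0
  obtain ⟨T', hT'⟩ := D.eventually_near hz.2 (half_pos hG.2.1)
  obtain ⟨G, hGr, hno⟩ := D.exists_grid σ hG.one_le hG.2.1 1 (max T T')
  have hlo : ∀ q ∈ G, q.1 ≤ lo σ T ∧ (T : ℤ) ≤ q.2 := fun q hq => by
    obtain ⟨h1, h2⟩ := grid_lo hG.one_le (hGr q hq)
    have := lo_anti σ (le_max_left T T')
    exact ⟨h1.trans this, by push_cast at h2; omega⟩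
  have hall : ∀ᶠ β in atTop, ∀ q ∈ G, ∀ b e, Cuts σ M b q.1 q.2 e →
      D.Gm β b e (univ ∩ {ω | D.Stretch σ M ε (fun l => ω l) q.1 q.2}) ≤
        ENNReal.ofReal (Real.exp (β * (c - η))) * D.Gm β b e (box z r (lo σ T) T) := by
    rw [Filter.eventually_all_finset]
    intro q hq
    have hst := grid_cuts hG.one_le (hGr q hq)
    have h1 := hG.eventually_Gm_le hη0 (hGr q hq).1 hst .univ (fun _ _ _ => rfl) (x := D.base σ)
      (fun ω _ hrω => D.base_le (D.dom_cut hrω) (D.conf_cut _ (hGr q hq).1))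
      hz hc (D.grid_stretch (hGr q hq) fun l hl => hT' l (le_trans (by simp) hl)) hr
    filter_upwards [h1, eventually_ge_atTop 0] with β h2 hβ b e hcut
    refine (h2 b e hcut).trans (mul_le_mul' (ofReal_exp_le_iff.2 ?_)
      (measure_mono (box_mono z le_rfl (hlo q hq).1 (hlo q hq).2)))
    have : -(c - η) ≤ D.base σ - D.val σ z - 12 * η := by linarith
    nlinarith
  filter_upwards [hno, hall, eventually_const_mul_exp_le (k := 2) (c := 0) (by simp) one_pos,
    eventually_const_mul_exp_le (k := 2 * G.card) (ENNReal.mul_ne_top (by simp) (by simp)) hη0]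
    with β h1 h2 h3 h3'
  have hcuts : ∀ᶠ n : ℕ in atTop, ∀ q ∈ G, Cuts σ M (lo σ n) q.1 q.2 n := by
    rw [Filter.eventually_all_finset]
    exact fun q hq => eventually_cuts (hGr q hq).1 (grid_cuts hG.one_le (hGr q hq))
  filter_upwards [h1, hcuts] with n h4 h5
  set g := D.Gm β (lo σ n) n (box z r (lo σ T) T) with hg
  have h6 := D.Gm_le_grid (σ := σ) (M := M) (ε := ε) G β (lo σ n) n univ
  rw [measure_univ] at h6
  have h7 : ∑ q ∈ G, D.Gm β (lo σ n) n (univ ∩ {ω | D.Stretch σ M ε (fun l => ω l) q.1 q.2}) ≤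
      G.card * (ENNReal.ofReal (Real.exp (β * (c - η))) * g) := by
    refine (Finset.sum_le_sum fun q hq => h2 q hq _ _ (h5 q hq)).trans ?_
    rw [Finset.sum_const, nsmul_eq_mul]
  simp only [mul_zero, neg_zero, Real.exp_zero, ENNReal.ofReal_one] at h3 h3'
  -- Twice the probability of having no stretch is at most 1, so twice the sum over positions is at
  -- least 1.
  have h8 : 2 * (1 : ℝ≥0∞) ≤ 1 + 2 * (G.card * (ENNReal.ofReal (Real.exp (β * (c - η))) * g)) := by
    refine (mul_le_mul_right (h6.trans (add_le_add h4 h7)) 2).trans ?_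
    rw [mul_add]
    exact add_le_add h3 le_rfl
  have h9 : 1 ≤ 2 * (G.card * (ENNReal.ofReal (Real.exp (β * (c - η))) * g)) := by
    rw [mul_one] at h8
    exact (ENNReal.add_le_add_iff_left ENNReal.one_ne_top).1 (one_add_one_eq_two.trans_le h8)
  calc ENNReal.ofReal (Real.exp (-(β * c)))
      ≤ ENNReal.ofReal (Real.exp (-(β * c))) *
        (2 * (G.card * (ENNReal.ofReal (Real.exp (β * (c - η))) * g))) := le_mul_of_one_le_right' h9
    _ = (2 * G.card * ENNReal.ofReal (Real.exp (-(β * η)))) * g := by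
        have : ENNReal.ofReal (Real.exp (-(β * η))) = ENNReal.ofReal (Real.exp (-(β * c))) *
            ENNReal.ofReal (Real.exp (β * (c - η))) := by
          rw [← ENNReal.ofReal_mul (Real.exp_pos _).le, ← Real.exp_add]
          congr 2
          ring
        rw [this]
        ring
    _ ≤ 1 * g := mul_le_mul_left h3' g
    _ = g := one_mul g

end Model

namespace Model

variable (D : Model)

/-! ### Local bounds for the infinite volume measures -/

lemma exists_box_lim_le {σ : Bool} {z : ℤ → ℝ} (hc : D.Conf σ z) {c : ℝ}
    (h : D.Dom z → c + D.base σ < D.val σ z) : ∃ T : ℕ, ∃ r > 0, ∀ᶠ β in atTop,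
      D.lim σ β (box z r (lo σ T) T) ≤ ENNReal.ofReal (Real.exp (-(β * c))) := by
  obtain ⟨T, r, hr, h1⟩ := D.exists_box_Gm_le hc h
  refine ⟨T, r, hr, ?_⟩
  filter_upwards [h1, eventually_gt_atTop 0] with β h2 hβ
  exact D.lim_le_of_isOpen hβ (isOpen_box _ _ _ _) (dependsOn_box _ _ _ _) h2

lemma eventually_le_lim_box {σ : Bool} {z : ℤ → ℝ} (hz : D.Dom z) (hc : D.Conf σ z) {c : ℝ}
    (h : D.val σ z - D.base σ < c) (T : ℕ) {r : ℝ} (hr : 0 < r) : ∀ᶠ β in atTop,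
      ENNReal.ofReal (Real.exp (-(β * c))) ≤ D.lim σ β (box z r (lo σ T) T) := by
  -- Lower bounds pass to the limit on closed sets only; this closed box lies between the open boxes
  -- of radii `r / 2` and `r`.
  set B : Set (ℤ → RPos) := {ω | ∀ l, lo σ T ≤ l → l < T → |(ω l : ℝ) - z l| ≤ r / 2} with hB
  have hBc : IsClosed B := by
    have : B = ⋂ l : ℤ, ⋂ (_ : lo σ T ≤ l), ⋂ (_ : l < T),
        {ω : ℤ → RPos | |(ω l : ℝ) - z l| ≤ r / 2} := by
      ext ω
      simp [hB]
    rw [this]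
    refine isClosed_iInter fun l => isClosed_iInter fun _ => isClosed_iInter fun _ => ?_
    exact isClosed_le ((continuous_subtype_val.comp (continuous_apply l)).sub
      continuous_const).abs continuous_const
  have hBd : DependsOn (fun ω => ω ∈ B) (Set.Ico (lo σ T) (T : ℤ)) := fun ω ω' h =>
    propext ⟨fun hω l hl hl' => by rw [← h l ⟨hl, hl'⟩]; exact hω l hl hl',
      fun hω l hl hl' => by rw [h l ⟨hl, hl'⟩]; exact hω l hl hl'⟩
  filter_upwards [D.eventually_le_Gm_box hz hc h T (half_pos hr), eventually_gt_atTop 0] with β h1 hβ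
  refine (D.le_lim_of_isClosed hβ hBc hBd (h1.mono fun n h2 => h2.trans (measure_mono
    fun ω hω l hl hl' => (hω l hl hl').le))).trans (measure_mono fun ω hω l hl hl' => ?_)
  exact (hω l hl hl').trans_lt (half_lt_self hr)

/-- Site `j` is given the rate `L + |log (δ j)|` with `∑ δ j < 1`. For `β ≥ 1` the excess rate
yields the factor `δ j`, and the union bound over all sites converges. -/
lemma exists_compact_lim (σ : Bool) (L : ℝ) : ∃ A : ℤ → Set RPos, (∀ j, IsCompact (A j)) ∧
    ∀ᶠ β in atTop, D.lim σ β {ω | ∃ j, (σ = false → 0 ≤ j) ∧ ω j ∈ (A j)ᶜ} ≤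
      ENNReal.ofReal (Real.exp (-(β * L))) := by
  obtain ⟨δ, hδ, hsum⟩ := ENNReal.exists_pos_sum_of_countable one_ne_zero ℤ
  choose A hA hAβ using fun j : ℤ => D.exists_compact_site (L + |Real.log (δ j)|)
  refine ⟨A, hA, ?_⟩
  filter_upwards [eventually_ge_atTop 2] with β hβ
  have hβ0 : 0 < β := by linarith
  have hj : ∀ j : ℤ, (σ = false → 0 ≤ j) → D.lim σ β {ω | ω j ∈ (A j)ᶜ} ≤
      ENNReal.ofReal (Real.exp (-(β * L))) * δ j := by
    intro j hj
    have h1 : D.lim σ β {ω | ω j ∈ (A j)ᶜ} ≤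
        ENNReal.ofReal (Real.exp (-(β * (L + |Real.log (δ j)|)))) := by
      refine D.lim_le_of_isOpen hβ0 (N₀ := j.natAbs + 1)
        ((hA j).isClosed.isOpen_compl.preimage (continuous_apply j)) (fun ω ω' h => ?_)
        (Eventually.of_forall fun n => hAβ j β hβ _ _ j)
      have : ω j = ω' j := by
        refine h j ?_
        cases σ
        · have := hj rfl
          simp only [lo, Bool.false_eq_true, if_false, Set.mem_Ico]
          omega
        · simp only [lo, if_true, Set.mem_Ico]
          omega
      simp only [Set.mem_preimage, this]
    refine h1.trans ?_
    have h2 : (0 : ℝ) < δ j := hδ j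
    rw [← ENNReal.ofReal_coe_nnreal, ← ENNReal.ofReal_mul (Real.exp_pos _).le]
    refine ENNReal.ofReal_le_ofReal ?_
    calc Real.exp (-(β * (L + |Real.log (δ j)|)))
        = Real.exp (-(β * L)) * Real.exp (-(β * |Real.log (δ j)|)) := by
          rw [← Real.exp_add]
          congr 1
          ring
      _ ≤ Real.exp (-(β * L)) * Real.exp (Real.log (δ j)) := by
          refine mul_le_mul_of_nonneg_left (Real.exp_le_exp.2 ?_) (Real.exp_pos _).le
          have h3 := neg_abs_le (Real.log (δ j))
          have h4 := abs_nonneg (Real.log (δ j))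
          nlinarith
      _ = Real.exp (-(β * L)) * δ j := by rw [Real.exp_log h2]
  have hsub : {ω : ℤ → RPos | ∃ j, (σ = false → 0 ≤ j) ∧ ω j ∈ (A j)ᶜ} ⊆
      ⋃ j : ℤ, {ω | (σ = false → 0 ≤ j) ∧ ω j ∈ (A j)ᶜ} := fun ω ⟨j, h⟩ => mem_iUnion.2 ⟨j, h⟩
  refine (measure_mono hsub).trans ((measure_iUnion_le _).trans ?_)
  calc ∑' j : ℤ, D.lim σ β {ω | (σ = false → 0 ≤ j) ∧ ω j ∈ (A j)ᶜ}
      ≤ ∑' j : ℤ, ENNReal.ofReal (Real.exp (-(β * L))) * δ j := by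
        refine ENNReal.tsum_le_tsum fun j => ?_
        by_cases h : σ = false → 0 ≤ j
        · exact (measure_mono fun ω hω => hω.2).trans (hj j h)
        · simp [h]
    _ = ENNReal.ofReal (Real.exp (-(β * L))) * ∑' j : ℤ, (δ j : ℝ≥0∞) := ENNReal.tsum_mul_left
    _ ≤ _ := mul_le_of_le_one_right' hsum.le

/-! ### Large deviations -/

open Classical in
/-- The excess energy of a configuration, `∞` if the energy is not defined. -/
def rate (σ : Bool) (z : ℤ → ℝ) : EReal :=
  if D.Dom z then ((D.val σ z - D.base σ : ℝ) : EReal) else ⊤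

lemma rate_of_dom {σ : Bool} {z : ℤ → ℝ} (h : D.Dom z) :
    D.rate σ z = ((D.val σ z - D.base σ : ℝ) : EReal) := if_pos h

lemma rate_of_not_dom {σ : Bool} {z : ℤ → ℝ} (h : ¬ D.Dom z) : D.rate σ z = ⊤ := if_neg h

lemma isInducing_coe : Topology.IsInducing fun (ω : ℤ → RPos) (l : ℤ) => (ω l : ℝ) :=
  Topology.IsInducing.piMap fun _ : ℤ => Topology.IsInducing.subtypeVal

/-- The large deviations principle for the law of the spacings that are present in the chain. The
map `R` restricts to these spacings and `S` extends by the ground state spacing. -/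
lemma goodLDP_map (σ : Bool) {X : Type} [TopologicalSpace X] [T2Space X] [MeasurableSpace X]
    [OpensMeasurableSpace X] {R : (ℤ → RPos) → X} {S : X → ℤ → RPos} (hRm : Measurable R)
    (hR : Continuous R) (hS : Continuous S) (hRS : ∀ x, R (S x) = x)
    (hSR : ∀ ω l, (σ = false → 0 ≤ l) → S (R ω) l = ω l)
    (hconf : ∀ x, D.Conf σ fun l => S x l) {P : ℝ → Measure X}
    (hP : ∀ β > 0, P β = (D.lim σ β).map R) :
    GoodLDP P fun x => D.rate σ fun l => S x l := by
  set α : RPos := ⟨D.a, D.hrhc.trans D.rhc_lt_a⟩ with hα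
  have hSα : ∀ x l, ¬ (σ = false → 0 ≤ l) → S x l = α := by
    intro x l h
    push Not at h
    exact Subtype.ext (hconf x h.1 l h.2)
  have hadm : ∀ {T : ℕ} {l : ℤ}, lo σ T ≤ l → (σ = false → 0 ≤ l) := fun {T l} h hσ => by
    simpa [lo, hσ] using h
  refine goodLDP_of_local (fun β hβ => ?_) (fun x c hc => ?_) (fun L => ?_) fun x c O hx hO hxO => ?_
  · rw [hP β hβ, Measure.map_apply hRm .univ]
    exact prob_le_one
  · obtain ⟨T, r, hr, h⟩ := D.exists_box_lim_le (hconf x) (c := c) fun hd => by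
      rw [D.rate_of_dom hd, EReal.coe_lt_coe_iff] at hc
      linarith
    have hUo : IsOpen (S ⁻¹' box (fun l => (S x l : ℝ)) r (lo σ T) T) :=
      (isOpen_box _ _ _ _).preimage hS
    refine ⟨_, hUo.mem_nhds fun l _ _ => by simpa using hr, ?_⟩
    filter_upwards [h, eventually_gt_atTop 0] with β h1 hβ
    rw [hP β hβ, Measure.map_apply hRm hUo.measurableSet]
    refine (measure_mono fun ω hω l hl hl' => ?_).trans h1
    rw [← hSR ω l (hadm hl)]
    exact hω l hl hl'
  · obtain ⟨A, hA, h⟩ := D.exists_compact_lim σ L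
    -- The value `α` is added to each factor because `S` fills the absent spacings with the ground
    -- state.
    have hK : IsCompact (R '' Set.univ.pi fun j => insert α (A j)) :=
      (isCompact_univ_pi fun j => (hA j).insert α).image hR
    refine ⟨_, hK, ?_⟩
    filter_upwards [h, eventually_gt_atTop 0] with β h1 hβ
    rw [hP β hβ, Measure.map_apply hRm hK.isClosed.isOpen_compl.measurableSet]
    refine (measure_mono fun ω hω => ?_).trans h1
    by_contra hcon
    simp only [Set.mem_ofPred_eq, mem_compl_iff, not_exists, not_and, not_not] at hcon
    refine hω ⟨S (R ω), fun j _ => ?_, hRS _⟩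
    by_cases hj : σ = false → 0 ≤ j
    · rw [hSR ω j hj]
      exact mem_insert_of_mem _ (hcon j hj)
    · rw [hSα _ j hj]
      exact mem_insert _ _
  · have hd : D.Dom fun l => (S x l : ℝ) := by
      by_contra hd
      rw [D.rate_of_not_dom hd] at hx
      exact not_top_lt hx
    rw [D.rate_of_dom hd, EReal.coe_lt_coe_iff] at hx
    have hO' : R ⁻¹' O ∈ 𝓝 (S x) := (hO.preimage hR).mem_nhds (by rwa [mem_preimage, hRS])
    rw [isInducing_coe.nhds_eq_comap, mem_comap] at hO'
    obtain ⟨W, hW, hWO⟩ := hO'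
    obtain ⟨T, r, hr, hbox⟩ := exists_box_subset hW
    filter_upwards [D.eventually_le_lim_box hd (hconf x) hx T hr, eventually_gt_atTop 0] with β h1 hβ
    rw [hP β hβ, Measure.map_apply hRm hO.measurableSet]
    refine h1.trans (measure_mono fun ω hω => ?_)
    have h2 : S (R ω) ∈ R ⁻¹' O := by
      refine hWO (hbox _ fun l hl hl' => ?_)
      beta_reduce
      by_cases hj : σ = false → 0 ≤ l
      · rw [hSR ω l hj]
        refine hω l ?_ hl'
        cases σ
        · simpa [lo] using hj
        · simpa [lo] using hl
      · rw [hSα _ l hj, hSα _ l hj]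
        simpa using hr
    rwa [mem_preimage, hRS] at h2

/-- The extension of a one-sided chain by the ground state spacing. -/
def extPos (x : ℕ → RPos) (l : ℤ) : RPos :=
  if 0 ≤ l then x l.toNat else ⟨D.a, D.hrhc.trans D.rhc_lt_a⟩

lemma extPos_of_nonneg (x : ℕ → RPos) {l : ℤ} (hl : 0 ≤ l) : D.extPos x l = x l.toNat := if_pos hl

lemma extPos_of_neg (x : ℕ → RPos) {l : ℤ} (hl : l < 0) : (D.extPos x l : ℝ) = D.a := by
  unfold extPos
  rw [if_neg (by omega)]

lemma conf_extPos (x : ℕ → RPos) : D.Conf false fun l => (D.extPos x l : ℝ) :=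
  fun _ _ hj => D.extPos_of_neg x hj

lemma goodLDP_surface {ν : ℝ → Measure (ℕ → RPos)}
    (hν : ∀ β > 0, IsSurfaceGibbs D.v D.rhc D.m D.p β (ν β)) :
    GoodLDP ν fun x => D.rate false fun l => D.extPos x l := by
  refine D.goodLDP_map false (R := fun ω (k : ℕ) => ω (k : ℤ)) (S := D.extPos) measurable_nat
    (continuous_pi fun k => continuous_apply _) (continuous_pi fun l => ?_) (fun x => ?_)
    (fun ω l hl => ?_) D.conf_extPos fun β hβ => surfaceGibbs_unique (hν β hβ) (D.isSurfaceGibbs hβ)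
  · unfold extPos
    split_ifs
    exacts [continuous_apply _, continuous_const]
  · funext k
    simp [extPos]
  · rw [D.extPos_of_nonneg _ (hl rfl)]
    simp only [Int.toNat_of_nonneg (hl rfl)]

lemma goodLDP_bulk {μ : ℝ → Measure (ℤ → RPos)}
    (hμ : ∀ β > 0, IsBulkGibbs D.v D.rhc D.m D.p β (μ β)) :
    GoodLDP μ fun x => D.rate true fun l => x l :=
  D.goodLDP_map true (R := id) (S := id) measurable_id continuous_id continuous_id (fun _ => rfl)
    (fun _ _ _ => rfl) (fun _ h => by simp at h) fun β hβ => by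
      rw [Measure.map_id]
      exact bulkGibbs_unique (hμ β hβ) (D.isBulkGibbs hβ)

/-- One-sided chains attain their minimal energy. -/
lemma exists_val_eq_base : ∃ x : ℕ → RPos, D.Dom (fun l => (D.extPos x l : ℝ)) ∧
    D.val false (fun l => (D.extPos x l : ℝ)) = D.base false := by
  -- Attainment is read off from the large deviations principle: its rate function is lower
  -- semicontinuous with compact level sets, hence has a minimizer, and its infimum is 0 by
  -- definition of `base`.
  have hI := D.goodLDP_surface fun β hβ => D.isSurfaceGibbs hβ
  set I : (ℕ → RPos) → EReal := fun x => D.rate false fun l => D.extPos x l with hIdef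
  have hlow : ∀ δ : ℝ, 0 < δ → ∃ x, I x ≤ (δ : EReal) := by
    intro δ hδ
    obtain ⟨z, hz, hc, hv⟩ := D.exists_val_lt false hδ
    refine ⟨fun k => ⟨z k, D.hrhc.trans (hz.1 k)⟩, ?_⟩
    have hext : (fun l => (D.extPos (fun k => ⟨z k, D.hrhc.trans (hz.1 k)⟩) l : ℝ)) = z := by
      funext l
      by_cases hl : 0 ≤ l
      · rw [D.extPos_of_nonneg _ hl]
        simp only [Int.toNat_of_nonneg hl]
      · rw [D.extPos_of_neg _ (by omega), hc rfl l (by omega)]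
    simp only [hIdef]
    rw [hext, D.rate_of_dom hz, EReal.coe_le_coe_iff]
    linarith
  obtain ⟨x₁, hx₁⟩ := hlow 1 one_pos
  obtain ⟨x, -, hx⟩ := (hI.lowerSemicontinuous.lowerSemicontinuousOn _).exists_isMinOn
    ⟨x₁, hx₁⟩ (hI.compact_level 1)
  have hx0 : I x ≤ 0 := by
    refine EReal.le_of_forall_lt_iff_le.1 fun δ hδ => ?_
    have hδ0 : 0 < δ := EReal.coe_pos.1 hδ
    obtain ⟨y, hy⟩ := hlow (min δ 1) (lt_min hδ0 one_pos)
    exact (hx (hy.trans (EReal.coe_le_coe_iff.2 (min_le_right _ _)))).trans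
      (hy.trans (EReal.coe_le_coe_iff.2 (min_le_left _ _)))
  have hd : D.Dom fun l => (D.extPos x l : ℝ) := by
    by_contra hd
    simp only [hIdef] at hx0
    rw [D.rate_of_not_dom hd] at hx0
    exact absurd hx0 (by simp)
  refine ⟨x, hd, le_antisymm ?_ (D.base_le hd (D.conf_extPos x))⟩
  simp only [hIdef] at hx0
  rw [D.rate_of_dom hd, ← EReal.coe_zero, EReal.coe_le_coe_iff] at hx0
  linarith

/-! ### The energy functionals -/

lemma bulkBar_eq (x : ℤ → RPos) :
    bulkBar D.v D.rhc D.m D.p D.a D.e₀ x = D.rate true fun l => x l := by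
  unfold bulkBar extendTop
  by_cases h : D.Dom fun l => (x l : ℝ)
  · have h' : Memℓp (fun j => (x j : ℝ) - D.a) 2 ∧ ∀ j, D.rhc < (x j : ℝ) :=
      ⟨memℓp_two_iff.2 h.2, h.1⟩
    rw [dif_pos h', D.rate_of_dom h, D.base_bulk, D.bulk_eqOn fun j => by
      change D.rhc < D.a + ((x j : ℝ) - D.a)
      have := h.1 j
      linarith]
    simp [val]
  · rw [D.rate_of_not_dom h, dif_neg]
    exact fun h' => h ⟨h'.2, memℓp_two_iff.1 h'.1⟩

lemma surf_eq_val {γ : Strain ℕ} (hγ : γ ∈ strainDomain D.rhc D.a ℕ) :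
    surf D.v D.rhc D.m D.p D.a D.e₀ γ = D.val false fun l => D.a + extZ γ l := by
  rw [D.surf_eqOn hγ]
  simp [val]

lemma dom_extZ {γ : Strain ℕ} (hγ : γ ∈ strainDomain D.rhc D.a ℕ) :
    D.Dom fun l => D.a + extZ γ l :=
  ⟨extStrain_mem D.rhc_lt_a hγ, by simpa [coe_extStrain] using summable_sq (extStrain γ)⟩

lemma conf_extZ (γ : ℕ → ℝ) : D.Conf false fun l => D.a + extZ γ l := fun _ j hj => by
  beta_reduce
  rw [extZ_neg _ hj, add_zero]

lemma extPos_eq_extZ {x : ℕ → RPos} (h : Memℓp (fun j => (x j : ℝ) - D.a) 2) :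
    (fun l => (D.extPos x l : ℝ)) =
      fun l => D.a + extZ (⟨fun j => (x j : ℝ) - D.a, h⟩ : Strain ℕ) l := by
  funext l
  by_cases hl : 0 ≤ l
  · rw [D.extPos_of_nonneg _ hl, extZ_of_nonneg _ hl]
    ring
  · rw [D.extPos_of_neg _ (by omega), extZ_neg _ (by omega), add_zero]

lemma mem_strainDomain {x : ℕ → RPos} (h : Memℓp (fun j => (x j : ℝ) - D.a) 2)
    (hx : ∀ j, D.rhc < (x j : ℝ)) :
    (⟨fun j => (x j : ℝ) - D.a, h⟩ : Strain ℕ) ∈ strainDomain D.rhc D.a ℕ := fun j => by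
  change D.rhc < D.a + ((x j : ℝ) - D.a)
  linarith [hx j]

lemma dom_extPos_iff (x : ℕ → RPos) : D.Dom (fun l => (D.extPos x l : ℝ)) ↔
    Memℓp (fun j => (x j : ℝ) - D.a) 2 ∧ ∀ j, D.rhc < (x j : ℝ) := by
  have hcast : ∀ k : ℕ, D.extPos x k = x k := fun k => by simp [extPos]
  constructor
  · intro h
    refine ⟨memℓp_two_iff.2 ?_, fun j => by rw [← hcast j]; exact h.1 j⟩
    have := h.2.comp_injective (Nat.cast_injective (R := ℤ))
    simpa [Function.comp_def, hcast] using this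
  · rintro ⟨h1, h2⟩
    rw [D.extPos_eq_extZ h1]
    exact D.dom_extZ (D.mem_strainDomain h1 h2)

lemma surfBar_sub_eq (x : ℕ → RPos) :
    surfBar D.v D.rhc D.m D.p D.a D.e₀ x - (D.base false : EReal) =
      D.rate false fun l => D.extPos x l := by
  unfold surfBar extendTop
  by_cases h : D.Dom fun l => (D.extPos x l : ℝ)
  · have h' := (D.dom_extPos_iff x).1 h
    rw [dif_pos h', D.rate_of_dom h, D.surf_eq_val (D.mem_strainDomain h'.1 h'.2),
      ← D.extPos_eq_extZ h'.1, EReal.coe_sub]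
  · rw [D.rate_of_not_dom h, dif_neg fun h' => h ((D.dom_extPos_iff x).2 h'), EReal.top_sub_coe]

lemma isLeast_surf : IsLeast (surf D.v D.rhc D.m D.p D.a D.e₀ '' strainDomain D.rhc D.a ℕ)
    (D.base false) := by
  constructor
  · obtain ⟨x, hd, hx⟩ := D.exists_val_eq_base
    have h' := (D.dom_extPos_iff x).1 hd
    have hm := D.mem_strainDomain h'.1 h'.2
    refine ⟨_, hm, ?_⟩
    rw [D.surf_eq_val hm, ← D.extPos_eq_extZ h'.1, hx]
  · rintro _ ⟨γ, hγ, rfl⟩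
    rw [D.surf_eq_val hγ]
    exact D.base_le (D.dom_extZ hγ) (D.conf_extZ γ)

/-! ### The ground state energy -/

/-- The ground state energy of `n` spacings lies between `n * e₀`, by `E_ge`, and the energy of the
uniform chain, which is `n * e₀ - Waa + o(1)`. Division is by `n + 1`, the number of particles. -/
lemma tendsto_groundEnergy :
    Tendsto (fun n : ℕ => groundEnergy D.v D.rhc D.m D.p n / ((n + 1 : ℕ) : EReal)) atTop
      (𝓝 (D.e₀ : EReal)) := by
  have hlow : ∀ n : ℕ, ((n * D.e₀ : ℝ) : EReal) ≤ groundEnergy D.v D.rhc D.m D.p n := by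
    intro n
    refine le_iInf fun z => ?_
    by_cases hz : ∀ l, D.rhc < (z l : ℝ)
    · set y : ℤ → ℝ := fun l => if h : 0 ≤ l ∧ l < n then z ⟨l.toNat, by omega⟩ else D.a with hy
      have hyz : ∀ l : Fin n, y l = z l := fun l => by simp [hy]
      have hyr : ∀ l, (0 : ℤ) ≤ l → l < n → D.rhc < y l := fun l hl hl' => by
        simp only [hy, hl, hl', and_self, dif_pos]
        exact hz _
      rw [D.energy_eq_E y hyz hz, EReal.coe_le_coe_iff]
      have h1 := D.E_ge (b := 0) (e := n) (by omega) hyr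
      have h2 : 0 ≤ D.kappa * ∑ l ∈ Finset.Ico (0 : ℤ) n, D.theta (y l) :=
        mul_nonneg D.kappa_pos.le (Finset.sum_nonneg fun l _ => D.theta_nonneg _)
      push_cast at h1
      linarith
    · push Not at hz
      obtain ⟨l, hl⟩ := hz
      rw [D.energy_eq_top hl]
      exact le_top
  have hup : ∀ n : ℕ, groundEnergy D.v D.rhc D.m D.p n ≤ ((D.E (fun _ => D.a) 0 n : ℝ) : EReal) := by
    intro n
    refine (iInf_le _ fun _ => ⟨D.a, D.hrhc.trans D.rhc_lt_a⟩).trans (le_of_eq ?_)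
    exact D.energy_eq_E (fun _ => D.a) (fun _ => rfl) fun _ => D.rhc_lt_a
  have hdiv : ∀ (q : ℝ) (n : ℕ), (q : EReal) / ((n + 1 : ℕ) : EReal) = ((q / (n + 1) : ℝ) : EReal) := by
    intro q n
    rw [EReal.coe_div]
    norm_cast
  have hpos : ∀ n : ℕ, (0 : EReal) ≤ ((n + 1 : ℕ) : EReal) := fun n => by positivity
  have hl1 : Tendsto (fun n : ℕ => (n * D.e₀) / ((n : ℝ) + 1)) atTop (𝓝 D.e₀) := by
    have := (tendsto_natCast_div_add_atTop (1 : ℝ)).mul_const D.e₀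
    rw [one_mul] at this
    refine this.congr fun n => by ring
  have hl2 : Tendsto (fun n : ℕ => D.E (fun _ => D.a) 0 n / ((n : ℝ) + 1)) atTop (𝓝 D.e₀) := by
    have h1 := (D.tendsto_E_const.sub_const D.Waa).mul tendsto_one_div_add_atTop_nhds_zero_nat
    have h2 := h1.add hl1
    rw [mul_zero, zero_add] at h2
    refine h2.congr fun n => ?_
    field_simp
    ring
  refine tendsto_of_tendsto_of_tendsto_of_le_of_le
    ((continuous_coe_real_ereal.tendsto _).comp hl1) ((continuous_coe_real_ereal.tendsto _).comp hl2)
    (fun n => ?_) fun n => ?_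
  · simp only [Function.comp, ← hdiv]
    exact EReal.div_le_div_right_of_nonneg (hpos n) (hlow n)
  · simp only [Function.comp, ← hdiv]
    exact EReal.div_le_div_right_of_nonneg (hpos n) (hup n)

end Model
end Chain
end

theorem mainTheorem1 (v : ℝ → ℝ) (rhc zmin zmax α₁ α₂ s : ℝ)
    (hv : Chain.PotentialAssumption v rhc zmin zmax α₁ α₂ s)
    (hrhc : 0 < rhc) (hcore : Tendsto v (𝓝[>] rhc) atTop)
    (m : ℕ∞) (hm : 1 ≤ m) (p : ℝ) (hp : 0 < p) (hp' : p < |v zmax| / zmax) :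
    -- the ground state spacing `a`, the energy per particle `e₀` and the minimum of the
    -- surface energy
    ∃ a e₀ minSurf : ℝ,
      Chain.IsGroundSpacing v rhc m p a ∧
      Tendsto (fun n : ℕ => Chain.groundEnergy v rhc m p n / ((n + 1 : ℕ) : EReal)) atTop
        (𝓝 (e₀ : EReal)) ∧
      -- `surf` and `bulk` really are continuous extensions, and the minimum is attained
      (ContinuousOn (Chain.surf v rhc m p a e₀) (Chain.strainDomain rhc a ℕ) ∧
        EqOn (Chain.surf v rhc m p a e₀) (Chain.surf₀ v m p a e₀)
          (Chain.finiteStrainDomain rhc a ℕ)) ∧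
      (ContinuousOn (Chain.bulk v rhc m p a e₀) (Chain.strainDomain rhc a ℤ) ∧
        EqOn (Chain.bulk v rhc m p a e₀) (Chain.bulk₀ v m p a e₀)
          (Chain.finiteStrainDomain rhc a ℤ)) ∧
      IsLeast (Chain.surf v rhc m p a e₀ '' Chain.strainDomain rhc a ℕ) minSurf ∧
      -- the infinite-volume Gibbs measures exist and are unique
      (∀ β : ℝ, 0 < β → ∃! ν : Measure (ℕ → Chain.RPos), Chain.IsSurfaceGibbs v rhc m p β ν) ∧
      (∀ β : ℝ, 0 < β → ∃! μ : Measure (ℤ → Chain.RPos), Chain.IsBulkGibbs v rhc m p β μ) ∧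
      -- the large deviations principles
      (∀ ν : ℝ → Measure (ℕ → Chain.RPos),
        (∀ β : ℝ, 0 < β → Chain.IsSurfaceGibbs v rhc m p β (ν β)) →
        Chain.GoodLDP ν
          (fun z => Chain.surfBar v rhc m p a e₀ z - (minSurf : EReal))) ∧
      (∀ μ : ℝ → Measure (ℤ → Chain.RPos),
        (∀ β : ℝ, 0 < β → Chain.IsBulkGibbs v rhc m p β (μ β)) →
        Chain.GoodLDP μ (Chain.bulkBar v rhc m p a e₀)) := by
  let D : Chain.Model := ⟨v, rhc, zmin, zmax, α₁, α₂, s, hv, hrhc, hcore, m, hm, p, hp, hp'⟩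
  refine ⟨D.a, D.e₀, D.base false, D.isGroundSpacing, D.tendsto_groundEnergy,
    ⟨D.continuousOn_surf, D.surf_eqOn_surf₀⟩, ⟨D.continuousOn_bulk, D.bulk_eqOn_bulk₀⟩,
    D.isLeast_surf, fun β hβ => ⟨D.surfaceGibbs β, D.isSurfaceGibbs hβ, fun ν h =>
      Chain.Model.surfaceGibbs_unique h (D.isSurfaceGibbs hβ)⟩,
    fun β hβ => ⟨D.lim true β, D.isBulkGibbs hβ, fun μ h =>
      Chain.Model.bulkGibbs_unique h (D.isBulkGibbs hβ)⟩, fun ν hν => ?_, fun μ hμ => ?_⟩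
  · have h := D.goodLDP_surface hν
    rwa [← funext D.surfBar_sub_eq] at h
  · have h := D.goodLDP_bulk hμ
    rwa [← funext D.bulkBar_eq] at h
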